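/- **Setting.** Fix $\ell$, put $\mathcal O=\mathcal T=\mathbb R^\ell$, $\mathcal O^+=\mathcal O\oplus\mathcal T$, and let $f:\mathcal O^+\times\mathcal T\to\mathbb R$, $(r;\epsilon)\mapsto f(r;\epsilon)$ with $r=x\oplus y$, be measurable, with $f(0;\cdot)$ integrable under $N(0,I_{\mathcal T})$. Matrices carry the Frobenius norm $\|\cdot\|$. For each $d\ge1$ let $K=K_d\in\mathbb R^{d\times d}$ be symmetric with $\lambda_{\min}(K)>0$, with eigenvalues $\lambda_i$ and orthonormal eigenvectors $\omega_i$ $(1\le i\le d)$, and let $X^\star=X^\star_d,\ X_0=X_{0,d}\in\mathbb R^{d\times\ell}$. The data are $(a,\epsilon)\sim N(0,K)\otimes N(0,I_{\mathcal T})$. For $X\in\mathbb R^{d\times \ell}$ put $W=(X\,|\,X^\star)$, $B(W)=W^{T}KW$, $\Psi(X;a,\epsilon)=f(X^{T}a\oplus X^{\star T}a;\epsilon)$, $\mathcal R(X)=\mathbb E\,\Psi(X;a,\epsilon)$. Let $(a_k,\epsilon_k)_{k\ge1}$ be i.i.d. copies of $(a,\epsilon)$, and for a constant $\gamma$ let SGD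 be $X_{k+1}=X_k-\frac{\gamma}{d}\nabla_X\Psi(X_k;a_{k+1},\epsilon_{k+1})$, started at $X_0$. **Assumptions.** There are an open set $U\subseteq(\mathcal O^+)^{\otimes2}$, a function $h:(\mathcal O^+)^{\otimes 2}\to\mathbb R$ and constants $\alpha\ge0$, $L(f),L(h),L(I),\bar K,C,\bar\gamma$, all independent of $d$, such that: 1. $|f(r;\epsilon)-f(\hat r;\epsilon)|\le L(f)\|r-\hat r\|(1+\|r\|^\alpha+\|\hat r\|^\alpha+\|\epsilon\|^\alpha)$ for all $r,\hat r,\epsilon$. 2. $\|X^\star\|,\|X_0\|\le C$; the operator norm of $K$ is at most $\bar K$; $B(W_0)\in U$, where $W_0=(X_0\,|\,X^\star)$. 3. $h(B^{T})=h(B)$ for all $B$; $h(B)=\mathbb E f(r;\epsilon)$ for $(r,\epsilon)\sim N(0,B)\otimes N(0,I_{\mathcal T})$ whenever $B\in U$ is positive semidefinite (so $\mathcal R(X)=h(B(W))$ when $B(W)\in U$); $h$ is $C^1$ on $U$ and $\|\nabla h(B)-\nabla h(\hat B)\|\le L(h)\|B-\hat B\|(1+\|B\|^\alpha+\|\hat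 B\|^\alpha)$ for $B,\hat B\in U$; whenever $B(W)\in U$, $\mathcal R$ is differentiable at $X$ and $\nabla\mathcal R(X)=\mathbb E\,\nabla_X\Psi(X;a,\epsilon)$. 4. $I(B)=\mathbb E[\nabla_xf(r;\epsilon)^{\otimes2}]$, with $(r,\epsilon)\sim N(0,B)\otimes N(0,I_{\mathcal T})$, satisfies $\|I(B)-I(\hat B)\|\le L(I)\|B-\hat B\|(1+\|B\|^\alpha+\|\hat B\|^\alpha)$ for positive semidefinite $B,\hat B\in U$. 5. For some $\hat L,\hat\mu>0$ and for all $y,\epsilon\in\mathbb R^\ell$, the function $g(x)=f(x\oplus y;\epsilon)$ is $C^1$, is $\hat L$-smooth, i.e. $g(\hat x)\le g(x)+\langle\nabla g(x),\hat x-x\rangle+\frac{\hat L}{2}\|\hat x-x\|^2$ for all $x,\hat x$, and satisfies the $\hat\mu$-RSI: $\langle x-x^\star,\nabla g(x)\rangle\ge\hat\mu\|x-x^\star\|^2$ for all $x$ and all $x^\star\in\operatorname{argmin} g$. 6. $X^\star\in\operatorname{argmin}\mathcal R$, and for almost every $(a,\epsilon)$, $X^{\star T}a\in\operatorname{argmin}_x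 f(x\oplus X^{\star T}a;\epsilon)$. 7. The step size is $\gamma=\gamma_d=\dfrac{2\hat\mu}{\hat L^2\,\frac1d\operatorname{tr}K}\,\zeta$ with a fixed $0<\zeta<1$, and $\gamma_d\le\bar\gamma$ for all $d$. **Deterministic equivalent.** Consider positive semidefinite matrices $\mathscr B_i(t)=\begin{pmatrix}\mathscr B_{11,i}&\mathscr B_{12,i}\\ \mathscr B_{12,i}^T&\mathscr B_{22,i}\end{pmatrix}(t)\in(\mathcal O^+)^{\otimes2}$, $1\le i\le d$, with $\mathscr B(t)=\frac1d\sum_i\lambda_i\mathscr B_i(t)\in U$, solving $$\frac{d}{dt}\mathscr B_i=-2\lambda_i\gamma\,(\mathscr B_iH_t+H_t^{T}\mathscr B_i)+\lambda_i\gamma^2\begin{pmatrix}I(\mathscr B(t))&0\\0&0\end{pmatrix},\qquad H_t=\begin{pmatrix}\nabla h_{11}(\mathscr B(t))&0\\ \nabla h_{21}(\mathscr B(t))&0\end{pmatrix},$$ $$\mathscr B_i(0)=d\,(W_0^{T}\omega_i)(W_0^{T}\omega_i)^{T},$$ and put $\mathscr D^2(t)=\frac1d\sum_{i=1}^d\operatorname{tr}\big(\mathscr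 B_{11,i}(t)-2\mathscr B_{12,i}(t)+\mathscr B_{22,i}(t)\big)$. **Proposition.** Under these assumptions, for each $d\ge1$ the system has a (unique) maximal solution, defined on some $[0,\Theta_d)$ with $0<\Theta_d\le\infty$, and $$\mathscr D^2(t)\le e^{-at}\mathscr D^2(0)\quad\text{for all }0\le t<\Theta_d,\qquad a=\gamma(1-\zeta)\hat\mu\,\lambda_{\min}(K).$$ Moreover, let $T>0$ and suppose that for some $\eta>0$ independent of $d$ one has $\|\mathscr B(t)-V\|\ge\eta$ for all $d\ge1$, all $t\in[0,T]$ with $t<\Theta_d$ and all $V\notin U$. Then $\Theta_d>T$ for all $d$, and for some $\varepsilon>0$ independent of $d$, $$\sup_{0\le t\le T}\Big|\,\|X_{\lfloor td\rfloor}-X^\star\|^2-\mathscr D^2(t)\Big|\le d^{-\varepsilon}\quad\text{with overwhelming probability},$$ i.e. there is $w:\mathbb N\to\mathbb R$ with $w(d)/\log d\to\infty$ such that the inequality fails with probability at most $e^{-w(d)}$. -/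

import Mathlib

open MeasureTheory ProbabilityTheory Filter Topology
open scoped Matrix.Norms.Frobenius RealInnerProductSpace

namespace HighDimSGD

/-- `ℝⁿ` with the Euclidean norm. -/
abbrev Vec (n : ℕ) : Type := EuclideanSpace ℝ (Fin n)

/-- The space `𝒪 ⊕ 𝒯` with `𝒪 = 𝒯 = ℝˡ`. -/
abbrev Vec2 (l : ℕ) : Type := EuclideanSpace ℝ (Fin l ⊕ Fin l)

/-- Matrices on `𝒪 ⊕ 𝒯`, with the Frobenius norm. -/
abbrev Mat2 (l : ℕ) : Type := Matrix (Fin l ⊕ Fin l) (Fin l ⊕ Fin l) ℝ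

noncomputable section

/-- The direct sum `x ⊕ y` of two vectors. -/
def cat {l : ℕ} (x y : Vec l) : Vec2 l := WithLp.toLp 2 (Sum.elim x.ofLp y.ofLp)

/-- The `𝒪`-component of `r = x ⊕ y`. -/
def fstV {l : ℕ} (r : Vec2 l) : Vec l := WithLp.toLp 2 fun i => r (Sum.inl i)

/-- The `𝒯`-component of `r = x ⊕ y`. -/
def sndV {l : ℕ} (r : Vec2 l) : Vec l := WithLp.toLp 2 fun i => r (Sum.inr i)

/-- The gradient (matrix of partial derivatives) of a scalar function of a matrix. -/
def matGrad {m n : Type*} [Fintype m] [Fintype n] [DecidableEq m] [DecidableEq n]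
    (F : Matrix m n ℝ → ℝ) (A : Matrix m n ℝ) : Matrix m n ℝ :=
  Matrix.of fun p q => fderiv ℝ F A (Matrix.single p q 1)

/-! ### The outer function -/

/-- The function `x ↦ f(x ⊕ y; ε)`, in which `y` and `ε` are hidden parameters. -/
def slice {l : ℕ} (f : Vec2 l → Vec l → ℝ) (y e : Vec l) : Vec l → ℝ := fun x => f (cat x y) e

/-- The partial gradient `∇ₓ f(r; ε)`, where `r = x ⊕ y`. -/
def gradX {l : ℕ} (f : Vec2 l → Vec l → ℝ) (r : Vec2 l) (e : Vec l) : Vec l :=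
  gradient (slice f (sndV r) e) (fstV r)

/-- `f` is `α`-pseudo-Lipschitz with constant `L`. -/
def PseudoLipschitz {l : ℕ} (α L : ℝ) (f : Vec2 l → Vec l → ℝ) : Prop :=
  ∀ r r' : Vec2 l, ∀ e : Vec l,
    |f r e - f r' e| ≤ L * ‖r - r'‖ * (1 + ‖r‖ ^ α + ‖r'‖ ^ α + ‖e‖ ^ α)

/-- `L`-smoothness: `g` is `C¹` and satisfies the quadratic upper bound. -/
def IsLSmooth {l : ℕ} (L : ℝ) (g : Vec l → ℝ) : Prop :=
  ContDiff ℝ 1 g ∧ ∀ x x' : Vec l, g x' ≤ g x + ⟪gradient g x, x' - x⟫ + L / 2 * ‖x' - x‖ ^ 2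

/-- The `μ`-restricted secant inequality. -/
def RSI {l : ℕ} (μ : ℝ) (g : Vec l → ℝ) : Prop :=
  ContDiff ℝ 1 g ∧ ∀ x xs : Vec l, (∀ y, g xs ≤ g y) →
    μ * ‖x - xs‖ ^ 2 ≤ ⟪x - xs, gradient g x⟫

/-! ### Data, risk and stochastic gradient descent -/

/-- The contraction `⟨X, a⟩ ∈ ℝˡ`, i.e. `Xᵀ a`. -/
def contract {d l : ℕ} (X : Matrix (Fin d) (Fin l) ℝ) (a : Vec d) : Vec l :=
  WithLp.toLp 2 (X.transpose.mulVec a.ofLp)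

/-- `Ψ(X; a, ε) = f(⟨X, a⟩ ⊕ ⟨X⋆, a⟩; ε)`. -/
def Psi {d l : ℕ} (f : Vec2 l → Vec l → ℝ) (Xs X : Matrix (Fin d) (Fin l) ℝ)
    (a : Vec d) (e : Vec l) : ℝ :=
  f (cat (contract X a) (contract Xs a)) e

/-- The law of `(a, ε)`: `N(0, K) ⊗ N(0, I)`. -/
def dataLaw {d : ℕ} (l : ℕ) (K : Matrix (Fin d) (Fin d) ℝ) : Measure (Vec d × Vec l) :=
  (multivariateGaussian 0 K).prod (stdGaussian (Vec l))

/-- The risk `R(X) = 𝔼 Ψ(X; a, ε)`. -/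
def risk {d l : ℕ} (f : Vec2 l → Vec l → ℝ) (K : Matrix (Fin d) (Fin d) ℝ)
    (Xs X : Matrix (Fin d) (Fin l) ℝ) : ℝ :=
  ∫ z, Psi f Xs X z.1 z.2 ∂(dataLaw l K)

/-- `B(W) = Wᵀ K W` for `W = X ⊕ X⋆`: the covariance of `⟨X, a⟩ ⊕ ⟨X⋆, a⟩`. -/
def covB {d l : ℕ} (K : Matrix (Fin d) (Fin d) ℝ) (X Xs : Matrix (Fin d) (Fin l) ℝ) : Mat2 l :=
  (Matrix.fromCols X Xs).transpose * K * Matrix.fromCols X Xs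

/-- The law of `(r, ε)` with `r ∼ N(0, B)` and `ε ∼ N(0, I)` independent. -/
def covLaw {l : ℕ} (B : Mat2 l) : Measure (Vec2 l × Vec l) :=
  (multivariateGaussian 0 B).prod (stdGaussian (Vec l))

/-- The matrix `I(B) = 𝔼[∇ₓ f(r; ε)^{⊗ 2}]`, `r ∼ N(0, B)` (used for `B` positive semidefinite). -/
def fisher {l : ℕ} (f : Vec2 l → Vec l → ℝ) (B : Mat2 l) : Matrix (Fin l) (Fin l) ℝ :=
  Matrix.of fun p q => ∫ z, gradX f z.1 z.2 p * gradX f z.1 z.2 q ∂(covLaw B)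

/-- The positive semidefinite matrices in `U`. -/
def psdPart {l : ℕ} (U : Set (Mat2 l)) : Set (Mat2 l) := {B | B ∈ U ∧ B.PosSemidef}

/-- The Fisher matrix is `α`-pseudo-Lipschitz on (the positive semidefinite part of) `U`. -/
def FisherPseudoLipschitz {l : ℕ} (α L : ℝ) (U : Set (Mat2 l)) (f : Vec2 l → Vec l → ℝ) : Prop :=
  ∀ B ∈ psdPart U, ∀ B' ∈ psdPart U,
    ‖fisher f B - fisher f B'‖ ≤ L * ‖B - B'‖ * (1 + ‖B‖ ^ α + ‖B'‖ ^ α)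

/-- `h` represents the risk on the open set `U` as a function of the covariance of
`⟨X, a⟩ ⊕ ⟨X⋆, a⟩`; it is symmetric, continuously differentiable on `U`, and its gradient is
`α`-pseudo-Lipschitz there. -/
structure RiskRepresentation {l : ℕ} (α L : ℝ) (U : Set (Mat2 l)) (f : Vec2 l → Vec l → ℝ)
    (h : Mat2 l → ℝ) : Prop where
  isOpen : IsOpen U
  eq_integral : ∀ B ∈ psdPart U, h B = ∫ z, f z.1 z.2 ∂(covLaw B)
  symm : ∀ B, h B.transpose = h B
  contDiffOn : ContDiffOn ℝ 1 h U
  grad_lipschitz : ∀ B ∈ U, ∀ B' ∈ U,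
    ‖matGrad h B - matGrad h B'‖ ≤ L * ‖B - B'‖ * (1 + ‖B‖ ^ α + ‖B'‖ ^ α)

/-- Gradient and expectation commute: `∇ R(X) = 𝔼 ∇_X Ψ(X; a, ε)` whenever `B(W) ∈ U`. -/
def UnbiasedGradient {d l : ℕ} (U : Set (Mat2 l)) (f : Vec2 l → Vec l → ℝ)
    (K : Matrix (Fin d) (Fin d) ℝ) (Xs : Matrix (Fin d) (Fin l) ℝ) : Prop :=
  ∀ X : Matrix (Fin d) (Fin l) ℝ, covB K X Xs ∈ U →
    DifferentiableAt ℝ (risk f K Xs) X ∧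
    ∀ p q, matGrad (risk f K Xs) X p q
      = ∫ z, matGrad (fun Y => Psi f Xs Y z.1 z.2) X p q ∂(dataLaw l K)

/-- Streaming SGD with constant step size `γ / d`; the step from `X_k` to `X_{k+1}` uses the fresh
sample `(a k, e k)`. -/
def sgd {d l : ℕ} (f : Vec2 l → Vec l → ℝ) (Xs X0 : Matrix (Fin d) (Fin l) ℝ) (γ : ℝ)
    (a : ℕ → Vec d) (e : ℕ → Vec l) : ℕ → Matrix (Fin d) (Fin l) ℝ
  | 0 => X0
  | k + 1 => sgd f Xs X0 γ a e k
      - (γ / d) • matGrad (fun X => Psi f Xs X (a k) (e k)) (sgd f Xs X0 γ a e k)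

/-! ### The deterministic equivalent -/

/-- `𝓑(t) = (1/d) ∑ λᵢ 𝓑ᵢ(t)`, where `λᵢ` are the eigenvalues of `K`. -/
def avgB {d l : ℕ} {K : Matrix (Fin d) (Fin d) ℝ} (hK : K.IsHermitian)
    (B : Fin d → Mat2 l) : Mat2 l :=
  (1 / (d : ℝ)) • ∑ i, hK.eigenvalues i • B i

/-- The block matrix `[[H₁₁, 0], [H₂₁, 0]]` made from the first block column of `∇h(B)`. -/
def driftH {l : ℕ} (h : Mat2 l → ℝ) (B : Mat2 l) : Mat2 l :=
  Matrix.fromBlocks (matGrad h B).toBlocks₁₁ 0 (matGrad h B).toBlocks₂₁ 0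

/-- Right-hand side of the coupled equations,
`-2 λᵢ γ (𝓑ᵢ H + Hᵀ 𝓑ᵢ) + λᵢ γ² [[I(𝓑), 0], [0, 0]]`, with `H = driftH h 𝓑`. -/
def odeRHS {d l : ℕ} {K : Matrix (Fin d) (Fin d) ℝ} (hK : K.IsHermitian)
    (f : Vec2 l → Vec l → ℝ) (h : Mat2 l → ℝ) (γ : ℝ) (B : Fin d → Mat2 l) (i : Fin d) : Mat2 l :=
  (-2 * hK.eigenvalues i * γ) •
      (B i * driftH h (avgB hK B) + (driftH h (avgB hK B)).transpose * B i)
    + (hK.eigenvalues i * γ ^ 2) • Matrix.fromBlocks (fisher f (avgB hK B)) 0 0 0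

/-- Initial value `𝓑ᵢ(0) = d ⟨W₀ ⊗ W₀, ωᵢ ⊗ ωᵢ⟩`, with `ωᵢ` the orthonormal eigenvectors of `K`. -/
def odeInit {d l : ℕ} {K : Matrix (Fin d) (Fin d) ℝ} (hK : K.IsHermitian)
    (X0 Xs : Matrix (Fin d) (Fin l) ℝ) (i : Fin d) : Mat2 l :=
  (d : ℝ) • Matrix.vecMulVec
    ((Matrix.fromCols X0 Xs).transpose.mulVec (hK.eigenvectorBasis i).ofLp)
    ((Matrix.fromCols X0 Xs).transpose.mulVec (hK.eigenvectorBasis i).ofLp)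

/-- `(𝓑ᵢ)` solves the coupled equations on `[0, S)`: the `𝓑ᵢ` are positive semidefinite and
`𝓑(t)` stays in `U`. -/
structure IsSolution {d l : ℕ} {K : Matrix (Fin d) (Fin d) ℝ} (hK : K.IsHermitian)
    (f : Vec2 l → Vec l → ℝ) (h : Mat2 l → ℝ) (U : Set (Mat2 l)) (γ : ℝ)
    (X0 Xs : Matrix (Fin d) (Fin l) ℝ) (S : EReal) (B : ℝ → Fin d → Mat2 l) : Prop where
  init : ∀ i, B 0 i = odeInit hK X0 Xs i
  psd : ∀ t : ℝ, 0 ≤ t → (t : EReal) < S → ∀ i, (B t i).PosSemidef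
  mem : ∀ t : ℝ, 0 ≤ t → (t : EReal) < S → avgB hK (B t) ∈ U
  ode : ∀ t : ℝ, 0 ≤ t → (t : EReal) < S → ∀ i,
    HasDerivWithinAt (fun s => B s i) (odeRHS hK f h γ (B t) i) (Set.Ici 0) t

/-- `(𝓑ᵢ)` is the maximal solution and `[0, Θ)` its interval of existence. -/
structure IsMaximalSolution {d l : ℕ} {K : Matrix (Fin d) (Fin d) ℝ} (hK : K.IsHermitian)
    (f : Vec2 l → Vec l → ℝ) (h : Mat2 l → ℝ) (U : Set (Mat2 l)) (γ : ℝ)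
    (X0 Xs : Matrix (Fin d) (Fin l) ℝ) (Θ : EReal) (B : ℝ → Fin d → Mat2 l) : Prop where
  pos : 0 < Θ
  sol : IsSolution hK f h U γ X0 Xs Θ B
  maximal : ∀ (S : EReal) (B' : ℝ → Fin d → Mat2 l), IsSolution hK f h U γ X0 Xs S B' →
    S ≤ Θ ∧ ∀ t : ℝ, 0 ≤ t → (t : EReal) < S → B' t = B t

/-- `𝓓² = (1/d) ∑ᵢ tr(𝓑₁₁,ᵢ - 2 𝓑₁₂,ᵢ + 𝓑₂₂,ᵢ)`. -/
def distSq {d l : ℕ} (B : Fin d → Mat2 l) : ℝ :=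
  (1 / (d : ℝ)) * ∑ i,
    ((B i).toBlocks₁₁ - (2 : ℝ) • (B i).toBlocks₁₂ + (B i).toBlocks₂₂).trace

/-- The set `U_η` of the points of `U` at distance at least `η` from the complement of `U`. -/
def innerSet {l : ℕ} (U : Set (Mat2 l)) (η : ℝ) : Set (Mat2 l) :=
  {B | B ∈ U ∧ ∀ V, V ∉ U → η ≤ ‖B - V‖}

/-! ### Step size, rate, overwhelming probability -/

/-- The step size `γ = 2 μ ζ / (L² (1/d) tr K)`. -/
def stepSize {d : ℕ} (μ L ζ : ℝ) (K : Matrix (Fin d) (Fin d) ℝ) : ℝ :=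
  2 * μ / (L ^ 2 * ((1 / (d : ℝ)) * K.trace)) * ζ

/-- The smallest eigenvalue of a symmetric matrix (for `d ≥ 1`). -/
def lamMin {d : ℕ} {K : Matrix (Fin d) (Fin d) ℝ} (hK : K.IsHermitian) : ℝ :=
  ⨅ i, hK.eigenvalues i

/-- The events `E d` (`d ≥ 1`) hold with overwhelming probability: the probability that `E d` fails
is at most `e^{-w(d)}`, where `w(d) / log d → ∞`. -/
def WithOverwhelmingProbability {Ω : ℕ → Type*} [∀ d, MeasurableSpace (Ω d)]
    (P : ∀ d, Measure (Ω d)) (E : ∀ d, Set (Ω d)) : Prop :=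
  ∃ w : ℕ → ℝ, Tendsto (fun d : ℕ => w d / Real.log d) atTop atTop ∧
    ∀ d, 0 < d → P d (E d)ᶜ ≤ ENNReal.ofReal (Real.exp (-w d))

end

end HighDimSGD

namespace HighDimSGD

noncomputable section

/-! ### Superpolynomial decay and overwhelming probability -/

/-! The family `𝓑ᵢ` enters only through its moments `M_m = (1/d) ∑ λᵢᵐ 𝓑ᵢ` (`momB`). Their
counterparts for SGD are `P_m = Wᵀ Kᵐ W` (`powB`). Both start from the same values and follow, to
leading order, one infinite hierarchy (`momField`), in which `M_m` is driven linearly by `M_{m+1}`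
and the coefficients `∇h` and `I` depend on `M_1` only. The squared distances `‖X - X⋆‖²` and `𝓓²`
are the same linear functional, the trace against `diffForm`, of `P_0` and `M_0`.

Decay. Differentiating `h` along the covariances of `(x + s(x - y)) ⊕ y` identifies the drift of
`𝓓²` with `-2γ 𝔼⟨∇ₓf, x - y⟩` (`trace_drift_eq_integral`). The lower right block of the covariance
is conserved, so `y` almost surely minimizes the slice of `f`. RSI bounds the drift from one side
and smoothness gives `tr I ≤ L̂² 𝔼‖x - y‖²` (`energy_bounds`). The step size makes the second-order
term the fraction `ζ` of the secant term, and `λ_min` compares `M_1` with `M_0`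
(`IsSolution.distSq_le`).

Existence. The Fisher matrix is Lipschitz on positive semidefinite matrices only, and these form a
closed cone. It is replaced by a Lipschitz extension, to which Picard-Lindelöf applies. The solution
remains in the cone by a Nagumo argument (`mem_of_infDist_tangent`), because an Euler step is a
congruence plus a positive source, up to second order (`euler_posSemidef`). The decay bounds `tr
M_0` uniformly in `d` and in time. A solution that stays inside `U` with a margin therefore has
bounded speed and can be continued (`lt_of_maximal_flow`).

Comparison. One SGD step changes `P_m` by its conditional mean plus a centred term. The mean is
`momField / d` up to `O(d^{-3/2})`, since `aᵀKᵐa` concentrates around `tr K^{m+1}`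
(`abs_integral_incr_sub_le`). The centred terms have size `1/d`, so moment bounds for martingales
control their sums over `O(d)` steps by `d^{-1/4}`, outside events of superpolynomially small
probability. Errors are measured with the weights `(2κ)^m`: the shift from `m` to `m + 1` costs only
a constant, and the surplus `2^m` over the natural size `κ^m` makes the exceptional probabilities
summable over all `m` (`exists_deviation_bound`). A discrete Gronwall argument
(`norm_powB_sub_momB_le`) then keeps SGD close to the deterministic equivalent and inside the region
where the estimates hold. -/

theorem withOverwhelmingProbability_of_superpolynomial {Ω : ℕ → Type*}
    [∀ d, MeasurableSpace (Ω d)] {P : ∀ d, Measure (Ω d)} [∀ d, IsProbabilityMeasure (P d)]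
    {E : ∀ d, Set (Ω d)}
    (h : ∀ p : ℕ, ∃ C : ℝ, ∀ d : ℕ, 0 < d →
      P d (E d)ᶜ ≤ ENNReal.ofReal (C * ((d : ℝ) ^ p)⁻¹)) :
    WithOverwhelmingProbability P E := by
  set r : ℕ → ℝ := fun d => (P d (E d)ᶜ).toReal with hr
  -- The choice `w = -log r` turns the required bound into an equality. If the failure probability
  -- is zero, any rate that beats `log d` will do.
  refine ⟨fun d => if r d = 0 then (d : ℝ) else - Real.log (r d), ?_, ?_⟩
  · rw [tendsto_atTop]
    intro b
    -- One power of `d` more than needed: the spare `log d` absorbs the logarithm of the constant.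
    obtain ⟨p, hp⟩ := exists_nat_ge (b + 1)
    obtain ⟨C, hC⟩ := h p
    have h1 : ∀ᶠ d : ℕ in atTop, b * Real.log d ≤ d := by
      have := (Real.isLittleO_log_id_atTop.comp_tendsto tendsto_natCast_atTop_atTop).def
        (c := 1 / (|b| + 1)) (by positivity)
      filter_upwards [this, eventually_ge_atTop 1] with d hd hd1
      have hlog : 0 ≤ Real.log d := Real.log_natCast_nonneg d
      simp only [Function.comp_apply, id_eq, Real.norm_eq_abs, abs_of_nonneg hlog,
        Nat.abs_cast] at hd
      have h3 : (|b| + 1) * Real.log d ≤ d := by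
        rw [one_div, inv_mul_eq_div, le_div_iff₀ (by positivity)] at hd
        linarith
      nlinarith [le_abs_self b]
    have h2 : ∀ᶠ d : ℕ in atTop, |Real.log (max C 1)| ≤ Real.log d :=
      (Real.tendsto_log_atTop.comp tendsto_natCast_atTop_atTop).eventually_ge_atTop _
    filter_upwards [h1, h2, eventually_ge_atTop 2] with d h1 h2 hd
    have hd0 : (0 : ℝ) < d := by positivity
    have hlog : 0 < Real.log d := Real.log_pos (by exact_mod_cast hd)
    rw [le_div_iff₀ hlog]
    split_ifs with h0
    · exact h1
    · have hrpos : 0 < r d := lt_of_le_of_ne ENNReal.toReal_nonneg (Ne.symm h0)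
      have hle : r d ≤ max C 1 * ((d : ℝ) ^ p)⁻¹ := by
        refine ENNReal.toReal_le_of_le_ofReal (by positivity) ((hC d (by omega)).trans ?_)
        exact ENNReal.ofReal_le_ofReal (mul_le_mul_of_nonneg_right (le_max_left _ _) (by positivity))
      have := Real.log_le_log hrpos hle
      rw [Real.log_mul (by positivity) (by positivity), Real.log_inv, Real.log_pow] at this
      nlinarith [le_abs_self (Real.log (max C 1))]
  · intro d hd
    beta_reduce
    split_ifs with h0
    · have : P d (E d)ᶜ = 0 := by
        rcases (ENNReal.toReal_eq_zero_iff _).1 h0 with h | h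
        · exact h
        · exact absurd h (measure_ne_top _ _)
      simp [this]
    · have hrpos : 0 < r d := lt_of_le_of_ne ENNReal.toReal_nonneg (Ne.symm h0)
      rw [neg_neg, Real.exp_log hrpos, hr, ENNReal.ofReal_toReal (measure_ne_top _ _)]

/-! ### Markov chains driven by independent samples -/

section Chain

variable {Ω S Z : Type*} [MeasurableSpace Ω] [MeasurableSpace S] [MeasurableSpace Z]

/-- The chain `s (k+1) = Φ (s k, z k)` started at `s₀`. -/
def chain (Φ : S × Z → S) (s₀ : S) (z : ℕ → Z) : ℕ → S
  | 0 => s₀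
  | k + 1 => Φ (chain Φ s₀ z k, z k)

/-- The sample `z k` is used only in the step from `k` to `k + 1`, so the state at time `k` is a
measurable function of `z 0, …, z (k - 1)`. -/
theorem chain_indepFun {P : Measure Ω} {Φ : S × Z → S} (hΦ : Measurable Φ) (s₀ : S)
    {z : ℕ → Ω → Z} (hz : ∀ k, Measurable (z k)) (hind : iIndepFun z P) (k : ℕ) :
    IndepFun (fun ω => chain Φ s₀ (fun j => z j ω) k) (z k) P := by
  have key : ∀ k : ℕ, ∃ T : (Finset.range k → Z) → S, Measurable T ∧
      ∀ y : ℕ → Z, chain Φ s₀ y k = T (fun j => y j) := by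
    intro k
    induction k with
    | zero => exact ⟨fun _ => s₀, measurable_const, fun y => rfl⟩
    | succ k ih =>
      obtain ⟨T, hT, hTe⟩ := ih
      refine ⟨fun y => Φ (T (fun j => y ⟨j.1, Finset.mem_range.2
        ((Finset.mem_range.1 j.2).trans (Nat.lt_succ_self k))⟩), y ⟨k, Finset.self_mem_range_succ k⟩),
        ?_, fun y => by rw [chain, hTe]⟩
      exact hΦ.comp ((hT.comp (measurable_pi_lambda _ fun j => measurable_pi_apply _)).prodMk
        (measurable_pi_apply _))
  obtain ⟨T, hT, hTe⟩ := key k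
  have h1 := hind.indepFun_finset (Finset.range k) {k} (by simp) hz
  have h2 := h1.comp hT (measurable_pi_apply (⟨k, by simp⟩ : ({k} : Finset ℕ)))
  have e1 : (fun ω => chain Φ s₀ (fun j => z j ω) k)
      = T ∘ fun ω (i : Finset.range k) => z i ω := funext fun ω => hTe _
  rw [e1]
  exact h2

theorem chain_measurable {Φ : S × Z → S} (hΦ : Measurable Φ) (s₀ : S)
    {z : ℕ → Ω → Z} (hz : ∀ k, Measurable (z k)) (k : ℕ) :
    Measurable (fun ω => chain Φ s₀ (fun j => z j ω) k) := by
  induction k with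
  | zero => exact measurable_const
  | succ k ih => exact hΦ.comp (ih.prodMk (hz k))

/-- A pointwise inequality behind the moment bounds for martingales. -/
theorem exists_add_pow_le (q : ℕ) : ∃ c : ℝ, 0 ≤ c ∧ ∀ s y : ℝ,
    (s + y) ^ (2 * (q + 1)) ≤ s ^ (2 * (q + 1)) + (2 * (q + 1) : ℕ) * s ^ (2 * q + 1) * y
      + c * (s ^ (2 * q) * y ^ 2 + y ^ (2 * (q + 1))) := by
  refine ⟨2 * 2 ^ (2 * (q + 1)), by positivity, fun s y => ?_⟩
  have hn : 2 * (q + 1) = 2 * q + 2 := by ring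
  rw [hn, add_pow s y, Finset.sum_range_succ, Finset.sum_range_succ]
  have hch : (2 * q + 2).choose (2 * q + 1) = 2 * q + 2 := Nat.choose_succ_self_right _
  -- Every monomial with at least two factors `y` is dominated by `s^{2q} y²` if `|y| ≤ |s|` and by
  -- `y^{2q+2}` otherwise. The binomial coefficients add up to at most `2^{2q+2}`.
  have hbd : ∑ m ∈ Finset.range (2 * q + 1), s ^ m * y ^ (2 * q + 2 - m) * ((2 * q + 2).choose m : ℝ)
      ≤ 2 * 2 ^ (2 * q + 2) * (s ^ (2 * q) * y ^ 2 + y ^ (2 * q + 2)) := by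
    have hpos : 0 ≤ s ^ (2 * q) * y ^ 2 + y ^ (2 * q + 2) := by
      have h1 : 0 ≤ s ^ (2 * q) := by rw [pow_mul]; positivity
      have h2 : 0 ≤ y ^ (2 * q + 2) := by
        rw [show 2 * q + 2 = 2 * (q + 1) by ring, pow_mul]; positivity
      positivity
    calc _ ≤ ∑ m ∈ Finset.range (2 * q + 1),
          (s ^ (2 * q) * y ^ 2 + y ^ (2 * q + 2)) * ((2 * q + 2).choose m : ℝ) := by
          refine Finset.sum_le_sum fun m hm => mul_le_mul_of_nonneg_right ?_ (by positivity)
          have hm' : m ≤ 2 * q := by simpa [Nat.lt_succ_iff] using hm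
          have e1 : s ^ (2 * q) = |s| ^ (2 * q) := by rw [pow_mul, pow_mul, sq_abs]
          have e2 : y ^ (2 * q + 2) = |y| ^ (2 * q + 2) := by
            rw [show 2 * q + 2 = 2 * (q + 1) by ring, pow_mul, pow_mul, sq_abs]
          refine (le_abs_self _).trans ?_
          rw [abs_mul, abs_pow, abs_pow, e1, e2, ← sq_abs y]
          have hs := abs_nonneg s
          have hy := abs_nonneg y
          rcases le_total |s| |y| with hsy | hsy
          · calc |s| ^ m * |y| ^ (2 * q + 2 - m) ≤ |y| ^ m * |y| ^ (2 * q + 2 - m) := by gcongr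
              _ = |y| ^ (2 * q + 2) := by rw [← pow_add]; congr 1; omega
              _ ≤ _ := le_add_of_nonneg_left (by positivity)
          · calc |s| ^ m * |y| ^ (2 * q + 2 - m)
                = |s| ^ m * (|y| ^ (2 * q - m) * |y| ^ 2) := by
                  rw [← pow_add]; congr 2; omega
              _ ≤ |s| ^ m * (|s| ^ (2 * q - m) * |y| ^ 2) := by gcongr
              _ = |s| ^ (2 * q) * |y| ^ 2 := by rw [← mul_assoc, ← pow_add]; congr 2; omega
              _ ≤ _ := le_add_of_nonneg_right (by positivity)
      _ = (s ^ (2 * q) * y ^ 2 + y ^ (2 * q + 2)) *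
          ∑ m ∈ Finset.range (2 * q + 1), ((2 * q + 2).choose m : ℝ) := by rw [Finset.mul_sum]
      _ ≤ (s ^ (2 * q) * y ^ 2 + y ^ (2 * q + 2)) * 2 ^ (2 * q + 2) := by
          refine mul_le_mul_of_nonneg_left ?_ hpos
          have := Nat.sum_range_choose (2 * q + 2)
          rw [show 2 * q + 2 + 1 = (2 * q + 1) + 1 + 1 by ring, Finset.sum_range_succ,
            Finset.sum_range_succ] at this
          have h3 : ∑ m ∈ Finset.range (2 * q + 1), (2 * q + 2).choose m ≤ 2 ^ (2 * q + 2) := by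
            omega
          exact_mod_cast h3
      _ ≤ _ := by nlinarith [pow_pos (two_pos (α := ℝ)) (2 * q + 2)]
  have e3 : 2 * q + 2 - (2 * q + 1) = 1 := by omega
  rw [hch, e3]
  simp only [Nat.sub_self, pow_zero, Nat.choose_self, Nat.cast_one, mul_one, pow_one]
  push_cast at hbd ⊢
  linarith

/-- Moment bounds for sums of centred functionals of a chain: the `2q`-th moment of a sum of `n`
martingale increments of size `A` is of order `n ^ q * A ^ (2 * q)`. -/
theorem exists_chain_moment_bound (q : ℕ) : ∃ c : ℝ, 0 ≤ c ∧
    ∀ {Ω S Z : Type*} [MeasurableSpace Ω] [MeasurableSpace S] [MeasurableSpace Z]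
      {P : Measure Ω} [IsProbabilityMeasure P] {μ : Measure Z} [IsProbabilityMeasure μ]
      {Φ : S × Z → S} (_ : Measurable Φ) (s₀ : S)
      {z : ℕ → Ω → Z} (_ : ∀ k, Measurable (z k)) (_ : ∀ k, P.map (z k) = μ)
      (_ : iIndepFun z P)
      {ψ : S × Z → ℝ} (_ : Measurable ψ) {A : ℝ} (_ : 0 ≤ A)
      (_ : ∀ x, ∀ j, Integrable (fun y => ψ (x, y) ^ j) μ)
      (_ : ∀ x, ∀ j ≤ q, ∫ y, ψ (x, y) ^ (2 * j) ∂μ ≤ A ^ (2 * j))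
      (_ : ∀ x, ∫ y, ψ (x, y) ∂μ = 0) (n : ℕ),
      ∫⁻ ω, ENNReal.ofReal
        ((∑ k ∈ Finset.range n, ψ (chain Φ s₀ (fun j => z j ω) k, z k ω)) ^ (2 * q)) ∂P
        ≤ ENNReal.ofReal (c * n ^ q * A ^ (2 * q)) := by
  induction q with
  | zero => exact ⟨1, zero_le_one, by intros; simp⟩
  | succ q ih =>
    obtain ⟨c, hc, ih⟩ := ih
    obtain ⟨b, hb, hpt⟩ := exists_add_pow_le q
    refine ⟨b * (c + 1), by positivity, ?_⟩
    intro Ω S Z _ _ _ P _ μ _ Φ hΦ s₀ z hz hzl hind ψ hψ A hA hint hmom hmean n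
    have ihn := fun n => ih hΦ s₀ hz hzl hind hψ hA hint (fun x j hj => hmom x j (hj.trans (Nat.le_succ q))) hmean n
    induction n with
    | zero => simp
    | succ n hn =>
      -- the augmented chain
      let Φ' : (S × ℝ) × Z → S × ℝ := fun p => (Φ (p.1.1, p.2), p.1.2 + ψ (p.1.1, p.2))
      have hΦ' : Measurable Φ' := by fun_prop
      have haug : ∀ (y : ℕ → Z) (k : ℕ), chain Φ' (s₀, 0) y k
          = (chain Φ s₀ y k, ∑ j ∈ Finset.range k, ψ (chain Φ s₀ y j, y j)) := by
        intro y k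
        induction k with
        | zero => rfl
        | succ k ihk => rw [chain, ihk, Finset.sum_range_succ]; rfl
      -- With the partial sum adjoined to the state, the next sample is independent of the state and
      -- the sum jointly.
      have hI := chain_indepFun (P := P) hΦ' (s₀, 0) hz hind n
      have hM := chain_measurable hΦ' (s₀, (0 : ℝ)) hz n
      set Y : Ω → S × ℝ := fun ω => chain Φ' (s₀, 0) (fun j => z j ω) n with hY
      have hY1 : ∀ ω, (Y ω).1 = chain Φ s₀ (fun j => z j ω) n := fun ω => by rw [hY]; simp [haug]
      have hY2 : ∀ ω, (Y ω).2 = ∑ j ∈ Finset.range n, ψ (chain Φ s₀ (fun j => z j ω) j, z j ω) :=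
        fun ω => by rw [hY]; simp [haug]
      have hprod := (indepFun_iff_map_prod_eq_prod_map_map hM.aemeasurable
        (hz n).aemeasurable).1 hI
      rw [hzl n] at hprod
      have hev : ∀ t : ℝ, ∀ j, 0 ≤ t ^ (2 * j) := fun t j => by rw [pow_mul]; positivity
      calc ∫⁻ ω, ENNReal.ofReal ((∑ k ∈ Finset.range (n + 1),
              ψ (chain Φ s₀ (fun j => z j ω) k, z k ω)) ^ (2 * (q + 1))) ∂P
          = ∫⁻ ω, (fun p : (S × ℝ) × Z =>
              ENNReal.ofReal ((p.1.2 + ψ (p.1.1, p.2)) ^ (2 * (q + 1)))) (Y ω, z n ω) ∂P := by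
            refine lintegral_congr fun ω => ?_
            simp only [hY1, hY2, Finset.sum_range_succ]
        _ = ∫⁻ p, ENNReal.ofReal ((p.1.2 + ψ (p.1.1, p.2)) ^ (2 * (q + 1)))
              ∂((P.map Y).prod μ) := by
            rw [← hprod, lintegral_map (by fun_prop) (hM.prodMk (hz n))]
        _ = ∫⁻ s, ∫⁻ y, ENNReal.ofReal ((s.2 + ψ (s.1, y)) ^ (2 * (q + 1))) ∂μ ∂(P.map Y) := by
            rw [lintegral_prod _ (by fun_prop)]
        -- Given the past, the term linear in the increment integrates to zero. What remains is the
        -- previous value of the moment, the moment of order `2q` weighted by `A²`, and a constant: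
        -- the induction on `q` treats the second and the induction on `n` the first.
        _ ≤ ∫⁻ s, (ENNReal.ofReal (s.2 ^ (2 * (q + 1)))
              + ENNReal.ofReal (b * A ^ 2) * ENNReal.ofReal (s.2 ^ (2 * q))
              + ENNReal.ofReal (b * A ^ (2 * (q + 1)))) ∂(P.map Y) := by
            refine lintegral_mono fun s => ?_
            have i1 := hint s.1 1
            have i2 := hint s.1 2
            have iq := hint s.1 (2 * (q + 1))
            simp only [pow_one] at i1
            have hI0 : Integrable (fun y => s.2 ^ (2 * (q + 1))
                + (2 * (q + 1) : ℕ) * s.2 ^ (2 * q + 1) * ψ (s.1, y)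
                + b * (s.2 ^ (2 * q) * ψ (s.1, y) ^ 2 + ψ (s.1, y) ^ (2 * (q + 1)))) μ :=
              ((integrable_const _).add (i1.const_mul _)).add
                (((i2.const_mul _).add iq).const_mul _)
            calc ∫⁻ y, ENNReal.ofReal ((s.2 + ψ (s.1, y)) ^ (2 * (q + 1))) ∂μ
                ≤ ∫⁻ y, ENNReal.ofReal (s.2 ^ (2 * (q + 1))
                + (2 * (q + 1) : ℕ) * s.2 ^ (2 * q + 1) * ψ (s.1, y)
                + b * (s.2 ^ (2 * q) * ψ (s.1, y) ^ 2 + ψ (s.1, y) ^ (2 * (q + 1)))) ∂μ :=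
                  lintegral_mono fun y => ENNReal.ofReal_le_ofReal (hpt _ _)
              _ = ENNReal.ofReal (∫ y, (s.2 ^ (2 * (q + 1))
                + (2 * (q + 1) : ℕ) * s.2 ^ (2 * q + 1) * ψ (s.1, y)
                + b * (s.2 ^ (2 * q) * ψ (s.1, y) ^ 2 + ψ (s.1, y) ^ (2 * (q + 1)))) ∂μ) :=
                  (ofReal_integral_eq_lintegral_ofReal hI0
                    (ae_of_all _ fun y => (hev _ _).trans (hpt _ _))).symm
              _ ≤ ENNReal.ofReal (s.2 ^ (2 * (q + 1)) + b * A ^ 2 * s.2 ^ (2 * q)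
                    + b * A ^ (2 * (q + 1))) := by
                  refine ENNReal.ofReal_le_ofReal ?_
                  have j1 : Integrable (fun y => (2 * (q + 1) : ℕ) * s.2 ^ (2 * q + 1)
                    * ψ (s.1, y)) μ := i1.const_mul _
                  have j2 : Integrable (fun y => s.2 ^ (2 * (q + 1))
                    + (2 * (q + 1) : ℕ) * s.2 ^ (2 * q + 1) * ψ (s.1, y)) μ :=
                    (integrable_const _).add j1
                  have j3 : Integrable (fun y => s.2 ^ (2 * q) * ψ (s.1, y) ^ 2) μ :=
                    i2.const_mul _
                  have j4 : Integrable (fun y => b * (s.2 ^ (2 * q) * ψ (s.1, y) ^ 2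
                    + ψ (s.1, y) ^ (2 * (q + 1)))) μ := (j3.add iq).const_mul _
                  rw [integral_add j2 j4, integral_add (integrable_const _) j1,
                    integral_const_mul, integral_const_mul, integral_add j3 iq,
                    integral_const_mul, hmean]
                  have m2 := hmom s.1 1 (by omega)
                  have mq := hmom s.1 (q + 1) le_rfl
                  rw [mul_one] at m2
                  have := mul_le_mul_of_nonneg_left m2 (hev s.2 q)
                  have h4 : b * (s.2 ^ (2 * q) * ∫ y, ψ (s.1, y) ^ 2 ∂μ
                      + ∫ y, ψ (s.1, y) ^ (2 * (q + 1)) ∂μ)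
                      ≤ b * (s.2 ^ (2 * q) * A ^ 2 + A ^ (2 * (q + 1))) :=
                    mul_le_mul_of_nonneg_left (add_le_add this mq) hb
                  simp only [integral_const, probReal_univ, one_smul, mul_zero,
                    add_zero]
                  linarith
              _ = _ := by
                  rw [ENNReal.ofReal_add (add_nonneg (hev _ _) (mul_nonneg (by positivity)
                    (hev _ _))) (by positivity), ENNReal.ofReal_add (hev _ _)
                    (mul_nonneg (by positivity) (hev _ _)),
                    ENNReal.ofReal_mul (p := b * A ^ 2) (by positivity)]
        _ = ∫⁻ s, ENNReal.ofReal (s.2 ^ (2 * (q + 1))) ∂(P.map Y)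
              + ENNReal.ofReal (b * A ^ 2) * ∫⁻ s, ENNReal.ofReal (s.2 ^ (2 * q)) ∂(P.map Y)
              + ENNReal.ofReal (b * A ^ (2 * (q + 1))) := by
            have : IsProbabilityMeasure (P.map Y) := Measure.isProbabilityMeasure_map hM.aemeasurable
            rw [lintegral_add_right _ measurable_const, lintegral_add_right _ (by fun_prop),
              lintegral_const_mul _ (by fun_prop), lintegral_const, measure_univ, mul_one]
        _ = ∫⁻ ω, ENNReal.ofReal ((∑ k ∈ Finset.range n,
              ψ (chain Φ s₀ (fun j => z j ω) k, z k ω)) ^ (2 * (q + 1))) ∂P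
              + ENNReal.ofReal (b * A ^ 2) * ∫⁻ ω, ENNReal.ofReal ((∑ k ∈ Finset.range n,
              ψ (chain Φ s₀ (fun j => z j ω) k, z k ω)) ^ (2 * q)) ∂P
              + ENNReal.ofReal (b * A ^ (2 * (q + 1))) := by
            rw [lintegral_map (by fun_prop) hM, lintegral_map (by fun_prop) hM]
            simp only [hY2]
        _ ≤ ENNReal.ofReal (b * (c + 1) * n ^ (q + 1) * A ^ (2 * (q + 1)))
              + ENNReal.ofReal (b * A ^ 2) * ENNReal.ofReal (c * n ^ q * A ^ (2 * q))
              + ENNReal.ofReal (b * A ^ (2 * (q + 1))) := by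
            gcongr
            exact ihn n
        _ ≤ _ := by
            rw [← ENNReal.ofReal_mul (by positivity), ← ENNReal.ofReal_add (by positivity)
              (by positivity), ← ENNReal.ofReal_add (by positivity) (by positivity)]
            refine ENNReal.ofReal_le_ofReal ?_
            have hn0 : (0 : ℝ) ≤ n := Nat.cast_nonneg n
            have e1 : b * A ^ 2 * (c * n ^ q * A ^ (2 * q)) = b * c * n ^ q * A ^ (2 * (q + 1)) := by
              ring
            have hA' : 0 ≤ b * A ^ (2 * (q + 1)) := by positivity
            -- The coefficient `b (c + 1)` is split: the part `b c` absorbs the term of order `n^q`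
            -- and the part `b` absorbs the constant one.
            have hge : (n : ℝ) ^ (q + 1) + n ^ q ≤ (n + 1 : ℝ) ^ (q + 1) := by
              have := pow_le_pow_left₀ hn0 (by linarith : (n : ℝ) ≤ n + 1) q
              have h5 : (0 : ℝ) ≤ n ^ q := by positivity
              rw [pow_succ, pow_succ]; nlinarith
            have hge1 : (1 : ℝ) + n ^ (q + 1) ≤ (n + 1 : ℝ) ^ (q + 1) := by
              have := one_le_pow₀ (by linarith : (1 : ℝ) ≤ n + 1) (n := q)
              have h6 := pow_le_pow_left₀ hn0 (by linarith : (n : ℝ) ≤ n + 1) q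
              rw [pow_succ, pow_succ]; nlinarith
            rw [e1]
            push_cast
            have h7 := mul_le_mul_of_nonneg_left hge (mul_nonneg hA' hc)
            have h8 := mul_le_mul_of_nonneg_left hge1 hA'
            linarith [h7, h8]

end Chain


/-! ### Autonomous equations on a domain -/

section Flow

variable {E : Type*} [NormedAddCommGroup E] [NormedSpace ℝ E]

/-- `u` solves `u' = v u` on `[0, S)`, starts at `x₀` and stays in `D`. -/
structure FlowsOn (D : Set E) (v : E → E) (x₀ : E) (S : EReal) (u : ℝ → E) : Prop where
  init : u 0 = x₀
  mem : ∀ t : ℝ, 0 ≤ t → (t : EReal) < S → u t ∈ D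
  ode : ∀ t : ℝ, 0 ≤ t → (t : EReal) < S → HasDerivWithinAt u (v (u t)) (Set.Ici 0) t

/-- `v` is locally Lipschitz on `D`. -/
def LocLip (D : Set E) (v : E → E) : Prop :=
  ∀ x ∈ D, ∃ K : NNReal, ∃ s ∈ 𝓝 x, LipschitzOnWith K v (s ∩ D)

/-- Every point of `D` is the start of a solution that exists for a positive time. -/
def LocSolvable (D : Set E) (v : E → E) : Prop :=
  ∀ x ∈ D, ∃ τ : ℝ, 0 < τ ∧ ∃ u, FlowsOn D v x τ u

variable {D : Set E} {v : E → E} {x₀ : E}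

omit [NormedSpace ℝ E] in
theorem LocLip.continuousOn (hv : LocLip D v) : ContinuousOn v D := by
  intro x hx
  obtain ⟨K, s, hs, hK⟩ := hv x hx
  have := hK.continuousOn x ⟨mem_of_mem_nhds hs, hx⟩
  exact (continuousWithinAt_inter' (mem_nhdsWithin_of_mem_nhds hs)).1
    (by rwa [Set.inter_comm] at this)

theorem FlowsOn.continuousOn {S : EReal} {u : ℝ → E} (hu : FlowsOn D v x₀ S u) {t : ℝ}
    (ht : (t : EReal) < S) : ContinuousOn u (Set.Icc 0 t) := fun s hs =>
  ((hu.ode s hs.1 (lt_of_le_of_lt (EReal.coe_le_coe_iff.2 hs.2) ht)).continuousWithinAt).mono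
    Set.Icc_subset_Ici_self

/-- Continuous induction: the set of times of agreement is closed in `[0, t]`, and the Gronwall
uniqueness theorem near a common value prolongs it to the right. `D` need not be open, since both
solutions stay in `D` and the Lipschitz bound is only used there. -/
theorem FlowsOn.unique (hv : LocLip D v) {S S' : EReal} {u u' : ℝ → E}
    (hu : FlowsOn D v x₀ S u) (hu' : FlowsOn D v x₀ S' u') {t : ℝ} (h0 : 0 ≤ t)
    (ht : (t : EReal) < S) (ht' : (t : EReal) < S') : u t = u' t := by
  have hc := hu.continuousOn ht
  have hc' := hu'.continuousOn ht'
  suffices h : Set.Icc 0 t ⊆ {s | u s = u' s} from h (Set.right_mem_Icc.2 h0)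
  have hlt : ∀ s ∈ Set.Icc 0 t, (s : EReal) < S ∧ (s : EReal) < S' := fun s hs =>
    ⟨(EReal.coe_le_coe_iff.2 hs.2).trans_lt ht, (EReal.coe_le_coe_iff.2 hs.2).trans_lt ht'⟩
  refine IsClosed.Icc_subset_of_forall_exists_gt ?_ (by simp [hu.init, hu'.init]) ?_
  · have := (hc.sub hc').preimage_isClosed_of_isClosed isClosed_Icc (isClosed_singleton (x := (0 : E)))
    convert this using 1
    ext s
    simp [sub_eq_zero, and_comm]
  · rintro x ⟨hx, hx0, hxt⟩ y hy
    have hxe : u x = u' x := hx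
    have hxl := hlt x ⟨hx0, hxt.le⟩
    obtain ⟨K, s, hs, hK⟩ := hv _ (hu.mem x hx0 hxl.1)
    have e1 : ∀ᶠ w in 𝓝[Set.Ici x] x, u w ∈ s :=
      ((hu.ode x hx0 hxl.1).continuousWithinAt.mono (Set.Ici_subset_Ici.2 hx0)) hs
    have e2 : ∀ᶠ w in 𝓝[Set.Ici x] x, u' w ∈ s :=
      ((hu'.ode x hx0 hxl.2).continuousWithinAt.mono (Set.Ici_subset_Ici.2 hx0)) (hxe ▸ hs)
    obtain ⟨w, hw, hws⟩ := (mem_nhdsGE_iff_exists_mem_Ioc_Ico_subset (show x < min y t from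
      lt_min hy hxt)).1 (e1.and e2)
    obtain ⟨hwx, hwy⟩ := hw
    have hwt : w ≤ t := hwy.trans (min_le_right _ _)
    have hsub : ∀ r ∈ Set.Ico x w, r ∈ Set.Icc 0 t := fun r hr =>
      ⟨hx0.trans hr.1, hr.2.le.trans hwt⟩
    have := ODE_solution_unique_of_mem_Icc_right (v := fun _ => v) (s := fun _ => s ∩ D) (K := K)
      (f := u) (g := u') (a := x) (b := w) (fun _ _ => hK)
      (hc.mono (Set.Icc_subset_Icc hx0 hwt))
      (fun r hr => (hu.ode r (hsub r hr).1 (hlt r (hsub r hr)).1).mono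
        (Set.Ici_subset_Ici.2 (hsub r hr).1))
      (fun r hr => ⟨(hws hr).1, hu.mem r (hsub r hr).1 (hlt r (hsub r hr)).1⟩)
      (hc'.mono (Set.Icc_subset_Icc hx0 hwt))
      (fun r hr => (hu'.ode r (hsub r hr).1 (hlt r (hsub r hr)).2).mono
        (Set.Ici_subset_Ici.2 (hsub r hr).1))
      (fun r hr => ⟨(hws hr).2, hu'.mem r (hsub r hr).1 (hlt r (hsub r hr)).2⟩)
      hxe
    exact ⟨w, this (Set.right_mem_Icc.2 hwx.le), hwx, hwy.trans (min_le_left _ _)⟩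

/-- Existence of the maximal solution. -/
theorem exists_maximal_flow (hv : LocLip D v) (hs : LocSolvable D v) (hx₀ : x₀ ∈ D) :
    ∃ (Θ : EReal) (u : ℝ → E), 0 < Θ ∧ FlowsOn D v x₀ Θ u ∧
      ∀ (S : EReal) (u' : ℝ → E), FlowsOn D v x₀ S u' →
        S ≤ Θ ∧ ∀ t : ℝ, 0 ≤ t → (t : EReal) < S → u' t = u t := by
  classical
  set 𝒮 : Set EReal := {S | ∃ u, FlowsOn D v x₀ S u} with h𝒮
  -- All solutions are glued: the value at `t` is that of any solution alive at time `t`, and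
  -- uniqueness makes the choice irrelevant.
  set u : ℝ → E := fun t =>
    if h : ∃ p : EReal × (ℝ → E), FlowsOn D v x₀ p.1 p.2 ∧ (t : EReal) < p.1
    then h.choose.2 t else 0 with hu
  have hagree : ∀ (S : EReal) (w : ℝ → E), FlowsOn D v x₀ S w → ∀ t : ℝ, 0 ≤ t →
      (t : EReal) < S → w t = u t := by
    intro S w hw t h0 ht
    have h : ∃ p : EReal × (ℝ → E), FlowsOn D v x₀ p.1 p.2 ∧ (t : EReal) < p.1 := ⟨(S, w), hw, ht⟩
    simp only [hu, dif_pos h]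
    exact hw.unique hv h.choose_spec.1 h0 ht h.choose_spec.2
  obtain ⟨τ, hτ, w₀, hw₀⟩ := hs x₀ hx₀
  have hΘ : (0 : EReal) < sSup 𝒮 :=
    lt_of_lt_of_le (EReal.coe_pos.2 hτ) (le_sSup ⟨w₀, hw₀⟩)
  refine ⟨sSup 𝒮, u, hΘ, ⟨?_, ?_, ?_⟩, fun S u' hu' => ⟨le_sSup ⟨u', hu'⟩, hagree S u' hu'⟩⟩
  · rw [← hagree τ w₀ hw₀ 0 le_rfl (EReal.coe_pos.2 hτ), hw₀.init]
  · intro t h0 ht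
    obtain ⟨S, ⟨w, hw⟩, hS⟩ := lt_sSup_iff.1 ht
    rw [← hagree S w hw t h0 hS]
    exact hw.mem t h0 hS
  · intro t h0 ht
    obtain ⟨S, ⟨w, hw⟩, hS⟩ := lt_sSup_iff.1 ht
    rw [← hagree S w hw t h0 hS]
    refine (hw.ode t h0 hS).congr_of_eventuallyEq ?_ (hagree S w hw t h0 hS).symm
    have : ∀ᶠ s : ℝ in 𝓝 t, (s : EReal) < S :=
      (continuous_coe_real_ereal.continuousAt (x := t)).eventually_lt continuousAt_const hS
    filter_upwards [self_mem_nhdsWithin, mem_nhdsWithin_of_mem_nhds this] with s hs0 hsS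
    exact (hagree S w hw s hs0 hsS).symm

/-- A solution with a limit in `D` at the end of its interval can be continued. -/
theorem FlowsOn.extend (hv : LocLip D v) (hs : LocSolvable D v) {τ : ℝ} (hτ : 0 < τ) {u : ℝ → E}
    (hu : FlowsOn D v x₀ τ u) {x : E} (hx : x ∈ D) (hlim : Tendsto u (𝓝[<] τ) (𝓝 x)) :
    ∃ (S : EReal) (w : ℝ → E), (τ : EReal) < S ∧ FlowsOn D v x₀ S w := by
  obtain ⟨σ, hσ, y, hy⟩ := hs x hx
  set w : ℝ → E := fun t => if t < τ then u t else y (t - τ) with hw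
  have hwlt : ∀ t, t < τ → w t = u t := fun t ht => if_pos ht
  have hwge : ∀ t, τ ≤ t → w t = y (t - τ) := fun t ht => if_neg (not_lt.2 ht)
  have hlt : ∀ t : ℝ, ((t : EReal) < ((τ + σ : ℝ) : EReal)) → t - τ < σ := fun t ht => by
    have := EReal.coe_lt_coe_iff.1 ht; linarith
  have hshift : ∀ t : ℝ, τ ≤ t → t - τ < σ →
      HasDerivWithinAt w (v (w t)) (Set.Ici τ) t := by
    intro t h1 h2
    have h3 := hy.ode (t - τ) (by linarith) (EReal.coe_lt_coe_iff.2 h2)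
    have h4 : HasDerivWithinAt (fun s : ℝ => s - τ) 1 (Set.Ici τ) t :=
      (hasDerivWithinAt_id t _).sub_const τ
    have h5 := h3.scomp t h4 (fun s hs => by simpa using hs)
    rw [one_smul] at h5
    rw [hwge t h1]
    exact h5.congr (fun s hs => hwge s hs) (hwge t h1)
  have hleft : ∀ t : ℝ, 0 ≤ t → t < τ → HasDerivWithinAt w (v (w t)) (Set.Ici 0) t := by
    intro t h0 ht
    rw [hwlt t ht]
    refine (hu.ode t h0 (EReal.coe_lt_coe_iff.2 ht)).congr_of_eventuallyEq ?_ (hwlt t ht)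
    filter_upwards [mem_nhdsWithin_of_mem_nhds (Iio_mem_nhds ht)] with s hs using hwlt s hs
  have hwτ : w τ = x := by rw [hwge τ le_rfl, sub_self, hy.init]
  have hmem : ∀ t : ℝ, 0 ≤ t → (t : EReal) < ((τ + σ : ℝ) : EReal) → w t ∈ D := by
    intro t h0 ht
    rcases lt_or_ge t τ with h | h
    · rw [hwlt t h]; exact hu.mem t h0 (EReal.coe_lt_coe_iff.2 h)
    · rw [hwge t h]; exact hy.mem _ (by linarith) (EReal.coe_lt_coe_iff.2 (hlt t ht))
  refine ⟨((τ + σ : ℝ) : EReal), w, EReal.coe_lt_coe_iff.2 (by linarith), ⟨?_, hmem, ?_⟩⟩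
  · rw [hwlt 0 hτ, hu.init]
  intro t h0 ht
  rcases lt_trichotomy t τ with h | rfl | h
  · exact hleft t h0 h
  -- At the junction the left derivative is the limit of the derivatives, by continuity of `v` on
  -- `D`. The right derivative comes from the restarted solution.
  · have hda : ∀ s ∈ Set.Ioo 0 t, HasDerivAt w (v (w s)) s := fun s hs =>
      (hleft s hs.1.le hs.2).hasDerivAt (Ici_mem_nhds hs.1)
    have hwlim : Tendsto w (𝓝[<] t) (𝓝 x) := hlim.congr' (by
      filter_upwards [self_mem_nhdsWithin] with s hs using (hwlt s hs).symm)
    have hIoo : Set.Ioo 0 t ∈ 𝓝[<] t := Ioo_mem_nhdsLT hτ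
    have h1 : HasDerivWithinAt w (v x) (Set.Iic t) t := by
      refine hasDerivWithinAt_Iic_of_tendsto_deriv (s := Set.Ioo 0 t)
        (fun s hs => (hda s hs).differentiableAt.differentiableWithinAt) ?_ hIoo ?_
      · rw [ContinuousWithinAt, hwτ]
        exact hwlim.mono_left (nhdsWithin_mono _ fun s hs => hs.2)
      · have h2 : Tendsto (fun s => v (w s)) (𝓝[<] t) (𝓝 (v x)) := by
          refine (hv.continuousOn x hx).tendsto.comp
            (tendsto_nhdsWithin_iff.2 ⟨hwlim, ?_⟩)
          filter_upwards [hIoo] with s hs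
          exact hmem s hs.1.le (EReal.coe_lt_coe_iff.2 (by linarith [hs.2]))
        refine h2.congr' ?_
        filter_upwards [hIoo] with s hs using (hda s hs).deriv.symm
    have h2 := hshift t le_rfl (by simpa using hσ)
    rw [hwτ] at h2 ⊢
    exact (h1.union h2).mono (by simp)
  · have := (hshift t h.le (hlt t ht)).hasDerivAt (Ici_mem_nhds h)
    exact this.hasDerivWithinAt

/-- A maximal solution that stays, with bounded speed, in a closed subset of the domain up to time
`T` exists beyond time `T`. -/
theorem lt_of_maximal_flow [FiniteDimensional ℝ E] (hv : LocLip D v) (hs : LocSolvable D v)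
    {Θ : EReal} {u : ℝ → E} (hΘ : 0 < Θ) (hu : FlowsOn D v x₀ Θ u)
    (hmax : ∀ (S : EReal) (u' : ℝ → E), FlowsOn D v x₀ S u' → S ≤ Θ)
    {T : ℝ} {F : Set E} (hF : IsClosed F) (hFD : F ⊆ D) {c : NNReal}
    (h : ∀ t : ℝ, 0 ≤ t → t ≤ T → (t : EReal) < Θ → u t ∈ F ∧ ‖v (u t)‖₊ ≤ c) :
    (T : EReal) < Θ := by
  by_contra hT
  rw [not_lt] at hT
  obtain ⟨τ, rfl⟩ : ∃ τ : ℝ, Θ = τ := by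
    induction Θ with
    | bot => simp at hΘ
    | coe τ => exact ⟨τ, rfl⟩
    | top => simp at hT
  have hτ : 0 < τ := EReal.coe_pos.1 hΘ
  have hτT : τ ≤ T := EReal.coe_le_coe_iff.1 hT
  have hin : ∀ t ∈ Set.Ico 0 τ, u t ∈ F ∧ ‖v (u t)‖₊ ≤ c := fun t ht =>
    h t ht.1 (ht.2.le.trans hτT) (EReal.coe_lt_coe_iff.2 ht.2)
  have hlip : LipschitzOnWith c u (Set.Ico 0 τ) :=
    (convex_Ico 0 τ).lipschitzOnWith_of_nnnorm_hasDerivWithin_le (f' := fun t => v (u t))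
      (fun t ht => (hu.ode t ht.1 (EReal.coe_lt_coe_iff.2 ht.2)).mono Set.Ico_subset_Ici_self)
      fun t ht => (hin t ht).2
  -- Bounded speed makes `u` Lipschitz on `[0, τ)`; a Lipschitz extension to the whole line supplies
  -- the limit at `τ`.
  obtain ⟨g, hg, hgu⟩ := hlip.extend_finite_dimension
  have hIco : Set.Ico 0 τ ∈ 𝓝[<] τ :=
    mem_of_superset (Ioo_mem_nhdsLT hτ) Set.Ioo_subset_Ico_self
  have hlim : Tendsto u (𝓝[<] τ) (𝓝 (g τ)) := by
    refine ((hg.continuous.tendsto τ).mono_left nhdsWithin_le_nhds).congr' ?_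
    filter_upwards [hIco] with s hs using (hgu hs).symm
  have hx : g τ ∈ F := hF.mem_of_tendsto hlim (by
    filter_upwards [hIco] with s hs using (hin s hs).1)
  obtain ⟨S, w, hS, hw⟩ := hu.extend hv hs hτ (hFD hx) hlim
  exact absurd (hmax S w hw) (not_le.2 hS)

/-- An invariance criterion of Nagumo type: a curve which starts in the closed set `C` stays there
if its tangent directions keep, to first order, the distance to `C` under control. -/
theorem mem_of_infDist_tangent {C : Set E} (hC : IsClosed C) {u w : ℝ → E} {τ r k m : ℝ}
    (hk : 0 ≤ k) (h0 : u 0 ∈ C) (hcont : ContinuousOn u (Set.Icc 0 τ))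
    (hder : ∀ t ∈ Set.Ico 0 τ, HasDerivWithinAt u (w t) (Set.Ici t) t)
    (hnear : ∀ t ∈ Set.Ico 0 τ, dist (u t) (u 0) < r)
    (htan : ∀ t ∈ Set.Ico 0 τ, ∀ p ∈ C, ‖u t - p‖ ≤ r → ∀ s ∈ Set.Ioc (0 : ℝ) 1,
      Metric.infDist (u t + s • w t) C ≤ (1 + k * s) * ‖u t - p‖ + m * s ^ 2) :
    ∀ t ∈ Set.Icc 0 τ, u t ∈ C := by
  have hne : C.Nonempty := ⟨_, h0⟩
  set g : ℝ → ℝ := fun t => Metric.infDist (u t) C with hg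
  have hstep : ∀ t ∈ Set.Ico 0 τ, ∀ s ∈ Set.Ioc (0 : ℝ) 1,
      Metric.infDist (u t + s • w t) C ≤ (1 + k * s) * g t + m * s ^ 2 := by
    intro t ht s hs
    have hgr : g t < r := (Metric.infDist_le_dist_of_mem h0).trans_lt (hnear t ht)
    have hks : 0 < 1 + k * s := by have := mul_nonneg hk hs.1.le; linarith
    -- A nearest point of `C` need not exist, so a nearly nearest one is used. Its slack is divided
    -- by the factor by which the estimate multiplies it.
    refine le_of_forall_pos_le_add fun ε hε => ?_
    obtain ⟨p, hp, hpd⟩ := (Metric.infDist_lt_iff hne).1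
      (show Metric.infDist (u t) C < min r (g t + ε / (1 + k * s)) from
        lt_min hgr (by rw [hg]; have := div_pos hε hks; linarith))
    rw [dist_eq_norm] at hpd
    have h1 := htan t ht p hp (hpd.le.trans (min_le_left _ _)) s hs
    have h2 : (1 + k * s) * ‖u t - p‖ ≤ (1 + k * s) * (g t + ε / (1 + k * s)) :=
      mul_le_mul_of_nonneg_left (hpd.le.trans (min_le_right _ _)) hks.le
    rw [mul_add, mul_div_cancel₀ _ hks.ne'] at h2
    linarith
  have hgc : ContinuousOn g (Set.Icc 0 τ) :=
    (Metric.continuous_infDist_pt C).comp_continuousOn hcont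
  -- The distance `g` to `C` satisfies `g' ≤ k g` in the sense of upper right Dini derivatives and
  -- vanishes at time zero, hence it vanishes identically.
  have hbound := le_gronwallBound_of_liminf_deriv_right_le (f := g) (f' := fun t => k * g t)
    (δ := 0) (K := k) (ε := 0) (a := 0) (b := τ) hgc ?_ ?_ (fun t _ => by simp)
  · intro t ht
    have := hbound t ht
    rw [gronwallBound_ε0_δ0] at this
    have h2 : Metric.infDist (u t) C = 0 := le_antisymm this Metric.infDist_nonneg
    exact (hC.mem_iff_infDist_zero hne).2 h2
  · intro t ht ρ hρ
    refine Eventually.frequently ?_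
    have hd : Tendsto (fun s => (s - t)⁻¹ • (u s - u t)) (𝓝[>] t) (𝓝 (w t)) := by
      have := (hder t ht).Ioi_of_Ici
      rw [hasDerivWithinAt_iff_tendsto_slope' (by simp)] at this
      exact this
    have hd' : Tendsto (fun s => ‖(s - t)⁻¹ • (u s - u t) - w t‖ + |m| * (s - t)) (𝓝[>] t) (𝓝 0) := by
      have h1 : Tendsto (fun s => ‖(s - t)⁻¹ • (u s - u t) - w t‖) (𝓝[>] t) (𝓝 0) := by
        simpa using (hd.sub_const (w t)).norm
      have h2 : Tendsto (fun s : ℝ => |m| * (s - t)) (𝓝[>] t) (𝓝 0) := by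
        have : Continuous fun s : ℝ => |m| * (s - t) := by fun_prop
        simpa using (this.tendsto t).mono_left nhdsWithin_le_nhds
      simpa using h1.add h2
    have hpos : 0 < ρ - k * g t := by linarith
    filter_upwards [hd'.eventually_lt_const hpos, Ioc_mem_nhdsGT (show t < t + 1 by linarith)]
      with s hs hst
    have hst0 : 0 < s - t := by linarith [hst.1]
    have h1 := hstep t ht (s - t) ⟨hst0, by linarith [hst.2]⟩
    have h2 : g s ≤ Metric.infDist (u t + (s - t) • w t) C + ‖u s - (u t + (s - t) • w t)‖ := by
      rw [← dist_eq_norm]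
      exact Metric.infDist_le_infDist_add_dist
    have h3 : ‖u s - (u t + (s - t) • w t)‖ = (s - t) * ‖(s - t)⁻¹ • (u s - u t) - w t‖ := by
      rw [← abs_of_pos hst0, ← Real.norm_eq_abs, ← norm_smul, Real.norm_eq_abs, abs_of_pos hst0,
        smul_sub, smul_inv_smul₀ hst0.ne', sub_sub]
    rw [h3] at h2
    rw [inv_mul_lt_iff₀ hst0]
    have h4 : m * (s - t) ^ 2 ≤ |m| * (s - t) ^ 2 :=
      mul_le_mul_of_nonneg_right (le_abs_self m) (by positivity)
    nlinarith
  · simp [hg, Metric.infDist_zero_of_mem h0]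

end Flow


/-! ### Spectral calculus for powers of a symmetric matrix -/

section Spectral

variable {d : ℕ} {K : Matrix (Fin d) (Fin d) ℝ}

theorem pow_apply_eq_sum_eigen (hK : K.IsHermitian) (m : ℕ) (j k : Fin d) :
    (K ^ m) j k = ∑ i, hK.eigenvalues i ^ m * (hK.eigenvectorBasis i j * hK.eigenvectorBasis i k) := by
  conv_lhs => rw [hK.spectral_theorem, ← map_pow, Unitary.conjStarAlgAut_apply,
    Matrix.diagonal_pow]
  rw [Matrix.mul_apply]
  refine Finset.sum_congr rfl fun i _ => ?_
  rw [Matrix.mul_diagonal, Matrix.star_apply]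
  simp only [Matrix.IsHermitian.eigenvectorUnitary_apply, Pi.pow_apply, Function.comp_apply,
    RCLike.ofReal_real_eq_id, id_eq, star_trivial]
  ring

theorem eigenvectorBasis_sum_mul (hK : K.IsHermitian) (i k : Fin d) :
    ∑ j, hK.eigenvectorBasis i j * hK.eigenvectorBasis k j = if i = k then 1 else 0 := by
  have := (orthonormal_iff_ite.1 hK.eigenvectorBasis.orthonormal) k i
  rw [PiLp.inner_apply] at this
  simp only [RCLike.inner_apply, conj_trivial] at this
  rw [this]
  simp [eq_comm]

theorem trace_pow_eq_sum_eigenvalues (hK : K.IsHermitian) (m : ℕ) :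
    (K ^ m).trace = ∑ i, hK.eigenvalues i ^ m := by
  simp only [Matrix.trace, Matrix.diag_apply, pow_apply_eq_sum_eigen hK]
  rw [Finset.sum_comm]
  refine Finset.sum_congr rfl fun i _ => ?_
  rw [← Finset.mul_sum, eigenvectorBasis_sum_mul, if_pos rfl, mul_one]

theorem dotProduct_pow_mulVec (hK : K.IsHermitian) (m : ℕ) (v w : Fin d → ℝ) :
    v ⬝ᵥ (K ^ m).mulVec w = ∑ i, hK.eigenvalues i ^ m
      * ((hK.eigenvectorBasis i).ofLp ⬝ᵥ v) * ((hK.eigenvectorBasis i).ofLp ⬝ᵥ w) := by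
  simp only [dotProduct, Matrix.mulVec, pow_apply_eq_sum_eigen hK, Finset.sum_mul, Finset.mul_sum]
  rw [Finset.sum_comm' (t' := Finset.univ) (s' := fun _ => Finset.univ) (by simp)]
  rw [Finset.sum_comm_cycle]
  refine Finset.sum_congr rfl fun i _ => ?_
  refine Finset.sum_congr rfl fun j _ => Finset.sum_congr rfl fun k _ => ?_
  ring

theorem eigenvalues_le_of_opNorm {κ : ℝ} (hK : K.IsHermitian)
    (hop : ‖Matrix.toEuclideanCLM (n := Fin d) (𝕜 := ℝ) K‖ ≤ κ) (i : Fin d) :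
    |hK.eigenvalues i| ≤ κ := by
  have h1 : Matrix.toEuclideanCLM (n := Fin d) (𝕜 := ℝ) K (hK.eigenvectorBasis i)
      = hK.eigenvalues i • hK.eigenvectorBasis i := by
    apply (WithLp.ofLp_injective 2)
    rw [Matrix.ofLp_toEuclideanCLM, hK.mulVec_eigenvectorBasis]
    rfl
  have h2 := (Matrix.toEuclideanCLM (n := Fin d) (𝕜 := ℝ) K).le_opNorm (hK.eigenvectorBasis i)
  rw [h1, norm_smul, hK.eigenvectorBasis.norm_eq_one, mul_one, mul_one] at h2
  exact h2.trans hop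

theorem dotProduct_pow_mulVec_le {κ : ℝ} (hK : K.PosSemidef)
    (hκ : ∀ i, hK.isHermitian.eigenvalues i ≤ κ) (m : ℕ) (v : Fin d → ℝ) :
    v ⬝ᵥ (K ^ m).mulVec v ≤ κ ^ m * (v ⬝ᵥ v) := by
  have h0 := dotProduct_pow_mulVec hK.isHermitian 0 v v
  rw [dotProduct_pow_mulVec hK.isHermitian]
  simp only [pow_zero, Matrix.one_mulVec, one_mul] at h0
  rw [h0, Finset.mul_sum]
  refine Finset.sum_le_sum fun i _ => ?_
  rw [mul_assoc]
  exact mul_le_mul_of_nonneg_right (pow_le_pow_left₀ (hK.eigenvalues_nonneg i) (hκ i) m)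
    (mul_self_nonneg _)

theorem dotProduct_pow_mulVec_nonneg (hK : K.PosSemidef) (m : ℕ) (v : Fin d → ℝ) :
    0 ≤ v ⬝ᵥ (K ^ m).mulVec v := by
  rw [dotProduct_pow_mulVec hK.isHermitian]
  refine Finset.sum_nonneg fun i _ => ?_
  rw [mul_assoc]
  exact mul_nonneg (pow_nonneg (hK.eigenvalues_nonneg i) m) (mul_self_nonneg _)

theorem trace_pow_le {κ : ℝ} (hK : K.PosSemidef)
    (hκ : ∀ i, hK.isHermitian.eigenvalues i ≤ κ) (m : ℕ) :
    (K ^ m).trace ≤ d * κ ^ m := by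
  rw [trace_pow_eq_sum_eigenvalues hK.isHermitian]
  calc _ ≤ ∑ _i : Fin d, κ ^ m := Finset.sum_le_sum fun i _ =>
        pow_le_pow_left₀ (hK.eigenvalues_nonneg i) (hκ i) m
    _ = _ := by simp

theorem trace_pow_nonneg (hK : K.PosSemidef) (m : ℕ) : 0 ≤ (K ^ m).trace := by
  rw [trace_pow_eq_sum_eigenvalues hK.isHermitian]
  exact Finset.sum_nonneg fun i _ => pow_nonneg (hK.eigenvalues_nonneg i) m

end Spectral

/-! ### Linear images and moments of Gaussian vectors -/

section Gaussian

variable {m n : Type*} [Fintype m] [Fintype n] [DecidableEq m] [DecidableEq n]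

/-- The characteristic functions agree, which covers singular covariances as well. -/
theorem multivariateGaussian_map_mulVec {S : Matrix n n ℝ} (hS : S.PosSemidef)
    (A : Matrix m n ℝ) :
    (multivariateGaussian 0 S).map (fun x => (WithLp.toLp 2 (A.mulVec x.ofLp) : EuclideanSpace ℝ m))
      = multivariateGaussian 0 (A * S * A.transpose) := by
  have hm : Measurable fun x : EuclideanSpace ℝ n =>
      (WithLp.toLp 2 (A.mulVec x.ofLp) : EuclideanSpace ℝ m) := by
    have : Continuous fun x : EuclideanSpace ℝ n =>
      (WithLp.toLp 2 (A.mulVec x.ofLp) : EuclideanSpace ℝ m) := by fun_prop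
    exact this.measurable
  have hP := Measure.isProbabilityMeasure_map (μ := multivariateGaussian 0 S) hm.aemeasurable
  have hAS : (A * S * A.transpose).PosSemidef := by
    have := hS.mul_mul_conjTranspose_same A
    rwa [Matrix.conjTranspose_eq_transpose_of_trivial] at this
  apply Measure.ext_of_charFun
  ext t
  have h1 : charFun (multivariateGaussian 0 S) (WithLp.toLp 2 (A.transpose.mulVec t.ofLp))
      = charFun ((multivariateGaussian 0 S).map (fun x =>
        (WithLp.toLp 2 (A.mulVec x.ofLp) : EuclideanSpace ℝ m))) t := by
    rw [charFun_apply, charFun_apply, integral_map hm.aemeasurable (by fun_prop)]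
    congr 1
    ext x
    congr 2
    simp only [EuclideanSpace.inner_eq_star_dotProduct, star_trivial]
    congr 1
    rw [dotProduct_comm, dotProduct_comm t.ofLp, Matrix.dotProduct_mulVec, Matrix.vecMul_transpose]
  rw [← h1, charFun_multivariateGaussian hS, charFun_multivariateGaussian hAS]
  congr 2
  · simp
  · congr 2
    rw [← Matrix.mulVec_mulVec, ← Matrix.mulVec_mulVec, Matrix.dotProduct_mulVec t.ofLp,
      ← Matrix.mulVec_transpose]

theorem multivariateGaussian_map_dotProduct {S : Matrix n n ℝ} (hS : S.PosSemidef) (v : n → ℝ) :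
    (multivariateGaussian 0 S).map (fun x => v ⬝ᵥ x.ofLp)
      = gaussianReal 0 (v ⬝ᵥ S.mulVec v).toNNReal := by
  have h1 : (fun x : EuclideanSpace ℝ n => v ⬝ᵥ x.ofLp)
      = innerSL ℝ (WithLp.toLp 2 v : EuclideanSpace ℝ n) := by
    ext x
    simp [EuclideanSpace.inner_eq_star_dotProduct, dotProduct_comm]
  rw [h1, IsGaussian.map_eq_gaussianReal]
  congr 1
  · rw [(innerSL ℝ (WithLp.toLp 2 v : EuclideanSpace ℝ n)).integral_comp_id_comm
      IsGaussian.integrable_id, integral_id_multivariateGaussian, map_zero]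
  · congr 1
    rw [← covariance_self (by fun_prop)]
    have := covarianceBilin_apply_eq_cov (μ := multivariateGaussian (0 : EuclideanSpace ℝ n) S)
      IsGaussian.memLp_two_id (WithLp.toLp 2 v) (WithLp.toLp 2 v)
    rw [covarianceBilin_multivariateGaussian hS] at this
    exact this.symm

/-- The `p`-norm of a standard Gaussian variable. -/
def gaussNorm (p : ENNReal) : ENNReal := eLpNorm id p (gaussianReal 0 1)

theorem gaussNorm_ne_top {p : ENNReal} (hp : p ≠ ⊤) : gaussNorm p ≠ ⊤ :=
  (memLp_id_gaussianReal' p hp).2.ne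

/-- The linear form has the law of `τ` times a standard Gaussian variable, where `τ² = vᵀSv ≤ σ²`.
The dimension does not enter. -/
theorem eLpNorm_dotProduct_le {S : Matrix n n ℝ} (hS : S.PosSemidef) {v : n → ℝ} {σ : ℝ}
    (hσ : 0 ≤ σ) (hv : v ⬝ᵥ S.mulVec v ≤ σ ^ 2) (p : ENNReal) :
    eLpNorm (fun x : EuclideanSpace ℝ n => v ⬝ᵥ x.ofLp) p (multivariateGaussian 0 S)
      ≤ ENNReal.ofReal σ * gaussNorm p := by
  have hm : Measurable fun x : EuclideanSpace ℝ n => v ⬝ᵥ x.ofLp := by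
    have : Continuous fun x : EuclideanSpace ℝ n => v ⬝ᵥ x.ofLp := by
      unfold dotProduct; fun_prop
    exact this.measurable
  have hnn : 0 ≤ v ⬝ᵥ S.mulVec v := by simpa using hS.dotProduct_mulVec_nonneg v
  set τ := Real.sqrt (v ⬝ᵥ S.mulVec v) with hτ
  have h1 : (gaussianReal 0 1).map (fun x => τ * x)
      = gaussianReal 0 (v ⬝ᵥ S.mulVec v).toNNReal := by
    rw [gaussianReal_map_const_mul, mul_zero, mul_one]
    congr 1
    ext
    simp [hτ, Real.sq_sqrt hnn, Real.coe_toNNReal _ hnn]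
  have h2 : eLpNorm (fun x : EuclideanSpace ℝ n => v ⬝ᵥ x.ofLp) p (multivariateGaussian 0 S)
      = eLpNorm id p ((multivariateGaussian 0 S).map (fun x => v ⬝ᵥ x.ofLp)) := by
    rw [eLpNorm_map_measure (by fun_prop) hm.aemeasurable]; rfl
  rw [h2, multivariateGaussian_map_dotProduct hS, ← h1,
    eLpNorm_map_measure (by fun_prop) (by fun_prop)]
  have h3 : (id ∘ fun x : ℝ => τ * x) = τ • (id : ℝ → ℝ) := by ext; simp
  rw [h3]
  refine eLpNorm_const_smul_le.trans ?_
  rw [Real.enorm_eq_ofReal (Real.sqrt_nonneg _)]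
  exact mul_le_mul_left (ENNReal.ofReal_le_ofReal (Real.sqrt_le_iff.2 ⟨hσ, hv⟩)) _

theorem memLp_dotProduct {S : Matrix n n ℝ} (hS : S.PosSemidef) (v : n → ℝ) {p : ENNReal}
    (hp : p ≠ ⊤) :
    MemLp (fun x : EuclideanSpace ℝ n => v ⬝ᵥ x.ofLp) p (multivariateGaussian 0 S) := by
  have hnn : 0 ≤ v ⬝ᵥ S.mulVec v := by simpa using hS.dotProduct_mulVec_nonneg v
  refine ⟨?_, (eLpNorm_dotProduct_le hS (Real.sqrt_nonneg _) (Real.sq_sqrt hnn).ge p).trans_lt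
    (ENNReal.mul_lt_top ENNReal.ofReal_lt_top (gaussNorm_ne_top hp).lt_top)⟩
  have : Continuous fun x : EuclideanSpace ℝ n => v ⬝ᵥ x.ofLp := by
      unfold dotProduct; fun_prop
  exact this.aestronglyMeasurable

theorem integral_mul_multivariateGaussian {S : Matrix n n ℝ} (hS : S.PosSemidef) (i j : n) :
    ∫ x : EuclideanSpace ℝ n, x i * x j ∂(multivariateGaussian 0 S) = S i j := by
  have hmean : ∀ i : n, ∫ x : EuclideanSpace ℝ n, x i ∂(multivariateGaussian 0 S) = 0 := fun i => by
    have := (EuclideanSpace.proj (𝕜 := ℝ) i : EuclideanSpace ℝ n →L[ℝ] ℝ).integral_comp_id_comm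
      (μ := multivariateGaussian 0 S) IsGaussian.integrable_id
    rw [integral_id_multivariateGaussian, map_zero] at this
    simpa using this
  have hmem : ∀ i : n, MemLp (fun x : EuclideanSpace ℝ n => x i) 2 (multivariateGaussian 0 S) :=
    fun i => by
      have := memLp_dotProduct (p := 2) hS (Pi.single i 1) (by simp)
      simpa using this
  have := covariance_eval_multivariateGaussian (μ := 0) hS i j
  rw [covariance_eq_sub (hmem i) (hmem j), hmean, hmean, mul_zero, sub_zero] at this
  exact this

end Gaussian

/-! ### Quadratic forms of Gaussian vectors -/

section Quadratic

variable {d : ℕ} {K : Matrix (Fin d) (Fin d) ℝ}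

/-- In the eigenbasis, a Gaussian vector has independent coordinates. -/
theorem exists_multivariateGaussian_eq_map_pi (hK : K.PosSemidef) :
    ∃ T : (Fin d → ℝ) → Vec d, Measurable T ∧
      multivariateGaussian 0 K = (Measure.pi fun _ : Fin d => gaussianReal 0 1).map T ∧
      ∀ (m : ℕ) x, (T x).ofLp ⬝ᵥ (K ^ m).mulVec (T x).ofLp
        = ∑ i, hK.isHermitian.eigenvalues i ^ (m + 1) * x i ^ 2 := by
  have hH := hK.isHermitian
  -- The columns are `√λᵢ ωᵢ`, so that `A Aᵀ = K`.
  set A : Matrix (Fin d) (Fin d) ℝ :=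
    Matrix.of fun j i => hH.eigenvectorBasis i j * Real.sqrt (hH.eigenvalues i) with hA
  have hAA : A * 1 * A.transpose = K := by
    ext j k
    have := pow_apply_eq_sum_eigen hH 1 j k
    rw [pow_one] at this
    rw [this, mul_one, Matrix.mul_apply]
    refine Finset.sum_congr rfl fun i _ => ?_
    rw [hA, Matrix.transpose_apply, Matrix.of_apply, Matrix.of_apply, pow_one]
    have := Real.mul_self_sqrt (hK.eigenvalues_nonneg i)
    linear_combination (hH.eigenvectorBasis i j * hH.eigenvectorBasis i k) * this
  have hc : Continuous fun x : Vec d => (WithLp.toLp 2 (A.mulVec x.ofLp) : Vec d) := by fun_prop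
  refine ⟨fun x => WithLp.toLp 2 (A.mulVec x), ?_, ?_, fun m x => ?_⟩
  · have : Continuous fun x : Fin d → ℝ => (WithLp.toLp 2 (A.mulVec x) : Vec d) := by fun_prop
    exact this.measurable
  · have := multivariateGaussian_map_mulVec (Matrix.PosSemidef.one (n := Fin d) (R := ℝ)) A
    rw [hAA, multivariateGaussian_zero_one, ← map_pi_eq_stdGaussian,
      Measure.map_map hc.measurable (by fun_prop)] at this
    exact this.symm
  · rw [dotProduct_pow_mulVec hH]
    refine Finset.sum_congr rfl fun i _ => ?_
    have h1 : (hH.eigenvectorBasis i).ofLp ⬝ᵥ A.mulVec x = Real.sqrt (hH.eigenvalues i) * x i := by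
      simp only [dotProduct, Matrix.mulVec, hA, Matrix.of_apply, Finset.mul_sum]
      rw [Finset.sum_comm]
      have : ∀ k, ∑ j, (hH.eigenvectorBasis i) j
          * ((hH.eigenvectorBasis k) j * Real.sqrt (hH.eigenvalues k) * x k)
          = (if i = k then 1 else 0) * (Real.sqrt (hH.eigenvalues k) * x k) := fun k => by
        rw [← eigenvectorBasis_sum_mul hH i k, Finset.sum_mul]
        exact Finset.sum_congr rfl fun j _ => by ring
      simp only [this, ite_mul, one_mul, zero_mul, Finset.sum_ite_eq, Finset.mem_univ, if_true]
    change _ * (_ ⬝ᵥ A.mulVec x) * (_ ⬝ᵥ A.mulVec x) = _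
    rw [h1, pow_succ]
    have := Real.mul_self_sqrt (hK.eigenvalues_nonneg i)
    linear_combination (hH.eigenvalues i ^ m * x i ^ 2) * this

/-- The variance of the square of a standard Gaussian variable. -/
def gaussSqVar : ℝ := Var[fun x => x ^ 2; gaussianReal 0 1]

theorem gaussSqVar_nonneg : 0 ≤ gaussSqVar := variance_nonneg _ _

theorem memLp_sq_gaussianReal {p : ENNReal} (hp : p ≠ ⊤) :
    MemLp (fun x : ℝ => x ^ 2) p (gaussianReal 0 1) := by
  have h := memLp_id_gaussianReal' (μ := 0) (v := 1) (2 * p) (ENNReal.mul_ne_top (by simp) hp)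
  have : ENNReal.HolderTriple (2 * p) (2 * p) p := by
    refine ⟨?_⟩
    rw [ENNReal.mul_inv (by simp) (by simp), ← add_mul, ENNReal.inv_two_add_inv_two, one_mul]
  have h2 := h.mul h (r := p)
  refine h2.congr_norm (by fun_prop) (ae_of_all _ fun x => by simp [sq])

/-- In the eigenbasis the quadratic form is `∑ λᵢ^{m+1} xᵢ²` with independent standard `xᵢ`. Its
mean is the trace and its variances add up. The variance is thus of order `d`, not `d²`, which is
the source of the `d^{-1/2}` relative error in the drift of SGD. -/
theorem integral_sub_trace_sq_le {κ : ℝ} (hK : K.PosSemidef)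
    (hκ : ∀ i, hK.isHermitian.eigenvalues i ≤ κ) (m : ℕ) :
    Integrable (fun x : Vec d => (x.ofLp ⬝ᵥ (K ^ m).mulVec x.ofLp - (K ^ (m + 1)).trace) ^ 2)
      (multivariateGaussian 0 K) ∧
    ∫ x : Vec d, (x.ofLp ⬝ᵥ (K ^ m).mulVec x.ofLp - (K ^ (m + 1)).trace) ^ 2
      ∂(multivariateGaussian 0 K) ≤ d * (κ ^ (m + 1)) ^ 2 * gaussSqVar := by
  obtain ⟨T, hT, hlaw, hq⟩ := exists_multivariateGaussian_eq_map_pi hK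
  have hcont : Continuous fun x : Vec d =>
      (x.ofLp ⬝ᵥ (K ^ m).mulVec x.ofLp - (K ^ (m + 1)).trace) ^ 2 := by
    unfold dotProduct Matrix.mulVec dotProduct; fun_prop
  have hL : ∀ i, MemLp (fun x : ℝ => hK.isHermitian.eigenvalues i ^ (m + 1) * x ^ 2) 2
      (gaussianReal 0 1) := fun i => (memLp_sq_gaussianReal (by simp)).const_mul _
  have hsum : MemLp (∑ i, fun ω : Fin d → ℝ => hK.isHermitian.eigenvalues i ^ (m + 1) * ω i ^ 2) 2
      (Measure.pi fun _ : Fin d => gaussianReal 0 1) :=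
    memLp_finsetSum' _ fun i _ => (hL i).comp_measurePreserving
      (measurePreserving_eval (fun _ : Fin d => gaussianReal 0 1) i)
  have hint2 : ∫ x : ℝ, x ^ 2 ∂(gaussianReal 0 1) = 1 := by
    have h := variance_id_gaussianReal (μ := 0) (v := 1)
    rw [variance_eq_sub (memLp_id_gaussianReal 2)] at h
    simpa using h
  have hmean : (Measure.pi fun _ : Fin d => gaussianReal 0 1)[∑ i, fun ω : Fin d → ℝ =>
      hK.isHermitian.eigenvalues i ^ (m + 1) * ω i ^ 2] = (K ^ (m + 1)).trace := by
    simp only [Finset.sum_apply]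
    rw [integral_finsetSum, trace_pow_eq_sum_eigenvalues hK.isHermitian]
    · refine Finset.sum_congr rfl fun i _ => ?_
      have hmp := measurePreserving_eval (fun _ : Fin d => gaussianReal 0 1) i
      have h1 := integral_map (f := fun x : ℝ => hK.isHermitian.eigenvalues i ^ (m + 1) * x ^ 2)
        hmp.measurable.aemeasurable (by rw [hmp.map_eq]; exact (hL i).1)
      rw [hmp.map_eq, integral_const_mul, hint2, mul_one] at h1
      exact h1.symm
    · intro i _
      exact ((hL i).comp_measurePreserving
        (measurePreserving_eval (fun _ : Fin d => gaussianReal 0 1) i)).integrable (by simp)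
  have hfun : (fun ω => ((T ω).ofLp ⬝ᵥ (K ^ m).mulVec (T ω).ofLp - (K ^ (m + 1)).trace) ^ 2)
      = fun ω => ((∑ i, fun ω : Fin d → ℝ => hK.isHermitian.eigenvalues i ^ (m + 1) * ω i ^ 2) ω
        - (Measure.pi fun _ : Fin d => gaussianReal 0 1)[∑ i, fun ω : Fin d → ℝ =>
      hK.isHermitian.eigenvalues i ^ (m + 1) * ω i ^ 2]) ^ 2 := by
    ext ω; rw [hq, hmean, Finset.sum_apply]
  rw [hlaw]
  constructor
  · rw [integrable_map_measure hcont.aestronglyMeasurable hT.aemeasurable]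
    change Integrable (fun ω => ((T ω).ofLp ⬝ᵥ (K ^ m).mulVec (T ω).ofLp - (K ^ (m + 1)).trace) ^ 2) _
    rw [hfun]
    exact (hsum.sub (memLp_const _)).integrable_sq
  · rw [integral_map hT.aemeasurable hcont.aestronglyMeasurable, hfun,
      ← variance_eq_integral hsum.1.aemeasurable, variance_sum_pi hL]
    calc ∑ i, Var[fun x => hK.isHermitian.eigenvalues i ^ (m + 1) * x ^ 2; gaussianReal 0 1]
        = ∑ i, (hK.isHermitian.eigenvalues i ^ (m + 1)) ^ 2 * gaussSqVar :=
          Finset.sum_congr rfl fun i _ => variance_const_mul _ _ _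
      _ ≤ ∑ _i : Fin d, (κ ^ (m + 1)) ^ 2 * gaussSqVar := by
          refine Finset.sum_le_sum fun i _ => mul_le_mul_of_nonneg_right ?_ gaussSqVar_nonneg
          exact pow_le_pow_left₀ (pow_nonneg (hK.eigenvalues_nonneg i) _)
            (pow_le_pow_left₀ (hK.eigenvalues_nonneg i) (hκ i) _) 2
      _ = _ := by simp; ring

end Quadratic


/-! ### Direct sums and contractions -/

section Basic

variable {d l : ℕ}

@[simp] theorem fstV_cat (x y : Vec l) : fstV (cat x y) = x := rfl

@[simp] theorem sndV_cat (x y : Vec l) : sndV (cat x y) = y := rfl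

theorem cat_fstV_sndV (r : Vec2 l) : cat (fstV r) (sndV r) = r := by
  ext i; rcases i with i | i <;> rfl

theorem norm_sq_cat (x y : Vec l) : ‖cat x y‖ ^ 2 = ‖x‖ ^ 2 + ‖y‖ ^ 2 := by
  simp [EuclideanSpace.norm_sq_eq, Fintype.sum_sum_type, cat]

theorem norm_fstV_le (r : Vec2 l) : ‖fstV r‖ ≤ ‖r‖ := by
  have := norm_sq_cat (fstV r) (sndV r)
  rw [cat_fstV_sndV] at this
  exact le_of_sq_le_sq (by nlinarith [sq_nonneg ‖sndV r‖]) (norm_nonneg r)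

theorem norm_sndV_le (r : Vec2 l) : ‖sndV r‖ ≤ ‖r‖ := by
  have := norm_sq_cat (fstV r) (sndV r)
  rw [cat_fstV_sndV] at this
  exact le_of_sq_le_sq (by nlinarith [sq_nonneg ‖fstV r‖]) (norm_nonneg r)

theorem norm_fstV_sub_sndV_le (r : Vec2 l) : ‖fstV r - sndV r‖ ≤ 2 * ‖r‖ := by
  linarith [norm_sub_le (fstV r) (sndV r), norm_fstV_le r, norm_sndV_le r]

theorem continuous_fstV : Continuous (fstV : Vec2 l → Vec l) := by unfold fstV; fun_prop

theorem continuous_sndV : Continuous (sndV : Vec2 l → Vec l) := by unfold sndV; fun_prop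

theorem continuous_cat : Continuous fun p : Vec l × Vec l => cat p.1 p.2 := by
  unfold cat
  refine (PiLp.continuous_toLp 2 _).comp (continuous_pi fun i => ?_)
  rcases i with i | i <;> simp only [Sum.elim_inl, Sum.elim_inr] <;> fun_prop

theorem contract_apply (X : Matrix (Fin d) (Fin l) ℝ) (a : Vec d) (q : Fin l) :
    contract X a q = (fun p => X p q) ⬝ᵥ a.ofLp := rfl

theorem cat_contract (X Xs : Matrix (Fin d) (Fin l) ℝ) (a : Vec d) :
    cat (contract X a) (contract Xs a)
      = WithLp.toLp 2 ((Matrix.fromCols X Xs).transpose.mulVec a.ofLp) := by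
  ext i; rcases i with i | i <;> rfl

end Basic

/-! ### Smooth functions with a minimizer -/

/-- A gradient step of length `1/L` from `x` lowers `g` by at least `‖∇g(x)‖²/(2L)`, while `g(x)`
exceeds the minimum by at most `L/2 ‖x - xs‖²`, because the gradient vanishes at `xs`. -/
theorem IsLSmooth.norm_gradient_le {l : ℕ} {L : ℝ} (hL : 0 < L) {g : Vec l → ℝ}
    (hg : IsLSmooth L g) {xs : Vec l} (hxs : ∀ y, g xs ≤ g y) (x : Vec l) :
    ‖gradient g x‖ ≤ L * ‖x - xs‖ := by
  have h0 : gradient g xs = 0 := by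
    have : IsLocalMin g xs := Eventually.of_forall hxs
    rw [gradient, this.fderiv_eq_zero, map_zero]
  have h1 := hg.2 xs x
  rw [h0, inner_zero_left, add_zero] at h1
  have h2 := hg.2 x (x - (1 / L) • gradient g x)
  rw [sub_sub_cancel_left, inner_neg_right, inner_smul_right, real_inner_self_eq_norm_sq, norm_neg,
    norm_smul, Real.norm_eq_abs, abs_of_pos (by positivity)] at h2
  have h3 := hxs (x - (1 / L) • gradient g x)
  have h4 : 1 / L * ‖gradient g x‖ ^ 2 - L / 2 * (1 / L * ‖gradient g x‖) ^ 2
      = ‖gradient g x‖ ^ 2 / (2 * L) := by field_simp; ring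
  have h5 : ‖gradient g x‖ ^ 2 / (2 * L) ≤ L / 2 * ‖x - xs‖ ^ 2 := by linarith
  rw [div_le_iff₀ (by positivity)] at h5
  exact le_of_sq_le_sq (by nlinarith) (by positivity)

/-! ### The partial gradient -/

section Grad

variable {d l : ℕ} {f : Vec2 l → Vec l → ℝ}

theorem inner_gradX_eq_fderiv (r : Vec2 l) (e v : Vec l) :
    ⟪gradX f r e, v⟫ = fderiv ℝ (slice f (sndV r) e) (fstV r) v := by
  rw [gradX, gradient, InnerProductSpace.toDual_symm_apply]

theorem gradX_apply (r : Vec2 l) (e : Vec l) (q : Fin l) :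
    gradX f r e q = fderiv ℝ (slice f (sndV r) e) (fstV r) (EuclideanSpace.single q 1) := by
  rw [← inner_gradX_eq_fderiv, EuclideanSpace.inner_single_right]; simp

theorem matGrad_eq_of_hasFDerivAt {m n : Type*} [Fintype m] [Fintype n] [DecidableEq m]
    [DecidableEq n] {F : Matrix m n ℝ → ℝ} {A : Matrix m n ℝ} {F' : Matrix m n ℝ →L[ℝ] ℝ}
    (h : HasFDerivAt F F' A) (p : m) (q : n) : matGrad F A p q = F' (Matrix.single p q 1) :=
  DFunLike.congr_fun h.fderiv (Matrix.single p q 1)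

/-- `Psi` depends on the matrix through the linear map `X ↦ Xᵀa` only, so its gradient is the
rank-one matrix `a (∇ₓf)ᵀ`. This makes the increments of all `Wᵀ Kᵐ W` explicit. -/
theorem matGrad_Psi (hd : ∀ y e, ContDiff ℝ 1 (slice f y e)) (Xs X : Matrix (Fin d) (Fin l) ℝ)
    (a : Vec d) (e : Vec l) (p : Fin d) (q : Fin l) :
    matGrad (fun Y => Psi f Xs Y a e) X p q
      = a p * gradX f (cat (contract X a) (contract Xs a)) e q := by
  have hlin : ∃ T : Matrix (Fin d) (Fin l) ℝ →L[ℝ] Vec l, ∀ Y, T Y = contract Y a := by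
    refine ⟨LinearMap.toContinuousLinearMap
      { toFun := fun Y => contract Y a, map_add' := ?_, map_smul' := ?_ }, fun Y => rfl⟩
    · intro Y Z; ext i; simp [contract, Matrix.add_mulVec]
    · intro c Y; ext i; simp [contract, Matrix.smul_mulVec]
  obtain ⟨T, hT⟩ := hlin
  have h1 : (fun Y => Psi f Xs Y a e) = slice f (contract Xs a) e ∘ T := by
    ext Y; simp [Psi, slice, hT]
  have h2 : DifferentiableAt ℝ (slice f (contract Xs a) e) (T X) :=
    (hd _ _).differentiable one_ne_zero _
  rw [h1, matGrad_eq_of_hasFDerivAt (h2.hasFDerivAt.comp X T.hasFDerivAt)]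
  change fderiv ℝ (slice f (contract Xs a) e) (T X) (T (Matrix.single p q 1)) = _
  rw [gradX_apply, sndV_cat, fstV_cat, hT, hT]
  have h3 : contract (Matrix.single p q 1) a = a p • EuclideanSpace.single q (1 : ℝ) := by
    ext i
    simp only [contract_apply, Matrix.single_apply, dotProduct, PiLp.smul_apply,
      PiLp.single_apply, smul_eq_mul]
    rw [Finset.sum_eq_single p]
    · by_cases h : q = i
      · simp [h]
      · simp [h, Ne.symm h]
    · intro b _ hb; simp [Ne.symm hb]
    · simp
  rw [h3, map_smul, smul_eq_mul]

/-- The partial derivatives are limits of the difference quotients with step `1/(n + 1)`. -/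
theorem measurable_gradX (hf : Measurable (Function.uncurry f))
    (hd : ∀ y e, ContDiff ℝ 1 (slice f y e)) :
    Measurable fun z : Vec2 l × Vec l => gradX f z.1 z.2 := by
  have key : ∀ q, Measurable fun z : Vec2 l × Vec l => gradX f z.1 z.2 q := by
    intro q
    refine measurable_of_tendsto_metrizable (f := fun (n : ℕ) (z : Vec2 l × Vec l) =>
      ((n : ℝ) + 1) * (f (cat (fstV z.1 + ((n : ℝ) + 1)⁻¹ • EuclideanSpace.single q 1) (sndV z.1)) z.2
        - f z.1 z.2)) (fun n => ?_) ?_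
    · refine Measurable.const_mul (Measurable.sub ?_ hf) _
      refine hf.comp (Measurable.prodMk ?_ measurable_snd)
      exact (continuous_cat.comp (((continuous_fstV.comp continuous_fst).add continuous_const).prodMk
        (continuous_sndV.comp continuous_fst))).measurable
    · rw [tendsto_pi_nhds]
      intro z
      have h1 : HasFDerivAt (slice f (sndV z.1) z.2)
          (fderiv ℝ (slice f (sndV z.1) z.2) (fstV z.1)) (fstV z.1) :=
        ((hd _ _).differentiable one_ne_zero _).hasFDerivAt
      have h2 := h1.hasLineDerivAt (EuclideanSpace.single q 1)
      have h3 := (hasDerivAt_iff_tendsto_slope_zero.1 h2).comp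
        (f := fun n : ℕ => ((n : ℝ) + 1)⁻¹) (x := atTop) (tendsto_nhdsWithin_iff.2
          ⟨by simpa [one_div] using tendsto_one_div_add_atTop_nhds_zero_nat (𝕜 := ℝ),
            Eventually.of_forall fun n => by
              simp only [Set.mem_compl_iff, Set.mem_singleton_iff]; positivity⟩)
      rw [gradX_apply]
      refine h3.congr fun n => ?_
      simp only [Function.comp_apply, inv_inv, zero_add, zero_smul, add_zero, smul_eq_mul]
      rw [slice, slice, cat_fstV_sndV]
  have h2 : (fun z : Vec2 l × Vec l => gradX f z.1 z.2)
      = fun z => WithLp.toLp 2 fun q => gradX f z.1 z.2 q := rfl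
  rw [h2]
  exact (PiLp.continuous_toLp 2 _).measurable.comp (measurable_pi_lambda _ key)

end Grad

/-! ### Laws of the contractions -/

section Laws

variable {d l : ℕ}

instance (K : Matrix (Fin d) (Fin d) ℝ) : IsProbabilityMeasure (dataLaw l K) := by
  unfold dataLaw; infer_instance

theorem covB_posSemidef {K : Matrix (Fin d) (Fin d) ℝ} (hK : K.PosSemidef)
    (X Xs : Matrix (Fin d) (Fin l) ℝ) : (covB K X Xs).PosSemidef := by
  have := hK.conjTranspose_mul_mul_same (Matrix.fromCols X Xs)
  rwa [Matrix.conjTranspose_eq_transpose_of_trivial] at this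

theorem dataLaw_map_cat {K : Matrix (Fin d) (Fin d) ℝ} (hK : K.PosSemidef)
    (X Xs : Matrix (Fin d) (Fin l) ℝ) :
    (dataLaw l K).map (fun z => (cat (contract X z.1) (contract Xs z.1), z.2))
      = covLaw (covB K X Xs) := by
  have h1 := multivariateGaussian_map_mulVec hK (Matrix.fromCols X Xs).transpose
  rw [Matrix.transpose_transpose] at h1
  have hm : Measurable fun a : Vec d => cat (contract X a) (contract Xs a) := by
    have : Continuous fun a : Vec d => cat (contract X a) (contract Xs a) := by
      simp only [cat_contract]; fun_prop
    exact this.measurable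
  rw [covLaw, dataLaw, covB, ← h1]
  simp only [← cat_contract]
  conv_rhs => rw [← Measure.map_id (μ := stdGaussian (Vec l)),
    Measure.map_prod_map _ _ hm measurable_id]
  rfl

theorem measurePreserving_cat {K : Matrix (Fin d) (Fin d) ℝ} (hK : K.PosSemidef)
    (X Xs : Matrix (Fin d) (Fin l) ℝ) :
    MeasurePreserving (fun z : Vec d × Vec l => (cat (contract X z.1) (contract Xs z.1), z.2))
      (dataLaw l K) (covLaw (covB K X Xs)) := by
  refine ⟨?_, dataLaw_map_cat hK X Xs⟩
  have : Continuous fun z : Vec d × Vec l => (cat (contract X z.1) (contract Xs z.1), z.2) := by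
    simp only [cat_contract]; fun_prop
  exact this.measurable

theorem covLaw_map_linear {B : Mat2 l} (hB : B.PosSemidef) (A : Mat2 l) :
    (covLaw B).map (fun z => (WithLp.toLp 2 (A.mulVec z.1.ofLp), z.2))
      = covLaw (A * B * A.transpose) := by
  have hm : Measurable fun r : Vec2 l => (WithLp.toLp 2 (A.mulVec r.ofLp) : Vec2 l) := by
    have : Continuous fun r : Vec2 l => (WithLp.toLp 2 (A.mulVec r.ofLp) : Vec2 l) := by fun_prop
    exact this.measurable
  rw [covLaw, covLaw, ← multivariateGaussian_map_mulVec hB A]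
  conv_rhs => rw [← Measure.map_id (μ := stdGaussian (Vec l)),
    Measure.map_prod_map _ _ hm measurable_id]
  rfl

/-- The law of `(y, ε)` sees only the lower right block of the covariance, the one that the coupled
equations conserve. -/
theorem covLaw_map_sndV {B : Mat2 l} (hB : B.PosSemidef) :
    (covLaw B).map (fun z => (sndV z.1, z.2))
      = (multivariateGaussian 0 B.toBlocks₂₂).prod (stdGaussian (Vec l)) := by
  have h1 := multivariateGaussian_map_mulVec hB
    (Matrix.fromCols (0 : Matrix (Fin l) (Fin l) ℝ) (1 : Matrix (Fin l) (Fin l) ℝ))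
  have h2 : Matrix.fromCols (0 : Matrix (Fin l) (Fin l) ℝ) (1 : Matrix (Fin l) (Fin l) ℝ) * B
      * (Matrix.fromCols (0 : Matrix (Fin l) (Fin l) ℝ) (1 : Matrix (Fin l) (Fin l) ℝ)).transpose
      = B.toBlocks₂₂ := by
    conv_lhs => rw [← Matrix.fromBlocks_toBlocks B]
    rw [Matrix.transpose_fromCols, Matrix.fromCols_mul_fromBlocks, Matrix.fromCols_mul_fromRows]
    simp
  have h3 : (fun r : Vec2 l => (WithLp.toLp 2 ((Matrix.fromCols (0 : Matrix (Fin l) (Fin l) ℝ)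
      (1 : Matrix (Fin l) (Fin l) ℝ)).mulVec r.ofLp) : Vec l)) = sndV := by
    ext r i
    simp only [Matrix.fromCols_mulVec]
    simp [sndV]
  rw [h2, h3] at h1
  rw [covLaw, ← h1]
  conv_rhs => rw [← Measure.map_id (μ := stdGaussian (Vec l)),
    Measure.map_prod_map _ _ continuous_sndV.measurable measurable_id]
  rfl

end Laws

/-! ### The hidden parameter minimizes the outer function -/

section Argmin

variable {d l : ℕ} {f : Vec2 l → Vec l → ℝ}

/-- `y` minimizes `x ↦ f(x ⊕ y; ε)`. -/
def MinAt (f : Vec2 l → Vec l → ℝ) (p : Vec l × Vec l) : Prop :=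
  ∀ x, slice f p.1 p.2 p.1 ≤ slice f p.1 p.2 x

/-- By continuity of the slices, minimality may be tested on a countable dense set. Measurability is
what allows almost sure minimality to pass through image measures. -/
theorem measurableSet_minAt (hf : Measurable (Function.uncurry f))
    (hd : ∀ y e, ContDiff ℝ 1 (slice f y e)) : MeasurableSet {p | MinAt f p} := by
  have h1 : {p | MinAt f p} = ⋂ n : ℕ, {p : Vec l × Vec l |
      f (cat p.1 p.1) p.2 ≤ f (cat (TopologicalSpace.denseSeq (Vec l) n) p.1) p.2} := by
    ext p
    simp only [Set.mem_ofPred_eq, Set.mem_iInter]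
    refine ⟨fun h n => h _, fun h x => ?_⟩
    have hc : IsClosed {x | slice f p.1 p.2 p.1 ≤ slice f p.1 p.2 x} :=
      isClosed_le continuous_const (hd _ _).continuous
    exact (TopologicalSpace.denseRange_denseSeq (Vec l)).induction_on
      (p := fun x => slice f p.1 p.2 p.1 ≤ slice f p.1 p.2 x) x hc h
  rw [h1]
  refine MeasurableSet.iInter fun n => measurableSet_le ?_ ?_
  · exact hf.comp (((continuous_cat.comp (continuous_fst.prodMk continuous_fst)).measurable).prodMk
      measurable_snd)
  · exact hf.comp (((continuous_cat.comp (continuous_const.prodMk continuous_fst)).measurable).prodMk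
      measurable_snd)

/-- Minimality is a property of `(y, ε)`, whose law depends on the lower right block alone. The
first argument of `covB K Xs Xs` is a placeholder, since it does not affect that block. -/
theorem ae_minAt_covLaw (hf : Measurable (Function.uncurry f))
    (hd : ∀ y e, ContDiff ℝ 1 (slice f y e)) {K : Matrix (Fin d) (Fin d) ℝ} (hK : K.PosSemidef)
    {Xs : Matrix (Fin d) (Fin l) ℝ}
    (hmin : ∀ᵐ z ∂(dataLaw l K), ∀ x : Vec l,
      slice f (contract Xs z.1) z.2 (contract Xs z.1) ≤ slice f (contract Xs z.1) z.2 x)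
    {B : Mat2 l} (hB : B.PosSemidef) (h22 : B.toBlocks₂₂ = (covB K Xs Xs).toBlocks₂₂) :
    ∀ᵐ z ∂(covLaw B), MinAt f (sndV z.1, z.2) := by
  have hms := measurableSet_minAt hf hd
  have hsm : Measurable fun z : Vec2 l × Vec l => (sndV z.1, z.2) :=
    (continuous_sndV.measurable.comp measurable_fst).prodMk measurable_snd
  have hmp := measurePreserving_cat (l := l) hK Xs Xs
  have h1 : ∀ᵐ p ∂((covLaw (covB K Xs Xs)).map (fun z => (sndV z.1, z.2))), MinAt f p := by
    rw [ae_map_iff hsm.aemeasurable hms, ← hmp.map_eq]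
    exact (ae_map_iff hmp.measurable.aemeasurable (hsm hms)).2 hmin
  rw [covLaw_map_sndV (covB_posSemidef hK _ _), ← h22, ← covLaw_map_sndV hB,
    ae_map_iff hsm.aemeasurable hms] at h1
  exact h1

end Argmin


/-! ### Polynomial bounds -/

section Poly

variable {l : ℕ} {f : Vec2 l → Vec l → ℝ} {α L : ℝ}

/-- The weight `(1 + ‖r‖)(1 + ‖ε‖)`. -/
def wt (z : Vec2 l × Vec l) : ℝ := (1 + ‖z.1‖) * (1 + ‖z.2‖)

theorem one_le_wt (z : Vec2 l × Vec l) : 1 ≤ wt z := by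
  unfold wt
  nlinarith [norm_nonneg z.1, norm_nonneg z.2, mul_nonneg (norm_nonneg z.1) (norm_nonneg z.2)]

theorem continuous_wt : Continuous (wt : Vec2 l × Vec l → ℝ) := by unfold wt; fun_prop

theorem integrable_one_add_norm_pow {ι : Type*} [Fintype ι] (μ : Measure (EuclideanSpace ℝ ι))
    [IsGaussian μ] (k : ℕ) : Integrable (fun x => (1 + ‖x‖) ^ k) μ := by
  have h0 : MemLp (fun x : EuclideanSpace ℝ ι => ‖x‖) (k : ENNReal) μ :=
    (IsGaussian.memLp_id μ (k : ENNReal) (ENNReal.natCast_ne_top k)).norm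
  have h1 : MemLp (fun x : EuclideanSpace ℝ ι => 1 + ‖x‖) (k : ENNReal) μ :=
    (memLp_const (1 : ℝ)).add h0
  refine h1.integrable_norm_pow'.congr (ae_of_all _ fun x => ?_)
  simp only [Real.norm_eq_abs]
  rw [abs_of_nonneg (by positivity)]

theorem integrable_wt_pow (B : Mat2 l) (k : ℕ) : Integrable (fun z => wt z ^ k) (covLaw B) := by
  have h1 := integrable_one_add_norm_pow (multivariateGaussian (0 : Vec2 l) B) k
  have h2 := integrable_one_add_norm_pow (stdGaussian (Vec l)) k
  refine (h1.mul_prod h2).congr (ae_of_all _ fun z => ?_)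
  simp [wt, mul_pow]

/-- The real power `α` is traded for the integer power `⌈α⌉₊` of a base that is at least `1`. The
resulting weights have Gaussian moments of all orders. -/
theorem PseudoLipschitz.abs_sub_le (hα : 0 ≤ α) (hf : PseudoLipschitz α L f) {r r' : Vec2 l}
    {e : Vec l} {c : ℝ} (hr : 1 + ‖r‖ ≤ c) (hr' : 1 + ‖r'‖ ≤ c) :
    |f r e - f r' e| ≤ 4 * |L| * (c * (1 + ‖e‖)) ^ ⌈α⌉₊ * ‖r - r'‖ := by
  have hc1 : 1 ≤ c := by linarith [norm_nonneg r]
  have he1 : 1 ≤ 1 + ‖e‖ := by linarith [norm_nonneg e]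
  have hpow : ∀ {t s : ℝ}, 0 ≤ t → t ≤ s → 1 ≤ s → t ^ α ≤ s ^ ⌈α⌉₊ := fun {t s} h0 hts hs => by
    rw [← Real.rpow_natCast]
    exact (Real.rpow_le_rpow h0 hts hα).trans (Real.rpow_le_rpow_of_exponent_le hs (Nat.le_ceil α))
  have h1 : c ^ ⌈α⌉₊ ≤ (c * (1 + ‖e‖)) ^ ⌈α⌉₊ :=
    pow_le_pow_left₀ (by linarith) (by nlinarith) _
  have h2 : (1 + ‖e‖) ^ ⌈α⌉₊ ≤ (c * (1 + ‖e‖)) ^ ⌈α⌉₊ :=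
    pow_le_pow_left₀ (by linarith) (by nlinarith) _
  have h3 : 1 ≤ (c * (1 + ‖e‖)) ^ ⌈α⌉₊ := one_le_pow₀ (by nlinarith)
  have e1 := hpow (norm_nonneg r) (by linarith [norm_nonneg r] : ‖r‖ ≤ c) hc1
  have e2 := hpow (norm_nonneg r') (by linarith [norm_nonneg r] : ‖r'‖ ≤ c) hc1
  have e3 := hpow (norm_nonneg e) (by linarith : ‖e‖ ≤ 1 + ‖e‖) he1
  have e4 : 1 + ‖r‖ ^ α + ‖r'‖ ^ α + ‖e‖ ^ α ≤ 4 * (c * (1 + ‖e‖)) ^ ⌈α⌉₊ := by linarith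
  calc |f r e - f r' e| ≤ L * ‖r - r'‖ * (1 + ‖r‖ ^ α + ‖r'‖ ^ α + ‖e‖ ^ α) := hf r r' e
    _ ≤ |L| * ‖r - r'‖ * (1 + ‖r‖ ^ α + ‖r'‖ ^ α + ‖e‖ ^ α) := by
        gcongr; exact le_abs_self L
    _ ≤ |L| * ‖r - r'‖ * (4 * (c * (1 + ‖e‖)) ^ ⌈α⌉₊) := by gcongr
    _ = _ := by ring

theorem cat_sub (x x' y y' : Vec l) : cat x y - cat x' y' = cat (x - x') (y - y') := by
  ext i; rcases i with i | i <;> rfl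

theorem norm_cat_zero (x : Vec l) : ‖cat x 0‖ = ‖x‖ := by
  have := norm_sq_cat x 0
  rw [norm_zero, zero_pow two_ne_zero, add_zero] at this
  exact (pow_left_inj₀ (norm_nonneg _) (norm_nonneg _) two_ne_zero).1 this

theorem norm_gradX_le (hα : 0 ≤ α) (hf : PseudoLipschitz α L f)
    (hd : ∀ y e, ContDiff ℝ 1 (slice f y e)) (z : Vec2 l × Vec l) :
    ‖gradX f z.1 z.2‖ ≤ 4 * |L| * 2 ^ ⌈α⌉₊ * wt z ^ ⌈α⌉₊ := by
  have h1 : HasFDerivAt (slice f (sndV z.1) z.2)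
      (fderiv ℝ (slice f (sndV z.1) z.2) (fstV z.1)) (fstV z.1) :=
    ((hd _ _).differentiable one_ne_zero _).hasFDerivAt
  have h2 : ‖gradX f z.1 z.2‖ = ‖fderiv ℝ (slice f (sndV z.1) z.2) (fstV z.1)‖ := by
    rw [gradX, gradient, LinearIsometryEquiv.norm_map]
  have h0 : (1 : ℝ) ≤ 1 + ‖z.1‖ := by linarith [norm_nonneg z.1]
  rw [h2]
  refine h1.le_of_lip' (by have := one_le_wt z; positivity) ?_
  filter_upwards [Metric.ball_mem_nhds (fstV z.1) one_pos] with x hx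
  rw [Metric.mem_ball, dist_eq_norm] at hx
  have hcs : cat x (sndV z.1) - z.1 = cat (x - fstV z.1) 0 := by
    conv_lhs => rw [← cat_fstV_sndV z.1]
    rw [cat_sub, sndV_cat, sub_self]
  have hn : ‖cat x (sndV z.1) - z.1‖ = ‖x - fstV z.1‖ := by rw [hcs, norm_cat_zero]
  -- In the unit ball around `fstV z.1` the norm grows by at most `1`, which explains `c = 2 (1 +
  -- ‖z.1‖)` and the factor `2 ^ ⌈α⌉₊` of the bound.
  have h3 := hf.abs_sub_le hα (r := cat x (sndV z.1)) (r' := z.1) (e := z.2)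
    (c := 2 * (1 + ‖z.1‖)) (by
      have := norm_add_le (cat x (sndV z.1) - z.1) z.1
      rw [sub_add_cancel, hn] at this
      linarith) (by linarith)
  rw [hn] at h3
  rw [Real.norm_eq_abs]
  unfold slice
  rw [cat_fstV_sndV]
  refine h3.trans (le_of_eq ?_)
  rw [wt, mul_assoc 2, mul_pow 2]
  ring

theorem memLp_two_gradX (hα : 0 ≤ α) (hfm : Measurable (Function.uncurry f))
    (hf : PseudoLipschitz α L f)
    (hd : ∀ y e, ContDiff ℝ 1 (slice f y e)) (B : Mat2 l) :
    MemLp (fun z => gradX f z.1 z.2) 2 (covLaw B) := by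
  have hm := (measurable_gradX hfm hd).aestronglyMeasurable (μ := covLaw B)
  have h1 : MemLp (fun z : Vec2 l × Vec l => 4 * |L| * 2 ^ ⌈α⌉₊ * wt z ^ ⌈α⌉₊) 2 (covLaw B) := by
    refine MemLp.const_mul ?_ _
    rw [memLp_two_iff_integrable_sq (by have := continuous_wt (l := l); fun_prop)]
    simp only [← pow_mul]
    exact integrable_wt_pow B _
  exact h1.mono' hm (ae_of_all _ fun z => norm_gradX_le hα hf hd z)

theorem memLp_coord {B : Mat2 l} {g : Vec2 l × Vec l → Vec l} {p : ENNReal}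
    (hg : MemLp g p (covLaw B)) (q : Fin l) : MemLp (fun z => g z q) p (covLaw B) :=
  (EuclideanSpace.proj (𝕜 := ℝ) q : Vec l →L[ℝ] ℝ).comp_memLp' hg

/-- This makes the source term of the coupled equations point into the positive semidefinite cone.
-/
theorem fisher_posSemidef (hα : 0 ≤ α) (hfm : Measurable (Function.uncurry f))
    (hf : PseudoLipschitz α L f)
    (hd : ∀ y e, ContDiff ℝ 1 (slice f y e)) (B : Mat2 l) : (fisher f B).PosSemidef := by
  have hL := memLp_coord (memLp_two_gradX hα hfm hf hd B)
  refine Matrix.PosSemidef.of_dotProduct_mulVec_nonneg ?_ fun v => ?_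
  · ext p q
    simp only [fisher, Matrix.conjTranspose_apply, Matrix.of_apply, star_trivial]
    exact integral_congr_ae (ae_of_all _ fun z => mul_comm _ _)
  · have h1 : star v ⬝ᵥ (fisher f B).mulVec v
        = ∫ z, (∑ p, v p * gradX f z.1 z.2 p) ^ 2 ∂(covLaw B) := by
      have h2 : ∀ p q, Integrable (fun z : Vec2 l × Vec l => v p * (gradX f z.1 z.2 p * gradX f z.1 z.2 q * v q))
          (covLaw B) := fun p q => (((hL p).integrable_mul (hL q)).mul_const _).const_mul _
      simp only [dotProduct, Matrix.mulVec, fisher, Matrix.of_apply, star_trivial, Pi.star_apply]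
      simp only [sq, Finset.sum_mul_sum]
      rw [integral_finsetSum]
      · refine Finset.sum_congr rfl fun p _ => ?_
        rw [Finset.mul_sum, integral_finsetSum]
        · refine Finset.sum_congr rfl fun q _ => ?_
          rw [← integral_mul_const, ← integral_const_mul]
          exact integral_congr_ae (ae_of_all _ fun z => by ring)
        · intro q _
          exact (h2 p q).congr (ae_of_all _ fun z => by ring)
      · intro p _
        refine integrable_finsetSum _ fun q _ => ?_
        exact (h2 p q).congr (ae_of_all _ fun z => by ring)
    rw [h1]
    exact integral_nonneg fun z => sq_nonneg _

theorem integrable_covLaw (hα : 0 ≤ α) (hfm : Measurable (Function.uncurry f))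
    (hfi : Integrable (fun e => f 0 e) (stdGaussian (Vec l)))
    (hf : PseudoLipschitz α L f) (B : Mat2 l) :
    Integrable (fun z => f z.1 z.2) (covLaw B) := by
  have h1 : Integrable (fun z : Vec2 l × Vec l => f 0 z.2) (covLaw B) := hfi.comp_snd _
  refine (h1.norm.add ((integrable_wt_pow B (⌈α⌉₊ + 1)).const_mul (4 * |L|))).mono'
    hfm.aestronglyMeasurable (ae_of_all _ fun z => ?_)
  have h2 := hf.abs_sub_le hα (r := z.1) (r' := 0) (e := z.2) (c := 1 + ‖z.1‖) le_rfl (by simp)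
  rw [sub_zero] at h2
  have h3 : ‖z.1‖ ≤ wt z := by
    unfold wt; nlinarith [norm_nonneg z.1, norm_nonneg z.2, mul_nonneg (norm_nonneg z.1) (norm_nonneg z.2)]
  have h4 : 4 * |L| * wt z ^ ⌈α⌉₊ * ‖z.1‖ ≤ 4 * |L| * wt z ^ ⌈α⌉₊ * wt z :=
    mul_le_mul_of_nonneg_left h3 (by have := one_le_wt z; positivity)
  simp only [Real.norm_eq_abs, Pi.add_apply, pow_succ]
  have h5 : 4 * |L| * ((1 + ‖z.1‖) * (1 + ‖z.2‖)) ^ ⌈α⌉₊ * ‖z.1‖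
      ≤ 4 * |L| * wt z ^ ⌈α⌉₊ * wt z := h4
  have h6 : |f z.1 z.2| ≤ |f 0 z.2| + |f z.1 z.2 - f 0 z.2| := by
    have := abs_add_le (f 0 z.2) (f z.1 z.2 - f 0 z.2)
    rwa [add_sub_cancel] at this
  linarith

end Poly

/-! ### The gradient of the risk as a function of the covariance -/

section RiskGrad

variable {d l : ℕ} {f : Vec2 l → Vec l → ℝ} {h : Mat2 l → ℝ} {U : Set (Mat2 l)} {α L Lh : ℝ}

theorem sum_mul_eq_trace {m n : Type*} [Fintype m] [Fintype n] (G S : Matrix m n ℝ) :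
    ∑ i, ∑ j, G i j * S i j = (G.transpose * S).trace := by
  simp only [Matrix.trace, Matrix.diag_apply, Matrix.mul_apply, Matrix.transpose_apply]
  exact Finset.sum_comm

theorem hasFDerivAt_apply_eq_trace {m n : Type*} [Fintype m] [Fintype n] [DecidableEq m]
    [DecidableEq n] {F : Matrix m n ℝ → ℝ} {A : Matrix m n ℝ} {F' : Matrix m n ℝ →L[ℝ] ℝ}
    (hF : HasFDerivAt F F' A) (S : Matrix m n ℝ) :
    F' S = ((matGrad F A).transpose * S).trace := by
  rw [← sum_mul_eq_trace]
  conv_lhs => rw [Matrix.matrix_eq_sum_single S, map_sum]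
  refine Finset.sum_congr rfl fun i _ => ?_
  rw [map_sum]
  refine Finset.sum_congr rfl fun j _ => ?_
  rw [matGrad_eq_of_hasFDerivAt hF]
  have : Matrix.single i j (S i j) = S i j • Matrix.single i j (1 : ℝ) := by
    rw [Matrix.smul_single, smul_eq_mul, mul_one]
  rw [this, map_smul, smul_eq_mul, mul_comm]

theorem RiskRepresentation.differentiableAt (hh : RiskRepresentation α Lh U f h) {B : Mat2 l}
    (hB : B ∈ U) : DifferentiableAt ℝ h B :=
  ((hh.contDiffOn.differentiableOn one_ne_zero) B hB).differentiableAt (hh.isOpen.mem_nhds hB)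

theorem RiskRepresentation.matGrad_transpose (hh : RiskRepresentation α Lh U f h) {B : Mat2 l}
    (hB : B ∈ U) (hs : B.transpose = B) : (matGrad h B).transpose = matGrad h B := by
  have h1 := (hh.differentiableAt hB).hasFDerivAt
  obtain ⟨T, hT⟩ : ∃ T : Mat2 l →L[ℝ] Mat2 l, ∀ A, T A = A.transpose :=
    ⟨LinearMap.toContinuousLinearMap
      { toFun := fun A => A.transpose, map_add' := fun _ _ => rfl, map_smul' := fun _ _ => rfl },
      fun _ => rfl⟩
  have h2 : HasFDerivAt h (fderiv ℝ h B) (T B) := by rw [hT, hs]; exact h1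
  have h3 := h2.comp B T.hasFDerivAt
  have h4 : h ∘ T = h := by ext A; simp only [Function.comp_apply, hT, hh.symm]
  rw [h4] at h3
  ext p q
  rw [Matrix.transpose_apply, matGrad_eq_of_hasFDerivAt h3, matGrad_eq_of_hasFDerivAt h1]
  change fderiv ℝ h B (T (Matrix.single q p 1)) = _
  rw [hT, Matrix.transpose_single]

/-- When a matrix or a Gaussian vector moves along a line, its covariance moves along such a
quadratic curve, and only the linear part contributes to the derivative at zero. -/
theorem hasDerivAt_comp_quadratic {B : Mat2 l} (hd : DifferentiableAt ℝ h B) (S Q : Mat2 l) :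
    HasDerivAt (fun s : ℝ => h (B + s • S + s ^ 2 • Q)) ((matGrad h B).transpose * S).trace 0 := by
  have hc : HasDerivAt (fun s : ℝ => B + s • S + s ^ 2 • Q) S 0 := by
    have h1 : HasDerivAt (fun s : ℝ => s • S) ((1 : ℝ) • S) 0 := (hasDerivAt_id 0).smul_const S
    have h2 : HasDerivAt (fun s : ℝ => s ^ 2 • Q) ((((2 : ℕ) : ℝ) * (0 : ℝ) ^ 1) • Q) 0 :=
      (hasDerivAt_pow 2 (0 : ℝ)).smul_const Q
    have h3 := (h1.const_add B).add h2
    have e : (1 : ℝ) • S + (((2 : ℕ) : ℝ) * (0 : ℝ) ^ 1) • Q = S := by simp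
    rw [e] at h3
    exact h3
  have h0 : B + (0 : ℝ) • S + (0 : ℝ) ^ 2 • Q = B := by simp
  have h1 : HasFDerivAt h (fderiv ℝ h B) (B + (0 : ℝ) • S + (0 : ℝ) ^ 2 • Q) := by
    rw [h0]; exact hd.hasFDerivAt
  have h2 := h1.comp_hasDerivAt (0 : ℝ) hc
  exact h2.congr_deriv (hasFDerivAt_apply_eq_trace hd.hasFDerivAt S)

theorem covB_add_smul (K : Matrix (Fin d) (Fin d) ℝ) (X Xs V : Matrix (Fin d) (Fin l) ℝ) (s : ℝ) :
    covB K (X + s • V) Xs = covB K X Xs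
      + s • ((Matrix.fromCols V 0).transpose * K * Matrix.fromCols X Xs
        + (Matrix.fromCols X Xs).transpose * K * Matrix.fromCols V (0 : Matrix (Fin d) (Fin l) ℝ))
      + s ^ 2 • ((Matrix.fromCols V 0).transpose * K
        * Matrix.fromCols V (0 : Matrix (Fin d) (Fin l) ℝ)) := by
  have h1 : Matrix.fromCols (X + s • V) Xs = Matrix.fromCols X Xs
      + s • Matrix.fromCols V (0 : Matrix (Fin d) (Fin l) ℝ) := by
    ext i j; rcases j with j | j <;> simp
  rw [covB, covB, h1, Matrix.transpose_add, Matrix.transpose_smul]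
  simp only [Matrix.add_mul, Matrix.mul_add, Matrix.smul_mul, Matrix.mul_smul, smul_add, smul_smul,
    sq]
  abel

theorem risk_eq_integral_covLaw {K : Matrix (Fin d) (Fin d) ℝ} (hK : K.PosSemidef)
    (hfm : Measurable (Function.uncurry f)) (X Xs : Matrix (Fin d) (Fin l) ℝ) :
    risk f K Xs X = ∫ z, f z.1 z.2 ∂(covLaw (covB K X Xs)) := by
  have hmp := measurePreserving_cat (l := l) hK X Xs
  rw [← hmp.map_eq]
  exact (integral_map (f := fun z : Vec2 l × Vec l => f z.1 z.2) hmp.measurable.aemeasurable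
    hfm.aestronglyMeasurable).symm

/-- The gradient of the risk, in terms of the gradient of `h`. -/
theorem integral_mul_gradX (hh : RiskRepresentation α Lh U f h)
    (hfm : Measurable (Function.uncurry f)) (hd : ∀ y e, ContDiff ℝ 1 (slice f y e))
    {K : Matrix (Fin d) (Fin d) ℝ} (hK : K.PosSemidef)
    {X Xs : Matrix (Fin d) (Fin l) ℝ} (hU : covB K X Xs ∈ U) (hg : UnbiasedGradient U f K Xs)
    (p : Fin d) (q : Fin l) :
    ∫ z, z.1 p * gradX f (cat (contract X z.1) (contract Xs z.1)) z.2 q ∂(dataLaw l K)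
      = 2 * (K * Matrix.fromCols X Xs * matGrad h (covB K X Xs)) p (Sum.inl q) := by
  obtain ⟨hdiff, hint⟩ := hg X hU
  have hKt : K.transpose = K := by
    have := hK.isHermitian.eq
    rwa [Matrix.conjTranspose_eq_transpose_of_trivial] at this
  have hBt : (covB K X Xs).transpose = covB K X Xs := by
    have := (covB_posSemidef hK X Xs).isHermitian.eq
    rwa [Matrix.conjTranspose_eq_transpose_of_trivial] at this
  have h1 := hint p q
  simp only [matGrad_Psi hd] at h1
  rw [← h1]
  set V : Matrix (Fin d) (Fin l) ℝ := Matrix.single p q 1 with hV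
  set W := Matrix.fromCols X Xs with hW
  set V' := Matrix.fromCols V (0 : Matrix (Fin d) (Fin l) ℝ) with hV'
  set G := matGrad h (covB K X Xs) with hG
  have hGt : G.transpose = G := hh.matGrad_transpose hU hBt
  have hline : HasDerivAt (fun s : ℝ => risk f K Xs (X + s • V)) (matGrad (risk f K Xs) X p q) 0 := by
    rw [matGrad_eq_of_hasFDerivAt hdiff.hasFDerivAt]
    exact hdiff.hasFDerivAt.hasLineDerivAt V
  have hcurve := hasDerivAt_comp_quadratic (hh.differentiableAt hU)
    (V'.transpose * K * W + W.transpose * K * V') (V'.transpose * K * V')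
  have hcont : Continuous fun s : ℝ => covB K (X + s • V) Xs := by
    simp only [covB_add_smul]; fun_prop
  -- For small `s` the covariance remains in the open set `U`, where the risk is `h` of the
  -- covariance. The derivative of the risk along `V` can then be computed by the chain rule for
  -- `h`.
  have hev : (fun s : ℝ => risk f K Xs (X + s • V)) =ᶠ[𝓝 0] fun s : ℝ => h (covB K X Xs
      + s • (V'.transpose * K * W + W.transpose * K * V') + s ^ 2 • (V'.transpose * K * V')) := by
    have h2 : ∀ᶠ s : ℝ in 𝓝 0, covB K (X + s • V) Xs ∈ U :=
      hcont.continuousAt.eventually_mem (by simpa using hh.isOpen.mem_nhds hU)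
    filter_upwards [h2] with s hs
    rw [risk_eq_integral_covLaw hK hfm, ← hh.eq_integral _ ⟨hs, covB_posSemidef hK _ _⟩,
      covB_add_smul]
  rw [hline.unique (hcurve.congr_of_eventuallyEq hev), hGt, Matrix.mul_add, Matrix.trace_add]
  -- By symmetry the two cross terms agree, which produces the factor `2`.
  have e1 : (G * (V'.transpose * K * W)).trace = (G * (W.transpose * K * V')).trace := by
    rw [← Matrix.trace_transpose, Matrix.transpose_mul, Matrix.transpose_mul, Matrix.transpose_mul,
      Matrix.transpose_transpose, hGt, hKt, Matrix.trace_mul_comm, Matrix.mul_assoc]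
  have e2 : (G * (W.transpose * K * V')).trace = (K * W * G) p (Sum.inl q) := by
    have e3 : (K * W * G).transpose = G * (W.transpose * K) := by
      rw [Matrix.transpose_mul, Matrix.transpose_mul, hGt, hKt]
    rw [← Matrix.mul_assoc, ← e3, ← sum_mul_eq_trace, Finset.sum_eq_single p,
      Finset.sum_eq_single (Sum.inl q)]
    · simp [hV', hV]
    · intro j _ hj
      rcases j with j | j
      · have : q ≠ j := fun h => hj (by rw [h])
        simp [hV', hV, this]
      · simp [hV']
    · simp
    · intro i _ hi
      refine Finset.sum_eq_zero fun j _ => ?_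
      rcases j with j | j
      · simp [hV', hV, Ne.symm hi]
      · simp [hV']
    · simp
  rw [e1, e2]; ring

end RiskGrad


/-! ### The drift of the squared distance -/

section Drift

variable {l : ℕ} {f : Vec2 l → Vec l → ℝ} {h : Mat2 l → ℝ} {U : Set (Mat2 l)} {α L Lh : ℝ}

/-- The matrix of the quadratic form `‖x - y‖²` on `𝒪 ⊕ 𝒯`. -/
def diffForm (l : ℕ) : Mat2 l := Matrix.fromBlocks 1 (-1) (-1) 1

/-- The matrix of `x ⊕ y ↦ (x - y) ⊕ 0`. -/
def diffMap (l : ℕ) : Mat2 l := Matrix.fromBlocks 1 (-1) 0 0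

/-- The matrix of the projection `x ⊕ y ↦ x ⊕ 0`. -/
def projFst (l : ℕ) : Mat2 l := Matrix.fromBlocks 1 0 0 0

theorem projFst_mul_diffForm : projFst l * diffForm l = diffMap l := by
  simp [projFst, diffForm, diffMap, Matrix.fromBlocks_multiply]

theorem diffForm_transpose : (diffForm l).transpose = diffForm l := by
  simp [diffForm, Matrix.fromBlocks_transpose]

theorem projFst_transpose : (projFst l).transpose = projFst l := by
  simp [projFst, Matrix.fromBlocks_transpose]

theorem driftH_eq (B : Mat2 l) : driftH h B = matGrad h B * projFst l := by
  conv_rhs => rw [← Matrix.fromBlocks_toBlocks (matGrad h B)]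
  simp [driftH, projFst, Matrix.fromBlocks_multiply]

theorem posSemidef_transpose {n : Type*} [Fintype n] {B : Matrix n n ℝ} (hB : B.PosSemidef) :
    B.transpose = B := by
  have := hB.isHermitian.eq
  rwa [Matrix.conjTranspose_eq_transpose_of_trivial] at this

theorem trace_fromBlocks {n : Type*} [Fintype n] (A B C D : Matrix n n ℝ) :
    (Matrix.fromBlocks A B C D).trace = A.trace + D.trace := by
  simp [Matrix.trace, Fintype.sum_sum_type]

theorem trace_mul_diffForm {M : Mat2 l} (hM : M.transpose = M) :
    (M * diffForm l).trace
      = (M.toBlocks₁₁ - (2 : ℝ) • M.toBlocks₁₂ + M.toBlocks₂₂).trace := by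
  have h21 : M.toBlocks₂₁.trace = M.toBlocks₁₂.trace := by
    have : M.toBlocks₂₁ = M.toBlocks₁₂.transpose := by
      ext i j
      have := congrFun (congrFun hM (Sum.inr i)) (Sum.inl j)
      simpa [Matrix.toBlocks₂₁, Matrix.toBlocks₁₂] using this.symm
    rw [this, Matrix.trace_transpose]
  conv_lhs => rw [← Matrix.fromBlocks_toBlocks M]
  rw [diffForm, Matrix.fromBlocks_multiply, trace_fromBlocks]
  simp only [Matrix.mul_one, Matrix.mul_neg, Matrix.trace_add, Matrix.trace_neg, Matrix.trace_sub,
    Matrix.trace_smul, smul_eq_mul, h21]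
  ring

theorem diffMap_mulVec (r : Vec2 l) :
    (WithLp.toLp 2 ((diffMap l).mulVec r.ofLp) : Vec2 l) = cat (fstV r - sndV r) 0 := by
  have : r.ofLp = Sum.elim (fstV r).ofLp (sndV r).ofLp := by
    ext i; rcases i with i | i <;> rfl
  rw [this, diffMap, Matrix.fromBlocks_mulVec]
  ext i
  rcases i with i | i <;> simp [cat, sub_eq_add_neg, Function.comp_def, Matrix.neg_mulVec]

theorem line_mulVec (r : Vec2 l) (s : ℝ) :
    (WithLp.toLp 2 ((1 + s • diffMap l).mulVec r.ofLp) : Vec2 l)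
      = cat (fstV r + s • (fstV r - sndV r)) (sndV r) := by
  have h1 : (WithLp.toLp 2 ((1 + s • diffMap l).mulVec r.ofLp) : Vec2 l)
      = r + s • (WithLp.toLp 2 ((diffMap l).mulVec r.ofLp) : Vec2 l) := by
    rw [Matrix.add_mulVec, Matrix.one_mulVec, Matrix.smul_mulVec]; rfl
  rw [h1, diffMap_mulVec]
  conv_lhs => rw [← cat_fstV_sndV r]
  ext i
  rcases i with i | i <;> simp [cat, fstV, sndV]

/-- Stretching the difference `x - y` under the integral. -/
theorem hasDerivAt_integral_stretch (hα : 0 ≤ α) (hfm : Measurable (Function.uncurry f))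
    (hfi : Integrable (fun e => f 0 e) (stdGaussian (Vec l)))
    (hf : PseudoLipschitz α L f) (hd : ∀ y e, ContDiff ℝ 1 (slice f y e)) (B : Mat2 l) :
    HasDerivAt (fun s : ℝ => ∫ z, f (cat (fstV z.1 + s • (fstV z.1 - sndV z.1)) (sndV z.1)) z.2
      ∂(covLaw B)) (∫ z, ⟪gradX f z.1 z.2, fstV z.1 - sndV z.1⟫ ∂(covLaw B)) 0 := by
  have hmeas : ∀ s : ℝ, Measurable fun z : Vec2 l × Vec l =>
      f (cat (fstV z.1 + s • (fstV z.1 - sndV z.1)) (sndV z.1)) z.2 := fun s => by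
    refine hfm.comp (Measurable.prodMk (Continuous.measurable ?_) measurable_snd)
    have c1 := (continuous_fstV (l := l)).comp (continuous_fst (X := Vec2 l) (Y := Vec l))
    have c2 := (continuous_sndV (l := l)).comp (continuous_fst (X := Vec2 l) (Y := Vec l))
    exact continuous_cat.comp ((c1.add ((c1.sub c2).const_smul s)).prodMk c2)
  -- In the dominating function, `3 ^ ⌈α⌉₊` accounts for the growth of the norm when `|s| < 1`, and
  -- the factor `2` together with one more power of `wt` for `‖x - y‖ ≤ 2 ‖r‖`.
  refine (hasDerivAt_integral_of_dominated_loc_of_lip (μ := covLaw B)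
    (F := fun (s : ℝ) (z : Vec2 l × Vec l) =>
      f (cat (fstV z.1 + s • (fstV z.1 - sndV z.1)) (sndV z.1)) z.2)
    (F' := fun z => ⟪gradX f z.1 z.2, fstV z.1 - sndV z.1⟫)
    (bound := fun z => 4 * |L| * 3 ^ ⌈α⌉₊ * 2 * wt z ^ (⌈α⌉₊ + 1))
    (Metric.ball_mem_nhds 0 one_pos)
    (Eventually.of_forall fun s => (hmeas s).aestronglyMeasurable) ?_ ?_ ?_ ?_ ?_).2
  · simp only [zero_smul, add_zero, cat_fstV_sndV]
    exact integrable_covLaw hα hfm hfi hf B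
  · refine (Measurable.inner (measurable_gradX hfm hd) ?_).aestronglyMeasurable
    exact ((continuous_fstV.comp continuous_fst).sub (continuous_sndV.comp continuous_fst)).measurable
  · refine ae_of_all _ fun z => LipschitzOnWith.of_dist_le_mul fun s hs t ht => ?_
    rw [Metric.mem_ball, dist_zero_right, Real.norm_eq_abs] at hs ht
    have hw := one_le_wt z
    rw [Real.coe_nnabs, abs_of_nonneg (by positivity)]
    have hnorm : ∀ u : ℝ, |u| < 1 →
        1 + ‖cat (fstV z.1 + u • (fstV z.1 - sndV z.1)) (sndV z.1)‖ ≤ 3 * (1 + ‖z.1‖) := by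
      intro u hu
      have e1 : cat (fstV z.1 + u • (fstV z.1 - sndV z.1)) (sndV z.1) - z.1
          = cat (u • (fstV z.1 - sndV z.1)) 0 := by
        conv_lhs => rw [← cat_fstV_sndV z.1]
        simp only [cat_sub, fstV_cat, sndV_cat, sub_self, add_sub_cancel_left]
      have e2 := norm_add_le (cat (fstV z.1 + u • (fstV z.1 - sndV z.1)) (sndV z.1) - z.1) z.1
      rw [sub_add_cancel, e1, norm_cat_zero, norm_smul, Real.norm_eq_abs] at e2
      have e3 := norm_fstV_sub_sndV_le z.1
      have e4 : |u| * ‖fstV z.1 - sndV z.1‖ ≤ 1 * (2 * ‖z.1‖) :=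
        mul_le_mul hu.le e3 (norm_nonneg _) zero_le_one
      linarith
    have h1 := hf.abs_sub_le hα (e := z.2) (hnorm s hs) (hnorm t ht)
    have e5 : ‖cat (fstV z.1 + s • (fstV z.1 - sndV z.1)) (sndV z.1)
        - cat (fstV z.1 + t • (fstV z.1 - sndV z.1)) (sndV z.1)‖
        = |s - t| * ‖fstV z.1 - sndV z.1‖ := by
      rw [cat_sub, sub_self, norm_cat_zero, add_sub_add_left_eq_sub, ← sub_smul, norm_smul,
        Real.norm_eq_abs]
    rw [e5] at h1
    rw [Real.dist_eq, Real.dist_eq]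
    have e6 : ‖fstV z.1 - sndV z.1‖ ≤ 2 * wt z := by
      refine (norm_fstV_sub_sndV_le z.1).trans ?_
      unfold wt
      nlinarith [norm_nonneg z.1, norm_nonneg z.2, mul_nonneg (norm_nonneg z.1) (norm_nonneg z.2)]
    have e7 : (3 * (1 + ‖z.1‖) * (1 + ‖z.2‖)) ^ ⌈α⌉₊ = 3 ^ ⌈α⌉₊ * wt z ^ ⌈α⌉₊ := by
      rw [wt, mul_assoc, mul_pow]
    rw [e7] at h1
    calc _ ≤ 4 * |L| * (3 ^ ⌈α⌉₊ * wt z ^ ⌈α⌉₊) * (|s - t| * ‖fstV z.1 - sndV z.1‖) := h1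
      _ ≤ 4 * |L| * (3 ^ ⌈α⌉₊ * wt z ^ ⌈α⌉₊) * (|s - t| * (2 * wt z)) := by gcongr
      _ = _ := by rw [pow_succ]; ring
  · exact (integrable_wt_pow B _).const_mul _
  · refine ae_of_all _ fun z => ?_
    have h1 : HasFDerivAt (slice f (sndV z.1) z.2)
        (fderiv ℝ (slice f (sndV z.1) z.2) (fstV z.1)) (fstV z.1) :=
      ((hd _ _).differentiable one_ne_zero _).hasFDerivAt
    rw [inner_gradX_eq_fderiv]
    exact h1.hasLineDerivAt (fstV z.1 - sndV z.1)

/-- Both sides are the derivative at `s = 0` of `h((1 + sN) B (1 + sN)ᵀ)` with `N = diffMap l`. This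
matrix is the covariance of `(x + s(x - y)) ⊕ y`. The chain rule for `h` gives the left side, and
differentiation under the integral gives the right side. -/
theorem trace_drift_eq_integral (hα : 0 ≤ α) (hfm : Measurable (Function.uncurry f))
    (hfi : Integrable (fun e => f 0 e) (stdGaussian (Vec l)))
    (hf : PseudoLipschitz α L f) (hd : ∀ y e, ContDiff ℝ 1 (slice f y e))
    (hh : RiskRepresentation α Lh U f h) {B : Mat2 l} (hB : B ∈ psdPart U) :
    ((B * driftH h B + (driftH h B).transpose * B) * diffForm l).trace
      = ∫ z, ⟪gradX f z.1 z.2, fstV z.1 - sndV z.1⟫ ∂(covLaw B) := by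
  obtain ⟨hBU, hBp⟩ := hB
  have hBt := posSemidef_transpose hBp
  have hGt := hh.matGrad_transpose hBU hBt
  set G := matGrad h B with hG
  set N := diffMap l with hN
  have h1 := hasDerivAt_integral_stretch hα hfm hfi hf hd B
  have h2 := hasDerivAt_comp_quadratic (hh.differentiableAt hBU) (N * B + B * N.transpose)
    (N * B * N.transpose)
  have hcurve : ∀ s : ℝ, (1 + s • N) * B * (1 + s • N).transpose
      = B + s • (N * B + B * N.transpose) + s ^ 2 • (N * B * N.transpose) := by
    intro s
    simp only [Matrix.transpose_add, Matrix.transpose_one, Matrix.transpose_smul, Matrix.add_mul,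
      Matrix.mul_add, Matrix.one_mul, Matrix.mul_one, Matrix.smul_mul, Matrix.mul_smul, smul_add,
      smul_smul, sq]
    abel
  have hcont : Continuous fun s : ℝ =>
      B + s • (N * B + B * N.transpose) + s ^ 2 • (N * B * N.transpose) := by fun_prop
  have hev : (fun s : ℝ => ∫ z, f (cat (fstV z.1 + s • (fstV z.1 - sndV z.1)) (sndV z.1)) z.2
      ∂(covLaw B)) =ᶠ[𝓝 0] fun s : ℝ => h (B + s • (N * B + B * N.transpose)
        + s ^ 2 • (N * B * N.transpose)) := by
    have h3 : ∀ᶠ s : ℝ in 𝓝 0,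
        B + s • (N * B + B * N.transpose) + s ^ 2 • (N * B * N.transpose) ∈ U :=
      hcont.continuousAt.eventually_mem (by simpa using hh.isOpen.mem_nhds hBU)
    filter_upwards [h3] with s hs
    have hp : ((1 + s • N) * B * (1 + s • N).transpose).PosSemidef := by
      have := hBp.mul_mul_conjTranspose_same (1 + s • N)
      rwa [Matrix.conjTranspose_eq_transpose_of_trivial] at this
    rw [← hcurve] at hs ⊢
    rw [hh.eq_integral _ ⟨hs, hp⟩, ← covLaw_map_linear hBp]
    have hm : Measurable fun z : Vec2 l × Vec l =>
        ((WithLp.toLp 2 ((1 + s • N).mulVec z.1.ofLp) : Vec2 l), z.2) := by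
      have : Continuous fun z : Vec2 l × Vec l =>
        ((WithLp.toLp 2 ((1 + s • N).mulVec z.1.ofLp) : Vec2 l), z.2) := by fun_prop
      exact this.measurable
    have h4 := integral_map (μ := covLaw B) (f := fun z : Vec2 l × Vec l => f z.1 z.2)
      hm.aemeasurable hfm.aestronglyMeasurable
    rw [h4]
    simp only [hN, line_mulVec]
  rw [h1.unique (h2.congr_of_eventuallyEq hev), driftH_eq, ← hG, hGt]
  -- This factorization and the cyclicity of the trace move `projFst` onto the gradient, where it
  -- produces `driftH`, and leave `diffForm` as the test matrix.
  have hNJ : N = projFst l * diffForm l := projFst_mul_diffForm.symm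
  rw [hNJ, Matrix.transpose_mul, Matrix.transpose_mul, hGt, projFst_transpose, diffForm_transpose,
    Matrix.add_mul, Matrix.mul_add, Matrix.trace_add, Matrix.trace_add]
  congr 1
  · rw [Matrix.mul_assoc B, Matrix.trace_mul_comm B]
    simp only [Matrix.mul_assoc]
  · rw [Matrix.mul_assoc, Matrix.mul_assoc, Matrix.trace_mul_comm]
    simp only [Matrix.mul_assoc]

theorem integral_norm_sq_sub (B : Mat2 l) (hB : B.PosSemidef) :
    Integrable (fun z : Vec2 l × Vec l => ‖fstV z.1 - sndV z.1‖ ^ 2) (covLaw B) ∧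
    ∫ z, ‖fstV z.1 - sndV z.1‖ ^ 2 ∂(covLaw B) = (B * diffForm l).trace := by
  have hmem : ∀ i, MemLp (fun r : Vec2 l => r i) 2 (multivariateGaussian 0 B) := fun i => by
    simpa using memLp_dotProduct (p := 2) hB (Pi.single i 1) (by simp)
  have hint : ∀ i j, Integrable (fun r : Vec2 l => r i * r j) (multivariateGaussian 0 B) :=
    fun i j => (hmem i).integrable_mul (hmem j)
  have hexp : ∀ r : Vec2 l, ‖fstV r - sndV r‖ ^ 2 = ∑ q, (r (Sum.inl q) * r (Sum.inl q)
      - r (Sum.inl q) * r (Sum.inr q) - r (Sum.inr q) * r (Sum.inl q)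
      + r (Sum.inr q) * r (Sum.inr q)) := by
    intro r
    rw [EuclideanSpace.real_norm_sq_eq]
    refine Finset.sum_congr rfl fun q _ => ?_
    simp only [PiLp.sub_apply, fstV, sndV]; ring
  have hI : Integrable (fun r : Vec2 l => ‖fstV r - sndV r‖ ^ 2) (multivariateGaussian 0 B) := by
    simp only [hexp]
    exact integrable_finsetSum _ fun q _ =>
      (((hint _ _).sub (hint _ _)).sub (hint _ _)).add (hint _ _)
  have hI2 : Integrable (fun z : Vec2 l × Vec l => ‖fstV z.1 - sndV z.1‖ ^ 2) (covLaw B) :=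
    hI.comp_fst _
  refine ⟨hI2, ?_⟩
  rw [covLaw, integral_fun_fst (fun r : Vec2 l => ‖fstV r - sndV r‖ ^ 2), probReal_univ, one_smul]
  simp only [hexp]
  have hI3 : ∀ q, Integrable (fun r : Vec2 l => r (Sum.inl q) * r (Sum.inl q)
      - r (Sum.inl q) * r (Sum.inr q) - r (Sum.inr q) * r (Sum.inl q)
      + r (Sum.inr q) * r (Sum.inr q)) (multivariateGaussian 0 B) := fun q =>
    (((hint _ _).sub (hint _ _)).sub (hint _ _)).add (hint _ _)
  rw [integral_finsetSum _ fun q _ => hI3 q]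
  conv_rhs => rw [← Matrix.fromBlocks_toBlocks B]
  rw [diffForm, Matrix.fromBlocks_multiply, trace_fromBlocks, Matrix.trace, Matrix.trace,
    ← Finset.sum_add_distrib]
  refine Finset.sum_congr rfl fun q _ => ?_
  have i1 := hint (Sum.inl q) (Sum.inl q)
  have i2 := hint (Sum.inl q) (Sum.inr q)
  have i3 := hint (Sum.inr q) (Sum.inl q)
  have i4 := hint (Sum.inr q) (Sum.inr q)
  have j1 : Integrable (fun r : Vec2 l => r (Sum.inl q) * r (Sum.inl q)
      - r (Sum.inl q) * r (Sum.inr q)) (multivariateGaussian 0 B) := i1.sub i2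
  have j2 : Integrable (fun r : Vec2 l => r (Sum.inl q) * r (Sum.inl q)
      - r (Sum.inl q) * r (Sum.inr q) - r (Sum.inr q) * r (Sum.inl q))
      (multivariateGaussian 0 B) := j1.sub i3
  rw [integral_add j2 i4, integral_sub j1 i3, integral_sub i1 i2]
  simp only [integral_mul_multivariateGaussian hB]
  simp [Matrix.toBlocks₁₁, Matrix.toBlocks₁₂, Matrix.toBlocks₂₁, Matrix.toBlocks₂₂]
  ring

theorem trace_fisher (hα : 0 ≤ α) (hfm : Measurable (Function.uncurry f))
    (hf : PseudoLipschitz α L f) (hd : ∀ y e, ContDiff ℝ 1 (slice f y e)) (B : Mat2 l) :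
    (fisher f B).trace = ∫ z, ‖gradX f z.1 z.2‖ ^ 2 ∂(covLaw B) := by
  have hL := memLp_coord (memLp_two_gradX hα hfm hf hd B)
  simp only [EuclideanSpace.real_norm_sq_eq]
  rw [integral_finsetSum _ fun q _ => (hL q).integrable_sq, Matrix.trace]
  refine Finset.sum_congr rfl fun q _ => ?_
  simp only [fisher, Matrix.diag_apply, Matrix.of_apply, sq]

/-- The restricted secant inequality and smoothness, averaged. -/
theorem energy_bounds (hα : 0 ≤ α) (hfm : Measurable (Function.uncurry f))
    (hfi : Integrable (fun e => f 0 e) (stdGaussian (Vec l)))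
    (hf : PseudoLipschitz α L f) (hh : RiskRepresentation α Lh U f h)
    {Lhat μhat : ℝ} (hL : 0 < Lhat) (hsmooth : ∀ y e : Vec l, IsLSmooth Lhat (slice f y e))
    (hrsi : ∀ y e : Vec l, RSI μhat (slice f y e))
    {B : Mat2 l} (hB : B ∈ psdPart U) (hmin : ∀ᵐ z ∂(covLaw B), MinAt f (sndV z.1, z.2)) :
    0 ≤ (B * diffForm l).trace ∧
    μhat * (B * diffForm l).trace
      ≤ ((B * driftH h B + (driftH h B).transpose * B) * diffForm l).trace ∧
    (fisher f B).trace ≤ Lhat ^ 2 * (B * diffForm l).trace := by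
  have hd : ∀ y e, ContDiff ℝ 1 (slice f y e) := fun y e => (hsmooth y e).1
  obtain ⟨hI, hE⟩ := integral_norm_sq_sub B hB.2
  have hg := memLp_two_gradX hα hfm hf hd B
  have hdiff : MemLp (fun z : Vec2 l × Vec l => fstV z.1 - sndV z.1) 2 (covLaw B) := by
    rw [memLp_two_iff_integrable_sq_norm]
    · exact hI
    · exact ((continuous_fstV.comp continuous_fst).sub
        (continuous_sndV.comp continuous_fst)).aestronglyMeasurable
  rw [trace_drift_eq_integral hα hfm hfi hf hd hh hB, trace_fisher hα hfm hf hd, ← hE,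
    ← integral_const_mul, ← integral_const_mul]
  refine ⟨integral_nonneg fun z => sq_nonneg _, ?_, ?_⟩
  · have hIn : Integrable (fun z : Vec2 l × Vec l => ⟪gradX f z.1 z.2, fstV z.1 - sndV z.1⟫)
        (covLaw B) := (hg.norm.integrable_mul hdiff.norm).mono' (hg.1.inner hdiff.1)
      (ae_of_all _ fun z => by
        rw [Real.norm_eq_abs]; exact abs_real_inner_le_norm _ _)
    refine integral_mono_ae (hI.const_mul _) hIn ?_
    filter_upwards [hmin] with z hz
    -- RSI is used with the minimizer `x⋆ = y`.
    have := (hrsi (sndV z.1) z.2).2 (fstV z.1) (sndV z.1) hz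
    rwa [real_inner_comm] at this
  · refine integral_mono_ae ((memLp_two_iff_integrable_sq_norm hg.1).1 hg) (hI.const_mul _) ?_
    filter_upwards [hmin] with z hz
    have := (hsmooth (sndV z.1) z.2).norm_gradient_le hL hz (fstV z.1)
    rw [← mul_pow]
    exact pow_le_pow_left₀ (norm_nonneg _) this 2

end Drift


/-! ### The coupled equations -/

/-- A field that agrees on a closed set with a Lipschitz field tangent to it can be solved
locally within that set. -/
theorem exists_flowsOn_of_extension {E : Type*} [NormedAddCommGroup E] [NormedSpace ℝ E]
    [CompleteSpace E] {D C : Set E} {v w : E → E} {x : E} {ρ k k' m : ℝ} (hρ : 0 < ρ)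
    (hk : 0 ≤ k) (hk' : 0 ≤ k') (hC : IsClosed C) (hx : x ∈ C)
    (hlip : ∀ y y', ‖y - x‖ ≤ ρ → ‖y' - x‖ ≤ ρ → ‖w y - w y'‖ ≤ k * ‖y - y'‖)
    (heq : ∀ y ∈ C, ‖y - x‖ ≤ ρ → y ∈ D ∧ w y = v y)
    (htan : ∀ y, ‖y - x‖ ≤ ρ → ∀ p ∈ C, ‖p - x‖ ≤ 2 * ρ → ∀ s ∈ Set.Ioc (0 : ℝ) 1,
      Metric.infDist (y + s • w y) C ≤ (1 + k' * s) * ‖y - p‖ + m * s ^ 2) :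
    ∃ τ : ℝ, 0 < τ ∧ ∃ u, FlowsOn D v x τ u := by
  obtain ⟨b, hb0, hb⟩ : ∃ b : ℝ, 0 ≤ b ∧ ∀ y, ‖y - x‖ ≤ ρ → ‖w y‖ ≤ b := by
    refine ⟨‖w x‖ + k * ρ, by positivity, fun y hy => ?_⟩
    have h1 := hlip y x hy (by simpa using hρ.le)
    have h2 := norm_sub_norm_le (w y) (w x)
    have h3 := mul_le_mul_of_nonneg_left hy hk
    linarith
  obtain ⟨τ₀, hτ₀pos, hτ₀⟩ : ∃ τ₀ : ℝ, 0 < τ₀ ∧ b * τ₀ ≤ ρ := by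
    refine ⟨ρ / (b + 1), by positivity, ?_⟩
    rw [mul_div_assoc', div_le_iff₀ (by positivity)]
    nlinarith
  -- The theorem is applied to the extension `w`, which is Lipschitz on a full ball, whereas `v` is
  -- controlled on `C` only.
  have hPL : IsPicardLindelof (fun _ : ℝ => w) (tmin := 0) (tmax := τ₀)
      ⟨0, Set.left_mem_Icc.2 hτ₀pos.le⟩ x (Real.toNNReal ρ) 0 (Real.toNNReal b)
      (Real.toNNReal k) := by
    refine IsPicardLindelof.of_time_independent (fun y hy => ?_)
      (LipschitzOnWith.of_dist_le_mul fun B hB B' hB' => ?_) ?_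
    · rw [Metric.mem_closedBall, dist_eq_norm, Real.coe_toNNReal _ hρ.le] at hy
      rw [Real.coe_toNNReal _ hb0]
      exact hb y hy
    · rw [Metric.mem_closedBall, dist_eq_norm, Real.coe_toNNReal _ hρ.le] at hB hB'
      rw [dist_eq_norm, dist_eq_norm, Real.coe_toNNReal _ hk]
      exact hlip B B' hB hB'
    · rw [Real.coe_toNNReal _ hb0, Real.coe_toNNReal _ hρ.le]
      simpa [max_eq_left hτ₀pos.le] using hτ₀
  obtain ⟨u, hu0, hu⟩ := hPL.exists_eq_forall_mem_Icc_hasDerivWithinAt₀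
  simp only at hu0
  have hucont : ContinuousOn u (Set.Icc 0 τ₀) := fun t ht => (hu t ht).continuousWithinAt
  obtain ⟨τ, hτ, hτball⟩ : ∃ τ ∈ Set.Ioc 0 τ₀, ∀ t ∈ Set.Ico 0 τ, ‖u t - x‖ < ρ := by
    have h1 : ∀ᶠ t in 𝓝[≥] (0 : ℝ), ‖u t - x‖ < ρ := by
      have h2 : ContinuousWithinAt u (Set.Ici 0) 0 := by
        have := hucont 0 (Set.left_mem_Icc.2 hτ₀pos.le)
        exact this.mono_of_mem_nhdsWithin (Icc_mem_nhdsGE hτ₀pos)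
      have h3 := h2.eventually_mem (Metric.ball_mem_nhds (u 0) hρ)
      filter_upwards [h3] with t ht
      rwa [Metric.mem_ball, dist_eq_norm, hu0] at ht
    obtain ⟨τ, hτ, hsub⟩ := (mem_nhdsGE_iff_exists_mem_Ioc_Ico_subset hτ₀pos).1 h1
    exact ⟨τ, hτ, fun t ht => hsub ht⟩
  have hder : ∀ t ∈ Set.Ico 0 τ, HasDerivWithinAt u (w (u t)) (Set.Ici 0) t := by
    intro t ht
    exact (hu t ⟨ht.1, ht.2.le.trans hτ.2⟩).mono_of_mem_nhdsWithin
      (mem_nhdsWithin.2 ⟨Set.Iio τ₀, isOpen_Iio, ht.2.trans_le hτ.2,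
        fun y hy => ⟨hy.2, hy.1.le⟩⟩)
  have hmemC : ∀ t ∈ Set.Icc 0 τ, u t ∈ C := by
    refine mem_of_infDist_tangent (w := fun t => w (u t)) (r := ρ) (k := k') (m := m) hC hk'
      (by rw [hu0]; exact hx) (hucont.mono (Set.Icc_subset_Icc_right hτ.2))
      (fun t ht => (hder t ht).mono (Set.Ici_subset_Ici.2 ht.1))
      (fun t ht => by rw [dist_eq_norm, hu0]; exact hτball t ht) ?_
    intro t ht p hp hpn s hs
    have hut := hτball t ht
    refine htan _ hut.le p hp ?_ s hs
    -- The point `p` is within `ρ` of `u t`, which is within `ρ` of `x`; this is why tangency is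
    -- required for `p` up to distance `2 ρ`.
    have := norm_sub_le (u t - x) (u t - p)
    rw [sub_sub_sub_cancel_left] at this
    linarith
  have hmem : ∀ t ∈ Set.Ico 0 τ, u t ∈ D ∧ w (u t) = v (u t) := fun t ht =>
    heq _ (hmemC t ⟨ht.1, ht.2.le⟩) (hτball t ht).le
  exact ⟨τ, hτ.1, u, hu0, fun t h0 ht => (hmem t ⟨h0, EReal.coe_lt_coe_iff.1 ht⟩).1,
    fun t h0 ht => by
      have ht' : t ∈ Set.Ico 0 τ := ⟨h0, EReal.coe_lt_coe_iff.1 ht⟩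
      rw [← (hmem t ht').2]
      exact hder t ht'⟩

/-! ### Size and Lipschitz estimates for the right-hand side. -/

section Rhs

variable {l : ℕ} {f : Vec2 l → Vec l → ℝ} {h : Mat2 l → ℝ} {U : Set (Mat2 l)} {α Lh LI : ℝ}

/-- The bilinear expression `-2 c (B H + Hᵀ B) + c' [[Q, 0], [0, 0]]`. -/
def lyap (c c' : ℝ) (H B : Mat2 l) (Q : Matrix (Fin l) (Fin l) ℝ) : Mat2 l :=
  (-2 * c) • (B * H + H.transpose * B) + c' • Matrix.fromBlocks Q 0 0 0

theorem norm_fromBlocks_zero (Q : Matrix (Fin l) (Fin l) ℝ) :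
    ‖(Matrix.fromBlocks Q 0 0 0 : Mat2 l)‖ = ‖Q‖ := by
  simp [Matrix.frobenius_norm_def, Fintype.sum_sum_type]

theorem norm_lyap_le {c c' m : ℝ} {H B : Mat2 l} {Q : Matrix (Fin l) (Fin l) ℝ}
    (hH : ‖H‖ ≤ m) (hQ : ‖Q‖ ≤ m) : ‖lyap c c' H B Q‖ ≤ 4 * |c| * m * ‖B‖ + |c'| * m := by
  have h1 : ‖B * H + H.transpose * B‖ ≤ 2 * (m * ‖B‖) := by
    refine (norm_add_le _ _).trans ?_
    have e1 := (Matrix.frobenius_norm_mul B H).trans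
      (mul_le_mul_of_nonneg_left hH (norm_nonneg B))
    have e2 := (Matrix.frobenius_norm_mul H.transpose B)
    rw [Matrix.frobenius_norm_transpose] at e2
    have e3 := mul_le_mul_of_nonneg_right hH (norm_nonneg B)
    linarith
  refine (norm_add_le _ _).trans ?_
  rw [norm_smul, norm_smul, norm_fromBlocks_zero, Real.norm_eq_abs, Real.norm_eq_abs, abs_mul,
    abs_neg, abs_two]
  have e4 := mul_le_mul_of_nonneg_left h1 (abs_nonneg c)
  have e5 := mul_le_mul_of_nonneg_left hQ (abs_nonneg c')
  linarith

/-- The products are split as `(B - B') H + B' (H - H')`. The estimate therefore needs the size of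
`H` at the first point and the size of `B` at the second point only, where a bound is at hand. -/
theorem norm_lyap_sub_le {c c' : ℝ} {H H' B B' : Mat2 l} {Q Q' : Matrix (Fin l) (Fin l) ℝ} :
    ‖lyap c c' H B Q - lyap c c' H' B' Q'‖
      ≤ 4 * |c| * (‖H‖ * ‖B - B'‖ + ‖B'‖ * ‖H - H'‖) + |c'| * ‖Q - Q'‖ := by
  have h1 : lyap c c' H B Q - lyap c c' H' B' Q'
      = (-2 * c) • (((B - B') * H + B' * (H - H'))
        + (H.transpose * (B - B') + (H - H').transpose * B'))
        + c' • (Matrix.fromBlocks (Q - Q') 0 0 0 : Mat2 l) := by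
    have e : (Matrix.fromBlocks (Q - Q') 0 0 0 : Mat2 l)
        = Matrix.fromBlocks Q 0 0 0 - Matrix.fromBlocks Q' 0 0 0 := by
      ext i j; rcases i with i | i <;> rcases j with j | j <;> simp
    rw [e, lyap, lyap, Matrix.transpose_sub]
    simp only [Matrix.sub_mul, Matrix.mul_sub, smul_add, smul_sub]
    abel
  rw [h1]
  refine (norm_add_le _ _).trans ?_
  rw [norm_smul, norm_smul, norm_fromBlocks_zero, Real.norm_eq_abs, Real.norm_eq_abs, abs_mul,
    abs_neg, abs_two]
  have e1 := Matrix.frobenius_norm_mul (B - B') H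
  have e2 := Matrix.frobenius_norm_mul B' (H - H')
  have e3 := Matrix.frobenius_norm_mul H.transpose (B - B')
  have e4 := Matrix.frobenius_norm_mul (H - H').transpose B'
  rw [Matrix.frobenius_norm_transpose] at e3 e4
  have e5 : ‖((B - B') * H + B' * (H - H')) + (H.transpose * (B - B') + (H - H').transpose * B')‖
      ≤ 2 * (‖H‖ * ‖B - B'‖ + ‖B'‖ * ‖H - H'‖) := by
    refine (norm_add_le _ _).trans ?_
    have := norm_add_le ((B - B') * H) (B' * (H - H'))
    have := norm_add_le (H.transpose * (B - B')) ((H - H').transpose * B')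
    linarith
  have e6 := mul_le_mul_of_nonneg_left e5 (abs_nonneg c)
  linarith

/-- Bounds and Lipschitz constants of the coefficients on bounded sets. -/
theorem exists_coeff_bounds (hα : 0 ≤ α) (hh : RiskRepresentation α Lh U f h)
    (hI : FisherPseudoLipschitz α LI U f) (R : ℝ) : ∃ m : ℝ, 0 ≤ m ∧
      (∀ A ∈ psdPart U, ‖A‖ ≤ R → ‖driftH h A‖ ≤ m ∧ ‖fisher f A‖ ≤ m) ∧
      (∀ A ∈ psdPart U, ∀ A' ∈ psdPart U, ‖A‖ ≤ R → ‖A'‖ ≤ R →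
        ‖driftH h A - driftH h A'‖ ≤ m * ‖A - A'‖ ∧ ‖fisher f A - fisher f A'‖ ≤ m * ‖A - A'‖) := by
  have key : ∀ R : ℝ, 0 ≤ R → ∃ m : ℝ, 0 ≤ m ∧
      (∀ A ∈ psdPart U, ∀ A' ∈ psdPart U, ‖A‖ ≤ R → ‖A'‖ ≤ R →
        ‖driftH h A - driftH h A'‖ ≤ m * ‖A - A'‖ ∧ ‖fisher f A - fisher f A'‖ ≤ m * ‖A - A'‖) := by
    intro R hR
    refine ⟨|Lh| * (1 + R ^ α + R ^ α) * ‖projFst l‖ + |LI| * (1 + R ^ α + R ^ α), by positivity, ?_⟩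
    intro A hA A' hA' hAR hAR'
    have e1 := Real.rpow_le_rpow (norm_nonneg A) hAR hα
    have e2 := Real.rpow_le_rpow (norm_nonneg A') hAR' hα
    have pos : 0 ≤ R ^ α := by positivity
    have aux : ∀ c : ℝ, c * ‖A - A'‖ * (1 + ‖A‖ ^ α + ‖A'‖ ^ α)
        ≤ |c| * (1 + R ^ α + R ^ α) * ‖A - A'‖ := fun c => by
      calc _ ≤ |c| * ‖A - A'‖ * (1 + ‖A‖ ^ α + ‖A'‖ ^ α) := by gcongr; exact le_abs_self c
        _ ≤ |c| * ‖A - A'‖ * (1 + R ^ α + R ^ α) := by gcongr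
        _ = _ := by ring
    constructor
    · rw [driftH_eq, driftH_eq, ← Matrix.sub_mul]
      refine (Matrix.frobenius_norm_mul _ _).trans ?_
      have e3 := ((hh.grad_lipschitz A hA.1 A' hA'.1).trans (aux Lh))
      have e4 := mul_le_mul_of_nonneg_right e3 (norm_nonneg (projFst l))
      have e5 : 0 ≤ |LI| * (1 + R ^ α + R ^ α) * ‖A - A'‖ := by positivity
      linarith
    · have e3 := ((hI A hA A' hA').trans (aux LI))
      have e5 : 0 ≤ |Lh| * (1 + R ^ α + R ^ α) * ‖projFst l‖ * ‖A - A'‖ := by positivity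
      linarith
  rcases Set.eq_empty_or_nonempty (psdPart U) with he | ⟨A₀, hA₀⟩
  · exact ⟨0, le_rfl, by simp [he], by simp [he]⟩
  -- A reference point `A₀` turns the Lipschitz estimates into bounds. The radius is enlarged so
  -- that the estimates also cover `A₀`.
  · have hRR : 0 ≤ max R ‖A₀‖ := (norm_nonneg A₀).trans (le_max_right _ _)
    obtain ⟨m, hm, hlip⟩ := key (max R ‖A₀‖) hRR
    refine ⟨m + (m * (2 * max R ‖A₀‖) + ‖driftH h A₀‖ + ‖fisher f A₀‖), by positivity, ?_, ?_⟩
    · intro A hA hAR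
      have h1 := hlip A hA A₀ hA₀ (hAR.trans (le_max_left _ _)) (le_max_right _ _)
      have h2 : ‖A - A₀‖ ≤ 2 * max R ‖A₀‖ := by
        have := norm_sub_le A A₀
        have := hAR.trans (le_max_left R ‖A₀‖)
        have := le_max_right R ‖A₀‖
        linarith
      have h3 := mul_le_mul_of_nonneg_left h2 hm
      have h4 := norm_sub_norm_le (driftH h A) (driftH h A₀)
      have h5 := norm_sub_norm_le (fisher f A) (fisher f A₀)
      have h6 := norm_nonneg (driftH h A₀)
      have h7 := norm_nonneg (fisher f A₀)
      constructor <;> linarith [h1.1, h1.2]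
    · intro A hA A' hA' hAR hAR'
      have h1 := hlip A hA A' hA' (hAR.trans (le_max_left _ _)) (hAR'.trans (le_max_left _ _))
      have h2 : 0 ≤ (m * (2 * max R ‖A₀‖) + ‖driftH h A₀‖ + ‖fisher f A₀‖) * ‖A - A'‖ := by
        positivity
      constructor <;> linarith [h1.1, h1.2]

end Rhs

/-! ### Local solvability of the coupled equations in the cone of positive semidefinite families. -/

section Ode

variable {d l : ℕ} {f : Vec2 l → Vec l → ℝ} {h : Mat2 l → ℝ} {U : Set (Mat2 l)} {α L Lh LI : ℝ}
  {K : Matrix (Fin d) (Fin d) ℝ}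

theorem odeRHS_eq_lyap (hK : K.IsHermitian) (γ : ℝ) (B : Fin d → Mat2 l) (i : Fin d) :
    odeRHS hK f h γ B i = lyap (hK.eigenvalues i * γ) (hK.eigenvalues i * γ ^ 2)
      (driftH h (avgB hK B)) (B i) (fisher f (avgB hK B)) := by
  rw [odeRHS, lyap, mul_assoc]

/-- The states of the coupled equations. -/
def odeDomain (hK : K.IsHermitian) (U : Set (Mat2 l)) : Set (Fin d → Mat2 l) :=
  {B | (∀ i, (B i).PosSemidef) ∧ avgB hK B ∈ U}

theorem avgB_sub (hK : K.IsHermitian) (B B' : Fin d → Mat2 l) :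
    avgB hK B - avgB hK B' = avgB hK (B - B') := by
  simp only [avgB, Pi.sub_apply, smul_sub, Finset.sum_sub_distrib]

theorem continuous_avgB (hK : K.IsHermitian) :
    Continuous (avgB hK : (Fin d → Mat2 l) → Mat2 l) := by
  unfold avgB; fun_prop

/-- A bound for the norm of `avgB`. -/
def eigMean (hK : K.IsHermitian) : ℝ := 1 / (d : ℝ) * ∑ i, |hK.eigenvalues i|

theorem eigMean_nonneg (hK : K.IsHermitian) : 0 ≤ eigMean hK := by
  unfold eigMean
  exact mul_nonneg (by positivity) (Finset.sum_nonneg fun i _ => abs_nonneg _)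

theorem norm_avgB_le (hK : K.IsHermitian) (B : Fin d → Mat2 l) :
    ‖avgB hK B‖ ≤ eigMean hK * ‖B‖ := by
  rw [avgB, eigMean, norm_smul, Real.norm_eq_abs, abs_of_nonneg (by positivity), mul_assoc]
  refine mul_le_mul_of_nonneg_left ?_ (by positivity)
  rw [Finset.sum_mul]
  refine (norm_sum_le _ _).trans (Finset.sum_le_sum fun i _ => ?_)
  rw [norm_smul, Real.norm_eq_abs]
  exact mul_le_mul_of_nonneg_left (norm_le_pi_norm B i) (abs_nonneg _)

theorem avgB_posSemidef (hK : K.PosSemidef) {B : Fin d → Mat2 l}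
    (hB : ∀ i, (B i).PosSemidef) : (avgB hK.isHermitian B).PosSemidef := by
  unfold avgB
  refine Matrix.PosSemidef.smul (Matrix.posSemidef_sum _ fun i _ => ?_) (by positivity)
  exact (hB i).smul (hK.eigenvalues_nonneg i)

theorem odeDomain_psdPart (hK : K.PosSemidef) {B : Fin d → Mat2 l}
    (hB : B ∈ odeDomain hK.isHermitian U) : avgB hK.isHermitian B ∈ psdPart U :=
  ⟨hB.2, avgB_posSemidef hK hB.1⟩

/-- A common bound for the coefficients of the coupled equations. -/
def eigSum (hK : K.IsHermitian) (γ : ℝ) : ℝ := (∑ i, |hK.eigenvalues i|) * (|γ| + γ ^ 2)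

theorem coeff_le_eigSum (hK : K.IsHermitian) (γ : ℝ) (i : Fin d) :
    |hK.eigenvalues i * γ| ≤ eigSum hK γ ∧ |hK.eigenvalues i * γ ^ 2| ≤ eigSum hK γ := by
  have h1 : |hK.eigenvalues i| ≤ ∑ i, |hK.eigenvalues i| :=
    Finset.single_le_sum (f := fun i => |hK.eigenvalues i|) (fun _ _ => abs_nonneg _)
      (Finset.mem_univ i)
  have h0 := abs_nonneg (hK.eigenvalues i)
  rw [abs_mul, abs_mul, abs_of_nonneg (sq_nonneg γ)]
  constructor
  · exact mul_le_mul h1 (by linarith [sq_nonneg γ]) (abs_nonneg _) (h0.trans h1)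
  · exact mul_le_mul h1 (by linarith [abs_nonneg γ]) (sq_nonneg _) (h0.trans h1)

theorem eigSum_nonneg (hK : K.IsHermitian) (γ : ℝ) : 0 ≤ eigSum hK γ := by
  unfold eigSum
  exact mul_nonneg (Finset.sum_nonneg fun i _ => abs_nonneg _) (by positivity)

theorem locLip_odeRHS (hα : 0 ≤ α) (hh : RiskRepresentation α Lh U f h)
    (hI : FisherPseudoLipschitz α LI U f) (hK : K.PosSemidef) (γ : ℝ) :
    LocLip (odeDomain hK.isHermitian U) (odeRHS hK.isHermitian f h γ) := by
  intro x hx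
  have hH := hK.isHermitian
  set e := eigMean hH with he
  have he0 : 0 ≤ e := eigMean_nonneg hH
  set R := ‖x‖ + 1 with hR
  obtain ⟨m, hm, hbd, hlip⟩ := exists_coeff_bounds hα hh hI (e * R)
  set s := eigSum hH γ with hs
  have hs0 : 0 ≤ s := eigSum_nonneg hH γ
  have hC : 0 ≤ 4 * s * (m + R * (m * e)) + s * (m * e) := by positivity
  refine ⟨Real.toNNReal (4 * s * (m + R * (m * e)) + s * (m * e)), Metric.ball x 1, Metric.ball_mem_nhds x one_pos,
    LipschitzOnWith.of_dist_le_mul fun B hB B' hB' => ?_⟩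
  have hnorm : ∀ B ∈ Metric.ball x 1 ∩ odeDomain hH U, ‖B‖ ≤ R := fun B hB => by
    have h1 := hB.1
    rw [Metric.mem_ball, dist_eq_norm] at h1
    have := norm_add_le (B - x) x
    rw [sub_add_cancel] at this
    linarith
  have hA := odeDomain_psdPart hK hB.2
  have hA' := odeDomain_psdPart hK hB'.2
  have nA := (norm_avgB_le hH B).trans (mul_le_mul_of_nonneg_left (hnorm B hB) he0)
  have nA' := (norm_avgB_le hH B').trans (mul_le_mul_of_nonneg_left (hnorm B' hB') he0)
  have hd := hlip _ hA _ hA' nA nA'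
  have hsub : ‖avgB hH B - avgB hH B'‖ ≤ e * ‖B - B'‖ := by
    rw [avgB_sub]; exact norm_avgB_le hH _
  rw [dist_eq_norm, dist_eq_norm, Real.coe_toNNReal _ hC]
  refine (pi_norm_le_iff_of_nonneg (mul_nonneg hC (norm_nonneg _))).2 ?_
  intro i
  rw [Pi.sub_apply, odeRHS_eq_lyap, odeRHS_eq_lyap]
  refine norm_lyap_sub_le.trans ?_
  have c1 := (coeff_le_eigSum hH γ i).1
  have c2 := (coeff_le_eigSum hH γ i).2
  have n1 : ‖B i - B' i‖ ≤ ‖B - B'‖ := norm_le_pi_norm (B - B') i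
  have n2 : ‖B' i‖ ≤ R := (norm_le_pi_norm B' i).trans (hnorm B' hB')
  have n3 := hd.1.trans (mul_le_mul_of_nonneg_left hsub hm)
  have n4 := hd.2.trans (mul_le_mul_of_nonneg_left hsub hm)
  have n5 := (hbd _ hA nA).1
  have hR0 : 0 ≤ R := by positivity
  calc _ ≤ 4 * s * (m * ‖B - B'‖ + R * (m * (e * ‖B - B'‖))) + s * (m * (e * ‖B - B'‖)) := by
        gcongr
    _ = _ := by ring

theorem isClosed_posSemidef {n : Type*} [Fintype n] :
    IsClosed {B : Matrix n n ℝ | B.PosSemidef} := by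
  have : {B : Matrix n n ℝ | B.PosSemidef} = {B | B.transpose = B} ∩
      ⋂ v : n → ℝ, {B | 0 ≤ v ⬝ᵥ B.mulVec v} := by
    ext B
    simp only [Set.mem_ofPred_eq, Set.mem_inter_iff, Set.mem_iInter]
    refine ⟨fun hB => ⟨posSemidef_transpose hB, fun v => by
      simpa using hB.dotProduct_mulVec_nonneg v⟩, fun hB => ?_⟩
    refine Matrix.PosSemidef.of_dotProduct_mulVec_nonneg ?_ fun v => by simpa using hB.2 v
    rw [Matrix.IsHermitian, Matrix.conjTranspose_eq_transpose_of_trivial, hB.1]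
  rw [this]
  refine (isClosed_eq (by fun_prop) continuous_id).inter (isClosed_iInter fun v => ?_)
  refine isClosed_le continuous_const ?_
  unfold dotProduct Matrix.mulVec dotProduct
  fun_prop

theorem isClosed_forall_posSemidef : IsClosed {B : Fin d → Mat2 l | ∀ i, (B i).PosSemidef} := by
  have : {B : Fin d → Mat2 l | ∀ i, (B i).PosSemidef}
      = ⋂ i, (fun B : Fin d → Mat2 l => B i) ⁻¹' {B | B.PosSemidef} := by
    ext B; simp
  rw [this]
  exact isClosed_iInter fun i => isClosed_posSemidef.preimage (continuous_apply i)

/-- The Euler step for `lyap` is, up to second order, a congruence. -/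
theorem add_smul_lyap_eq (c c' s : ℝ) (H P : Mat2 l) (Q : Matrix (Fin l) (Fin l) ℝ) :
    (1 - (2 * c * s) • H).transpose * P * (1 - (2 * c * s) • H)
      + (s * c') • (Matrix.fromBlocks Q 0 0 0 : Mat2 l)
      = P + s • lyap c c' H P Q + (4 * c ^ 2 * s ^ 2) • (H.transpose * P * H) := by
  rw [lyap, Matrix.transpose_sub, Matrix.transpose_one, Matrix.transpose_smul]
  simp only [Matrix.sub_mul, Matrix.mul_sub, Matrix.one_mul, Matrix.mul_one, Matrix.smul_mul,
    Matrix.mul_smul, smul_add, smul_smul, smul_sub]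
  have e1 : s * (-2 * c) = - (2 * c * s) := by ring
  have e2 : 2 * c * s * (2 * c * s) = 4 * c ^ 2 * s ^ 2 := by ring
  rw [e1, e2]
  simp only [neg_smul]
  abel

theorem fromBlocks_posSemidef {Q : Matrix (Fin l) (Fin l) ℝ} (hQ : Q.PosSemidef) :
    (Matrix.fromBlocks Q 0 0 0 : Mat2 l).PosSemidef := by
  have h1 : (Matrix.fromBlocks Q 0 0 0 : Mat2 l)
      = Matrix.fromRows (1 : Matrix (Fin l) (Fin l) ℝ) (0 : Matrix (Fin l) (Fin l) ℝ) * Q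
      * (Matrix.fromRows (1 : Matrix (Fin l) (Fin l) ℝ) (0 : Matrix (Fin l) (Fin l) ℝ)).transpose := by
    rw [Matrix.transpose_fromRows, Matrix.fromRows_mul, Matrix.fromRows_mul_fromCols]
    simp
  have := hQ.mul_mul_conjTranspose_same
    (Matrix.fromRows (1 : Matrix (Fin l) (Fin l) ℝ) (0 : Matrix (Fin l) (Fin l) ℝ))
  rw [Matrix.conjTranspose_eq_transpose_of_trivial] at this
  rw [h1]; exact this

/-- The coupled equations with a general matrix function `F` in the role of the Fisher matrix. -/
def odeField (hK : K.IsHermitian) (h : Mat2 l → ℝ) (F : Mat2 l → Matrix (Fin l) (Fin l) ℝ) (γ : ℝ)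
    (B : Fin d → Mat2 l) (i : Fin d) : Mat2 l :=
  lyap (hK.eigenvalues i * γ) (hK.eigenvalues i * γ ^ 2) (driftH h (avgB hK B)) (B i)
    (F (avgB hK B))

theorem norm_odeField_sub_le (hK : K.IsHermitian) {F : Mat2 l → Matrix (Fin l) (Fin l) ℝ} {γ m R : ℝ}
    (hm : 0 ≤ m) (hR : 0 ≤ R) {B B' : Fin d → Mat2 l} (hB' : ‖B'‖ ≤ R)
    (hbd : ‖driftH h (avgB hK B)‖ ≤ m)
    (hH : ‖driftH h (avgB hK B) - driftH h (avgB hK B')‖ ≤ m * ‖avgB hK B - avgB hK B'‖)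
    (hF : ‖F (avgB hK B) - F (avgB hK B')‖ ≤ m * ‖avgB hK B - avgB hK B'‖) :
    ‖odeField hK h F γ B - odeField hK h F γ B'‖
      ≤ (4 * eigSum hK γ * (m + R * (m * eigMean hK)) + eigSum hK γ * (m * eigMean hK))
        * ‖B - B'‖ := by
  have he0 := eigMean_nonneg hK
  have hs0 := eigSum_nonneg hK γ
  have hsub : ‖avgB hK B - avgB hK B'‖ ≤ eigMean hK * ‖B - B'‖ := by
    rw [avgB_sub]; exact norm_avgB_le hK _
  refine (pi_norm_le_iff_of_nonneg (by positivity)).2 fun i => ?_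
  rw [Pi.sub_apply]
  refine norm_lyap_sub_le.trans ?_
  have c1 := (coeff_le_eigSum hK γ i).1
  have c2 := (coeff_le_eigSum hK γ i).2
  have n1 : ‖B i - B' i‖ ≤ ‖B - B'‖ := norm_le_pi_norm (B - B') i
  have n2 : ‖B' i‖ ≤ R := (norm_le_pi_norm B' i).trans hB'
  have n3 := hH.trans (mul_le_mul_of_nonneg_left hsub hm)
  have n4 := hF.trans (mul_le_mul_of_nonneg_left hsub hm)
  calc _ ≤ 4 * eigSum hK γ * (m * ‖B - B'‖ + R * (m * (eigMean hK * ‖B - B'‖)))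
        + eigSum hK γ * (m * (eigMean hK * ‖B - B'‖)) := by gcongr
    _ = _ := by ring

/-- The three terms are the initial distance, `s` times the difference of the fields, and the
second-order term that completes the Euler step from `P` to a congruence. -/
theorem norm_euler_sub_le {c c' S s m R δ q : ℝ} {B P H : Mat2 l} {Q Q' : Matrix (Fin l) (Fin l) ℝ}
    (hs : 0 ≤ s) (hc : |c| ≤ S) (hc' : |c'| ≤ S) (hH : ‖H‖ ≤ m) (hP : ‖P‖ ≤ R)
    (hBP : ‖B - P‖ ≤ δ) (hQ : ‖Q - Q'‖ ≤ q) :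
    ‖B + s • lyap c c' H B Q
        - (P + s • lyap c c' H P Q' + (4 * c ^ 2 * s ^ 2) • (H.transpose * P * H))‖
      ≤ δ + s * (4 * S * (m * δ) + S * q) + 4 * S ^ 2 * s ^ 2 * (m * R * m) := by
  have hm : 0 ≤ m := (norm_nonneg _).trans hH
  have hR : 0 ≤ R := (norm_nonneg _).trans hP
  have hS : 0 ≤ S := (abs_nonneg _).trans hc
  have e1 : B + s • lyap c c' H B Q
        - (P + s • lyap c c' H P Q' + (4 * c ^ 2 * s ^ 2) • (H.transpose * P * H))
      = (B - P) + s • (lyap c c' H B Q - lyap c c' H P Q')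
        - (4 * c ^ 2 * s ^ 2) • (H.transpose * P * H) := by
    rw [smul_sub]; abel
  have k5 : ‖lyap c c' H B Q - lyap c c' H P Q'‖ ≤ 4 * S * (m * δ) + S * q := by
    refine norm_lyap_sub_le.trans ?_
    rw [sub_self, norm_zero, mul_zero, add_zero]
    gcongr
  have k6 : ‖H.transpose * P * H‖ ≤ m * R * m := by
    refine (Matrix.frobenius_norm_mul _ _).trans ?_
    have h1 := Matrix.frobenius_norm_mul H.transpose P
    rw [Matrix.frobenius_norm_transpose] at h1
    exact mul_le_mul (h1.trans (mul_le_mul hH hP (norm_nonneg _) hm)) hH (norm_nonneg _)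
      (by positivity)
  have k7 : c ^ 2 ≤ S ^ 2 := by
    rw [← sq_abs]; exact pow_le_pow_left₀ (abs_nonneg _) hc 2
  rw [e1]
  refine (norm_sub_le _ _).trans (add_le_add ((norm_add_le _ _).trans (add_le_add hBP ?_)) ?_)
  · rw [norm_smul, Real.norm_eq_abs, abs_of_nonneg hs]
    gcongr
  · rw [norm_smul, Real.norm_eq_abs, abs_of_nonneg (by positivity : 0 ≤ 4 * c ^ 2 * s ^ 2)]
    gcongr

/-- By `add_smul_lyap_eq` this matrix is a congruence of `P` plus a nonnegative multiple of the
source. -/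
theorem euler_posSemidef {c c' s : ℝ} (hs : 0 ≤ s) (hc' : 0 ≤ c') {P H : Mat2 l}
    {Q : Matrix (Fin l) (Fin l) ℝ} (hP : P.PosSemidef) (hQ : Q.PosSemidef) :
    (P + s • lyap c c' H P Q + (4 * c ^ 2 * s ^ 2) • (H.transpose * P * H)).PosSemidef := by
  rw [← add_smul_lyap_eq]
  refine Matrix.PosSemidef.add ?_ ((fromBlocks_posSemidef hQ).smul (mul_nonneg hs hc'))
  have := hP.conjTranspose_mul_mul_same (1 - (2 * c * s) • H)
  rwa [Matrix.conjTranspose_eq_transpose_of_trivial] at this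

theorem infDist_odeField_le (hK : K.PosSemidef) {F : Mat2 l → Matrix (Fin l) (Fin l) ℝ} {γ m R : ℝ}
    (hm : 0 ≤ m) {B P : Fin d → Mat2 l} (hP : ∀ i, (P i).PosSemidef) (hPR : ‖P‖ ≤ R)
    (hFP : (F (avgB hK.isHermitian P)).PosSemidef)
    (hbd : ‖driftH h (avgB hK.isHermitian B)‖ ≤ m)
    (hF : ‖F (avgB hK.isHermitian B) - F (avgB hK.isHermitian P)‖
      ≤ m * ‖avgB hK.isHermitian B - avgB hK.isHermitian P‖) {s : ℝ} (hs : 0 ≤ s) :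
    Metric.infDist (B + s • odeField hK.isHermitian h F γ B)
        {B : Fin d → Mat2 l | ∀ i, (B i).PosSemidef}
      ≤ (1 + (4 * eigSum hK.isHermitian γ * m
          + eigSum hK.isHermitian γ * (m * eigMean hK.isHermitian)) * s) * ‖B - P‖
        + 4 * eigSum hK.isHermitian γ ^ 2 * m ^ 2 * R * s ^ 2 := by
  have hH := hK.isHermitian
  have he0 := eigMean_nonneg hH
  have hs0 := eigSum_nonneg hH γ
  have hR : 0 ≤ R := (norm_nonneg P).trans hPR
  have hsub : ‖avgB hH B - avgB hH P‖ ≤ eigMean hH * ‖B - P‖ := by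
    rw [avgB_sub]; exact norm_avgB_le hH _
  have n4 := hF.trans (mul_le_mul_of_nonneg_left hsub hm)
  -- The comparison point in the cone is a corrected Euler step from `P`. The drift matrix is taken
  -- at `B`, since positivity holds for any drift; the source is taken at `P`, where it is known to
  -- be positive semidefinite.
  obtain ⟨P', hP'⟩ : ∃ P' : Fin d → Mat2 l, ∀ i, P' i = P i
      + s • lyap (hH.eigenvalues i * γ) (hH.eigenvalues i * γ ^ 2) (driftH h (avgB hH B)) (P i)
        (F (avgB hH P))
      + (4 * (hH.eigenvalues i * γ) ^ 2 * s ^ 2) •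
        ((driftH h (avgB hH B)).transpose * P i * driftH h (avgB hH B)) := ⟨_, fun _ => rfl⟩
  have hP'psd : P' ∈ {B : Fin d → Mat2 l | ∀ i, (B i).PosSemidef} := fun i => by
    rw [hP']
    exact euler_posSemidef hs (mul_nonneg (hK.eigenvalues_nonneg i) (sq_nonneg γ)) (hP i) hFP
  refine (Metric.infDist_le_dist_of_mem hP'psd).trans ?_
  rw [dist_eq_norm]
  refine (pi_norm_le_iff_of_nonneg (by positivity)).2 fun i => ?_
  rw [Pi.sub_apply, Pi.add_apply, Pi.smul_apply, hP', odeField]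
  refine (norm_euler_sub_le hs (coeff_le_eigSum hH γ i).1 (coeff_le_eigSum hH γ i).2 hbd
    ((norm_le_pi_norm P i).trans hPR) (norm_le_pi_norm (B - P) i) n4).trans (le_of_eq ?_)
  ring

/-- Picard-Lindelöf needs a field on a full neighbourhood, while the Fisher matrix is Lipschitz on
positive semidefinite matrices only. Away from these the extension has no meaning, and none is
needed, since the solution never goes there. -/
theorem exists_fisher_extension (hα : 0 ≤ α) (hh : RiskRepresentation α Lh U f h)
    (hI : FisherPseudoLipschitz α LI U f) (R : ℝ) :
    ∃ m : ℝ, 0 ≤ m ∧ ∃ F : Mat2 l → Matrix (Fin l) (Fin l) ℝ,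
      (∀ A A', ‖F A - F A'‖ ≤ m * ‖A - A'‖) ∧ ∀ A ∈ psdPart U, ‖A‖ ≤ R → F A = fisher f A := by
  obtain ⟨m, hm, hbd, hlip⟩ := exists_coeff_bounds hα hh hI R
  have hLI : LipschitzOnWith (Real.toNNReal m) (fisher f) {A | A ∈ psdPart U ∧ ‖A‖ ≤ R} :=
    LipschitzOnWith.of_dist_le_mul fun A hA A' hA' => by
      rw [dist_eq_norm, dist_eq_norm, Real.coe_toNNReal _ hm]
      exact (hlip A hA.1 A' hA'.1 hA.2 hA'.2).2
  obtain ⟨F, hF, hFeq⟩ := hLI.extend_finite_dimension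
  refine ⟨((lipschitzExtensionConstant (Matrix (Fin l) (Fin l) ℝ) * m.toNNReal : NNReal) : ℝ),
    NNReal.coe_nonneg _, F, fun A A' => ?_, fun A hA hAR => (hFeq ⟨hA, hAR⟩).symm⟩
  have := hF.dist_le_mul A A'
  rw [dist_eq_norm, dist_eq_norm] at this
  exact this

/-- In contrast to the Fisher matrix, `∇h` is Lipschitz on bounded parts of all of `U`, so the drift
needs no extension. -/
theorem exists_driftH_bounds (hα : 0 ≤ α) (hh : RiskRepresentation α Lh U f h) (R : ℝ) :
    ∃ m : ℝ, 0 ≤ m ∧ ∀ A ∈ U, ∀ A' ∈ U, ‖A‖ ≤ R → ‖A'‖ ≤ R →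
      ‖driftH h A - driftH h A'‖ ≤ m * ‖A - A'‖ := by
  rcases lt_or_ge R 0 with hR | hR
  · exact ⟨0, le_rfl, fun A _ _ _ hA => absurd (hA.trans_lt hR) (norm_nonneg A).not_gt⟩
  refine ⟨|Lh| * (1 + R ^ α + R ^ α) * ‖projFst l‖, by positivity, ?_⟩
  intro A hA A' hA' n n'
  rw [driftH_eq, driftH_eq, ← Matrix.sub_mul]
  refine (Matrix.frobenius_norm_mul _ _).trans ?_
  have e1 := Real.rpow_le_rpow (norm_nonneg A) n hα
  have e2 := Real.rpow_le_rpow (norm_nonneg A') n' hα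
  have e3 := hh.grad_lipschitz A hA A' hA'
  have e4 : Lh * ‖A - A'‖ * (1 + ‖A‖ ^ α + ‖A'‖ ^ α)
      ≤ |Lh| * (1 + R ^ α + R ^ α) * ‖A - A'‖ := by
    calc _ ≤ |Lh| * ‖A - A'‖ * (1 + ‖A‖ ^ α + ‖A'‖ ^ α) := by gcongr; exact le_abs_self _
      _ ≤ |Lh| * ‖A - A'‖ * (1 + R ^ α + R ^ α) := by gcongr
      _ = _ := by ring
  have e5 := mul_le_mul_of_nonneg_right (e3.trans e4) (norm_nonneg (projFst l))
  linarith

theorem locSolvable_odeRHS (hα : 0 ≤ α) (hfm : Measurable (Function.uncurry f))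
    (hf : PseudoLipschitz α L f) (hd : ∀ y e, ContDiff ℝ 1 (slice f y e))
    (hh : RiskRepresentation α Lh U f h)
    (hI : FisherPseudoLipschitz α LI U f) (hK : K.PosSemidef) (γ : ℝ) :
    LocSolvable (odeDomain hK.isHermitian U) (odeRHS hK.isHermitian f h γ) := by
  intro x hx
  have hH := hK.isHermitian
  have he0 : 0 ≤ eigMean hH := eigMean_nonneg hH
  have hs0 : 0 ≤ eigSum hH γ := eigSum_nonneg hH γ
  obtain ⟨ρ', hρ', hball⟩ : ∃ ρ' > 0, ∀ B, ‖B - x‖ < ρ' → avgB hH B ∈ U := by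
    have := (continuous_avgB hH (l := l)).continuousAt.preimage_mem_nhds
      (hh.isOpen.mem_nhds hx.2)
    obtain ⟨r, hr, hsub⟩ := Metric.mem_nhds_iff.1 this
    exact ⟨r, hr, fun B hB => hsub (by rwa [Metric.mem_ball, dist_eq_norm])⟩
  -- All points used lie within `2 ρ` of `x`. By the choice of `ρ`, their averages are in `U` and
  -- their norms at most `‖x‖ + 2`.
  obtain ⟨ρ, hρ, hρ4, hρ1⟩ : ∃ ρ : ℝ, 0 < ρ ∧ 4 * ρ ≤ ρ' ∧ ρ ≤ 1 :=
    ⟨min (ρ' / 4) 1, lt_min (by positivity) one_pos,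
      by have := min_le_left (ρ' / 4) 1; linarith, min_le_right _ _⟩
  obtain ⟨R, hR⟩ : ∃ R, R = ‖x‖ + 2 := ⟨_, rfl⟩
  have hR0 : 0 ≤ R := by rw [hR]; positivity
  obtain ⟨mF, hmF, F, hF, hFeq⟩ := exists_fisher_extension hα hh hI (eigMean hH * R)
  obtain ⟨mG, hmG, hG⟩ := exists_driftH_bounds hα hh (eigMean hH * R)
  have hnear : ∀ B : Fin d → Mat2 l, ‖B - x‖ ≤ 2 * ρ →
      ‖B‖ ≤ R ∧ ‖avgB hH B‖ ≤ eigMean hH * R ∧ avgB hH B ∈ U := by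
    intro B hB
    have h1 := norm_add_le (B - x) x
    rw [sub_add_cancel] at h1
    have h2 : ‖B‖ ≤ R := by rw [hR]; linarith
    exact ⟨h2, (norm_avgB_le hH B).trans (mul_le_mul_of_nonneg_left h2 he0),
      hball B (by linarith)⟩
  obtain ⟨m, hm, hmF', hmG', hbd⟩ : ∃ m, 0 ≤ m ∧ mF ≤ m ∧ mG ≤ m ∧
      ∀ B : Fin d → Mat2 l, ‖B - x‖ ≤ 2 * ρ → ‖driftH h (avgB hH B)‖ ≤ m := by
    have hp : 0 ≤ mG * (eigMean hH * (2 * ρ)) := by positivity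
    have hn := norm_nonneg (driftH h (avgB hH x))
    refine ⟨mF + mG + (‖driftH h (avgB hH x)‖ + mG * (eigMean hH * (2 * ρ))), by linarith,
      by linarith, by linarith, fun B hB => ?_⟩
    obtain ⟨_, n2, n3⟩ := hnear B hB
    obtain ⟨_, n2', n3'⟩ := hnear x (by rw [sub_self, norm_zero]; positivity)
    have h1 := hG _ n3 _ n3' n2 n2'
    have h2 : ‖avgB hH B - avgB hH x‖ ≤ eigMean hH * (2 * ρ) := by
      rw [avgB_sub]; exact (norm_avgB_le hH _).trans (mul_le_mul_of_nonneg_left hB he0)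
    have h3 := mul_le_mul_of_nonneg_left h2 hmG
    have h4 := norm_sub_norm_le (driftH h (avgB hH B)) (driftH h (avgB hH x))
    linarith
  have hFm : ∀ A A', ‖F A - F A'‖ ≤ m * ‖A - A'‖ := fun A A' =>
    (hF A A').trans (mul_le_mul_of_nonneg_right hmF' (norm_nonneg _))
  refine exists_flowsOn_of_extension (w := odeField hH h F γ)
    (k := 4 * eigSum hH γ * (m + R * (m * eigMean hH)) + eigSum hH γ * (m * eigMean hH))
    (k' := 4 * eigSum hH γ * m + eigSum hH γ * (m * eigMean hH))
    (m := 4 * eigSum hH γ ^ 2 * m ^ 2 * R) hρ (by positivity) (by positivity)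
    isClosed_forall_posSemidef hx.1 (fun B B' hB hB' => ?_) (fun B hB hBx => ?_)
    (fun B hB P hP hPx s hs => ?_)
  · obtain ⟨_, n2, n3⟩ := hnear B (by linarith)
    obtain ⟨n1', n2', n3'⟩ := hnear B' (by linarith)
    exact norm_odeField_sub_le hH hm hR0 n1' (hbd B (by linarith))
      ((hG _ n3 _ n3' n2 n2').trans (mul_le_mul_of_nonneg_right hmG' (norm_nonneg _))) (hFm _ _)
  · obtain ⟨_, n2, n3⟩ := hnear B (by linarith)
    refine ⟨⟨hB, n3⟩, ?_⟩
    ext1 i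
    rw [odeRHS_eq_lyap, odeField, hFeq _ ⟨n3, avgB_posSemidef hK hB⟩ n2]
  · obtain ⟨nP, nA, hAU⟩ := hnear P hPx
    refine infDist_odeField_le hK hm hP nP ?_ (hbd B (by linarith)) (hFm _ _) hs.1.le
    rw [hFeq _ ⟨hAU, avgB_posSemidef hK hP⟩ nA]
    exact fisher_posSemidef hα hfm hf hd _

end Ode


/-! ### Traces and norms of positive semidefinite matrices -/

section Psd

variable {l : ℕ}

theorem norm_sq_eq_sum {m n : Type*} [Fintype m] [Fintype n] (A : Matrix m n ℝ) :
    ‖A‖ ^ 2 = ∑ i, ∑ j, A i j ^ 2 := by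
  rw [Matrix.frobenius_norm_def, ← Real.sqrt_eq_rpow, Real.sq_sqrt (by positivity)]
  simp

open scoped MatrixOrder in
theorem exists_eq_transpose_mul_self {n : Type*} [Fintype n] [DecidableEq n] {B : Matrix n n ℝ}
    (hB : B.PosSemidef) : ∃ A : Matrix n n ℝ, B = A.transpose * A := by
  obtain ⟨A, rfl⟩ := CStarAlgebra.nonneg_iff_eq_star_mul_self.mp hB.nonneg
  exact ⟨A, rfl⟩

/-- With `B = AᵀA` one has `‖B‖ ≤ ‖A‖² = tr B`. -/
theorem norm_le_trace {n : Type*} [Fintype n] [DecidableEq n] {B : Matrix n n ℝ}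
    (hB : B.PosSemidef) : ‖B‖ ≤ B.trace := by
  obtain ⟨A, rfl⟩ := exists_eq_transpose_mul_self hB
  refine (Matrix.frobenius_norm_mul _ _).trans (le_of_eq ?_)
  rw [Matrix.frobenius_norm_transpose, ← sq, Matrix.trace, norm_sq_eq_sum, Finset.sum_comm]
  simp [Matrix.mul_apply, sq]

/-- The quadratic form of `B` is evaluated at `e_p ⊕ (-s e_p)` and summed over `p`. -/
theorem trace_add_quadratic_nonneg {B : Mat2 l} (hB : B.PosSemidef) (s : ℝ) :
    0 ≤ B.toBlocks₁₁.trace - (2 * s) * B.toBlocks₁₂.trace + s ^ 2 * B.toBlocks₂₂.trace := by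
  have hT := posSemidef_transpose hB
  have key : ∀ p : Fin l, 0 ≤ B (Sum.inl p) (Sum.inl p) - (2 * s) * B (Sum.inl p) (Sum.inr p)
      + s ^ 2 * B (Sum.inr p) (Sum.inr p) := by
    intro p
    have h1 := hB.dotProduct_mulVec_nonneg
      (Pi.single (Sum.inl p) 1 - s • Pi.single (Sum.inr p) 1 : Fin l ⊕ Fin l → ℝ)
    have h2 : B (Sum.inr p) (Sum.inl p) = B (Sum.inl p) (Sum.inr p) :=
      congrFun (congrFun hT (Sum.inl p)) (Sum.inr p)
    simp only [star_trivial, Matrix.mulVec_sub, Matrix.mulVec_smul, sub_dotProduct, smul_dotProduct,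
      dotProduct_sub, dotProduct_smul, Matrix.mulVec_single_one, single_dotProduct, one_mul,
      Matrix.col_apply, smul_eq_mul, h2] at h1
    linarith
  have := Finset.sum_nonneg fun p (_ : p ∈ Finset.univ) => key p
  simp only [Finset.sum_add_distrib, Finset.sum_sub_distrib, ← Finset.mul_sum] at this
  exact this

theorem trace_mul_diffForm_eq {B : Mat2 l} (hB : B.transpose = B) :
    (B * diffForm l).trace
      = B.toBlocks₁₁.trace - 2 * B.toBlocks₁₂.trace + B.toBlocks₂₂.trace := by
  rw [trace_mul_diffForm hB, Matrix.trace_add, Matrix.trace_sub, Matrix.trace_smul, smul_eq_mul]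

theorem trace_mul_diffForm_nonneg {B : Mat2 l} (hB : B.PosSemidef) :
    0 ≤ (B * diffForm l).trace := by
  rw [trace_mul_diffForm_eq (posSemidef_transpose hB)]
  have := trace_add_quadratic_nonneg hB 1
  linarith

/-- This is `‖x‖² ≤ 2 ‖x - y‖² + 2 ‖y‖²` at the level of covariances, and amounts to the case `s =
2` of `trace_add_quadratic_nonneg`. -/
theorem trace_le_diffForm {B : Mat2 l} (hB : B.PosSemidef) :
    B.trace ≤ 2 * (B * diffForm l).trace + 3 * B.toBlocks₂₂.trace := by
  rw [trace_mul_diffForm_eq (posSemidef_transpose hB)]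
  have h1 := trace_add_quadratic_nonneg hB 2
  have h2 : B.trace = B.toBlocks₁₁.trace + B.toBlocks₂₂.trace := by
    conv_lhs => rw [← Matrix.fromBlocks_toBlocks B]
    rw [trace_fromBlocks]
  linarith

end Psd

/-! ### Moments of a state of the coupled equations -/

section Moments

variable {d l : ℕ} {f : Vec2 l → Vec l → ℝ} {h : Mat2 l → ℝ} {U : Set (Mat2 l)} {α L Lh LI : ℝ}
  {K : Matrix (Fin d) (Fin d) ℝ}

/-- The moment `(1/d) ∑ λᵢᵐ 𝓑ᵢ`. -/
def momB (hK : K.IsHermitian) (m : ℕ) (B : Fin d → Mat2 l) : Mat2 l :=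
  (1 / (d : ℝ)) • ∑ i, hK.eigenvalues i ^ m • B i

/-- The matrix `Wᵀ Kᵐ W` for `W = X ⊕ X⋆`. -/
def powB (K : Matrix (Fin d) (Fin d) ℝ) (m : ℕ) (X Xs : Matrix (Fin d) (Fin l) ℝ) : Mat2 l :=
  (Matrix.fromCols X Xs).transpose * K ^ m * Matrix.fromCols X Xs

theorem avgB_eq_momB (hK : K.IsHermitian) (B : Fin d → Mat2 l) : avgB hK B = momB hK 1 B := by
  simp [avgB, momB]

theorem covB_eq_powB (X Xs : Matrix (Fin d) (Fin l) ℝ) : covB K X Xs = powB K 1 X Xs := by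
  rw [covB, powB, pow_one]

theorem momB_odeInit (hd : 0 < d) (hK : K.IsHermitian) (m : ℕ) (X0 Xs : Matrix (Fin d) (Fin l) ℝ) :
    momB hK m (odeInit hK X0 Xs) = powB K m X0 Xs := by
  have hd' : (d : ℝ) ≠ 0 := by positivity
  ext p q
  rw [powB, Matrix.mul_assoc, Matrix.mul_apply, momB]
  simp only [Matrix.mul_apply, pow_apply_eq_sum_eigen hK, odeInit, Matrix.smul_apply,
    Matrix.sum_apply, Matrix.vecMulVec_apply, smul_eq_mul, Matrix.mulVec, dotProduct,
    Matrix.transpose_apply]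
  rw [Finset.mul_sum]
  have e1 : ∀ i : Fin d, 1 / (d : ℝ) * (hK.eigenvalues i ^ m * ((d : ℝ) *
      ((∑ j, Matrix.fromCols X0 Xs j p * hK.eigenvectorBasis i j)
        * ∑ k, Matrix.fromCols X0 Xs k q * hK.eigenvectorBasis i k)))
      = ∑ j, ∑ k, Matrix.fromCols X0 Xs j p * (hK.eigenvalues i ^ m *
        (hK.eigenvectorBasis i j * hK.eigenvectorBasis i k) * Matrix.fromCols X0 Xs k q) := by
    intro i
    rw [Finset.sum_mul_sum, Finset.mul_sum, Finset.mul_sum, Finset.mul_sum]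
    refine Finset.sum_congr rfl fun j _ => ?_
    rw [Finset.mul_sum, Finset.mul_sum, Finset.mul_sum]
    refine Finset.sum_congr rfl fun k _ => ?_
    field_simp
  rw [Finset.sum_congr rfl fun i _ => e1 i, Finset.sum_comm]
  refine Finset.sum_congr rfl fun j _ => ?_
  rw [Finset.sum_comm, Finset.mul_sum]
  refine Finset.sum_congr rfl fun k _ => ?_
  rw [Finset.sum_mul, Finset.mul_sum]

theorem odeInit_posSemidef (hK : K.IsHermitian) (X0 Xs : Matrix (Fin d) (Fin l) ℝ) (i : Fin d) :
    (odeInit hK X0 Xs i).PosSemidef := by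
  have h1 := Matrix.posSemidef_vecMulVec_self_star
    ((Matrix.fromCols X0 Xs).transpose.mulVec (hK.eigenvectorBasis i).ofLp)
  rw [star_trivial] at h1
  exact h1.smul (Nat.cast_nonneg d)

theorem momB_posSemidef (hK : K.PosSemidef) (m : ℕ) {B : Fin d → Mat2 l}
    (hB : ∀ i, (B i).PosSemidef) : (momB hK.isHermitian m B).PosSemidef := by
  unfold momB
  refine Matrix.PosSemidef.smul (Matrix.posSemidef_sum _ fun i _ => ?_) (by positivity)
  exact (hB i).smul (pow_nonneg (hK.eigenvalues_nonneg i) m)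

theorem trace_momB_mul (hK : K.IsHermitian) (m : ℕ) (B : Fin d → Mat2 l) (N : Mat2 l) :
    (momB hK m B * N).trace = 1 / (d : ℝ) * ∑ i, hK.eigenvalues i ^ m * (B i * N).trace := by
  rw [momB, Matrix.smul_mul, Matrix.trace_smul, smul_eq_mul, Matrix.sum_mul, Matrix.trace_sum]
  simp [Matrix.trace_smul]

theorem distSq_eq_trace (hK : K.IsHermitian) {B : Fin d → Mat2 l} (hB : ∀ i, (B i).PosSemidef) :
    distSq B = (momB hK 0 B * diffForm l).trace := by
  rw [trace_momB_mul, distSq]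
  congr 1
  refine Finset.sum_congr rfl fun i _ => ?_
  rw [trace_mul_diffForm (posSemidef_transpose (hB i)), pow_zero, one_mul]

theorem trace_powB_zero_diffForm (X Xs : Matrix (Fin d) (Fin l) ℝ) :
    (powB K 0 X Xs * diffForm l).trace = ‖X - Xs‖ ^ 2 := by
  have e0 : powB K 0 X Xs = (Matrix.fromCols X Xs).transpose * Matrix.fromCols X Xs := by
    rw [powB, pow_zero, Matrix.mul_one]
  have hT : (powB K 0 X Xs).transpose = powB K 0 X Xs := by
    rw [e0, Matrix.transpose_mul, Matrix.transpose_transpose]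
  rw [trace_mul_diffForm_eq hT, e0, norm_sq_eq_sum, Finset.sum_comm]
  simp only [Matrix.trace, Matrix.diag_apply, Matrix.toBlocks₁₁, Matrix.toBlocks₁₂,
    Matrix.toBlocks₂₂, Matrix.of_apply, Matrix.mul_apply, Matrix.transpose_apply,
    Matrix.fromCols_apply_inl, Matrix.fromCols_apply_inr, Matrix.sub_apply]
  rw [Finset.mul_sum, ← Finset.sum_sub_distrib, ← Finset.sum_add_distrib]
  refine Finset.sum_congr rfl fun p _ => ?_
  rw [Finset.mul_sum, ← Finset.sum_sub_distrib, ← Finset.sum_add_distrib]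
  exact Finset.sum_congr rfl fun j _ => by ring

theorem trace_powB_zero_toBlocks₂₂ (X Xs : Matrix (Fin d) (Fin l) ℝ) :
    (powB K 0 X Xs).toBlocks₂₂.trace = ‖Xs‖ ^ 2 := by
  rw [powB, pow_zero, Matrix.mul_one, norm_sq_eq_sum, Finset.sum_comm]
  simp [Matrix.trace, Matrix.toBlocks₂₂, Matrix.mul_apply, sq]

/-- The second block column of `driftH` vanishes and the source sits in the upper left block. The
hidden parameter does not move, so the lower right blocks of all moments are conserved. -/
theorem lyap_toBlocks₂₂ (c c' : ℝ) (A B : Mat2 l) (Q : Matrix (Fin l) (Fin l) ℝ) (p q : Fin l) :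
    lyap c c' (driftH h A) B Q (Sum.inr p) (Sum.inr q) = 0 := by
  simp [lyap, driftH, Matrix.mul_apply, Fintype.sum_sum_type, Matrix.fromBlocks_transpose]

theorem trace_lyap_diffForm (c c' : ℝ) (H B : Mat2 l) (Q : Matrix (Fin l) (Fin l) ℝ) :
    (lyap c c' H B Q * diffForm l).trace
      = -2 * c * ((B * H + H.transpose * B) * diffForm l).trace + c' * Q.trace := by
  have h1 : ((Matrix.fromBlocks Q 0 0 0 : Mat2 l) * diffForm l).trace = Q.trace := by
    rw [diffForm, Matrix.fromBlocks_multiply, trace_fromBlocks]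
    simp
  rw [lyap, Matrix.add_mul, Matrix.trace_add, Matrix.smul_mul, Matrix.smul_mul, Matrix.trace_smul,
    Matrix.trace_smul, h1, smul_eq_mul, smul_eq_mul]

/-- The right-hand side of the `i`-th equation carries a factor `λᵢ`, so weighting by `λᵢᵐ` yields
the moment `m + 1`. The moments thus form a closed hierarchy, in which the `d` matrices no longer
appear separately; SGD obeys the same one on average. -/
theorem momB_odeRHS (hK : K.IsHermitian) (γ : ℝ) (m : ℕ) (B : Fin d → Mat2 l) :
    momB hK m (odeRHS hK f h γ B) = lyap γ (γ ^ 2 * (1 / (d : ℝ) * (K ^ (m + 1)).trace))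
      (driftH h (avgB hK B)) (momB hK (m + 1) B) (fisher f (avgB hK B)) := by
  rw [trace_pow_eq_sum_eigenvalues hK, lyap, momB, momB, Finset.mul_sum, Finset.mul_sum,
    Finset.sum_smul, Matrix.smul_mul, Matrix.mul_smul, Matrix.sum_mul, Matrix.mul_sum, ← smul_add,
    ← Finset.sum_add_distrib, Finset.smul_sum, Finset.smul_sum, Finset.smul_sum,
    ← Finset.sum_add_distrib]
  refine Finset.sum_congr rfl fun i _ => ?_
  rw [odeRHS, Matrix.smul_mul, Matrix.mul_smul, ← smul_add]
  simp only [smul_add, smul_smul]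
  ring_nf

theorem norm_momB_le (hK : K.PosSemidef) {κ : ℝ} (hκ : ∀ i, hK.isHermitian.eigenvalues i ≤ κ)
    (m : ℕ) {B : Fin d → Mat2 l} (hB : ∀ i, (B i).PosSemidef) :
    ‖momB hK.isHermitian m B‖ ≤ κ ^ m * (momB hK.isHermitian 0 B).trace := by
  refine (norm_le_trace (momB_posSemidef hK m hB)).trans ?_
  have e := trace_momB_mul hK.isHermitian m B 1
  have e0 := trace_momB_mul hK.isHermitian 0 B 1
  simp only [Matrix.mul_one, pow_zero, one_mul] at e e0
  rw [e, e0, mul_left_comm, Finset.mul_sum _ _ (κ ^ m)]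
  refine mul_le_mul_of_nonneg_left (Finset.sum_le_sum fun i _ => ?_)
    (one_div_nonneg.2 (Nat.cast_nonneg d))
  exact mul_le_mul_of_nonneg_right
    (pow_le_pow_left₀ (a := hK.isHermitian.eigenvalues i) (hK.eigenvalues_nonneg i) (hκ i) m)
    (hB i).trace_nonneg

/-! ### Solutions of the coupled equations -/

/-- The whole family is regarded as one point of a product space, to which the results on autonomous
equations apply. -/
theorem isSolution_iff_flowsOn {hK : K.IsHermitian} {γ : ℝ} {X0 Xs : Matrix (Fin d) (Fin l) ℝ}
    {S : EReal} {B : ℝ → Fin d → Mat2 l} :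
    IsSolution hK f h U γ X0 Xs S B
      ↔ FlowsOn (odeDomain hK U) (odeRHS hK f h γ) (odeInit hK X0 Xs) S B := by
  constructor
  · intro hB
    exact ⟨funext hB.init, fun t h0 ht => ⟨hB.psd t h0 ht, hB.mem t h0 ht⟩,
      fun t h0 ht => hasDerivWithinAt_pi.2 (hB.ode t h0 ht)⟩
  · intro hB
    exact ⟨fun i => congrFun hB.init i, fun t h0 ht => (hB.mem t h0 ht).1,
      fun t h0 ht => (hB.mem t h0 ht).2, fun t h0 ht => hasDerivWithinAt_pi.1 (hB.ode t h0 ht)⟩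

theorem odeInit_mem (hd : 0 < d) (hK : K.IsHermitian) {X0 Xs : Matrix (Fin d) (Fin l) ℝ}
    (hU : covB K X0 Xs ∈ U) : odeInit hK X0 Xs ∈ odeDomain hK U := by
  refine ⟨odeInit_posSemidef hK X0 Xs, ?_⟩
  rw [avgB_eq_momB, momB_odeInit hd, ← covB_eq_powB]
  exact hU

theorem exists_isMaximalSolution (hα : 0 ≤ α) (hfm : Measurable (Function.uncurry f))
    (hf : PseudoLipschitz α L f) (hs : ∀ y e, ContDiff ℝ 1 (slice f y e))
    (hh : RiskRepresentation α Lh U f h) (hI : FisherPseudoLipschitz α LI U f)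
    (hd : 0 < d) (hK : K.PosSemidef) (γ : ℝ) {X0 Xs : Matrix (Fin d) (Fin l) ℝ}
    (hU : covB K X0 Xs ∈ U) :
    ∃ (Θ : EReal) (B : ℝ → Fin d → Mat2 l), IsMaximalSolution hK.isHermitian f h U γ X0 Xs Θ B := by
  obtain ⟨Θ, u, hΘ, hu, hmax⟩ := exists_maximal_flow (locLip_odeRHS hα hh hI hK γ)
    (locSolvable_odeRHS hα hfm hf hs hh hI hK γ) (odeInit_mem hd hK.isHermitian hU)
  exact ⟨Θ, u, hΘ, isSolution_iff_flowsOn.2 hu, fun S B' hB' =>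
    hmax S B' (isSolution_iff_flowsOn.1 hB')⟩

theorem IsSolution.hasDerivWithinAt_momB {hK : K.IsHermitian} {γ : ℝ}
    {X0 Xs : Matrix (Fin d) (Fin l) ℝ} {S : EReal} {B : ℝ → Fin d → Mat2 l}
    (hB : IsSolution hK f h U γ X0 Xs S B) (m : ℕ) {t : ℝ} (h0 : 0 ≤ t) (ht : (t : EReal) < S) :
    HasDerivWithinAt (fun s => momB hK m (B s))
      (lyap γ (γ ^ 2 * (1 / (d : ℝ) * (K ^ (m + 1)).trace))
        (driftH h (momB hK 1 (B t))) (momB hK (m + 1) (B t)) (fisher f (momB hK 1 (B t))))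
      (Set.Ici 0) t := by
  have h1 : HasDerivWithinAt (fun s => momB hK m (B s)) (momB hK m (odeRHS hK f h γ (B t)))
      (Set.Ici 0) t := by
    unfold momB
    exact (HasDerivWithinAt.fun_sum (u := Finset.univ) fun i _ =>
      (hB.ode t h0 ht i).const_smul (hK.eigenvalues i ^ m)).const_smul (1 / (d : ℝ))
  rw [momB_odeRHS, avgB_eq_momB] at h1
  exact h1

theorem hasDerivWithinAt_matrix_apply {m n : Type*} [Fintype m] [Fintype n]
    {F : ℝ → Matrix m n ℝ} {F' : Matrix m n ℝ} {s : Set ℝ} {t : ℝ}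
    (hF : HasDerivWithinAt F F' s t) (i : m) (j : n) :
    HasDerivWithinAt (fun s => F s i j) (F' i j) s t := by
  let ev : Matrix m n ℝ →ₗ[ℝ] ℝ := Matrix.entryLinearMap ℝ ℝ i j
  exact (LinearMap.toContinuousLinearMap ev).hasFDerivAt.comp_hasDerivWithinAt t hF

theorem IsSolution.momB_toBlocks₂₂ {hK : K.IsHermitian} {γ : ℝ} (hd : 0 < d)
    {X0 Xs : Matrix (Fin d) (Fin l) ℝ} {S : EReal} {B : ℝ → Fin d → Mat2 l}
    (hB : IsSolution hK f h U γ X0 Xs S B) (m : ℕ) {t : ℝ} (h0 : 0 ≤ t) (ht : (t : EReal) < S) :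
    (momB hK m (B t)).toBlocks₂₂ = (powB K m X0 Xs).toBlocks₂₂ := by
  have hlt : ∀ s ∈ Set.Icc 0 t, (s : EReal) < S := fun s hs =>
    lt_of_le_of_lt (EReal.coe_le_coe_iff.2 hs.2) ht
  ext p q
  have hder : ∀ s ∈ Set.Icc 0 t, HasDerivWithinAt
      (fun s => momB hK m (B s) (Sum.inr p) (Sum.inr q)) 0 (Set.Ici 0) s := fun s hs => by
    have := hasDerivWithinAt_matrix_apply (hB.hasDerivWithinAt_momB m hs.1 (hlt s hs))
      (Sum.inr p) (Sum.inr q)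
    rwa [lyap_toBlocks₂₂] at this
  have h1 := constant_of_has_deriv_right_zero (a := 0) (b := t)
    (f := fun s => momB hK m (B s) (Sum.inr p) (Sum.inr q))
    (fun s hs => (hder s hs).continuousWithinAt.mono Set.Icc_subset_Ici_self)
    (fun s hs => (hder s ⟨hs.1, hs.2.le⟩).mono (Set.Ici_subset_Ici.2 hs.1)) t
    (Set.right_mem_Icc.2 h0)
  have h2 : B 0 = odeInit hK X0 Xs := funext hB.init
  rw [h2, momB_odeInit hd] at h1
  exact h1

theorem toBlocks₂₂_covB_eq (X X' Xs : Matrix (Fin d) (Fin l) ℝ) :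
    (covB K X Xs).toBlocks₂₂ = (covB K X' Xs).toBlocks₂₂ := by
  ext p q
  simp [covB, Matrix.toBlocks₂₂, Matrix.mul_apply]

theorem lamMin_le (hK : K.IsHermitian) (i : Fin d) : lamMin hK ≤ hK.eigenvalues i :=
  ciInf_le (Set.finite_range _).bddBelow i

theorem lamMin_nonneg (hK : K.PosSemidef) : 0 ≤ lamMin hK.isHermitian :=
  Real.iInf_nonneg fun i => hK.eigenvalues_nonneg i

theorem stepSize_mul (hd : 0 < d) (hK : K.PosDef) {μ L : ℝ} (hL : 0 < L) (ζ : ℝ) :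
    stepSize μ L ζ K * (L ^ 2 * (1 / (d : ℝ) * K.trace)) = 2 * μ * ζ := by
  have : Nonempty (Fin d) := ⟨⟨0, hd⟩⟩
  have h1 : 0 < K.trace := hK.trace_pos
  have h2 : (0 : ℝ) < d := by positivity
  rw [stepSize]
  field_simp

theorem stepSize_nonneg (hK : K.PosSemidef) {μ L ζ : ℝ} (hμ : 0 ≤ μ) (hζ : 0 ≤ ζ) :
    0 ≤ stepSize μ L ζ K := by
  have h1 : 0 ≤ K.trace := hK.trace_nonneg
  rw [stepSize]
  positivity

theorem le_exp_mul_of_deriv_le {φ φ' : ℝ → ℝ} {b t : ℝ} (h0 : 0 ≤ t)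
    (hφ : ∀ s ∈ Set.Icc 0 t, HasDerivWithinAt φ (φ' s) (Set.Ici 0) s)
    (hle : ∀ s ∈ Set.Icc 0 t, φ' s ≤ -b * φ s) : φ t ≤ Real.exp (-b * t) * φ 0 := by
  have hexp : ∀ s, HasDerivAt (fun s => Real.exp (b * s)) (Real.exp (b * s) * b) s := fun s => by
    have := ((hasDerivAt_id s).const_mul b).exp
    simpa using this
  have hanti : AntitoneOn (fun s => Real.exp (b * s) * φ s) (Set.Icc 0 t) := by
    refine antitoneOn_of_hasDerivWithinAt_nonpos (convex_Icc 0 t)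
      (f' := fun s => Real.exp (b * s) * b * φ s + Real.exp (b * s) * φ' s) ?_ ?_ ?_
    · intro s hs
      exact ((hexp s).continuousAt.continuousWithinAt).mul
        ((hφ s hs).continuousWithinAt.mono Set.Icc_subset_Ici_self)
    · intro s hs
      have hs' := interior_subset hs
      exact ((hexp s).hasDerivWithinAt.mul ((hφ s hs').mono
        (interior_subset.trans Set.Icc_subset_Ici_self)))
    · intro s hs
      have := mul_le_mul_of_nonneg_left (hle s (interior_subset hs)) (Real.exp_pos (b * s)).le
      linarith
  have h1 := hanti (Set.left_mem_Icc.2 h0) (Set.right_mem_Icc.2 h0) h0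
  simp only [mul_zero, Real.exp_zero, one_mul] at h1
  have h2 := mul_le_mul_of_nonneg_left h1 (Real.exp_pos (-b * t)).le
  rwa [← mul_assoc, ← Real.exp_add, neg_mul, neg_add_cancel, Real.exp_zero, one_mul,
    ← neg_mul] at h2

/-- `𝓓²` is the trace of `M_0` against `diffForm`, so its derivative involves `M_1` only.
`energy_bounds` is applied to `M_1`, whose conserved lower right block gives minimality, and
`lamMin` leads back to `M_0`. -/
theorem IsSolution.distSq_le (hα : 0 ≤ α) (hfm : Measurable (Function.uncurry f))
    (hfi : Integrable (fun e => f 0 e) (stdGaussian (Vec l)))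
    (hf : PseudoLipschitz α L f) (hh : RiskRepresentation α Lh U f h)
    {Lhat μhat ζ : ℝ} (hL : 0 < Lhat) (hμ : 0 < μhat) (hζ0 : 0 < ζ) (hζ1 : ζ < 1)
    (hsmooth : ∀ y e : Vec l, IsLSmooth Lhat (slice f y e))
    (hrsi : ∀ y e : Vec l, RSI μhat (slice f y e))
    (hd : 0 < d) (hK : K.PosDef) {X0 Xs : Matrix (Fin d) (Fin l) ℝ}
    (hmin : ∀ᵐ z ∂(dataLaw l K), ∀ x : Vec l,
      slice f (contract Xs z.1) z.2 (contract Xs z.1) ≤ slice f (contract Xs z.1) z.2 x)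
    {S : EReal} {B : ℝ → Fin d → Mat2 l}
    (hB : IsSolution hK.isHermitian f h U (stepSize μhat Lhat ζ K) X0 Xs S B)
    {t : ℝ} (h0 : 0 ≤ t) (ht : (t : EReal) < S) :
    distSq (B t) ≤ Real.exp (-(stepSize μhat Lhat ζ K * (1 - ζ) * μhat * lamMin hK.isHermitian) * t)
      * distSq (B 0) := by
  have hKp := hK.posSemidef
  have hH := hK.isHermitian
  have hlt : ∀ s ∈ Set.Icc 0 t, (s : EReal) < S := fun s hs =>
    lt_of_le_of_lt (EReal.coe_le_coe_iff.2 hs.2) ht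
  have hγ0 : 0 ≤ stepSize μhat Lhat ζ K := stepSize_nonneg hKp hμ.le hζ0.le
  have hγe := stepSize_mul hd hK (μ := μhat) hL ζ
  obtain ⟨γ, hγ⟩ : ∃ γ, γ = stepSize μhat Lhat ζ K := ⟨_, rfl⟩
  rw [← hγ] at hB hγ0 hγe ⊢
  have hlam := lamMin_nonneg hKp
  have hpsd : ∀ s ∈ Set.Icc 0 t, ∀ i, (B s i).PosSemidef := fun s hs => hB.psd s hs.1 (hlt s hs)
  have hdist : ∀ s ∈ Set.Icc 0 t, distSq (B s) = (momB hH 0 (B s) * diffForm l).trace :=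
    fun s hs => distSq_eq_trace hH (hpsd s hs)
  let J : Mat2 l →ₗ[ℝ] ℝ := (Matrix.traceLinearMap (Fin l ⊕ Fin l) ℝ ℝ).comp
    (LinearMap.mulRight ℝ (diffForm l))
  have hder : ∀ s ∈ Set.Icc 0 t, HasDerivWithinAt
      (fun s => (momB hH 0 (B s) * diffForm l).trace)
      ((lyap γ (γ ^ 2 * (1 / (d : ℝ) * (K ^ (0 + 1)).trace))
        (driftH h (momB hH 1 (B s))) (momB hH (0 + 1) (B s)) (fisher f (momB hH 1 (B s)))
          * diffForm l).trace) (Set.Ici 0) s := fun s hs =>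
    (LinearMap.toContinuousLinearMap J).hasFDerivAt.comp_hasDerivWithinAt s
      (hB.hasDerivWithinAt_momB 0 hs.1 (hlt s hs))
  have hmono : ∀ s ∈ Set.Icc 0 t, lamMin hH * (momB hH 0 (B s) * diffForm l).trace
      ≤ (momB hH 1 (B s) * diffForm l).trace := by
    intro s hs
    rw [trace_momB_mul, trace_momB_mul, mul_left_comm, Finset.mul_sum]
    refine mul_le_mul_of_nonneg_left (Finset.sum_le_sum fun i _ => ?_) (by positivity)
    rw [pow_zero, one_mul, pow_one]
    exact mul_le_mul_of_nonneg_right (lamMin_le hH i) (trace_mul_diffForm_nonneg (hpsd s hs i))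
  have hb0 : 0 ≤ γ * (1 - ζ) * μhat * lamMin hH :=
    mul_nonneg (mul_nonneg (mul_nonneg hγ0 (by linarith)) hμ.le) hlam
  have hmain := le_exp_mul_of_deriv_le (b := γ * (1 - ζ) * μhat * lamMin hH) h0 hder ?_
  · rwa [← hdist t (Set.right_mem_Icc.2 h0), ← hdist 0 (Set.left_mem_Icc.2 h0)] at hmain
  intro s hs
  have hpart : momB hH 1 (B s) ∈ psdPart U := by
    refine ⟨?_, momB_posSemidef hKp 1 (hpsd s hs)⟩
    rw [← avgB_eq_momB]
    exact hB.mem s hs.1 (hlt s hs)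
  have h22 : (momB hH 1 (B s)).toBlocks₂₂ = (covB K Xs Xs).toBlocks₂₂ := by
    rw [hB.momB_toBlocks₂₂ hd 1 hs.1 (hlt s hs), ← covB_eq_powB, toBlocks₂₂_covB_eq]
  have hen := energy_bounds hα hfm hfi hf hh hL hsmooth hrsi hpart
    (ae_minAt_covLaw hfm (fun y e => (hsmooth y e).1) hKp hmin hpart.2 h22)
  rw [trace_lyap_diffForm, zero_add, pow_one]
  obtain ⟨e0, e1, e2⟩ := hen
  have hm := hmono s hs
  have hg2 : 0 ≤ γ ^ 2 * (1 / (d : ℝ) * K.trace) :=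
    mul_nonneg (sq_nonneg _) (mul_nonneg (by positivity) hKp.trace_nonneg)
  have f1 := mul_le_mul_of_nonneg_left e1 (by linarith : 0 ≤ 2 * γ)
  have f2 := mul_le_mul_of_nonneg_left e2 hg2
  -- The step size is made for this identity: the second-order term is exactly the fraction `ζ` of
  -- the secant term `2 γ μ̂ tr(M_1 J)`, where `J` is `diffForm`.
  have f3 : γ ^ 2 * (1 / (d : ℝ) * K.trace) * (Lhat ^ 2 * (momB hH 1 (B s) * diffForm l).trace)
      = 2 * γ * ζ * μhat * (momB hH 1 (B s) * diffForm l).trace := by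
    linear_combination γ * (momB hH 1 (B s) * diffForm l).trace * hγe
  have f4 := mul_le_mul_of_nonneg_left hm
    (mul_nonneg (mul_nonneg hγ0 (by linarith : 0 ≤ 1 - ζ)) hμ.le)
  -- The estimates leave `-2 γ (1 - ζ) μ̂ tr(M_1 J)`. One half gives the rate, the other half is
  -- discarded by its sign.
  have f5 : 0 ≤ γ * (1 - ζ) * μhat * (momB hH 1 (B s) * diffForm l).trace :=
    mul_nonneg (mul_nonneg (mul_nonneg hγ0 (by linarith)) hμ.le) e0
  linarith

/-- A uniform bound for the solutions. -/
theorem IsSolution.trace_momB_zero_le {hK : K.IsHermitian} {γ : ℝ} (hd : 0 < d)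
    {X0 Xs : Matrix (Fin d) (Fin l) ℝ} {C : ℝ} (hX0 : ‖X0‖ ≤ C) (hXs : ‖Xs‖ ≤ C)
    {S : EReal} {B : ℝ → Fin d → Mat2 l} (hB : IsSolution hK f h U γ X0 Xs S B) {t : ℝ}
    (h0 : 0 ≤ t) (ht : (t : EReal) < S) (hdec : distSq (B t) ≤ distSq (B 0)) :
    (momB hK 0 (B t)).trace ≤ 11 * C ^ 2 := by
  have hpsd := hB.psd t h0 ht
  have h00 : ∀ i, (B 0 i).PosSemidef := fun i => by
    rw [hB.init]; exact odeInit_posSemidef hK X0 Xs i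
  have hmom : (momB hK 0 (B t)).PosSemidef := by
    unfold momB
    refine Matrix.PosSemidef.smul (Matrix.posSemidef_sum _ fun i _ => ?_) (by positivity)
    rw [pow_zero, one_smul]; exact hpsd i
  -- The constant is `11 = 2 · 2² + 3`: the squared distance is at most `(2C)²`, and the lower right
  -- block contributes `3 C²`.
  have h1 := trace_le_diffForm hmom
  rw [← distSq_eq_trace hK hpsd, hB.momB_toBlocks₂₂ hd 0 h0 ht, trace_powB_zero_toBlocks₂₂] at h1
  have h2 : distSq (B 0) = ‖X0 - Xs‖ ^ 2 := by
    rw [distSq_eq_trace hK h00, show B 0 = odeInit hK X0 Xs from funext hB.init, momB_odeInit hd,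
      trace_powB_zero_diffForm]
  have h3 : ‖X0 - Xs‖ ^ 2 ≤ (2 * C) ^ 2 :=
    pow_le_pow_left₀ (norm_nonneg _) ((norm_sub_le _ _).trans (by linarith)) 2
  have h4 : ‖Xs‖ ^ 2 ≤ C ^ 2 := pow_le_pow_left₀ (norm_nonneg _) hXs 2
  linarith

theorem isClosed_innerSet {η : ℝ} (hη : 0 < η) : IsClosed (innerSet U η) := by
  have : innerSet U η = ⋂ V ∈ Uᶜ, {B : Mat2 l | η ≤ ‖B - V‖} := by
    ext B
    simp only [innerSet, Set.mem_ofPred_eq, Set.mem_iInter, Set.mem_compl_iff]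
    refine ⟨fun hB => hB.2, fun hB => ⟨?_, hB⟩⟩
    by_contra hBU
    have := hB B hBU
    rw [sub_self, norm_zero] at this
    linarith
  rw [this]
  exact isClosed_biInter fun V _ => isClosed_le continuous_const (by fun_prop)

/-- The bound on `tr M_0` gives `‖𝓑ᵢ‖ ≤ d R`, hence bounded speed; dependence on `d` is harmless
here. The closed set required by `lt_of_maximal_flow` consists of the positive semidefinite families
with average in `innerSet U η`. -/
theorem lt_of_isMaximalSolution (hα : 0 ≤ α) (hfm : Measurable (Function.uncurry f))
    (hf : PseudoLipschitz α L f) (hs : ∀ y e, ContDiff ℝ 1 (slice f y e))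
    (hh : RiskRepresentation α Lh U f h) (hI : FisherPseudoLipschitz α LI U f)
    (hd : 0 < d) (hK : K.PosSemidef) {γ : ℝ} {X0 Xs : Matrix (Fin d) (Fin l) ℝ}
    {Θ : EReal} {B : ℝ → Fin d → Mat2 l}
    (hB : IsMaximalSolution hK.isHermitian f h U γ X0 Xs Θ B) {T η R : ℝ} (hη : 0 < η)
    (hin : ∀ t : ℝ, 0 ≤ t → t ≤ T → (t : EReal) < Θ → avgB hK.isHermitian (B t) ∈ innerSet U η)
    (hbd : ∀ t : ℝ, 0 ≤ t → (t : EReal) < Θ → (momB hK.isHermitian 0 (B t)).trace ≤ R) :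
    (T : EReal) < Θ := by
  have hH := hK.isHermitian
  have hd' : (0 : ℝ) < d := by positivity
  obtain ⟨m, hm, hcb, -⟩ := exists_coeff_bounds hα hh hI (eigMean hH * (d * R))
  refine lt_of_maximal_flow (locLip_odeRHS hα hh hI hK γ)
    (locSolvable_odeRHS hα hfm hf hs hh hI hK γ) hB.pos (isSolution_iff_flowsOn.1 hB.sol)
    (fun S u' hu' => (hB.maximal S u' (isSolution_iff_flowsOn.2 hu')).1)
    (F := {B | ∀ i, (B i).PosSemidef} ∩ avgB hH ⁻¹' innerSet U η)
    (c := Real.toNNReal (4 * eigSum hH γ * m * (d * R) + eigSum hH γ * m))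
    (isClosed_forall_posSemidef.inter ((isClosed_innerSet hη).preimage (continuous_avgB hH)))
    (fun B hB => ⟨hB.1, hB.2.1⟩) fun t h0 htT ht => ?_
  have hpsd := hB.sol.psd t h0 ht
  refine ⟨⟨hpsd, hin t h0 htT ht⟩, ?_⟩
  have hs0 := eigSum_nonneg hH γ
  have hR : 0 ≤ R := (momB_posSemidef hK 0 hpsd).trace_nonneg.trans (hbd t h0 ht)
  have hBi : ∀ i, ‖B t i‖ ≤ d * R := by
    intro i
    refine (norm_le_trace (hpsd i)).trans ?_
    have h1 := trace_momB_mul hH 0 (B t) 1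
    simp only [Matrix.mul_one, pow_zero, one_mul] at h1
    have h2 := hbd t h0 ht
    rw [h1] at h2
    have h3 : (B t i).trace ≤ ∑ i, (B t i).trace :=
      Finset.single_le_sum (f := fun i => (B t i).trace) (fun j _ => (hpsd j).trace_nonneg)
        (Finset.mem_univ i)
    have h4 := mul_le_mul_of_nonneg_left h2 hd'.le
    rw [← mul_assoc, mul_one_div_cancel hd'.ne', one_mul] at h4
    exact h3.trans h4
  have hBn : ‖B t‖ ≤ d * R := (pi_norm_le_iff_of_nonneg (by positivity)).2 hBi
  have hA := odeDomain_psdPart hK (U := U) ⟨hpsd, hB.sol.mem t h0 ht⟩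
  have hc := hcb _ hA ((norm_avgB_le hH _).trans
    (mul_le_mul_of_nonneg_left hBn (eigMean_nonneg hH)))
  rw [← NNReal.coe_le_coe, coe_nnnorm, Real.coe_toNNReal _ (by positivity)]
  refine (pi_norm_le_iff_of_nonneg (by positivity)).2 fun i => ?_
  rw [odeRHS_eq_lyap]
  refine (norm_lyap_le hc.1 hc.2).trans ?_
  have c1 := (coeff_le_eigSum hH γ i).1
  have c2 := (coeff_le_eigSum hH γ i).2
  have c3 := hBi i
  gcongr

end Moments


/-! ### Bounds in `Lᵖ` -/

section LpBounds

variable {X : Type*} [MeasurableSpace X] {μ : Measure X} {p : ENNReal} {φ χ : X → ℝ} {c c' : ℝ}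

/-- `φ` has `Lᵖ`-norm at most `c`. -/
structure LpLE (μ : Measure X) (p : ENNReal) (φ : X → ℝ) (c : ℝ) : Prop where
  meas : AEStronglyMeasurable φ μ
  nonneg : 0 ≤ c
  le : eLpNorm φ p μ ≤ ENNReal.ofReal c

theorem LpLE.memLp (hφ : LpLE μ p φ c) : MemLp φ p μ :=
  ⟨hφ.meas, hφ.le.trans_lt ENNReal.ofReal_lt_top⟩

theorem LpLE.mono (hφ : LpLE μ p φ c) (h : c ≤ c') : LpLE μ p φ c' :=
  ⟨hφ.meas, hφ.nonneg.trans h, hφ.le.trans (ENNReal.ofReal_le_ofReal h)⟩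

theorem LpLE.add (hp : 1 ≤ p) (hφ : LpLE μ p φ c) (hχ : LpLE μ p χ c') :
    LpLE μ p (fun x => φ x + χ x) (c + c') := by
  refine ⟨hφ.meas.add hχ.meas, add_nonneg hφ.nonneg hχ.nonneg, ?_⟩
  rw [ENNReal.ofReal_add hφ.nonneg hχ.nonneg]
  exact (eLpNorm_add_le hφ.meas hχ.meas hp).trans (add_le_add hφ.le hχ.le)

theorem LpLE.sum {ι : Type*} (s : Finset ι) (hp : 1 ≤ p) {φ : ι → X → ℝ} {c : ι → ℝ}
    (hφ : ∀ i ∈ s, LpLE μ p (φ i) (c i)) :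
    LpLE μ p (fun x => ∑ i ∈ s, φ i x) (∑ i ∈ s, c i) := by
  classical
  induction s using Finset.induction_on with
  | empty => exact ⟨by simpa using aestronglyMeasurable_const, by simp, by simp⟩
  | insert i s hi ih =>
    simp only [Finset.sum_insert hi]
    exact (hφ i (Finset.mem_insert_self i s)).add hp
      (ih fun j hj => hφ j (Finset.mem_insert_of_mem hj))

theorem LpLE.const_mul (hφ : LpLE μ p φ c) (r : ℝ) :
    LpLE μ p (fun x => r * φ x) (|r| * c) := by
  refine ⟨hφ.meas.const_mul r, mul_nonneg (abs_nonneg r) hφ.nonneg, ?_⟩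
  have h1 := eLpNorm_const_smul r φ p μ
  rw [ENNReal.ofReal_mul (abs_nonneg r), ← Real.enorm_eq_ofReal_abs]
  exact h1.le.trans (mul_le_mul_right hφ.le _)

theorem LpLE.of_abs_le (hχ : LpLE μ p χ c) (hφ : AEStronglyMeasurable φ μ)
    (h : ∀ᵐ x ∂μ, |φ x| ≤ χ x) : LpLE μ p φ c := by
  refine ⟨hφ, hχ.nonneg, (eLpNorm_mono_ae ?_).trans hχ.le⟩
  filter_upwards [h] with x hx
  rw [Real.norm_eq_abs, Real.norm_eq_abs]
  exact hx.trans (le_abs_self _)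

theorem LpLE.abs (hφ : LpLE μ p φ c) : LpLE μ p (fun x => |φ x|) c :=
  ⟨hφ.meas.norm, hφ.nonneg, by
    have := eLpNorm_norm (p := p) (μ := μ) φ
    simp only [Real.norm_eq_abs] at this
    rw [this]; exact hφ.le⟩

theorem LpLE.mul (hφ : LpLE μ (2 * p) φ c) (hχ : LpLE μ (2 * p) χ c') :
    LpLE μ p (fun x => φ x * χ x) (c * c') := by
  have hH : ENNReal.HolderTriple (2 * p) (2 * p) p := ⟨by
    rw [ENNReal.mul_inv (Or.inl two_ne_zero) (Or.inl ENNReal.ofNat_ne_top), ← add_mul,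
      ENNReal.inv_two_add_inv_two, one_mul]⟩
  refine ⟨hφ.meas.mul hχ.meas, mul_nonneg hφ.nonneg hχ.nonneg, ?_⟩
  rw [ENNReal.ofReal_mul hφ.nonneg]
  exact (eLpNorm_smul_le_mul_eLpNorm (p := 2 * p) (q := 2 * p) hχ.meas hφ.meas).trans
    (mul_le_mul' hφ.le hχ.le)

theorem LpLE.mono_exponent [IsProbabilityMeasure μ] {q : ENNReal} (hφ : LpLE μ q φ c)
    (h : p ≤ q) : LpLE μ p φ c :=
  ⟨hφ.meas, hφ.nonneg, (eLpNorm_le_eLpNorm_of_exponent_le h hφ.meas).trans hφ.le⟩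

theorem LpLE.integrable [IsProbabilityMeasure μ] (hp : 1 ≤ p) (hφ : LpLE μ p φ c) :
    Integrable φ μ := hφ.memLp.integrable hp

theorem LpLE.abs_integral_le [IsProbabilityMeasure μ] (hp : 1 ≤ p) (hφ : LpLE μ p φ c) :
    |∫ x, φ x ∂μ| ≤ c := by
  have h1 := (hφ.mono_exponent hp).le
  rw [eLpNorm_one_eq_lintegral_enorm, ← ofReal_integral_norm_eq_lintegral_enorm
    (hφ.integrable hp)] at h1
  exact (norm_integral_le_integral_norm φ).trans ((ENNReal.ofReal_le_ofReal_iff hφ.nonneg).1 h1)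

theorem LpLE.sub_integral [IsProbabilityMeasure μ] (hp : 1 ≤ p) (hφ : LpLE μ p φ c) :
    LpLE μ p (fun x => φ x - ∫ y, φ y ∂μ) (2 * c) := by
  have h1 : LpLE μ p (fun _ : X => -∫ y, φ y ∂μ) c := by
    refine ⟨aestronglyMeasurable_const, hφ.nonneg, ?_⟩
    rw [eLpNorm_const _ (by positivity) (IsProbabilityMeasure.ne_zero μ)]
    rw [measure_univ, ENNReal.one_rpow, mul_one, Real.enorm_eq_ofReal_abs, abs_neg]
    exact ENNReal.ofReal_le_ofReal (hφ.abs_integral_le hp)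
  have := hφ.add hp h1
  simpa only [sub_eq_add_neg, two_mul] using this

theorem LpLE.integral_pow_le {j : ℕ} (hj : j ≠ 0)
    (hφ : LpLE μ ((2 * j : ℕ) : ENNReal) φ c) :
    Integrable (fun x => φ x ^ (2 * j)) μ ∧ ∫ x, φ x ^ (2 * j) ∂μ ≤ c ^ (2 * j) := by
  have h2j : (2 * j : ℕ) ≠ 0 := by omega
  have hpow : ∀ x, ‖φ x‖ ^ (2 * j) = φ x ^ (2 * j) := fun x => by
    rw [Real.norm_eq_abs, (even_two_mul j).pow_abs]
  have hint : Integrable (fun x => φ x ^ (2 * j)) μ := by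
    have := hφ.memLp.integrable_norm_pow h2j
    simpa only [hpow] using this
  refine ⟨hint, ?_⟩
  have h1 := hφ.le
  rw [eLpNorm_eq_lintegral_rpow_enorm_toReal (by exact_mod_cast h2j) (ENNReal.natCast_ne_top _),
    ENNReal.toReal_natCast] at h1
  have h2 := ENNReal.rpow_le_rpow h1 (by positivity : (0 : ℝ) ≤ ((2 * j : ℕ) : ℝ))
  rw [← ENNReal.rpow_mul, one_div_mul_cancel (by exact_mod_cast h2j), ENNReal.rpow_one,
    ENNReal.rpow_natCast, ← ENNReal.ofReal_pow hφ.nonneg] at h2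
  have h3 : ∫⁻ x, ‖φ x‖ₑ ^ ((2 * j : ℕ) : ℝ) ∂μ = ENNReal.ofReal (∫ x, φ x ^ (2 * j) ∂μ) := by
    rw [ofReal_integral_eq_lintegral_ofReal hint (ae_of_all _ fun x =>
      (even_two_mul j).pow_nonneg _)]
    refine lintegral_congr fun x => ?_
    rw [ENNReal.rpow_natCast, Real.enorm_eq_ofReal_abs, ← ENNReal.ofReal_pow (abs_nonneg _),
      (even_two_mul j).pow_abs]
  rw [h3] at h2
  exact (ENNReal.ofReal_le_ofReal_iff (pow_nonneg hφ.nonneg _)).1 h2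

/-- Cauchy-Schwarz for integrals with given bounds. -/
theorem abs_integral_mul_le {s t : ℝ} (hs : 0 < s) (ht : 0 < t)
    (hφ : AEStronglyMeasurable φ μ) (hχ : AEStronglyMeasurable χ μ)
    (hφi : Integrable (fun x => φ x ^ 2) μ) (hχi : Integrable (fun x => χ x ^ 2) μ)
    (hφs : ∫ x, φ x ^ 2 ∂μ ≤ s ^ 2) (hχt : ∫ x, χ x ^ 2 ∂μ ≤ t ^ 2) :
    Integrable (fun x => φ x * χ x) μ ∧ |∫ x, φ x * χ x ∂μ| ≤ s * t := by
  -- The weights of this arithmetic-geometric inequality are chosen so that the bounds `s²` and `t²`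
  -- combine to exactly `s t`.
  have hbd : ∀ x, |φ x * χ x| ≤ t / (2 * s) * φ x ^ 2 + s / (2 * t) * χ x ^ 2 := by
    intro x
    rw [abs_mul, ← sq_abs (φ x), ← sq_abs (χ x)]
    have h1 : t / (2 * s) * |φ x| ^ 2 + s / (2 * t) * |χ x| ^ 2 - |φ x| * |χ x|
        = (t * |φ x| - s * |χ x|) ^ 2 / (2 * s * t) := by
      field_simp
      ring
    have h2 : 0 ≤ (t * |φ x| - s * |χ x|) ^ 2 / (2 * s * t) := by positivity
    linarith
  have hi : Integrable (fun x => t / (2 * s) * φ x ^ 2 + s / (2 * t) * χ x ^ 2) μ :=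
    (hφi.const_mul _).add (hχi.const_mul _)
  have hpr : Integrable (fun x => φ x * χ x) μ :=
    hi.mono' (hφ.mul hχ) (ae_of_all _ hbd)
  refine ⟨hpr, ?_⟩
  refine (norm_integral_le_integral_norm _).trans
    ((integral_mono hpr.norm hi hbd).trans ?_)
  rw [integral_add (hφi.const_mul _) (hχi.const_mul _), integral_const_mul, integral_const_mul]
  have e1 := mul_le_mul_of_nonneg_left hφs (by positivity : 0 ≤ t / (2 * s))
  have e2 := mul_le_mul_of_nonneg_left hχt (by positivity : 0 ≤ s / (2 * t))
  have e3 : t / (2 * s) * s ^ 2 + s / (2 * t) * t ^ 2 = s * t := by field_simp; ring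
  linarith

end LpBounds


/-! ### One step of stochastic gradient descent -/

section Step

variable {d l : ℕ} {f : Vec2 l → Vec l → ℝ} {h : Mat2 l → ℝ} {U : Set (Mat2 l)} {α L Lh LI : ℝ}
  {K : Matrix (Fin d) (Fin d) ℝ} {X Xs : Matrix (Fin d) (Fin l) ℝ}

/-- The entries of `∇ₓ f` at the data point `z`, extended by zero to the second summand. -/
def extGrad (f : Vec2 l → Vec l → ℝ) (Xs X : Matrix (Fin d) (Fin l) ℝ) (z : Vec d × Vec l) :
    Fin l ⊕ Fin l → ℝ :=
  Sum.elim (gradX f (cat (contract X z.1) (contract Xs z.1)) z.2).ofLp 0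

/-- One step of stochastic gradient descent. -/
def sgdStep (f : Vec2 l → Vec l → ℝ) (Xs : Matrix (Fin d) (Fin l) ℝ) (γ : ℝ)
    (s : Matrix (Fin d) (Fin l) ℝ × (Vec d × Vec l)) : Matrix (Fin d) (Fin l) ℝ :=
  s.1 - (γ / d) • matGrad (fun Y => Psi f Xs Y s.2.1 s.2.2) s.1

/-- The increment of `Wᵀ Kᵐ W` in one step. -/
def incr (f : Vec2 l → Vec l → ℝ) (K : Matrix (Fin d) (Fin d) ℝ) (Xs : Matrix (Fin d) (Fin l) ℝ)
    (γ : ℝ) (m : ℕ) (s : Matrix (Fin d) (Fin l) ℝ × (Vec d × Vec l)) : Mat2 l :=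
  powB K m (sgdStep f Xs γ s) Xs - powB K m s.1 Xs

/-- The rows of `Wᵀ Kᵐ`. -/
def powRow (K : Matrix (Fin d) (Fin d) ℝ) (m : ℕ) (X Xs : Matrix (Fin d) (Fin l) ℝ)
    (p : Fin l ⊕ Fin l) : Fin d → ℝ :=
  ((Matrix.fromCols X Xs).transpose * K ^ m) p

theorem fromCols_sgdStep (hs : ∀ y e, ContDiff ℝ 1 (slice f y e)) (γ : ℝ) (z : Vec d × Vec l) :
    Matrix.fromCols (sgdStep f Xs γ (X, z)) Xs
      = Matrix.fromCols X Xs - (γ / d) • Matrix.vecMulVec z.1.ofLp (extGrad f Xs X z) := by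
  ext p q
  rcases q with q | q
  · simp only [sgdStep, Matrix.fromCols_apply_inl, Matrix.sub_apply, Matrix.smul_apply,
      Matrix.vecMulVec_apply, extGrad, Sum.elim_inl, matGrad_Psi hs]
  · simp [extGrad, Matrix.vecMulVec_apply]

theorem pow_transpose (hK : K.IsHermitian) (m : ℕ) : (K ^ m).transpose = K ^ m := by
  have := hK.eq
  rw [Matrix.conjTranspose_eq_transpose_of_trivial] at this
  rw [Matrix.transpose_pow, this]

/-- The update is of rank one, so the expansion is exact. The first-order part pairs the gradient
with Gaussian linear forms. The second-order part contains `aᵀKᵐa`, of order `d`, which compensates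
one of its two factors `1/d`. -/
theorem incr_apply (hs : ∀ y e, ContDiff ℝ 1 (slice f y e)) (hK : K.IsHermitian) (γ : ℝ) (m : ℕ)
    (z : Vec d × Vec l) (p q : Fin l ⊕ Fin l) :
    incr f K Xs γ m (X, z) p q
      = -(γ / d) * (extGrad f Xs X z p * (powRow K m X Xs q ⬝ᵥ z.1.ofLp)
          + (powRow K m X Xs p ⬝ᵥ z.1.ofLp) * extGrad f Xs X z q)
        + (γ / d) ^ 2 * ((z.1.ofLp ⬝ᵥ (K ^ m).mulVec z.1.ofLp)
          * (extGrad f Xs X z p * extGrad f Xs X z q)) := by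
  have hT := pow_transpose hK m
  rw [incr, powB, powB, fromCols_sgdStep hs]
  obtain ⟨g, hg⟩ : ∃ g, g = extGrad f Xs X z := ⟨_, rfl⟩
  obtain ⟨W, hW⟩ : ∃ W, W = Matrix.fromCols X Xs := ⟨_, rfl⟩
  obtain ⟨a, ha⟩ : ∃ a : Fin d → ℝ, a = z.1.ofLp := ⟨_, rfl⟩
  have hrow : ∀ p, powRow K m X Xs p ⬝ᵥ a = (W.transpose * K ^ m).mulVec a p := fun p => by
    rw [hW]; rfl
  dsimp only
  rw [← hg, ← ha, hrow, hrow, ← hW]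
  have e1 : (W - (γ / d) • Matrix.vecMulVec a g).transpose * K ^ m
        * (W - (γ / d) • Matrix.vecMulVec a g) - W.transpose * K ^ m * W
      = -(γ / d) • (Matrix.vecMulVec g ((W.transpose * K ^ m).mulVec a)
          + Matrix.vecMulVec ((W.transpose * K ^ m).mulVec a) g)
        + (γ / d) ^ 2 • ((a ⬝ᵥ (K ^ m).mulVec a) • Matrix.vecMulVec g g) := by
    have t1 : W.transpose * K ^ m * Matrix.vecMulVec a g
        = Matrix.vecMulVec ((W.transpose * K ^ m).mulVec a) g := Matrix.mul_vecMulVec _ _ _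
    have t2 : (Matrix.vecMulVec a g).transpose * K ^ m * W
        = Matrix.vecMulVec g ((W.transpose * K ^ m).mulVec a) := by
      rw [Matrix.transpose_vecMulVec, Matrix.mul_assoc, Matrix.vecMulVec_mul,
        ← Matrix.mulVec_transpose, Matrix.transpose_mul, hT]
    have t3 : (Matrix.vecMulVec a g).transpose * K ^ m * Matrix.vecMulVec a g
        = (a ⬝ᵥ (K ^ m).mulVec a) • Matrix.vecMulVec g g := by
      rw [Matrix.transpose_vecMulVec, Matrix.mul_assoc, Matrix.mul_vecMulVec,
        Matrix.vecMulVec_mul_vecMulVec, Matrix.vecMulVec_smul]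
    rw [← t1, ← t2, ← t3, Matrix.transpose_sub, Matrix.transpose_smul]
    simp only [Matrix.sub_mul, Matrix.mul_sub, Matrix.smul_mul, Matrix.mul_smul, smul_add,
      smul_sub, smul_smul, neg_smul, sq]
    abel
  rw [e1]
  simp only [Matrix.add_apply, Matrix.smul_apply, Matrix.vecMulVec_apply, smul_eq_mul]

/-! #### Measurability -/

instance instMeasurableSpaceMatrix {m n : Type*} : MeasurableSpace (Matrix m n ℝ) :=
  inferInstanceAs (MeasurableSpace (m → n → ℝ))

instance instBorelSpaceMatrix {m n : Type*} [Countable m] [Countable n] :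
    BorelSpace (Matrix m n ℝ) :=
  inferInstanceAs (BorelSpace (m → n → ℝ))

theorem measurable_matrix_iff {Y : Type*} [MeasurableSpace Y] {m n : Type*} {F : Y → Matrix m n ℝ} :
    Measurable F ↔ ∀ i j, Measurable fun y => F y i j :=
  ⟨fun h i j => (measurable_pi_apply j).comp ((measurable_pi_apply i).comp h),
    fun h => measurable_pi_lambda _ fun i => measurable_pi_lambda _ fun j => h i j⟩

theorem continuous_fromCols (Xs : Matrix (Fin d) (Fin l) ℝ) :
    Continuous fun X : Matrix (Fin d) (Fin l) ℝ => Matrix.fromCols X Xs := by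
  refine continuous_matrix fun i j => ?_
  rcases j with j | j
  · simp only [Matrix.fromCols_apply_inl]; fun_prop
  · simp only [Matrix.fromCols_apply_inr]; fun_prop

theorem measurable_extGrad (hfm : Measurable (Function.uncurry f))
    (hs : ∀ y e, ContDiff ℝ 1 (slice f y e)) (Xs : Matrix (Fin d) (Fin l) ℝ) (p : Fin l ⊕ Fin l) :
    Measurable fun s : Matrix (Fin d) (Fin l) ℝ × (Vec d × Vec l) => extGrad f Xs s.1 s.2 p := by
  have hc : Continuous fun s : Matrix (Fin d) (Fin l) ℝ × (Vec d × Vec l) =>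
      (cat (contract s.1 s.2.1) (contract Xs s.2.1), s.2.2) := by
    simp only [cat_contract]
    have := (continuous_fromCols Xs).comp
      (continuous_fst (X := Matrix (Fin d) (Fin l) ℝ) (Y := Vec d × Vec l))
    fun_prop
  have hm := (measurable_gradX hfm hs).comp hc.measurable
  rcases p with p | p
  · exact (EuclideanSpace.proj (𝕜 := ℝ) p : Vec l →L[ℝ] ℝ).measurable.comp hm
  · exact measurable_const

theorem measurable_sgdStep (hfm : Measurable (Function.uncurry f))
    (hs : ∀ y e, ContDiff ℝ 1 (slice f y e)) (Xs : Matrix (Fin d) (Fin l) ℝ) (γ : ℝ) :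
    Measurable (sgdStep f Xs γ) := by
  refine measurable_matrix_iff.2 fun i j => ?_
  have e : (fun s : Matrix (Fin d) (Fin l) ℝ × (Vec d × Vec l) => sgdStep f Xs γ s i j)
      = fun s => s.1 i j - (γ / d) * (s.2.1 i * extGrad f Xs s.1 s.2 (Sum.inl j)) := by
    ext s
    simp only [sgdStep, Matrix.sub_apply, Matrix.smul_apply, smul_eq_mul, matGrad_Psi hs, extGrad,
      Sum.elim_inl]
  rw [e]
  have h1 := measurable_extGrad hfm hs Xs (Sum.inl j)
  have h2 : Measurable fun s : Matrix (Fin d) (Fin l) ℝ × (Vec d × Vec l) => s.1 i j :=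
    (measurable_matrix_iff.1 measurable_id i j).comp measurable_fst
  have h3 : Measurable fun s : Matrix (Fin d) (Fin l) ℝ × (Vec d × Vec l) => s.2.1 i := by
    fun_prop
  exact h2.sub ((h3.mul h1).const_mul _)

theorem continuous_powB (K : Matrix (Fin d) (Fin d) ℝ) (m : ℕ) (Xs : Matrix (Fin d) (Fin l) ℝ) :
    Continuous fun X => powB K m X Xs := by
  have h1 : Continuous fun X : Matrix (Fin d) (Fin l) ℝ => Matrix.fromCols X Xs :=
    continuous_fromCols Xs
  unfold powB
  fun_prop

theorem measurable_incr (hfm : Measurable (Function.uncurry f))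
    (hs : ∀ y e, ContDiff ℝ 1 (slice f y e)) (K : Matrix (Fin d) (Fin d) ℝ)
    (Xs : Matrix (Fin d) (Fin l) ℝ) (γ : ℝ) (m : ℕ) (p q : Fin l ⊕ Fin l) :
    Measurable fun s => incr f K Xs γ m s p q := by
  have h1 := (continuous_powB K m Xs).measurable.comp (measurable_sgdStep hfm hs Xs γ)
  have h2 : Measurable fun s : Matrix (Fin d) (Fin l) ℝ × (Vec d × Vec l) => powB K m s.1 Xs :=
    (continuous_powB K m Xs).measurable.comp measurable_fst
  exact (measurable_matrix_iff.1 h1 p q).sub (measurable_matrix_iff.1 h2 p q)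

/-! #### Moments -/

/-- The `Lᵖ`-norm of a standard Gaussian variable. -/
def gaussMom (p : ENNReal) : ℝ := (gaussNorm p).toReal

theorem gaussMom_nonneg (p : ENNReal) : 0 ≤ gaussMom p := ENNReal.toReal_nonneg

theorem lpLE_dotProduct (hK : K.PosSemidef) {v : Fin d → ℝ} {σ : ℝ} (hσ : 0 ≤ σ)
    (hv : v ⬝ᵥ K.mulVec v ≤ σ ^ 2) {p : ENNReal} (hp : p ≠ ⊤) :
    LpLE (dataLaw l K) p (fun z => v ⬝ᵥ z.1.ofLp) (σ * gaussMom p) := by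
  have hc : Continuous fun x : Vec d => v ⬝ᵥ x.ofLp := by unfold dotProduct; fun_prop
  refine ⟨(hc.comp continuous_fst).aestronglyMeasurable, mul_nonneg hσ (gaussMom_nonneg p), ?_⟩
  have h1 : eLpNorm (fun z : Vec d × Vec l => v ⬝ᵥ z.1.ofLp) p (dataLaw l K)
      = eLpNorm (fun x : Vec d => v ⬝ᵥ x.ofLp) p (multivariateGaussian 0 K) :=
    eLpNorm_comp_measurePreserving hc.aestronglyMeasurable measurePreserving_fst
  rw [h1, ENNReal.ofReal_mul hσ, gaussMom, ENNReal.ofReal_toReal (gaussNorm_ne_top hp)]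
  exact eLpNorm_dotProduct_le hK hσ hv p

theorem col_dotProduct_le {n : ℕ} (A : Matrix (Fin d) (Fin l ⊕ Fin n) ℝ) (p : Fin l ⊕ Fin n) :
    (fun j => A j p) ⬝ᵥ (fun j => A j p) ≤ ‖A‖ ^ 2 := by
  rw [norm_sq_eq_sum]
  refine Finset.sum_le_sum fun j _ => ?_
  rw [← sq]
  exact Finset.single_le_sum (f := fun i => A j i ^ 2) (fun _ _ => sq_nonneg _) (Finset.mem_univ p)

variable {κ R : ℝ}

/-- The variance of the row is `wᵀ K^{2m+1} w` for a column `w` of `W`. One more power of `κ ≥ 1`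
turns the bound into a square. -/
theorem powRow_dotProduct_le (hK : K.PosSemidef) (hκ : ∀ i, hK.isHermitian.eigenvalues i ≤ κ)
    (hκ1 : 1 ≤ κ) (hW : ‖Matrix.fromCols X Xs‖ ≤ R) (m : ℕ) (p : Fin l ⊕ Fin l) :
    powRow K m X Xs p ⬝ᵥ K.mulVec (powRow K m X Xs p) ≤ (κ ^ (m + 1) * R) ^ 2 := by
  obtain ⟨w, hw⟩ : ∃ w, w = fun j => Matrix.fromCols X Xs j p := ⟨_, rfl⟩
  have hrow : powRow K m X Xs p = (K ^ m).mulVec w := by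
    ext j
    have hsymm : ∀ k, (K ^ m) k j = (K ^ m) j k := fun k =>
      congrFun (congrFun (pow_transpose hK.isHermitian m) j) k
    rw [powRow, Matrix.mul_apply, hw]
    simp only [Matrix.mulVec, dotProduct, Matrix.transpose_apply, hsymm]
    exact Finset.sum_congr rfl fun k _ => mul_comm _ _
  have e1 : powRow K m X Xs p ⬝ᵥ K.mulVec (powRow K m X Xs p)
      = w ⬝ᵥ (K ^ (m + 1 + m)).mulVec w := by
    rw [hrow, Matrix.mulVec_mulVec, ← pow_succ', Matrix.dotProduct_mulVec, ← Matrix.mulVec_transpose,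
      Matrix.mulVec_mulVec, pow_transpose hK.isHermitian, ← pow_add, dotProduct_comm]
  rw [e1]
  have h1 := dotProduct_pow_mulVec_le hK hκ (m + 1 + m) w
  have h2 : w ⬝ᵥ w ≤ R ^ 2 := by
    rw [hw]
    exact (col_dotProduct_le _ p).trans (pow_le_pow_left₀ (norm_nonneg _) hW 2)
  calc _ ≤ κ ^ (m + 1 + m) * R ^ 2 := h1.trans (mul_le_mul_of_nonneg_left h2 (by positivity))
    _ ≤ κ ^ (m + 1 + (m + 1)) * R ^ 2 := by
      refine mul_le_mul_of_nonneg_right (pow_le_pow_right₀ hκ1 (by omega)) (sq_nonneg R)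
    _ = _ := by rw [pow_add]; ring

/-- Since `X⋆ᵀa` minimizes the slice, the gradient is bounded by Gaussian linear forms. Its moments
are then controlled by `‖W‖` and `κ`, uniformly in `d`. -/
theorem extGrad_abs_le {Lhat : ℝ} (hL : 0 < Lhat)
    (hsmooth : ∀ y e : Vec l, IsLSmooth Lhat (slice f y e)) {z : Vec d × Vec l}
    (hmin : ∀ x : Vec l,
      slice f (contract Xs z.1) z.2 (contract Xs z.1) ≤ slice f (contract Xs z.1) z.2 x)
    (p : Fin l ⊕ Fin l) :
    |extGrad f Xs X z p|
      ≤ Lhat * ∑ i : Fin l, |(powRow K 0 X Xs (Sum.inl i) ⬝ᵥ z.1.ofLp)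
        + (-1) * (powRow K 0 X Xs (Sum.inr i) ⬝ᵥ z.1.ofLp)| := by
  have hnn : 0 ≤ ∑ i : Fin l, |(powRow K 0 X Xs (Sum.inl i) ⬝ᵥ z.1.ofLp)
        + (-1) * (powRow K 0 X Xs (Sum.inr i) ⬝ᵥ z.1.ofLp)| :=
    Finset.sum_nonneg fun _ _ => abs_nonneg _
  rcases p with p | p
  · have h1 := (hsmooth (contract Xs z.1) z.2).norm_gradient_le hL hmin (contract X z.1)
    have h2 : ‖gradX f (cat (contract X z.1) (contract Xs z.1)) z.2‖
        ≤ Lhat * ‖contract X z.1 - contract Xs z.1‖ := by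
      rw [gradX, fstV_cat, sndV_cat]; exact h1
    have h3 : |extGrad f Xs X z (Sum.inl p)|
        ≤ ‖gradX f (cat (contract X z.1) (contract Xs z.1)) z.2‖ :=
      PiLp.norm_apply_le (gradX f (cat (contract X z.1) (contract Xs z.1)) z.2) p
    refine (h3.trans h2).trans (mul_le_mul_of_nonneg_left ?_ hL.le)
    have h4 : ‖contract X z.1 - contract Xs z.1‖
        ≤ ∑ i, |(contract X z.1 - contract Xs z.1) i| := by
      rw [EuclideanSpace.norm_eq]
      refine Real.sqrt_le_iff.2 ⟨Finset.sum_nonneg fun _ _ => abs_nonneg _, ?_⟩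
      exact Finset.sum_sq_le_sq_sum_of_nonneg fun _ _ => abs_nonneg _
    refine h4.trans (le_of_eq (Finset.sum_congr rfl fun i _ => ?_))
    congr 1
    simp [contract_apply, powRow, dotProduct, sub_eq_add_neg]
  · simp only [extGrad, Sum.elim_inr, Pi.zero_apply, abs_zero]
    exact mul_nonneg hL.le hnn

end Step


/-! ### Moments and conditional means of the increments. -/

section StepMoments

variable {d l : ℕ} {f : Vec2 l → Vec l → ℝ} {h : Mat2 l → ℝ} {U : Set (Mat2 l)} {α L Lh LI : ℝ}
  {K : Matrix (Fin d) (Fin d) ℝ} {X Xs : Matrix (Fin d) (Fin l) ℝ} {κ R Lhat γ : ℝ}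

/-- The size of the gradient relative to the moments of a standard Gaussian variable. -/
def gradConst (l : ℕ) (Lhat κ R : ℝ) : ℝ := Lhat * (l * (2 * (κ * R)))

theorem lpLE_powRow (hK : K.PosSemidef) (hκ : ∀ i, hK.isHermitian.eigenvalues i ≤ κ)
    (hκ1 : 1 ≤ κ) (hW : ‖Matrix.fromCols X Xs‖ ≤ R) (m : ℕ) (q : Fin l ⊕ Fin l) {p : ENNReal}
    (hp : p ≠ ⊤) :
    LpLE (dataLaw l K) p (fun z => powRow K m X Xs q ⬝ᵥ z.1.ofLp)
      (κ ^ (m + 1) * R * gaussMom p) :=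
  lpLE_dotProduct hK (mul_nonneg (by positivity) ((norm_nonneg _).trans hW))
    (powRow_dotProduct_le hK hκ hκ1 hW m q) hp

theorem lpLE_extGrad (hfm : Measurable (Function.uncurry f)) (hL : 0 < Lhat)
    (hsmooth : ∀ y e : Vec l, IsLSmooth Lhat (slice f y e))
    (hK : K.PosSemidef) (hκ : ∀ i, hK.isHermitian.eigenvalues i ≤ κ)
    (hκ1 : 1 ≤ κ) (hW : ‖Matrix.fromCols X Xs‖ ≤ R)
    (hmin : ∀ᵐ z ∂(dataLaw l K), ∀ x : Vec l,
      slice f (contract Xs z.1) z.2 (contract Xs z.1) ≤ slice f (contract Xs z.1) z.2 x)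
    (q : Fin l ⊕ Fin l) {p : ENNReal} (hp1 : 1 ≤ p) (hp : p ≠ ⊤) :
    LpLE (dataLaw l K) p (fun z => extGrad f Xs X z q) (gradConst l Lhat κ R * gaussMom p) := by
  have h1 : LpLE (dataLaw l K) p (fun z : Vec d × Vec l =>
      Lhat * ∑ i : Fin l, |(powRow K 0 X Xs (Sum.inl i) ⬝ᵥ z.1.ofLp)
        + (-1) * (powRow K 0 X Xs (Sum.inr i) ⬝ᵥ z.1.ofLp)|)
      (|Lhat| * ∑ _i : Fin l, (κ ^ (0 + 1) * R * gaussMom p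
        + |(-1 : ℝ)| * (κ ^ (0 + 1) * R * gaussMom p))) :=
    (LpLE.sum _ hp1 fun i _ => ((lpLE_powRow hK hκ hκ1 hW 0 _ hp).add hp1
      ((lpLE_powRow hK hκ hκ1 hW 0 _ hp).const_mul (-1))).abs).const_mul Lhat
  have h2 := h1.of_abs_le (φ := fun z => extGrad f Xs X z q)
    (((measurable_extGrad hfm (fun y e => (hsmooth y e).1) Xs q).comp
      measurable_prodMk_left).aestronglyMeasurable) (by
      filter_upwards [hmin] with z hz
      exact extGrad_abs_le hL hsmooth hz q)
  refine h2.mono (le_of_eq ?_)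
  rw [abs_of_pos hL, gradConst]
  simp
  ring

/-- The crude bound `aᵀKᵐa ≤ κᵐ ‖a‖²` and the triangle inequality for `∑ aⱼ²` suffice, as only the
order `d` matters for the moments of the increments. -/
theorem lpLE_quadratic (hK : K.PosSemidef) (hκ : ∀ i, hK.isHermitian.eigenvalues i ≤ κ)
    (hκ1 : 1 ≤ κ) (m : ℕ) {p : ENNReal} (hp1 : 1 ≤ p) (hp : p ≠ ⊤) :
    LpLE (dataLaw l K) p (fun z => z.1.ofLp ⬝ᵥ (K ^ m).mulVec z.1.ofLp)
      (d * (κ ^ (m + 1) * gaussMom (2 * p) ^ 2)) := by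
  have hκ0 : 0 ≤ κ := by linarith
  have h1 : ∀ j : Fin d, LpLE (dataLaw l K) (2 * p) (fun z => z.1 j)
      (Real.sqrt κ * gaussMom (2 * p)) := fun j => by
    have h2 := dotProduct_pow_mulVec_le hK hκ 1 (Pi.single j 1)
    rw [pow_one, pow_one, single_dotProduct, single_dotProduct, Pi.single_eq_same, one_mul, one_mul,
      mul_one] at h2
    have h3 := lpLE_dotProduct (l := l) hK (v := Pi.single j 1) (Real.sqrt_nonneg κ)
      (by rw [Real.sq_sqrt hκ0, single_dotProduct, one_mul]; exact h2)
      (p := 2 * p) (ENNReal.mul_ne_top ENNReal.ofNat_ne_top hp)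
    simpa only [single_dotProduct, one_mul] using h3
  have h4 := (LpLE.sum Finset.univ hp1 fun j _ => (h1 j).mul (h1 j)).const_mul (κ ^ m)
  have hc : Continuous fun z : Vec d × Vec l => z.1.ofLp ⬝ᵥ (K ^ m).mulVec z.1.ofLp := by
    unfold dotProduct Matrix.mulVec dotProduct; fun_prop
  refine (h4.of_abs_le hc.aestronglyMeasurable (ae_of_all _ fun z => ?_)).mono (le_of_eq ?_)
  · rw [abs_of_nonneg (dotProduct_pow_mulVec_nonneg hK m _)]
    exact dotProduct_pow_mulVec_le hK hκ m _
  · rw [Finset.sum_const, Finset.card_univ, Fintype.card_fin, nsmul_eq_mul,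
      abs_of_nonneg (by positivity), mul_mul_mul_comm, Real.mul_self_sqrt hκ0]
    ring

/-- The size of the increments. -/
def stepConst (l : ℕ) (Lhat κ R γ N : ℝ) : ℝ :=
  2 * γ * (gradConst l Lhat κ R * N) * (κ * R * N)
    + γ ^ 2 * (κ * N ^ 2) * (gradConst l Lhat κ R * N) ^ 2

/-- Both parts of the increment are of order `1/d`. The exponent `4p` arises from two uses of
Hölder's inequality, in the product of the quadratic form with two gradient entries. -/
theorem lpLE_incr (hd : 0 < d) (hfm : Measurable (Function.uncurry f)) (hL : 0 < Lhat)
    (hsmooth : ∀ y e : Vec l, IsLSmooth Lhat (slice f y e))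
    (hK : K.PosSemidef) (hκ : ∀ i, hK.isHermitian.eigenvalues i ≤ κ)
    (hκ1 : 1 ≤ κ) (hW : ‖Matrix.fromCols X Xs‖ ≤ R)
    (hmin : ∀ᵐ z ∂(dataLaw l K), ∀ x : Vec l,
      slice f (contract Xs z.1) z.2 (contract Xs z.1) ≤ slice f (contract Xs z.1) z.2 x)
    (hγ : 0 ≤ γ) (m : ℕ) (i j : Fin l ⊕ Fin l) {p : ENNReal} (hp1 : 1 ≤ p) (hp : p ≠ ⊤) :
    LpLE (dataLaw l K) p (fun z => incr f K Xs γ m (X, z) i j)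
      (κ ^ m / d * stepConst l Lhat κ R γ (gaussMom (2 * (2 * p)))) := by
  have hs := fun y e => (hsmooth y e).1
  have hd' : (d : ℝ) ≠ 0 := by positivity
  have h12 : (1 : ENNReal) ≤ 2 := by norm_num
  have hp2 : p ≤ 2 * p := by
    calc p = 1 * p := (one_mul p).symm
      _ ≤ 2 * p := mul_le_mul' h12 le_rfl
  have hp4 : 2 * p ≤ 2 * (2 * p) := mul_le_mul' le_rfl hp2
  have ht2 : 2 * p ≠ ⊤ := ENNReal.mul_ne_top ENNReal.ofNat_ne_top hp
  have ht4 : 2 * (2 * p) ≠ ⊤ := ENNReal.mul_ne_top ENNReal.ofNat_ne_top ht2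
  have g4 := fun q => lpLE_extGrad hfm hL hsmooth hK hκ hκ1 hW hmin q
    ((hp1.trans hp2).trans hp4) ht4
  have g2 := fun q => (g4 q).mono_exponent hp4
  have u2 := fun q => (lpLE_powRow hK hκ hκ1 hW m q ht4).mono_exponent hp4
  have s2 := lpLE_quadratic (l := l) hK hκ hκ1 m (hp1.trans hp2) ht2
  have h1 := ((((g2 i).mul (u2 j)).add hp1 ((u2 i).mul (g2 j))).const_mul (-(γ / d))).add hp1
    ((s2.mul ((g4 i).mul (g4 j))).const_mul ((γ / d) ^ 2))
  simp only [incr_apply hs hK.isHermitian]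
  refine h1.mono (le_of_eq ?_)
  rw [abs_neg, abs_of_nonneg (by positivity : 0 ≤ γ / d), abs_of_nonneg (sq_nonneg _), stepConst,
    pow_succ]
  field_simp
  ring

theorem powB_transpose (hK : K.IsHermitian) (m : ℕ) (X Xs : Matrix (Fin d) (Fin l) ℝ) :
    (powB K m X Xs).transpose = powB K m X Xs := by
  rw [powB, Matrix.transpose_mul, Matrix.transpose_mul, Matrix.transpose_transpose,
    pow_transpose hK, Matrix.mul_assoc]

theorem integral_powRow_mul_extGrad (hh : RiskRepresentation α Lh U f h)
    (hfm : Measurable (Function.uncurry f)) (hs : ∀ y e, ContDiff ℝ 1 (slice f y e))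
    (hK : K.PosSemidef) (hU : covB K X Xs ∈ U) (hg : UnbiasedGradient U f K Xs)
    (hint : ∀ (j : Fin d) (q : Fin l ⊕ Fin l),
      Integrable (fun z => z.1 j * extGrad f Xs X z q) (dataLaw l K))
    (m : ℕ) (p q : Fin l ⊕ Fin l) :
    ∫ z, (powRow K m X Xs p ⬝ᵥ z.1.ofLp) * extGrad f Xs X z q ∂(dataLaw l K)
      = 2 * (powB K (m + 1) X Xs * driftH h (covB K X Xs)) p q := by
  have h1 : ∀ z : Vec d × Vec l, (powRow K m X Xs p ⬝ᵥ z.1.ofLp) * extGrad f Xs X z q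
      = ∑ j, powRow K m X Xs p j * (z.1 j * extGrad f Xs X z q) := fun z => by
    rw [dotProduct, Finset.sum_mul]
    exact Finset.sum_congr rfl fun j _ => by ring
  simp only [h1]
  rw [integral_finsetSum _ fun j _ => (hint j q).const_mul _]
  simp only [integral_const_mul]
  rcases q with q | q
  · have h2 : ∀ j, ∫ z, z.1 j * extGrad f Xs X z (Sum.inl q) ∂(dataLaw l K)
        = 2 * (K * Matrix.fromCols X Xs * matGrad h (covB K X Xs)) j (Sum.inl q) := fun j =>
      integral_mul_gradX hh hfm hs hK hU hg j q
    simp only [h2]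
    have h3 : (powB K (m + 1) X Xs * driftH h (covB K X Xs)) p (Sum.inl q)
        = (powB K (m + 1) X Xs * matGrad h (covB K X Xs)) p (Sum.inl q) := by
      rw [Matrix.mul_apply, Matrix.mul_apply]
      refine Finset.sum_congr rfl fun k _ => ?_
      rcases k with k | k <;> rfl
    have h4 : powB K (m + 1) X Xs * matGrad h (covB K X Xs)
        = ((Matrix.fromCols X Xs).transpose * K ^ m)
          * (K * Matrix.fromCols X Xs * matGrad h (covB K X Xs)) := by
      rw [powB, pow_succ]
      simp only [Matrix.mul_assoc]
    rw [h3, h4, Matrix.mul_apply, Finset.mul_sum]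
    exact Finset.sum_congr rfl fun j _ => by rw [powRow]; ring
  · have h2 : (powB K (m + 1) X Xs * driftH h (covB K X Xs)) p (Sum.inr q) = 0 := by
      rw [Matrix.mul_apply]
      refine Finset.sum_eq_zero fun k _ => ?_
      rcases k with k | k <;> simp [driftH]
    rw [h2]
    simp [extGrad]

theorem integral_extGrad_mul (hfm : Measurable (Function.uncurry f))
    (hs : ∀ y e, ContDiff ℝ 1 (slice f y e)) (hK : K.PosSemidef) (p q : Fin l ⊕ Fin l) :
    ∫ z, extGrad f Xs X z p * extGrad f Xs X z q ∂(dataLaw l K)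
      = (Matrix.fromBlocks (fisher f (covB K X Xs)) 0 0 0 : Mat2 l) p q := by
  rcases p with p | p <;> rcases q with q | q
  · have hm := measurable_gradX hfm hs
    have hm' : ∀ q, Measurable fun z : Vec2 l × Vec l => gradX f z.1 z.2 q := fun q =>
      (EuclideanSpace.proj (𝕜 := ℝ) q : Vec l →L[ℝ] ℝ).measurable.comp hm
    have h1 := integral_map (μ := dataLaw l K)
      (measurePreserving_cat hK X Xs).measurable.aemeasurable
      (f := fun z : Vec2 l × Vec l => gradX f z.1 z.2 p * gradX f z.1 z.2 q)
      ((hm' p).mul (hm' q)).aestronglyMeasurable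
    rw [(measurePreserving_cat hK X Xs).map_eq] at h1
    rw [Matrix.fromBlocks_apply₁₁, fisher, Matrix.of_apply, h1]
    rfl
  all_goals simp [extGrad]

/-- The size of the error in the conditional mean of the increments. -/
def meanConst (l : ℕ) (Lhat κ R γ : ℝ) : ℝ :=
  γ ^ 2 * (κ * Real.sqrt (gaussSqVar + 1)
    * ((gradConst l Lhat κ R * gaussMom 4) * (gradConst l Lhat κ R * gaussMom 4) + 1))

/-- The first-order part has exactly the mean prescribed by `lyap`. In the second-order part,
`aᵀKᵐa` is replaced by its mean `tr K^{m+1}`. By Cauchy-Schwarz this costs a standard deviation of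
order `√d`, hence `d^{-3/2}` after the factor `(γ/d)²`, and `d^{-1/2}` over a number of steps of
order `d`. -/
theorem abs_integral_incr_sub_le (hd : 0 < d) (hh : RiskRepresentation α Lh U f h)
    (hfm : Measurable (Function.uncurry f)) (hL : 0 < Lhat)
    (hsmooth : ∀ y e : Vec l, IsLSmooth Lhat (slice f y e))
    (hK : K.PosSemidef) (hκ : ∀ i, hK.isHermitian.eigenvalues i ≤ κ)
    (hκ1 : 1 ≤ κ) (hW : ‖Matrix.fromCols X Xs‖ ≤ R)
    (hmin : ∀ᵐ z ∂(dataLaw l K), ∀ x : Vec l,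
      slice f (contract Xs z.1) z.2 (contract Xs z.1) ≤ slice f (contract Xs z.1) z.2 x)
    (hU : covB K X Xs ∈ U) (hg : UnbiasedGradient U f K Xs) (m : ℕ) (i j : Fin l ⊕ Fin l) :
    |∫ z, incr f K Xs γ m (X, z) i j ∂(dataLaw l K)
      - 1 / d * lyap γ (γ ^ 2 * (1 / (d : ℝ) * (K ^ (m + 1)).trace)) (driftH h (covB K X Xs))
        (powB K (m + 1) X Xs) (fisher f (covB K X Xs)) i j|
      ≤ κ ^ m * meanConst l Lhat κ R γ / (d * Real.sqrt d) := by
  have hs := fun y e => (hsmooth y e).1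
  have hd' : (0 : ℝ) < d := by positivity
  have e2 : (2 : ENNReal) * 1 = 2 := mul_one _
  have e4 : (2 : ENNReal) * 2 = 4 := by norm_num
  have g4 : ∀ q, LpLE (dataLaw l K) (2 * 2) (fun z => extGrad f Xs X z q)
      (gradConst l Lhat κ R * gaussMom 4) := fun q => by
    rw [e4]
    exact lpLE_extGrad hfm hL hsmooth hK hκ hκ1 hW hmin q (by norm_num) (by norm_num)
  have g2 : ∀ q, LpLE (dataLaw l K) (2 * 1) (fun z => extGrad f Xs X z q)
      (gradConst l Lhat κ R * gaussMom 4) := fun q => (g4 q).mono_exponent (by norm_num)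
  have u2 := fun q => lpLE_powRow hK hκ hκ1 hW m q (p := 2 * 1) (by norm_num)
  have gg2 := (g4 i).mul (g4 j)
  have hgg : Integrable (fun z => extGrad f Xs X z i * extGrad f Xs X z j) (dataLaw l K) :=
    ((g2 i).mul (g2 j)).integrable le_rfl
  have hug : ∀ p q, Integrable (fun z => (powRow K m X Xs p ⬝ᵥ z.1.ofLp) * extGrad f Xs X z q)
      (dataLaw l K) := fun p q => ((u2 p).mul (g2 q)).integrable le_rfl
  have hcoord : ∀ (j : Fin d) (q : Fin l ⊕ Fin l),
      Integrable (fun z => z.1 j * extGrad f Xs X z q) (dataLaw l K) := fun j q => by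
    have h1 := lpLE_dotProduct (l := l) hK (v := Pi.single j 1)
      (Real.sqrt_nonneg (Pi.single j 1 ⬝ᵥ K.mulVec (Pi.single j 1)))
      (Real.sq_sqrt (by simpa using hK.dotProduct_mulVec_nonneg (Pi.single j 1))).ge
      (p := 2 * 1) (by norm_num)
    simp only [single_dotProduct, one_mul] at h1
    exact (h1.mul (g2 q)).integrable le_rfl
  -- the quadratic form concentrates around its mean
  obtain ⟨hvi, hv⟩ := integral_sub_trace_sq_le hK hκ m
  have hcq : Continuous fun a : Vec d =>
      a.ofLp ⬝ᵥ (K ^ m).mulVec a.ofLp - (K ^ (m + 1)).trace := by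
    unfold dotProduct Matrix.mulVec dotProduct; fun_prop
  have hfst : MeasurePreserving (Prod.fst : Vec d × Vec l → Vec d) (dataLaw l K)
      (multivariateGaussian 0 K) := measurePreserving_fst
  have hvi' : Integrable (fun z : Vec d × Vec l =>
      (z.1.ofLp ⬝ᵥ (K ^ m).mulVec z.1.ofLp - (K ^ (m + 1)).trace) ^ 2) (dataLaw l K) :=
    hfst.integrable_comp_of_integrable hvi
  have hv' : ∫ z : Vec d × Vec l, (z.1.ofLp ⬝ᵥ (K ^ m).mulVec z.1.ofLp - (K ^ (m + 1)).trace) ^ 2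
      ∂(dataLaw l K) ≤ (Real.sqrt d * κ ^ (m + 1) * Real.sqrt (gaussSqVar + 1)) ^ 2 := by
    have e1 := integral_map (μ := dataLaw l K) hfst.measurable.aemeasurable
      (f := fun a : Vec d => (a.ofLp ⬝ᵥ (K ^ m).mulVec a.ofLp - (K ^ (m + 1)).trace) ^ 2)
      (hcq.pow 2).aestronglyMeasurable
    rw [hfst.map_eq] at e1
    rw [← e1, mul_pow, mul_pow, Real.sq_sqrt hd'.le, Real.sq_sqrt (by
      have := gaussSqVar_nonneg; linarith)]
    refine hv.trans ?_
    have : 0 ≤ (d : ℝ) * (κ ^ (m + 1)) ^ 2 := by positivity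
    linarith
  have hsq := LpLE.integral_pow_le (j := 1) one_ne_zero (φ := fun z =>
    extGrad f Xs X z i * extGrad f Xs X z j) (by simpa using gg2)
  have hκ0 : 0 < κ := by linarith
  obtain ⟨c, hc⟩ : ∃ c, c = gradConst l Lhat κ R * gaussMom 4 := ⟨_, rfl⟩
  rw [← hc] at hsq
  -- The summands `1` in both bounds serve only to make them strictly positive.
  have hcs := abs_integral_mul_le (μ := dataLaw l K)
    (s := Real.sqrt d * κ ^ (m + 1) * Real.sqrt (gaussSqVar + 1)) (t := c * c + 1)
    (φ := fun z : Vec d × Vec l => z.1.ofLp ⬝ᵥ (K ^ m).mulVec z.1.ofLp - (K ^ (m + 1)).trace)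
    (χ := fun z => extGrad f Xs X z i * extGrad f Xs X z j)
    (mul_pos (mul_pos (Real.sqrt_pos.2 hd') (by positivity))
      (Real.sqrt_pos.2 (by have := gaussSqVar_nonneg; linarith)))
    (by nlinarith [mul_self_nonneg c])
    (hcq.comp continuous_fst).aestronglyMeasurable hgg.aestronglyMeasurable hvi'
    (by simpa using hsq.1) hv' (by
      have h1 := hsq.2
      rw [mul_one] at h1
      refine h1.trans ?_
      have h2 := mul_self_nonneg c
      exact pow_le_pow_left₀ h2 (by linarith) 2)
  obtain ⟨hdi, hdle⟩ := hcs
  have hquad : Integrable (fun z : Vec d × Vec l => (z.1.ofLp ⬝ᵥ (K ^ m).mulVec z.1.ofLp)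
      * (extGrad f Xs X z i * extGrad f Xs X z j)) (dataLaw l K) ∧
      ∫ z : Vec d × Vec l, (z.1.ofLp ⬝ᵥ (K ^ m).mulVec z.1.ofLp)
        * (extGrad f Xs X z i * extGrad f Xs X z j) ∂(dataLaw l K)
      = ∫ z : Vec d × Vec l, (z.1.ofLp ⬝ᵥ (K ^ m).mulVec z.1.ofLp - (K ^ (m + 1)).trace)
          * (extGrad f Xs X z i * extGrad f Xs X z j) ∂(dataLaw l K)
        + (K ^ (m + 1)).trace * ∫ z, extGrad f Xs X z i * extGrad f Xs X z j ∂(dataLaw l K) := by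
    have e1 : (fun z : Vec d × Vec l => (z.1.ofLp ⬝ᵥ (K ^ m).mulVec z.1.ofLp)
        * (extGrad f Xs X z i * extGrad f Xs X z j))
        = fun z => (z.1.ofLp ⬝ᵥ (K ^ m).mulVec z.1.ofLp - (K ^ (m + 1)).trace)
          * (extGrad f Xs X z i * extGrad f Xs X z j)
          + (K ^ (m + 1)).trace * (extGrad f Xs X z i * extGrad f Xs X z j) := by
      ext z; ring
    rw [e1]
    refine ⟨hdi.add (hgg.const_mul _), ?_⟩
    rw [integral_add hdi (hgg.const_mul _), integral_const_mul]
  have hgu : ∀ p q, Integrable (fun z => extGrad f Xs X z q * (powRow K m X Xs p ⬝ᵥ z.1.ofLp))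
      (dataLaw l K) := fun p q => ((g2 q).mul (u2 p)).integrable le_rfl
  have hmean : ∫ z, incr f K Xs γ m (X, z) i j ∂(dataLaw l K)
      = -(γ / d) * (2 * (powB K (m + 1) X Xs * driftH h (covB K X Xs)) j i
          + 2 * (powB K (m + 1) X Xs * driftH h (covB K X Xs)) i j)
        + (γ / d) ^ 2 * (∫ z : Vec d × Vec l,
            (z.1.ofLp ⬝ᵥ (K ^ m).mulVec z.1.ofLp - (K ^ (m + 1)).trace)
            * (extGrad f Xs X z i * extGrad f Xs X z j) ∂(dataLaw l K)
          + (K ^ (m + 1)).trace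
            * (Matrix.fromBlocks (fisher f (covB K X Xs)) 0 0 0 : Mat2 l) i j) := by
    have i1 : Integrable (fun z => -(γ / d) * (extGrad f Xs X z i * (powRow K m X Xs j ⬝ᵥ z.1.ofLp)
        + (powRow K m X Xs i ⬝ᵥ z.1.ofLp) * extGrad f Xs X z j)) (dataLaw l K) :=
      ((hgu j i).add (hug i j)).const_mul _
    simp only [incr_apply hs hK.isHermitian]
    rw [integral_add i1 (hquad.1.const_mul _), integral_const_mul, integral_const_mul,
      integral_add (hgu j i) (hug i j), hquad.2, integral_extGrad_mul hfm hs hK,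
      integral_powRow_mul_extGrad hh hfm hs hK hU hg hcoord]
    simp only [mul_comm (extGrad f Xs X _ i)]
    rw [integral_powRow_mul_extGrad hh hfm hs hK hU hg hcoord]
  have hlyap : 1 / d * lyap γ (γ ^ 2 * (1 / (d : ℝ) * (K ^ (m + 1)).trace)) (driftH h (covB K X Xs))
        (powB K (m + 1) X Xs) (fisher f (covB K X Xs)) i j
      = -(γ / d) * (2 * (powB K (m + 1) X Xs * driftH h (covB K X Xs)) j i
          + 2 * (powB K (m + 1) X Xs * driftH h (covB K X Xs)) i j)
        + (γ / d) ^ 2 * ((K ^ (m + 1)).trace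
            * (Matrix.fromBlocks (fisher f (covB K X Xs)) 0 0 0 : Mat2 l) i j) := by
    have e1 : ((driftH h (covB K X Xs)).transpose * powB K (m + 1) X Xs) i j
        = (powB K (m + 1) X Xs * driftH h (covB K X Xs)) j i := by
      rw [← Matrix.transpose_apply (powB K (m + 1) X Xs * driftH h (covB K X Xs)),
        Matrix.transpose_mul, powB_transpose hK.isHermitian]
    rw [lyap, Matrix.add_apply, Matrix.smul_apply, Matrix.smul_apply, Matrix.add_apply, e1,
      smul_eq_mul, smul_eq_mul]
    field_simp
    ring
  rw [hmean, hlyap]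
  have e5 : ∀ x y w v : ℝ, x + y * (w + v) - (x + y * v) = y * w := fun x y w v => by ring
  rw [e5, abs_mul, abs_of_nonneg (sq_nonneg (γ / d))]
  refine (mul_le_mul_of_nonneg_left hdle (sq_nonneg _)).trans (le_of_eq ?_)
  have hsd : Real.sqrt d * Real.sqrt d = d := Real.mul_self_sqrt hd'.le
  have hsd0 : Real.sqrt d ≠ 0 := (Real.sqrt_pos.2 hd').ne'
  rw [meanConst, ← hc, pow_succ, eq_div_iff (by positivity), div_pow]
  field_simp
  rw [show Real.sqrt d ^ 2 = d by rw [sq, hsd]]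
  ring

end StepMoments


/-! ### Simultaneous deviation bounds -/

theorem measure_abs_gt_le {Ω : Type*} [MeasurableSpace Ω] {P : Measure Ω} {Y : Ω → ℝ}
    (hY : Measurable Y) {q : ℕ} {b s : ℝ} (hs : 0 < s)
    (h : ∫⁻ ω, ENNReal.ofReal (Y ω ^ (2 * q)) ∂P ≤ ENNReal.ofReal b) :
    P {ω | s < |Y ω|} ≤ ENNReal.ofReal (b / s ^ (2 * q)) := by
  have hpos : 0 < s ^ (2 * q) := by positivity
  have h1 := mul_meas_ge_le_lintegral₀ (μ := P) (f := fun ω => ENNReal.ofReal (Y ω ^ (2 * q)))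
    (by fun_prop) (ENNReal.ofReal (s ^ (2 * q)))
  have h2 : P {ω | s < |Y ω|}
      ≤ P {ω | ENNReal.ofReal (s ^ (2 * q)) ≤ ENNReal.ofReal (Y ω ^ (2 * q))} := by
    refine measure_mono fun ω hω => ?_
    have : s ^ (2 * q) ≤ Y ω ^ (2 * q) := by
      rw [← (even_two_mul q).pow_abs (Y ω)]
      exact pow_le_pow_left₀ hs.le (le_of_lt hω) _
    exact ENNReal.ofReal_le_ofReal this
  refine h2.trans ?_
  rw [ENNReal.ofReal_div_of_pos hpos, ENNReal.le_div_iff_mul_le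
    (Or.inl (by simpa using hpos)) (Or.inl ENNReal.ofReal_ne_top), mul_comm]
  exact h1.trans h

/-- The increments of index `m` have size `κ^m A`, but are tested against `(2κ)^m δ`. Markov's
inequality for the moment of order `2q` gains `4^{-mq}`, so the union over all `m` costs a constant
factor only. -/
theorem exists_deviation_bound (q : ℕ) (hq : q ≠ 0) : ∃ c : ℝ, 0 ≤ c ∧
    ∀ {Ω S Z ι : Type*} [MeasurableSpace Ω] [MeasurableSpace S] [MeasurableSpace Z] [Fintype ι]
      {P : Measure Ω} [IsProbabilityMeasure P] {μ : Measure Z} [IsProbabilityMeasure μ]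
      {Φ : S × Z → S} (_ : Measurable Φ) (s₀ : S)
      {z : ℕ → Ω → Z} (_ : ∀ k, Measurable (z k)) (_ : ∀ k, P.map (z k) = μ)
      (_ : iIndepFun z P)
      {ψ : ℕ → ι → S × Z → ℝ} (_ : ∀ m i, Measurable (ψ m i)) {A κ : ℝ} (_ : 0 ≤ A) (_ : 0 < κ)
      (_ : ∀ m i x, ∀ j, Integrable (fun y => ψ m i (x, y) ^ j) μ)
      (_ : ∀ m i x, ∀ j ≤ q, ∫ y, ψ m i (x, y) ^ (2 * j) ∂μ ≤ (κ ^ m * A) ^ (2 * j))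
      (_ : ∀ m i x, ∫ y, ψ m i (x, y) ∂μ = 0) (N : ℕ) {δ : ℝ} (_ : 0 < δ),
      P {ω | ∃ n ≤ N, ∃ m i, (2 * κ) ^ m * δ
          < |∑ k ∈ Finset.range n, ψ m i (chain Φ s₀ (fun j => z j ω) k, z k ω)|}
        ≤ ENNReal.ofReal (c * Fintype.card ι * (N + 1) ^ (q + 1) * (A / δ) ^ (2 * q)) := by
  obtain ⟨c, hc, hmom⟩ := exists_chain_moment_bound q
  refine ⟨2 * c, by positivity, ?_⟩
  intro Ω S Z ι _ _ _ _ P _ μ _ Φ hΦ s₀ z hz hzl hind ψ hψ A κ hA hκ hint hmo hmean N δ hδ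
  have hmeas : ∀ n m i, Measurable fun ω =>
      ∑ k ∈ Finset.range n, ψ m i (chain Φ s₀ (fun j => z j ω) k, z k ω) := fun n m i =>
    Finset.measurable_sum _ fun k _ => (hψ m i).comp ((chain_measurable hΦ s₀ hz k).prodMk (hz k))
  have hone : ∀ n ≤ N, ∀ m i, P {ω | (2 * κ) ^ m * δ
      < |∑ k ∈ Finset.range n, ψ m i (chain Φ s₀ (fun j => z j ω) k, z k ω)|}
      ≤ ENNReal.ofReal (c * (N + 1) ^ q * (A / δ) ^ (2 * q) * (1 / 4) ^ m) := by
    intro n hn m i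
    refine (measure_abs_gt_le (hmeas n m i) (by positivity) (hmom hΦ s₀ hz hzl hind (hψ m i)
      (by positivity) (hint m i) (hmo m i) (hmean m i) n)).trans
      (ENNReal.ofReal_le_ofReal ?_)
    have e1 : c * (n : ℝ) ^ q * (κ ^ m * A) ^ (2 * q) / ((2 * κ) ^ m * δ) ^ (2 * q)
        = c * (n : ℝ) ^ q * (A / δ) ^ (2 * q) * ((1 / 4) ^ m) ^ q := by
      have e2 : ((1 / 4 : ℝ) ^ m) ^ q = 1 / (2 ^ m) ^ (2 * q) := by
        rw [show (1 / 4 : ℝ) = (1 / 2) ^ 2 by norm_num, ← pow_mul, ← pow_mul, ← pow_mul,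
          one_div_pow]
        congr 2; ring
      rw [e2, mul_pow, mul_pow, mul_pow, mul_pow, div_pow]
      have h2 : (2 : ℝ) ^ m ≠ 0 := by positivity
      field_simp
    rw [e1]
    have h1 : ((1 / 4 : ℝ) ^ m) ^ q ≤ (1 / 4) ^ m :=
      pow_le_of_le_one (by positivity) (pow_le_one₀ (by norm_num) (by norm_num)) hq
    have h2 : (n : ℝ) ^ q ≤ ((N : ℝ) + 1) ^ q := by
      refine pow_le_pow_left₀ (Nat.cast_nonneg n) ?_ q
      have : (n : ℝ) ≤ N := by exact_mod_cast hn
      linarith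
    have h3 : 0 ≤ (A / δ) ^ (2 * q) := by positivity
    gcongr
  have hunion : {ω | ∃ n ≤ N, ∃ m i, (2 * κ) ^ m * δ
      < |∑ k ∈ Finset.range n, ψ m i (chain Φ s₀ (fun j => z j ω) k, z k ω)|}
      ⊆ ⋃ n ∈ Finset.range (N + 1), ⋃ m : ℕ, ⋃ i ∈ (Finset.univ : Finset ι), {ω | (2 * κ) ^ m * δ
      < |∑ k ∈ Finset.range n, ψ m i (chain Φ s₀ (fun j => z j ω) k, z k ω)|} := by
    rintro ω ⟨n, hn, m, i, h⟩
    simp only [Set.mem_iUnion]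
    exact ⟨n, Finset.mem_range.2 (Nat.lt_succ_of_le hn), m, i, Finset.mem_univ i, h⟩
  set b : ℝ := c * (N + 1) ^ q * (A / δ) ^ (2 * q) with hb
  have hb0 : 0 ≤ b := by positivity
  have hgeom : ∑' m : ℕ, ENNReal.ofReal (b * (1 / 4) ^ m) ≤ ENNReal.ofReal (2 * b) := by
    have hs : Summable fun m : ℕ => b * (1 / 4 : ℝ) ^ m :=
      (summable_geometric_of_lt_one (by norm_num) (by norm_num)).mul_left b
    rw [← ENNReal.ofReal_tsum_of_nonneg (fun m => by positivity) hs, tsum_mul_left,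
      tsum_geometric_of_lt_one (by norm_num) (by norm_num)]
    exact ENNReal.ofReal_le_ofReal (by norm_num; linarith)
  calc _ ≤ ∑ n ∈ Finset.range (N + 1), ∑' m : ℕ, ∑ i : ι, P {ω | (2 * κ) ^ m * δ
      < |∑ k ∈ Finset.range n, ψ m i (chain Φ s₀ (fun j => z j ω) k, z k ω)|} := by
        refine (measure_mono hunion).trans ((measure_biUnion_finset_le _ _).trans ?_)
        refine Finset.sum_le_sum fun n _ => (measure_iUnion_le _).trans ?_
        exact ENNReal.tsum_le_tsum fun m => measure_biUnion_finset_le _ _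
    _ ≤ ∑ _n ∈ Finset.range (N + 1), ∑' m : ℕ, ∑ _i : ι, ENNReal.ofReal (b * (1 / 4) ^ m) := by
        refine Finset.sum_le_sum fun n hn => ENNReal.tsum_le_tsum fun m => ?_
        exact Finset.sum_le_sum fun i _ =>
          hone n (Nat.lt_succ_iff.1 (Finset.mem_range.1 hn)) m i
    _ ≤ ∑ _n ∈ Finset.range (N + 1), (Fintype.card ι : ENNReal) * ENNReal.ofReal (2 * b) := by
        refine Finset.sum_le_sum fun n _ => ?_
        simp only [Finset.sum_const, Finset.card_univ, nsmul_eq_mul]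
        rw [ENNReal.tsum_mul_left]
        exact mul_le_mul' le_rfl hgeom
    _ = _ := by
        rw [Finset.sum_const, Finset.card_range, nsmul_eq_mul, ← ENNReal.ofReal_natCast,
          ← ENNReal.ofReal_natCast, ← ENNReal.ofReal_mul (by positivity),
          ← ENNReal.ofReal_mul (by positivity), hb]
        congr 1
        push_cast
        ring

/-- A discrete Gronwall lemma for a family of sequences that is controlled as long as it is
small. -/
theorem discrete_gronwall {E : Type*} [NormedAddCommGroup E] {e ψ : ℕ → ℕ → E} {good : ℕ → Prop}
    {N : ℕ} {ρ lam b σ ε : ℝ} (hρ : 0 < ρ) (hlam : 0 ≤ lam) (hb : 0 ≤ b) (hσ : 0 ≤ σ)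
    (h0 : ∀ m, e 0 m = 0) (hψ : ∀ n ≤ N, ∀ m, ‖∑ k ∈ Finset.range n, ψ k m‖ ≤ ρ ^ m * σ)
    (hgood : ∀ n ≤ N, (∀ m, ‖e n m‖ ≤ ρ ^ m * ε) → good n)
    (hstep : ∀ n < N, good n → ∀ a, 0 ≤ a → a ≤ ε → (∀ m, ‖e n m‖ ≤ ρ ^ m * a) →
      ∀ m, ‖e (n + 1) m - e n m - ψ n m‖ ≤ ρ ^ m * (lam * a + b))
    (hε : (σ + N * b) * (1 + lam) ^ N ≤ ε) :
    ∀ n ≤ N, ∀ m, ‖e n m‖ ≤ ρ ^ m * ((σ + N * b) * (1 + lam) ^ n) := by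
  have hs0 : 0 ≤ σ + N * b := by positivity
  have hle : ∀ n ≤ N, (σ + N * b) * (1 + lam) ^ n ≤ ε := fun n hn =>
    (mul_le_mul_of_nonneg_left (pow_le_pow_right₀ (by linarith) hn) hs0).trans hε
  intro n
  induction n using Nat.strong_induction_on with
  | _ n ih =>
    intro hn m
    have hterm : ∀ k ∈ Finset.range n, ‖e (k + 1) m - e k m - ψ k m‖
        ≤ ρ ^ m * (lam * ((σ + N * b) * (1 + lam) ^ k) + b) := by
      intro k hk
      have hkn := Finset.mem_range.1 hk
      have hkN : k ≤ N := hkn.le.trans hn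
      have hbd := ih k hkn hkN
      -- The bounds already proved at time `k` show that the state is good there, which permits the
      -- next step estimate.
      refine hstep k (hkn.trans_le hn) (hgood k hkN fun m' => (hbd m').trans ?_) _
        (by positivity) (hle k hkN) hbd m
      exact mul_le_mul_of_nonneg_left (hle k hkN) (by positivity)
    have hsum : e n m = ∑ k ∈ Finset.range n, (e (k + 1) m - e k m - ψ k m)
        + ∑ k ∈ Finset.range n, ψ k m := by
      rw [← Finset.sum_add_distrib]
      simp only [sub_add_cancel]
      rw [Finset.sum_range_sub (fun k => e k m), h0, sub_zero]
    rw [hsum]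
    refine (norm_add_le _ _).trans ((add_le_add ((norm_sum_le _ _).trans
      (Finset.sum_le_sum hterm)) (hψ n hn m)).trans ?_)
    rw [← Finset.mul_sum, ← mul_add]
    refine mul_le_mul_of_nonneg_left ?_ (by positivity)
    -- The geometric sum reproduces the form of the claimed bound and closes the induction.
    have hgeo : lam * ∑ k ∈ Finset.range n, (1 + lam) ^ k = (1 + lam) ^ n - 1 := by
      have := mul_geom_sum (1 + lam) n
      rwa [add_sub_cancel_left] at this
    rw [Finset.sum_add_distrib, Finset.sum_const, Finset.card_range, nsmul_eq_mul]
    have e1 : ∑ k ∈ Finset.range n, lam * ((σ + N * b) * (1 + lam) ^ k)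
        = (σ + N * b) * (lam * ∑ k ∈ Finset.range n, (1 + lam) ^ k) := by
      rw [Finset.mul_sum, Finset.mul_sum]
      exact Finset.sum_congr rfl fun k _ => by ring
    rw [e1, hgeo]
    have h2 : (n : ℝ) * b ≤ N * b := mul_le_mul_of_nonneg_right (by exact_mod_cast hn) hb
    linarith


/-! ### The closed system of the moments -/

section MomentField

variable {d l : ℕ} {f : Vec2 l → Vec l → ℝ} {h : Mat2 l → ℝ} {U : Set (Mat2 l)} {α L Lh LI : ℝ}
  {K : Matrix (Fin d) (Fin d) ℝ} {κ γ g m₀ r a : ℝ}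

/-- The vector field followed by the moments `(1/d) ∑ λᵢᵐ 𝓑ᵢ`. -/
def momField (f : Vec2 l → Vec l → ℝ) (h : Mat2 l → ℝ) (K : Matrix (Fin d) (Fin d) ℝ) (γ : ℝ)
    (M : ℕ → Mat2 l) (m : ℕ) : Mat2 l :=
  lyap γ (γ ^ 2 * (1 / (d : ℝ) * (K ^ (m + 1)).trace)) (driftH h (M 1)) (M (m + 1))
    (fisher f (M 1))

/-- A bound for `momField`. -/
def fieldBound (g κ m₀ r : ℝ) : ℝ := 4 * g * m₀ * (κ * r) + g ^ 2 * κ * m₀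

/-- A Lipschitz constant for `momField`. -/
def fieldLip (g κ m₀ r : ℝ) : ℝ :=
  4 * g * (m₀ * (2 * κ) + κ * r * (m₀ * (2 * κ))) + g ^ 2 * κ * (m₀ * (2 * κ))

theorem abs_coeff_le (hd : 0 < d) (hK : K.PosSemidef)
    (hκ : ∀ i, hK.isHermitian.eigenvalues i ≤ κ) (hγ0 : 0 ≤ γ) (hγ : γ ≤ g) (m : ℕ) :
    |γ ^ 2 * (1 / (d : ℝ) * (K ^ (m + 1)).trace)| ≤ g ^ 2 * κ ^ (m + 1) := by
  have hd' : (0 : ℝ) < d := by positivity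
  have h1 : 1 / (d : ℝ) * (K ^ (m + 1)).trace ≤ κ ^ (m + 1) := by
    rw [one_div, inv_mul_le_iff₀ hd']
    exact trace_pow_le hK hκ (m + 1)
  have h0 : 0 ≤ 1 / (d : ℝ) * (K ^ (m + 1)).trace :=
    mul_nonneg (by positivity) (trace_pow_nonneg hK _)
  rw [abs_of_nonneg (mul_nonneg (sq_nonneg _) h0)]
  exact mul_le_mul (pow_le_pow_left₀ hγ0 hγ 2) h1 h0 (by positivity)

theorem norm_momField_le (hd : 0 < d) (hK : K.PosSemidef)
    (hκ : ∀ i, hK.isHermitian.eigenvalues i ≤ κ) (hγ0 : 0 ≤ γ) (hγ : γ ≤ g)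
    {M : ℕ → Mat2 l} (hH : ‖driftH h (M 1)‖ ≤ m₀) (hQ : ‖fisher f (M 1)‖ ≤ m₀)
    (m : ℕ) (hM : ‖M (m + 1)‖ ≤ κ ^ (m + 1) * r) :
    ‖momField f h K γ M m‖ ≤ κ ^ m * fieldBound g κ m₀ r := by
  have hm₀ : 0 ≤ m₀ := (norm_nonneg _).trans hH
  have h1 := abs_coeff_le hd hK hκ hγ0 hγ m
  refine (norm_lyap_le hH hQ).trans ?_
  rw [abs_of_nonneg hγ0]
  have hg : 0 ≤ g := hγ0.trans hγ
  calc _ ≤ 4 * g * m₀ * (κ ^ (m + 1) * r) + g ^ 2 * κ ^ (m + 1) * m₀ := by gcongr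
    _ = _ := by rw [fieldBound, pow_succ]; ring

/-- The difference at level `m + 1` carries the weight `(2κ)^{m+1}`. The additional factor `2κ` goes
into `fieldLip`, so the hierarchy needs no truncation in `m`. -/
theorem norm_momField_sub_le (hd : 0 < d) (hK : K.PosSemidef)
    (hκ : ∀ i, hK.isHermitian.eigenvalues i ≤ κ) (hγ0 : 0 ≤ γ) (hγ : γ ≤ g) (hκ0 : 0 ≤ κ)
    (hr : 0 ≤ r) {M M' : ℕ → Mat2 l} (hH : ‖driftH h (M 1)‖ ≤ m₀)
    (hH' : ‖driftH h (M 1) - driftH h (M' 1)‖ ≤ m₀ * ‖M 1 - M' 1‖)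
    (hQ' : ‖fisher f (M 1) - fisher f (M' 1)‖ ≤ m₀ * ‖M 1 - M' 1‖)
    (ha : ∀ k, ‖M k - M' k‖ ≤ (2 * κ) ^ k * a) (ha0 : 0 ≤ a)
    (m : ℕ) (hM : ‖M' (m + 1)‖ ≤ κ ^ (m + 1) * r) :
    ‖momField f h K γ M m - momField f h K γ M' m‖ ≤ (2 * κ) ^ m * (fieldLip g κ m₀ r * a) := by
  have hm₀ : 0 ≤ m₀ := (norm_nonneg _).trans hH
  have h1 := abs_coeff_le hd hK hκ hγ0 hγ m
  have hg : 0 ≤ g := hγ0.trans hγ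
  have a1 : ‖M 1 - M' 1‖ ≤ 2 * κ * a := by simpa using ha 1
  have b1 : ‖driftH h (M 1) - driftH h (M' 1)‖ ≤ m₀ * (2 * κ * a) :=
    hH'.trans (mul_le_mul_of_nonneg_left a1 hm₀)
  have b2 : ‖fisher f (M 1) - fisher f (M' 1)‖ ≤ m₀ * (2 * κ * a) :=
    hQ'.trans (mul_le_mul_of_nonneg_left a1 hm₀)
  have hpow : κ ^ m ≤ (2 * κ) ^ m := pow_le_pow_left₀ hκ0 (by linarith) m
  refine norm_lyap_sub_le.trans ?_
  rw [abs_of_nonneg hγ0]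
  calc _ ≤ 4 * g * (m₀ * ((2 * κ) ^ (m + 1) * a) + κ ^ (m + 1) * r * (m₀ * (2 * κ * a)))
        + g ^ 2 * κ ^ (m + 1) * (m₀ * (2 * κ * a)) := by
        gcongr
        exact ha (m + 1)
    _ = (2 * κ) ^ m * (4 * g * (m₀ * (2 * κ)) * a)
        + κ ^ m * ((4 * g * (κ * r * (m₀ * (2 * κ))) + g ^ 2 * κ * (m₀ * (2 * κ))) * a) := by
        rw [pow_succ, pow_succ]; ring
    _ ≤ (2 * κ) ^ m * (4 * g * (m₀ * (2 * κ)) * a)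
        + (2 * κ) ^ m * ((4 * g * (κ * r * (m₀ * (2 * κ))) + g ^ 2 * κ * (m₀ * (2 * κ))) * a) := by
        gcongr
    _ = _ := by rw [fieldLip]; ring

/-- Bounds and Lipschitz bounds of the coefficients on the ball of radius `R`. -/
structure CoeffBounds (f : Vec2 l → Vec l → ℝ) (h : Mat2 l → ℝ) (U : Set (Mat2 l))
    (R m₀ : ℝ) : Prop where
  nonneg : 0 ≤ m₀
  bound : ∀ A ∈ psdPart U, ‖A‖ ≤ R → ‖driftH h A‖ ≤ m₀ ∧ ‖fisher f A‖ ≤ m₀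
  lip : ∀ A ∈ psdPart U, ∀ A' ∈ psdPart U, ‖A‖ ≤ R → ‖A'‖ ≤ R →
    ‖driftH h A - driftH h A'‖ ≤ m₀ * ‖A - A'‖ ∧ ‖fisher f A - fisher f A'‖ ≤ m₀ * ‖A - A'‖

section Solution

variable {X0 Xs : Matrix (Fin d) (Fin l) ℝ} {S : EReal} {B : ℝ → Fin d → Mat2 l} {T R : ℝ}

theorem IsSolution.momB_one_mem (hK : K.PosSemidef)
    (hB : IsSolution hK.isHermitian f h U γ X0 Xs S B) {t : ℝ} (h0 : 0 ≤ t) (ht : (t : EReal) < S) :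
    momB hK.isHermitian 1 (B t) ∈ psdPart U := by
  refine ⟨?_, momB_posSemidef hK 1 (hB.psd t h0 ht)⟩
  rw [← avgB_eq_momB]
  exact hB.mem t h0 ht

theorem IsSolution.hasDerivWithinAt_momField {hK : K.IsHermitian}
    (hB : IsSolution hK f h U γ X0 Xs S B) (m : ℕ) {t : ℝ} (h0 : 0 ≤ t) (ht : (t : EReal) < S) :
    HasDerivWithinAt (fun s => momB hK m (B s))
      (momField f h K γ (fun m => momB hK m (B t)) m) (Set.Ici 0) t :=
  hB.hasDerivWithinAt_momB m h0 ht

theorem IsSolution.norm_momB_sub_le (hd : 0 < d) (hK : K.PosSemidef)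
    (hκ : ∀ i, hK.isHermitian.eigenvalues i ≤ κ) (hγ0 : 0 ≤ γ) (hγ : γ ≤ g)
    (hB : IsSolution hK.isHermitian f h U γ X0 Xs S B) (hT : (T : EReal) < S)
    (hc : CoeffBounds f h U R m₀) (hrR : κ * r ≤ R)
    (hr : ∀ t ∈ Set.Icc 0 T, ∀ m, ‖momB hK.isHermitian m (B t)‖ ≤ κ ^ m * r) (m : ℕ)
    {s t : ℝ} (hs : s ∈ Set.Icc 0 T) (ht : t ∈ Set.Icc 0 T) :
    ‖momB hK.isHermitian m (B t) - momB hK.isHermitian m (B s)‖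
      ≤ κ ^ m * fieldBound g κ m₀ r * |t - s| := by
  have hlt : ∀ x ∈ Set.Icc 0 T, (x : EReal) < S := fun x hx =>
    lt_of_le_of_lt (EReal.coe_le_coe_iff.2 hx.2) hT
  refine (convex_Icc 0 T).norm_image_sub_le_of_norm_hasDerivWithin_le
    (f := fun t => momB hK.isHermitian m (B t))
    (f' := fun t => momField f h K γ (fun m => momB hK.isHermitian m (B t)) m)
    (fun x hx => ?_) (fun x hx => ?_) hs ht
  · exact (hB.hasDerivWithinAt_momField m hx.1 (hlt x hx)).mono Set.Icc_subset_Ici_self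
  · have h1 := hc.bound _ (hB.momB_one_mem hK hx.1 (hlt x hx))
      ((hr x hx 1).trans (by rw [pow_one]; exact hrR))
    exact norm_momField_le (M := fun m => momB hK.isHermitian m (B x)) hd hK hκ hγ0 hγ h1.1 h1.2 m (hr x hx (m + 1))

/-- During a time `τ` the moments move by `fieldBound * τ`, so the field changes by `fieldLip` times
this; the mean value inequality gives one more factor `τ`. -/
theorem IsSolution.norm_momB_euler_le (hd : 0 < d) (hK : K.PosSemidef)
    (hκ : ∀ i, hK.isHermitian.eigenvalues i ≤ κ) (hγ0 : 0 ≤ γ) (hγ : γ ≤ g) (hκ0 : 0 ≤ κ)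
    (hB : IsSolution hK.isHermitian f h U γ X0 Xs S B) (hT : (T : EReal) < S)
    (hc : CoeffBounds f h U R m₀) (hrR : κ * r ≤ R) (hr0 : 0 ≤ r)
    (hr : ∀ t ∈ Set.Icc 0 T, ∀ m, ‖momB hK.isHermitian m (B t)‖ ≤ κ ^ m * r) (m : ℕ)
    {s τ : ℝ} (hs : 0 ≤ s) (hτ : 0 ≤ τ) (hsT : s + τ ≤ T) :
    ‖momB hK.isHermitian m (B (s + τ)) - momB hK.isHermitian m (B s)
        - τ • momField f h K γ (fun m => momB hK.isHermitian m (B s)) m‖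
      ≤ (2 * κ) ^ m * (fieldLip g κ m₀ r * (fieldBound g κ m₀ r * τ)) * τ := by
  have hg : 0 ≤ g := hγ0.trans hγ
  have hm₀ := hc.nonneg
  have hsm : s ∈ Set.Icc 0 T := ⟨hs, by linarith⟩
  have hlt : ∀ x ∈ Set.Icc 0 T, (x : EReal) < S := fun x hx =>
    lt_of_le_of_lt (EReal.coe_le_coe_iff.2 hx.2) hT
  have hsub : Set.Icc s (s + τ) ⊆ Set.Icc 0 T := Set.Icc_subset_Icc hs hsT
  have hfb : 0 ≤ fieldBound g κ m₀ r := by unfold fieldBound; positivity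
  have hrad : ∀ x ∈ Set.Icc 0 T, ‖momB hK.isHermitian 1 (B x)‖ ≤ R := fun x hx =>
    (hr x hx 1).trans (by rw [pow_one]; exact hrR)
  have hmv := (convex_Icc s (s + τ)).norm_image_sub_le_of_norm_hasDerivWithin_le
    (f := fun t => momB hK.isHermitian m (B t)
      - (t - s) • momField f h K γ (fun m => momB hK.isHermitian m (B s)) m)
    (f' := fun t => momField f h K γ (fun m => momB hK.isHermitian m (B t)) m
      - momField f h K γ (fun m => momB hK.isHermitian m (B s)) m)
    (C := (2 * κ) ^ m * (fieldLip g κ m₀ r * (fieldBound g κ m₀ r * τ)))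
    (x := s) (y := s + τ) (fun x hx => ?_) (fun x hx => ?_)
    (Set.left_mem_Icc.2 (by linarith)) (Set.right_mem_Icc.2 (by linarith))
  · simp only [add_sub_cancel_left, sub_self, zero_smul, sub_zero] at hmv
    rw [Real.norm_eq_abs, abs_of_nonneg hτ] at hmv
    rw [sub_right_comm]
    exact hmv
  · have h1 := (hB.hasDerivWithinAt_momField m (hsub hx).1 (hlt x (hsub hx))).mono
      (hsub.trans Set.Icc_subset_Ici_self)
    have h2 : HasDerivWithinAt (fun t : ℝ => (t - s) •
        momField f h K γ (fun m => momB hK.isHermitian m (B s)) m)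
        ((1 : ℝ) • momField f h K γ (fun m => momB hK.isHermitian m (B s)) m)
        (Set.Icc s (s + τ)) x :=
      ((hasDerivWithinAt_id x _).sub_const s).smul_const _
    rw [one_smul] at h2
    exact h1.sub h2
  · have hxT := hsub hx
    have p1 := hB.momB_one_mem hK hxT.1 (hlt x hxT)
    have p2 := hB.momB_one_mem hK hs (hlt s hsm)
    have hl := hc.lip _ p1 _ p2 (hrad x hxT) (hrad s hsm)
    have hb := hc.bound _ p1 (hrad x hxT)
    refine norm_momField_sub_le (M := fun m => momB hK.isHermitian m (B x))
      (M' := fun m => momB hK.isHermitian m (B s)) hd hK hκ hγ0 hγ hκ0 hr0 hb.1 hl.1 hl.2 (fun k => ?_)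
      (mul_nonneg hfb hτ) m (hr s hsm (m + 1))
    refine (hB.norm_momB_sub_le hd hK hκ hγ0 hγ hT hc hrR hr k hsm hxT).trans ?_
    have hx1 : |x - s| ≤ τ := by
      rw [abs_of_nonneg (by linarith [hx.1])]; linarith [hx.2]
    have hpow : κ ^ k ≤ (2 * κ) ^ k := pow_le_pow_left₀ hκ0 (by linarith) k
    rw [mul_assoc]
    gcongr

end Solution

theorem abs_apply_le_norm {m n : Type*} [Fintype m] [Fintype n] (A : Matrix m n ℝ) (i : m) (j : n) :
    |A i j| ≤ ‖A‖ := by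
  refine abs_le_of_sq_le_sq ?_ (norm_nonneg A)
  rw [norm_sq_eq_sum]
  refine (Finset.single_le_sum (f := fun j => A i j ^ 2) (fun _ _ => sq_nonneg _)
    (Finset.mem_univ j)).trans ?_
  exact Finset.single_le_sum (f := fun i => ∑ j, A i j ^ 2)
    (fun _ _ => Finset.sum_nonneg fun _ _ => sq_nonneg _) (Finset.mem_univ i)

theorem norm_le_sum_abs {m n : Type*} [Fintype m] [Fintype n] (A : Matrix m n ℝ) :
    ‖A‖ ≤ ∑ i, ∑ j, |A i j| := by
  have h0 : ∀ i, 0 ≤ ∑ j, |A i j| := fun i => Finset.sum_nonneg fun _ _ => abs_nonneg _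
  refine le_of_sq_le_sq ?_ (Finset.sum_nonneg fun i _ => h0 i)
  rw [norm_sq_eq_sum]
  refine le_trans (Finset.sum_le_sum fun i _ => ?_) (Finset.sum_sq_le_sq_sum_of_nonneg fun i _ => h0 i)
  simp only [← sq_abs (A i _)]
  exact Finset.sum_sq_le_sq_sum_of_nonneg fun _ _ => abs_nonneg _

/-- Linear functionals of matrices are bounded. -/
theorem exists_abs_trace_mul_le (N : Mat2 l) : ∃ c : ℝ, 0 ≤ c ∧
    ∀ M : Mat2 l, |(M * N).trace| ≤ c * ‖M‖ := by
  refine ⟨∑ i, ∑ j, |N j i|, Finset.sum_nonneg fun _ _ => Finset.sum_nonneg fun _ _ =>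
    abs_nonneg _, fun M => ?_⟩
  rw [Finset.sum_mul, Matrix.trace]
  refine (Finset.abs_sum_le_sum_abs _ _).trans (Finset.sum_le_sum fun i _ => ?_)
  rw [Matrix.diag_apply, Matrix.mul_apply, Finset.sum_mul]
  refine (Finset.abs_sum_le_sum_abs _ _).trans (Finset.sum_le_sum fun j _ => ?_)
  rw [abs_mul, mul_comm]
  exact mul_le_mul_of_nonneg_left (abs_apply_le_norm M i j) (abs_nonneg _)

end MomentField


/-! ### Centred increments, cut off outside the good set. -/

section Noise

variable {d l : ℕ} {f : Vec2 l → Vec l → ℝ} {h : Mat2 l → ℝ} {U : Set (Mat2 l)} {α L Lh LI : ℝ}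
  {K : Matrix (Fin d) (Fin d) ℝ} {X0 X Xs : Matrix (Fin d) (Fin l) ℝ} {κ R Lhat γ g η : ℝ}

/-- The parameters at which the comparison with the deterministic equivalent is controlled. -/
def goodSet (K : Matrix (Fin d) (Fin d) ℝ) (U : Set (Mat2 l)) (Xs : Matrix (Fin d) (Fin l) ℝ)
    (η R : ℝ) : Set (Matrix (Fin d) (Fin l) ℝ) :=
  {X | covB K X Xs ∈ innerSet U η ∧ ‖Matrix.fromCols X Xs‖ ≤ R}

theorem measurableSet_goodSet (hη : 0 < η) : MeasurableSet (goodSet K U Xs η R) := by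
  have h1 : IsClosed {X | covB K X Xs ∈ innerSet U η} := by
    simp only [covB_eq_powB]
    exact (isClosed_innerSet hη).preimage (continuous_powB K 1 Xs)
  have h2 : IsClosed {X : Matrix (Fin d) (Fin l) ℝ | ‖Matrix.fromCols X Xs‖ ≤ R} :=
    isClosed_le (continuous_fromCols Xs).norm continuous_const
  exact (h1.inter h2).measurableSet

open Classical in
/-- The centred increments, on the good set. -/
def noise (f : Vec2 l → Vec l → ℝ) (K : Matrix (Fin d) (Fin d) ℝ) (Xs : Matrix (Fin d) (Fin l) ℝ)
    (γ : ℝ) (G : Set (Matrix (Fin d) (Fin l) ℝ)) (m : ℕ)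
    (ij : (Fin l ⊕ Fin l) × (Fin l ⊕ Fin l)) (s : Matrix (Fin d) (Fin l) ℝ × (Vec d × Vec l)) : ℝ :=
  if s.1 ∈ G then incr f K Xs γ m s ij.1 ij.2
    - ∫ y, incr f K Xs γ m (s.1, y) ij.1 ij.2 ∂(dataLaw l K) else 0

theorem measurable_noise (hfm : Measurable (Function.uncurry f))
    (hs : ∀ y e, ContDiff ℝ 1 (slice f y e)) {G : Set (Matrix (Fin d) (Fin l) ℝ)}
    (hG : MeasurableSet G) (γ : ℝ) (m : ℕ) (ij : (Fin l ⊕ Fin l) × (Fin l ⊕ Fin l)) :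
    Measurable (noise f K Xs γ G m ij) := by
  classical
  have h1 := measurable_incr hfm hs K Xs γ m ij.1 ij.2
  have h2 : Measurable fun X : Matrix (Fin d) (Fin l) ℝ =>
      ∫ y, incr f K Xs γ m (X, y) ij.1 ij.2 ∂(dataLaw l K) :=
    (h1.stronglyMeasurable.integral_prod_right').measurable
  exact Measurable.ite (measurable_fst hG) (h1.sub (h2.comp measurable_fst)) measurable_const

/-- The cut-off makes the moment bounds hold at every state, as the deviation bound demands, while
the chain itself is not stopped. -/
theorem lpLE_noise (hd : 0 < d) (hfm : Measurable (Function.uncurry f)) (hL : 0 < Lhat)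
    (hsmooth : ∀ y e : Vec l, IsLSmooth Lhat (slice f y e))
    (hK : K.PosSemidef) (hκ : ∀ i, hK.isHermitian.eigenvalues i ≤ κ) (hκ1 : 1 ≤ κ) (hR : 0 ≤ R)
    (hmin : ∀ᵐ z ∂(dataLaw l K), ∀ x : Vec l,
      slice f (contract Xs z.1) z.2 (contract Xs z.1) ≤ slice f (contract Xs z.1) z.2 x)
    (hγ : 0 ≤ γ) (m : ℕ) (ij : (Fin l ⊕ Fin l) × (Fin l ⊕ Fin l)) {p : ENNReal}
    (hp1 : 1 ≤ p) (hp : p ≠ ⊤) (X : Matrix (Fin d) (Fin l) ℝ) :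
    LpLE (dataLaw l K) p (fun z => noise f K Xs γ (goodSet K U Xs η R) m ij (X, z))
      (κ ^ m * (2 / d * stepConst l Lhat κ R γ (gaussMom (2 * (2 * p))))) := by
  by_cases hX : X ∈ goodSet K U Xs η R
  · simp only [noise, if_pos hX]
    refine ((lpLE_incr hd hfm hL hsmooth hK hκ hκ1 hX.2 hmin hγ m ij.1 ij.2
      hp1 hp).sub_integral hp1).mono (le_of_eq ?_)
    ring
  · simp only [noise, if_neg hX]
    have hN := gaussMom_nonneg (2 * (2 * p))
    have hg : 0 ≤ gradConst l Lhat κ R := by unfold gradConst; positivity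
    refine ⟨aestronglyMeasurable_const, ?_, ?_⟩
    · unfold stepConst; positivity
    · have := eLpNorm_zero (p := p) (μ := dataLaw l K) (ε := ℝ)
      exact (le_of_eq this).trans zero_le

theorem integral_noise (hd : 0 < d) (hfm : Measurable (Function.uncurry f)) (hL : 0 < Lhat)
    (hsmooth : ∀ y e : Vec l, IsLSmooth Lhat (slice f y e))
    (hK : K.PosSemidef) (hκ : ∀ i, hK.isHermitian.eigenvalues i ≤ κ) (hκ1 : 1 ≤ κ)
    (hmin : ∀ᵐ z ∂(dataLaw l K), ∀ x : Vec l,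
      slice f (contract Xs z.1) z.2 (contract Xs z.1) ≤ slice f (contract Xs z.1) z.2 x)
    (hγ : 0 ≤ γ) (m : ℕ) (ij : (Fin l ⊕ Fin l) × (Fin l ⊕ Fin l))
    (X : Matrix (Fin d) (Fin l) ℝ) :
    ∫ z, noise f K Xs γ (goodSet K U Xs η R) m ij (X, z) ∂(dataLaw l K) = 0 := by
  by_cases hX : X ∈ goodSet K U Xs η R
  · simp only [noise, if_pos hX]
    rw [integral_sub ((lpLE_incr hd hfm hL hsmooth hK hκ hκ1 hX.2 hmin hγ m ij.1 ij.2
      le_rfl ENNReal.one_ne_top).integrable le_rfl) (integrable_const _)]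
    simp
  · simp [noise, if_neg hX]

theorem noise_moments (hd : 0 < d) (hfm : Measurable (Function.uncurry f)) (hL : 0 < Lhat)
    (hsmooth : ∀ y e : Vec l, IsLSmooth Lhat (slice f y e))
    (hK : K.PosSemidef) (hκ : ∀ i, hK.isHermitian.eigenvalues i ≤ κ) (hκ1 : 1 ≤ κ) (hR : 0 ≤ R)
    (hmin : ∀ᵐ z ∂(dataLaw l K), ∀ x : Vec l,
      slice f (contract Xs z.1) z.2 (contract Xs z.1) ≤ slice f (contract Xs z.1) z.2 x)
    (hγ : 0 ≤ γ) (m : ℕ) (ij : (Fin l ⊕ Fin l) × (Fin l ⊕ Fin l))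
    (X : Matrix (Fin d) (Fin l) ℝ) {q : ℕ} :
    (∀ j : ℕ, Integrable (fun z => noise f K Xs γ (goodSet K U Xs η R) m ij (X, z) ^ j)
      (dataLaw l K)) ∧
    ∀ j ≤ q, ∫ z, noise f K Xs γ (goodSet K U Xs η R) m ij (X, z) ^ (2 * j) ∂(dataLaw l K)
      ≤ (κ ^ m * (2 / d * stepConst l Lhat κ R γ
        (gaussMom (2 * (2 * ((2 * q : ℕ) : ENNReal)))))) ^ (2 * j) := by
  have hLp := fun (p : ENNReal) hp1 hp => lpLE_noise (U := U) (η := η) (p := p) hd hfm hL hsmooth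
    hK hκ hκ1 hR hmin hγ m ij hp1 hp X
  constructor
  · intro j
    rcases Nat.eq_zero_or_pos j with rfl | hj
    · simp
    · have h1 := hLp j (by exact_mod_cast hj) (ENNReal.natCast_ne_top j)
      have h2 := h1.memLp.integrable_norm_pow hj.ne'
      refine h2.mono (h1.meas.pow j) (ae_of_all _ fun z => ?_)
      simp
  · intro j hj
    rcases Nat.eq_zero_or_pos j with rfl | hj0
    · simp
    · have h1 := hLp ((2 * q : ℕ) : ENNReal) (by exact_mod_cast (by omega : 1 ≤ 2 * q))
        (ENNReal.natCast_ne_top _)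
      exact ((h1.mono_exponent (p := ((2 * j : ℕ) : ENNReal))
        (by exact_mod_cast (by omega : 2 * j ≤ 2 * q))).integral_pow_le hj0.ne').2

end Noise

/-! ### Comparison along a trajectory -/

section Comparison

variable {d l : ℕ} {f : Vec2 l → Vec l → ℝ} {h : Mat2 l → ℝ} {U : Set (Mat2 l)} {α L Lh LI : ℝ}
  {K : Matrix (Fin d) (Fin d) ℝ} {X0 X Xs : Matrix (Fin d) (Fin l) ℝ} {κ R Lhat γ g η m₀ r T : ℝ}
  {S : EReal} {B : ℝ → Fin d → Mat2 l}

theorem trace_powB_zero (X Xs : Matrix (Fin d) (Fin l) ℝ) :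
    (powB K 0 X Xs).trace = ‖Matrix.fromCols X Xs‖ ^ 2 := by
  rw [powB, pow_zero, Matrix.mul_one, norm_sq_eq_sum, Finset.sum_comm]
  simp only [Matrix.trace, Matrix.diag_apply, Matrix.mul_apply, Matrix.transpose_apply, sq]

theorem norm_covB_le (hK : K.PosSemidef) (hκ : ∀ i, hK.isHermitian.eigenvalues i ≤ κ)
    (X Xs : Matrix (Fin d) (Fin l) ℝ) : ‖covB K X Xs‖ ≤ κ * ‖Matrix.fromCols X Xs‖ ^ 2 := by
  refine (norm_le_trace (covB_posSemidef hK X Xs)).trans ?_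
  rw [norm_sq_eq_sum, Finset.sum_comm, Finset.mul_sum, Matrix.trace]
  refine Finset.sum_le_sum fun p _ => ?_
  have h1 := dotProduct_pow_mulVec_le hK hκ 1 (fun j => Matrix.fromCols X Xs j p)
  rw [pow_one, pow_one] at h1
  have e1 : (covB K X Xs).diag p = (fun j => Matrix.fromCols X Xs j p) ⬝ᵥ
      K.mulVec (fun j => Matrix.fromCols X Xs j p) := by
    rw [covB, Matrix.diag_apply, Matrix.mul_assoc, Matrix.mul_apply]
    simp only [dotProduct, Matrix.mulVec, Matrix.mul_apply, Matrix.transpose_apply]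
  rw [e1]
  refine h1.trans (le_of_eq ?_)
  simp only [dotProduct, sq]

theorem mem_innerSet_half {A A' : Mat2 l} (hη : 0 < η) (hA : A ∈ innerSet U η)
    (hAA : ‖A' - A‖ ≤ η / 2) : A' ∈ innerSet U (η / 2) := by
  have h1 : ∀ V, V ∉ U → η / 2 ≤ ‖A' - V‖ := fun V hV => by
    have h2 := hA.2 V hV
    have h3 := norm_sub_le (A' - V) (A' - A)
    rw [sub_sub_sub_cancel_left] at h3
    linarith
  refine ⟨?_, h1⟩
  by_contra hV
  have := h1 A' hV
  rw [sub_self, norm_zero] at this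
  linarith

/-- The error in one step of the comparison. -/
def stepErr (d l : ℕ) (Lhat κ R g m₀ r : ℝ) : ℝ :=
  (2 * l) ^ 2 * (meanConst l Lhat κ R g / (d * Real.sqrt d))
    + fieldLip g κ m₀ r * fieldBound g κ m₀ r / d / d

theorem norm_le_of_entries {A : Mat2 l} {c : ℝ} (hA : ∀ i j, |A i j| ≤ c) :
    ‖A‖ ≤ (2 * l) ^ 2 * c := by
  refine (norm_le_sum_abs A).trans ((Finset.sum_le_sum fun i _ => Finset.sum_le_sum fun j _ =>
    hA i j).trans (le_of_eq ?_))
  simp only [Finset.sum_const, Finset.card_univ, Fintype.card_sum, Fintype.card_fin, nsmul_eq_mul]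
  push_cast
  ring

theorem meanConst_mono (hg : γ ≤ g) (hγ0 : 0 ≤ γ) (hκ : 0 ≤ κ) :
    meanConst l Lhat κ R γ ≤ meanConst l Lhat κ R g := by
  unfold meanConst
  have := mul_self_nonneg (gradConst l Lhat κ R * gaussMom 4)
  gcongr

/-- A pathwise statement: once the sums of the noise are small, `discrete_gronwall` applies to `P_m
- M_m`. The field difference supplies the Lipschitz constant `fieldLip / d`, and the errors of the
conditional mean and of the Euler step make up `stepErr`. -/
theorem norm_powB_sub_momB_le (hd : 0 < d)
    (hh : RiskRepresentation α Lh U f h)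
    (hfm : Measurable (Function.uncurry f)) (hL : 0 < Lhat)
    (hsmooth : ∀ y e : Vec l, IsLSmooth Lhat (slice f y e))
    (hK : K.PosSemidef) (hκ : ∀ i, hK.isHermitian.eigenvalues i ≤ κ) (hκ1 : 1 ≤ κ)
    (hmin : ∀ᵐ z ∂(dataLaw l K), ∀ x : Vec l,
      slice f (contract Xs z.1) z.2 (contract Xs z.1) ≤ slice f (contract Xs z.1) z.2 x)
    (hg : UnbiasedGradient U f K Xs) (hγ0 : 0 ≤ γ) (hγ : γ ≤ g)
    (hB : IsSolution hK.isHermitian f h U γ X0 Xs S B) (hT : (T : EReal) < S)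
    (hη : 0 < η) (hin : ∀ t ∈ Set.Icc 0 T, avgB hK.isHermitian (B t) ∈ innerSet U η)
    (hr0 : 0 ≤ r) (hr : ∀ t ∈ Set.Icc 0 T, (momB hK.isHermitian 0 (B t)).trace ≤ r)
    {c : ℝ} (hc : ∀ M : Mat2 l, |(M * 1).trace| ≤ c * ‖M‖) (hc0 : 0 ≤ c)
    (hR0 : 0 ≤ R) (hR : r + c ≤ R ^ 2) (hcb : CoeffBounds f h U (κ * R ^ 2) m₀)
    {x : ℕ → Matrix (Fin d) (Fin l) ℝ} {z : ℕ → Vec d × Vec l} (hx0 : x 0 = X0)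
    (hx : ∀ n, x (n + 1) = sgdStep f Xs γ (x n, z n)) {N : ℕ} (hN : (N : ℝ) ≤ T * d) {δ ε : ℝ}
    (hδ : 0 ≤ δ)
    (hdev : ∀ n ≤ N, ∀ m ij, |∑ k ∈ Finset.range n,
      noise f K Xs γ (goodSet K U Xs (η / 2) R) m ij (x k, z k)| ≤ (2 * κ) ^ m * δ)
    (hε1 : ε ≤ 1) (hεη : 2 * κ * ε ≤ η / 2)
    (hε : ((2 * l) ^ 2 * δ + N * stepErr d l Lhat κ R g m₀ r)
      * (1 + fieldLip g κ m₀ r / d) ^ N ≤ ε) :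
    ∀ n ≤ N, ∀ m, ‖powB K m (x n) Xs - momB hK.isHermitian m (B (n / d))‖
      ≤ (2 * κ) ^ m * (((2 * l) ^ 2 * δ + N * stepErr d l Lhat κ R g m₀ r)
      * (1 + fieldLip g κ m₀ r / d) ^ n) := by
  have hH := hK.isHermitian
  have hd' : (0 : ℝ) < d := by positivity
  have hκ0 : 0 ≤ κ := by linarith
  have hg0 : 0 ≤ g := hγ0.trans hγ
  have hm₀ := hcb.nonneg
  have hT0 : 0 ≤ T := by
    by_contra hT0
    have : T * d < 0 := mul_neg_of_neg_of_pos (not_le.1 hT0) hd'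
    linarith [(Nat.cast_nonneg N : (0 : ℝ) ≤ N)]
  have hlip0 : 0 ≤ fieldLip g κ m₀ r := by unfold fieldLip; positivity
  have hfb0 : 0 ≤ fieldBound g κ m₀ r := by unfold fieldBound; positivity
  have hmc0 : 0 ≤ meanConst l Lhat κ R g := by
    unfold meanConst
    have := mul_self_nonneg (gradConst l Lhat κ R * gaussMom 4)
    positivity
  have htime : ∀ n ≤ N, (n : ℝ) / d ∈ Set.Icc 0 T := fun n hn => by
    refine ⟨by positivity, ?_⟩
    rw [div_le_iff₀ hd']
    have : (n : ℝ) ≤ N := by exact_mod_cast hn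
    linarith
  have hlt : ∀ t ∈ Set.Icc 0 T, (t : EReal) < S := fun t ht =>
    lt_of_le_of_lt (EReal.coe_le_coe_iff.2 ht.2) hT
  have hnorm : ∀ t ∈ Set.Icc 0 T, ∀ m, ‖momB hH m (B t)‖ ≤ κ ^ m * r := fun t ht m =>
    (norm_momB_le hK hκ m (hB.psd t ht.1 (hlt t ht))).trans
      (mul_le_mul_of_nonneg_left (hr t ht) (by positivity))
  have hrR : κ * r ≤ κ * R ^ 2 := mul_le_mul_of_nonneg_left (by linarith) hκ0
  obtain ⟨G, hG⟩ : ∃ G, G = goodSet K U Xs (η / 2) R := ⟨_, rfl⟩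
  rw [← hG] at hdev
  refine discrete_gronwall
    (e := fun n m => powB K m (x n) Xs - momB hH m (B (n / d)))
    (ψ := fun n m => Matrix.of fun i j => noise f K Xs γ G m (i, j) (x n, z n))
    (good := fun n => x n ∈ G) (ε := ε)
    (by positivity) (by positivity) (by unfold stepErr; positivity) (by positivity)
    (fun m => ?_) (fun n hn m => ?_) (fun n hn hbd => ?_) (fun n hn hgood a ha0 ha hbd m => ?_) hε
  · rw [hx0, Nat.cast_zero, zero_div, show B 0 = odeInit hH X0 Xs from funext hB.init,
      momB_odeInit hd, sub_self]
  · rw [mul_left_comm]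
    refine norm_le_of_entries fun i j => ?_
    rw [Matrix.sum_apply]
    exact hdev n hn m (i, j)
  · have ht := htime n hn
    rw [hG]
    refine ⟨?_, ?_⟩
    · rw [covB_eq_powB]
      refine mem_innerSet_half hη (hin _ ht) ?_
      rw [avgB_eq_momB]
      refine (hbd 1).trans ?_
      rw [pow_one]; exact hεη
    -- The trace of `P_0` is `‖W‖²`. Since `tr M_0 ≤ r` and the error is at most `1`, it is bounded
    -- by `r + c ≤ R²`.
    · have h1 := hc (powB K 0 (x n) Xs - momB hH 0 (B (n / d)))
      rw [Matrix.mul_one, Matrix.trace_sub, trace_powB_zero] at h1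
      have h2 := hbd 0
      rw [pow_zero, one_mul] at h2
      have h3 := mul_le_mul_of_nonneg_left (h2.trans hε1) hc0
      have h4 := hr _ ht
      have h5 := le_abs_self (‖Matrix.fromCols (x n) Xs‖ ^ 2 - (momB hH 0 (B (n / d))).trace)
      exact le_of_sq_le_sq (by linarith) hR0
  · have hnN : n ≤ N := hn.le
    have ht := htime n hnN
    have ht' := htime (n + 1) hn
    have hgood' := hgood
    rw [hG] at hgood'
    have hU : covB K (x n) Xs ∈ U := hgood'.1.1
    have hpU : covB K (x n) Xs ∈ psdPart U := ⟨hU, covB_posSemidef hK _ _⟩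
    have hcov : ‖covB K (x n) Xs‖ ≤ κ * R ^ 2 := (norm_covB_le hK hκ _ _).trans
      (mul_le_mul_of_nonneg_left (pow_le_pow_left₀ (norm_nonneg _) hgood'.2 2) hκ0)
    have hmom1 : ‖momB hH 1 (B (n / d))‖ ≤ κ * R ^ 2 :=
      (hnorm _ ht 1).trans (by rw [pow_one]; exact hrR)
    have hsucc : ((n + 1 : ℕ) : ℝ) / d = n / d + 1 / d := by push_cast; ring
    -- the three errors
    have h1 : ‖(Matrix.of fun i j => ∫ y, incr f K Xs γ m (x n, y) i j ∂(dataLaw l K) : Mat2 l)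
        - (1 / (d : ℝ)) • momField f h K γ (fun m => powB K m (x n) Xs) m‖
        ≤ (2 * l) ^ 2 * ((2 * κ) ^ m * (meanConst l Lhat κ R g / (d * Real.sqrt d))) := by
      refine norm_le_of_entries fun i j => ?_
      have h2 := abs_integral_incr_sub_le (γ := γ) hd hh hfm hL hsmooth hK hκ hκ1 hgood'.2 hmin hU
        hg m i j
      rw [covB_eq_powB] at h2
      refine h2.trans ?_
      rw [mul_div_assoc]
      have h3 := meanConst_mono (l := l) (Lhat := Lhat) (R := R) hγ hγ0 hκ0
      have h4 : κ ^ m ≤ (2 * κ) ^ m := pow_le_pow_left₀ hκ0 (by linarith) m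
      exact (mul_le_mul_of_nonneg_left (div_le_div_of_nonneg_right h3 (by positivity))
        (by positivity)).trans (mul_le_mul_of_nonneg_right h4 (by positivity))
    have h2 : ‖(1 / (d : ℝ)) • (momField f h K γ (fun m => powB K m (x n) Xs) m
        - momField f h K γ (fun m => momB hH m (B (n / d))) m)‖
        ≤ 1 / d * ((2 * κ) ^ m * (fieldLip g κ m₀ r * a)) := by
      rw [norm_smul, Real.norm_eq_abs, abs_of_nonneg (by positivity)]
      refine mul_le_mul_of_nonneg_left ?_ (by positivity)
      have p2 := hB.momB_one_mem hK ht.1 (hlt _ ht)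
      rw [covB_eq_powB] at hpU hcov
      have hb := hcb.bound _ hpU hcov
      have hl := hcb.lip _ hpU _ p2 hcov hmom1
      exact norm_momField_sub_le (M := fun m => powB K m (x n) Xs)
        (M' := fun m => momB hH m (B (n / d))) hd hK hκ hγ0 hγ hκ0 hr0 hb.1 hl.1 hl.2 hbd ha0 m
        (hnorm _ ht (m + 1))
    have h3 := hB.norm_momB_euler_le hd hK hκ hγ0 hγ hκ0 hT hcb hrR hr0 hnorm m ht.1
      (τ := 1 / d) (by positivity) (by rw [← hsucc]; exact ht'.2)
    have hψ : (Matrix.of fun i j => noise f K Xs γ G m (i, j) (x n, z n) : Mat2 l)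
        = incr f K Xs γ m (x n, z n)
          - Matrix.of fun i j => ∫ y, incr f K Xs γ m (x n, y) i j ∂(dataLaw l K) := by
      ext i j
      simp [noise, if_pos hgood]
    -- Once the noise is subtracted, only the conditional mean of the SGD increment is left. It is
    -- compared with the field at `P`, then with the field at `M`, then with the actual increment of
    -- `M`.
    have hsplit : powB K m (x (n + 1)) Xs - momB hH m (B ((n + 1 : ℕ) / d))
        - (powB K m (x n) Xs - momB hH m (B (n / d)))
        - (Matrix.of fun i j => noise f K Xs γ G m (i, j) (x n, z n) : Mat2 l)
        = ((Matrix.of fun i j => ∫ y, incr f K Xs γ m (x n, y) i j ∂(dataLaw l K) : Mat2 l)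
            - (1 / (d : ℝ)) • momField f h K γ (fun m => powB K m (x n) Xs) m)
          + (1 / (d : ℝ)) • (momField f h K γ (fun m => powB K m (x n) Xs) m
            - momField f h K γ (fun m => momB hH m (B (n / d))) m)
          - (momB hH m (B (n / d + 1 / d)) - momB hH m (B (n / d))
            - (1 / (d : ℝ)) • momField f h K γ (fun m => momB hH m (B (n / d))) m) := by
      rw [hψ, hx, hsucc, incr, smul_sub]
      abel
    rw [hsplit]
    refine (norm_sub_le _ _).trans ((add_le_add ((norm_add_le _ _).trans (add_le_add h1 h2))
      h3).trans (le_of_eq ?_))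
    unfold stepErr
    ring

end Comparison


/-! ### The comparison with overwhelming probability -/

/-- The samples are measurable only up to null sets. Passing to measurable modifications changes
neither their laws, nor their independence, nor the probability of the event. -/
theorem exists_deviation_bound_ae (q : ℕ) (hq : q ≠ 0) : ∃ c : ℝ, 0 ≤ c ∧
    ∀ {Ω S Z ι : Type*} [MeasurableSpace Ω] [MeasurableSpace S] [MeasurableSpace Z] [Fintype ι]
      {P : Measure Ω} [IsProbabilityMeasure P] {μ : Measure Z} [IsProbabilityMeasure μ]
      {Φ : S × Z → S} (_ : Measurable Φ) (s₀ : S)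
      {z : ℕ → Ω → Z} (_ : ∀ k, HasLaw (z k) μ P) (_ : iIndepFun z P)
      {ψ : ℕ → ι → S × Z → ℝ} (_ : ∀ m i, Measurable (ψ m i)) {A κ : ℝ} (_ : 0 ≤ A) (_ : 0 < κ)
      (_ : ∀ m i x, ∀ j, Integrable (fun y => ψ m i (x, y) ^ j) μ)
      (_ : ∀ m i x, ∀ j ≤ q, ∫ y, ψ m i (x, y) ^ (2 * j) ∂μ ≤ (κ ^ m * A) ^ (2 * j))
      (_ : ∀ m i x, ∫ y, ψ m i (x, y) ∂μ = 0) (N : ℕ) {δ : ℝ} (_ : 0 < δ),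
      P {ω | ∃ n ≤ N, ∃ m i, (2 * κ) ^ m * δ
          < |∑ k ∈ Finset.range n, ψ m i (chain Φ s₀ (fun j => z j ω) k, z k ω)|}
        ≤ ENNReal.ofReal (c * Fintype.card ι * (N + 1) ^ (q + 1) * (A / δ) ^ (2 * q)) := by
  obtain ⟨c, hc, hdev⟩ := exists_deviation_bound q hq
  refine ⟨c, hc, ?_⟩
  intro Ω S Z ι _ _ _ _ P _ μ _ Φ hΦ s₀ z hz hind ψ hψ A κ hA hκ hint hmo hmean N δ hδ
  have hae : ∀ k, z k =ᵐ[P] (hz k).aemeasurable.mk (z k) := fun k => (hz k).aemeasurable.ae_eq_mk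
  have h1 := hdev hΦ s₀ (z := fun k => (hz k).aemeasurable.mk (z k))
    (fun k => (hz k).aemeasurable.measurable_mk)
    (fun k => by rw [← Measure.map_congr (hae k), (hz k).map_eq])
    (hind.congr hae) hψ hA hκ hint hmo hmean N hδ
  refine le_trans (le_of_eq (measure_congr ?_)) h1
  filter_upwards [ae_all_iff.2 hae] with ω hω
  have e1 : (fun j => z j ω) = fun j => (hz j).aemeasurable.mk (z j) ω := funext hω
  refine propext ?_
  change (∃ n ≤ N, ∃ m i, (2 * κ) ^ m * δ
      < |∑ k ∈ Finset.range n, ψ m i (chain Φ s₀ (fun j => z j ω) k, z k ω)|)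
    ↔ (∃ n ≤ N, ∃ m i, (2 * κ) ^ m * δ
      < |∑ k ∈ Finset.range n, ψ m i (chain Φ s₀ (fun j => (hz j).aemeasurable.mk (z j) ω) k,
        (hz k).aemeasurable.mk (z k) ω)|)
  rw [e1]
  simp only [hω]

section Final

variable {d l : ℕ} {f : Vec2 l → Vec l → ℝ} {h : Mat2 l → ℝ} {U : Set (Mat2 l)} {α L Lh LI : ℝ}
  {K : Matrix (Fin d) (Fin d) ℝ} {X0 X Xs : Matrix (Fin d) (Fin l) ℝ} {κ R Lhat γ g η m₀ r T : ℝ}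
  {S : EReal} {B : ℝ → Fin d → Mat2 l}

theorem sgd_eq_chain (γ : ℝ) (a : ℕ → Vec d) (e : ℕ → Vec l) (k : ℕ) :
    sgd f Xs X0 γ a e k = chain (sgdStep f Xs γ) X0 (fun k => (a k, e k)) k := by
  induction k with
  | zero => rfl
  | succ k ih => rw [sgd, ih]; rfl

/-- The case `m = 0` of the comparison at the grid time `⌊td⌋/d`, tested against `diffForm`. Moving
from the grid time to `t` costs `fieldBound / d`. -/
theorem abs_norm_sq_sub_distSq_le (hd : 0 < d)
    (hh : RiskRepresentation α Lh U f h)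
    (hfm : Measurable (Function.uncurry f)) (hL : 0 < Lhat)
    (hsmooth : ∀ y e : Vec l, IsLSmooth Lhat (slice f y e))
    (hK : K.PosSemidef) (hκ : ∀ i, hK.isHermitian.eigenvalues i ≤ κ) (hκ1 : 1 ≤ κ)
    (hmin : ∀ᵐ z ∂(dataLaw l K), ∀ x : Vec l,
      slice f (contract Xs z.1) z.2 (contract Xs z.1) ≤ slice f (contract Xs z.1) z.2 x)
    (hg : UnbiasedGradient U f K Xs) (hγ0 : 0 ≤ γ) (hγ : γ ≤ g)
    (hB : IsSolution hK.isHermitian f h U γ X0 Xs S B) (hT : (T : EReal) < S) (hT0 : 0 ≤ T)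
    (hη : 0 < η) (hin : ∀ t ∈ Set.Icc 0 T, avgB hK.isHermitian (B t) ∈ innerSet U η)
    (hr0 : 0 ≤ r) (hr : ∀ t ∈ Set.Icc 0 T, (momB hK.isHermitian 0 (B t)).trace ≤ r)
    {c : ℝ} (hc : ∀ M : Mat2 l, |(M * 1).trace| ≤ c * ‖M‖) (hc0 : 0 ≤ c)
    {c' : ℝ} (hc' : ∀ M : Mat2 l, |(M * diffForm l).trace| ≤ c' * ‖M‖) (hc'0 : 0 ≤ c')
    (hR0 : 0 ≤ R) (hR : r + c ≤ R ^ 2) (hcb : CoeffBounds f h U (κ * R ^ 2) m₀)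
    {x : ℕ → Matrix (Fin d) (Fin l) ℝ} {z : ℕ → Vec d × Vec l} (hx0 : x 0 = X0)
    (hx : ∀ n, x (n + 1) = sgdStep f Xs γ (x n, z n)) {δ ε : ℝ}
    (hδ : 0 ≤ δ)
    (hdev : ∀ n ≤ ⌊T * d⌋₊, ∀ m ij, |∑ k ∈ Finset.range n,
      noise f K Xs γ (goodSet K U Xs (η / 2) R) m ij (x k, z k)| ≤ (2 * κ) ^ m * δ)
    (hε1 : ε ≤ 1) (hεη : 2 * κ * ε ≤ η / 2)
    (hε : ((2 * l) ^ 2 * δ + ⌊T * d⌋₊ * stepErr d l Lhat κ R g m₀ r)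
      * (1 + fieldLip g κ m₀ r / d) ^ ⌊T * d⌋₊ ≤ ε) {t : ℝ} (ht0 : 0 ≤ t) (htT : t ≤ T) :
    |‖x ⌊t * d⌋₊ - Xs‖ ^ 2 - distSq (B t)| ≤ c' * (ε + fieldBound g κ m₀ r / d) := by
  have hH := hK.isHermitian
  have hd' : (0 : ℝ) < d := by positivity
  have hκ0 : 0 ≤ κ := by linarith
  have hg0 : 0 ≤ g := hγ0.trans hγ
  have hm₀ := hcb.nonneg
  have hlip0 : 0 ≤ fieldLip g κ m₀ r := by unfold fieldLip; positivity
  have hfb0 : 0 ≤ fieldBound g κ m₀ r := by unfold fieldBound; positivity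
  have hmc0 : 0 ≤ meanConst l Lhat κ R g := by
    unfold meanConst
    have := mul_self_nonneg (gradConst l Lhat κ R * gaussMom 4)
    positivity
  have hlt : ∀ t ∈ Set.Icc 0 T, (t : EReal) < S := fun t ht =>
    lt_of_le_of_lt (EReal.coe_le_coe_iff.2 ht.2) hT
  have hnorm : ∀ t ∈ Set.Icc 0 T, ∀ m, ‖momB hH m (B t)‖ ≤ κ ^ m * r := fun t ht m =>
    (norm_momB_le hK hκ m (hB.psd t ht.1 (hlt t ht))).trans
      (mul_le_mul_of_nonneg_left (hr t ht) (by positivity))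
  have ht : t ∈ Set.Icc 0 T := ⟨ht0, htT⟩
  have htd : 0 ≤ t * d := by positivity
  have hfl : (⌊t * d⌋₊ : ℝ) ≤ t * d := Nat.floor_le htd
  have hfl' : t * d < ⌊t * d⌋₊ + 1 := Nat.lt_floor_add_one _
  have hnN : ⌊t * d⌋₊ ≤ ⌊T * d⌋₊ := Nat.floor_le_floor (mul_le_mul_of_nonneg_right htT hd'.le)
  obtain ⟨n, hn⟩ : ∃ n, n = ⌊t * d⌋₊ := ⟨_, rfl⟩
  rw [← hn] at hfl hfl' hnN ⊢
  have hs0 : (n : ℝ) / d ≤ t := by rwa [div_le_iff₀ hd']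
  have hs : (n : ℝ) / d ∈ Set.Icc 0 T := ⟨by positivity, hs0.trans htT⟩
  have hts : |t - n / d| ≤ 1 / d := by
    rw [abs_of_nonneg (by linarith), sub_le_iff_le_add, ← add_div, le_div_iff₀ hd']
    linarith
  have h1 := norm_powB_sub_momB_le hd hh hfm hL hsmooth hK hκ hκ1 hmin hg hγ0 hγ hB hT hη hin hr0 hr
    hc hc0 hR0 hR hcb hx0 hx (Nat.floor_le (by positivity)) hδ hdev hε1 hεη hε n hnN 0
  have h2 := hB.norm_momB_sub_le hd hK hκ hγ0 hγ hT hcb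
    (mul_le_mul_of_nonneg_left (by linarith) hκ0) hnorm 0 hs ht
  rw [pow_zero, one_mul] at h1 h2
  have hse0 : 0 ≤ stepErr d l Lhat κ R g m₀ r := by unfold stepErr; positivity
  have hpow : (1 + fieldLip g κ m₀ r / d) ^ n ≤ (1 + fieldLip g κ m₀ r / d) ^ ⌊T * d⌋₊ := by
    refine pow_le_pow_right₀ ?_ hnN
    have : 0 ≤ fieldLip g κ m₀ r / d := by positivity
    linarith
  have h3 := h1.trans ((mul_le_mul_of_nonneg_left hpow (by positivity)).trans hε)
  have h4 : ‖momB hH 0 (B t) - momB hH 0 (B (n / d))‖ ≤ fieldBound g κ m₀ r / d := by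
    refine h2.trans ((mul_le_mul_of_nonneg_left hts hfb0).trans (le_of_eq ?_))
    ring
  have h5 : ‖x n - Xs‖ ^ 2 - distSq (B t)
      = ((powB K 0 (x n) Xs - momB hH 0 (B t)) * diffForm l).trace := by
    rw [Matrix.sub_mul, Matrix.trace_sub, trace_powB_zero_diffForm,
      distSq_eq_trace hH (hB.psd t ht0 (hlt t ht))]
  have h6 : ‖powB K 0 (x n) Xs - momB hH 0 (B t)‖ ≤ ε + fieldBound g κ m₀ r / d := by
    have e1 : powB K 0 (x n) Xs - momB hH 0 (B t)
        = (powB K 0 (x n) Xs - momB hH 0 (B (n / d)))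
          - (momB hH 0 (B t) - momB hH 0 (B (n / d))) := by abel
    rw [e1]
    exact (norm_sub_le _ _).trans (add_le_add h3 h4)
  rw [h5]
  exact (hc' _).trans (mul_le_mul_of_nonneg_left h6 hc'0)

theorem stepConst_mono {N : ℝ} (hγ0 : 0 ≤ γ) (hγ : γ ≤ g) (hκ : 0 ≤ κ) (hR : 0 ≤ R) (hL : 0 ≤ Lhat)
    (hN : 0 ≤ N) : stepConst l Lhat κ R γ N ≤ stepConst l Lhat κ R g N := by
  have : 0 ≤ gradConst l Lhat κ R := by unfold gradConst; positivity
  unfold stepConst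
  gcongr

/-- The size of the comparison error, for the deviation `δ`. -/
theorem comparison_error_le (hd : 0 < d) {lam fb mc T δ : ℝ} (hlam : 0 ≤ lam) (hfb : 0 ≤ fb)
    (hmc : 0 ≤ mc) (hT : 0 ≤ T) (hδ : 0 ≤ δ) (h1 : 1 / (d : ℝ) ≤ δ) (h2 : 1 / Real.sqrt d ≤ δ) :
    ((2 * (l : ℝ)) ^ 2 * δ + ⌊T * d⌋₊ * ((2 * (l : ℝ)) ^ 2 * (mc / (d * Real.sqrt d))
        + lam * fb / d / d)) * (1 + lam / d) ^ ⌊T * d⌋₊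
      ≤ ((2 * (l : ℝ)) ^ 2 + T * ((2 * (l : ℝ)) ^ 2 * mc + lam * fb)) * Real.exp (lam * T) * δ := by
  have hd' : (0 : ℝ) < d := by positivity
  have hN : (⌊T * d⌋₊ : ℝ) ≤ T * d := Nat.floor_le (by positivity)
  have e1 : (1 + lam / d) ^ ⌊T * d⌋₊ ≤ Real.exp (lam * T) := by
    have h3 : 1 + lam / d ≤ Real.exp (lam / d) := by
      have := Real.add_one_le_exp (lam / d); linarith
    refine (pow_le_pow_left₀ (by positivity) h3 _).trans ?_
    rw [← Real.exp_nat_mul]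
    refine Real.exp_le_exp.2 ?_
    calc (⌊T * d⌋₊ : ℝ) * (lam / d) ≤ T * d * (lam / d) := by gcongr
      _ = lam * T := by field_simp
  have e2 : (⌊T * d⌋₊ : ℝ) * ((2 * (l : ℝ)) ^ 2 * (mc / (d * Real.sqrt d)) + lam * fb / d / d)
      ≤ T * ((2 * (l : ℝ)) ^ 2 * mc + lam * fb) * δ := by
    calc _ ≤ T * d * ((2 * (l : ℝ)) ^ 2 * (mc / (d * Real.sqrt d)) + lam * fb / d / d) := by
          gcongr
      _ = T * ((2 * (l : ℝ)) ^ 2 * mc * (1 / Real.sqrt d) + lam * fb * (1 / d)) := by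
          have : Real.sqrt d ≠ 0 := (Real.sqrt_pos.2 hd').ne'
          field_simp
      _ ≤ T * ((2 * (l : ℝ)) ^ 2 * mc * δ + lam * fb * δ) := by gcongr
      _ = _ := by ring
  calc _ ≤ ((2 * (l : ℝ)) ^ 2 * δ + T * ((2 * (l : ℝ)) ^ 2 * mc + lam * fb) * δ)
        * Real.exp (lam * T) := by
        refine mul_le_mul (by linarith) e1 (by positivity) ?_
        positivity
    _ = _ := by ring

/-- The size of the exceptional probability, for the deviation `d ^ (-1/4)`. -/
theorem deviation_prob_le (hd : 0 < d) {c v s δ T : ℝ} (hc : 0 ≤ c) (hv : 0 ≤ v)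
    (hT : 0 ≤ T) (hδ : δ ^ 4 = 1 / d) (p : ℕ) :
    c * v * ((⌊T * d⌋₊ : ℝ) + 1) ^ (2 * p + 2 + 1) * (2 / d * s / δ) ^ (2 * (2 * p + 2))
      ≤ c * v * (T + 1) ^ (2 * p + 3) * (16 * s ^ 4) ^ (p + 1) * ((d : ℝ) ^ p)⁻¹ := by
  have hd' : (0 : ℝ) < d := by positivity
  have hd1 : (1 : ℝ) ≤ d := by exact_mod_cast hd
  have hN : (⌊T * d⌋₊ : ℝ) + 1 ≤ (T + 1) * d := by
    have : (⌊T * d⌋₊ : ℝ) ≤ T * d := Nat.floor_le (by positivity)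
    linarith
  -- Four factors `2s/(dδ)` give `16 s⁴/d³`, because `δ⁴ = 1/d`. Against the `d^{2p+3}` from the
  -- number of steps, `d^{-3(p+1)}` leaves `d^{-p}`.
  have e1 : (2 / d * s / δ) ^ (2 * (2 * p + 2)) = (16 * s ^ 4 / d ^ 3) ^ (p + 1) := by
    rw [show 2 * (2 * p + 2) = 4 * (p + 1) by ring, pow_mul, div_pow, hδ]
    congr 1
    field_simp
    ring
  rw [e1]
  calc _ ≤ c * v * ((T + 1) * d) ^ (2 * p + 2 + 1) * (16 * s ^ 4 / d ^ 3) ^ (p + 1) := by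
        gcongr
    _ = _ := by
        rw [mul_pow, div_pow, ← pow_mul]
        have : (d : ℝ) ^ (3 * (p + 1)) = d ^ (2 * p + 2 + 1) * d ^ p := by
          rw [← pow_add]; congr 1; ring
        rw [this]
        field_simp

end Final


/-! ### Superpolynomial deviation bound for the noise, with constants independent of the dimension.
-/

section Concentration

variable {l : ℕ} {f : Vec2 l → Vec l → ℝ} {κ R Lhat g T : ℝ}

theorem exists_noise_deviation_bound (hfm : Measurable (Function.uncurry f)) (hL : 0 < Lhat)
    (hsmooth : ∀ y e : Vec l, IsLSmooth Lhat (slice f y e)) (hκ1 : 1 ≤ κ) (hR : 0 ≤ R)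
    (hg : 0 ≤ g) (hT : 0 ≤ T) (p : ℕ) :
    ∃ C : ℝ, 0 ≤ C ∧ ∀ {d : ℕ} (_ : 0 < d) {K : Matrix (Fin d) (Fin d) ℝ} (hK : K.PosSemidef)
      (_ : ∀ i, hK.isHermitian.eigenvalues i ≤ κ) {X0 Xs : Matrix (Fin d) (Fin l) ℝ}
      (_ : ∀ᵐ z ∂(dataLaw l K), ∀ x : Vec l,
        slice f (contract Xs z.1) z.2 (contract Xs z.1) ≤ slice f (contract Xs z.1) z.2 x)
      {U : Set (Mat2 l)} {η : ℝ} (_ : 0 < η) {γ : ℝ} (_ : 0 ≤ γ) (_ : γ ≤ g)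
      {Ω : Type*} [MeasurableSpace Ω] {P : Measure Ω} [IsProbabilityMeasure P]
      {a : ℕ → Ω → Vec d} {e : ℕ → Ω → Vec l}
      (_ : ∀ k, HasLaw (fun ω => (a k ω, e k ω)) (dataLaw l K) P)
      (_ : iIndepFun (fun k ω => (a k ω, e k ω)) P) {δ : ℝ} (_ : 0 < δ) (_ : δ ^ 4 = 1 / d),
      P {ω | ∃ n ≤ ⌊T * d⌋₊, ∃ m ij, (2 * κ) ^ m * δ < |∑ k ∈ Finset.range n,
          noise f K Xs γ (goodSet K U Xs η R) m ij
            (sgd f Xs X0 γ (fun k => a k ω) (fun k => e k ω) k, (a k ω, e k ω))|}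
        ≤ ENNReal.ofReal (C * ((d : ℝ) ^ p)⁻¹) := by
  -- With deviation `d^{-1/4}`, the moment of order `2q` gives a probability of order `d^{1 - q/2}`,
  -- which is `d^{-p}` for `q = 2p + 2`.
  obtain ⟨c, hc, hdev⟩ := exists_deviation_bound_ae (2 * p + 2) (by omega)
  have hκ0 : 0 < κ := by linarith
  set N := gaussMom (2 * (2 * ((2 * (2 * p + 2) : ℕ) : ENNReal))) with hN
  have hN0 : 0 ≤ N := gaussMom_nonneg _
  have hgc : 0 ≤ gradConst l Lhat κ R := by unfold gradConst; positivity
  have hstep : ∀ {γ : ℝ}, 0 ≤ γ → 0 ≤ stepConst l Lhat κ R γ N := fun {γ} hγ => by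
    unfold stepConst; positivity
  have hs := hstep hg
  set s := stepConst l Lhat κ R g N with hsdef
  refine ⟨c * Fintype.card ((Fin l ⊕ Fin l) × (Fin l ⊕ Fin l)) * (T + 1) ^ (2 * p + 3)
    * (16 * s ^ 4) ^ (p + 1), by positivity, ?_⟩
  intro d hd K hK hκ X0 Xs hmin U η hη γ hγ0 hγ Ω _ P _ a e hlaw hindep δ hδ hδ4
  have hsm : ∀ y e, ContDiff ℝ 1 (slice f y e) := fun y e => (hsmooth y e).1
  have hpm : IsProbabilityMeasure (dataLaw l K) := by unfold dataLaw; infer_instance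
  have h1 := hdev (measurable_sgdStep hfm hsm Xs γ) X0 hlaw hindep
    (ψ := fun m ij => noise f K Xs γ (goodSet K U Xs η R) m ij) (A := 2 / d * s) (κ := κ)
    (fun m ij => measurable_noise hfm hsm (measurableSet_goodSet hη) γ m ij)
    (by positivity) hκ0
    (fun m ij X j => (noise_moments (q := 2 * p + 2) hd hfm hL hsmooth hK hκ hκ1 hR hmin hγ0 m ij
      X).1 j)
    (fun m ij X j hj => ((noise_moments (q := 2 * p + 2) hd hfm hL hsmooth hK hκ hκ1 hR hmin hγ0 m
      ij X).2 j hj).trans (by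
        have h2 := stepConst_mono (l := l) hγ0 hγ hκ0.le hR hL.le hN0
        have h3 := hstep hγ0
        gcongr))
    (fun m ij X => integral_noise hd hfm hL hsmooth hK hκ hκ1 hmin hγ0 m ij X) ⌊T * d⌋₊ hδ
  simp only [sgd_eq_chain]
  refine h1.trans (ENNReal.ofReal_le_ofReal ?_)
  exact deviation_prob_le hd hc (by positivity) hT hδ4 p

end Concentration

end

end HighDimSGD

/-! ### The main theorem. -/

open HighDimSGD in
theorem mainTheorem7
    -- dimension of `𝒪 = 𝒯`, outer function, covariance representation of the risk
    (l : ℕ) (f : Vec2 l → Vec l → ℝ) (h : Mat2 l → ℝ) (U : Set (Mat2 l))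
    (α Lf Lh LI : ℝ) (hα : 0 ≤ α)
    (hf_meas : Measurable (Function.uncurry f))
    (hf_int : Integrable (fun e => f 0 e) (stdGaussian (Vec l)))
    (hf_lip : PseudoLipschitz α Lf f)
    (hh : RiskRepresentation α Lh U f h)
    (hI : FisherPseudoLipschitz α LI U f)
    -- smoothness and restricted secant inequality in `x`, for all values of the hidden parameters
    (Lhat μhat ζ : ℝ) (hL : 0 < Lhat) (hμ : 0 < μhat) (hζ0 : 0 < ζ) (hζ1 : ζ < 1)
    (hsmooth : ∀ y e : Vec l, IsLSmooth Lhat (slice f y e))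
    (hrsi : ∀ y e : Vec l, RSI μhat (slice f y e))
    -- covariances, hidden parameters and initializations, bounded independently of `d`
    (K : ∀ d, Matrix (Fin d) (Fin d) ℝ) (hK : ∀ d, (K d).PosDef)
    (Kbar : ℝ) (hKbar : ∀ d, 0 < d → ‖Matrix.toEuclideanCLM (n := Fin d) (𝕜 := ℝ) (K d)‖ ≤ Kbar)
    (Xs X0 : ∀ d, Matrix (Fin d) (Fin l) ℝ)
    (C : ℝ) (hC : ∀ d, 0 < d → ‖Xs d‖ ≤ C ∧ ‖X0 d‖ ≤ C)
    (hU0 : ∀ d, 0 < d → covB (K d) (X0 d) (Xs d) ∈ U)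
    (hgrad : ∀ d, 0 < d → UnbiasedGradient U f (K d) (Xs d))
    -- the hidden parameter minimizes the risk, and almost surely the outer function
    (hmin_risk : ∀ d, 0 < d → ∀ X, risk f (K d) (Xs d) (Xs d) ≤ risk f (K d) (Xs d) X)
    (hmin_outer : ∀ d, 0 < d → ∀ᵐ z ∂(dataLaw l (K d)), ∀ x : Vec l,
      slice f (contract (Xs d) z.1) z.2 (contract (Xs d) z.1)
        ≤ slice f (contract (Xs d) z.1) z.2 x)
    -- the constant step size, bounded independently of `d`
    (γbar : ℝ) (hγ : ∀ d, 0 < d → stepSize μhat Lhat ζ (K d) ≤ γbar)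
    -- for every `d`, independent samples of the data distribution
    (Ω : ℕ → Type*) [∀ d, MeasurableSpace (Ω d)] (P : ∀ d, Measure (Ω d))
    [∀ d, IsProbabilityMeasure (P d)]
    (a : ∀ d, ℕ → Ω d → Vec d) (e : ∀ d, ℕ → Ω d → Vec l)
    (hlaw : ∀ d, 0 < d → ∀ k, HasLaw (fun ω => (a d k ω, e d k ω)) (dataLaw l (K d)) (P d))
    (hindep : ∀ d, 0 < d → iIndepFun (fun k ω => (a d k ω, e d k ω)) (P d)) :
    -- the coupled equations have a maximal solution
    (∀ d, 0 < d → ∃ (Θ : EReal) (B : ℝ → Fin d → Mat2 l),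
      IsMaximalSolution (hK d).isHermitian f h U (stepSize μhat Lhat ζ (K d))
        (X0 d) (Xs d) Θ B) ∧
    ∀ (Θ : ℕ → EReal) (B : ∀ d, ℝ → Fin d → Mat2 l),
      (∀ d, 0 < d → IsMaximalSolution (hK d).isHermitian f h U (stepSize μhat Lhat ζ (K d))
        (X0 d) (Xs d) (Θ d) (B d)) →
      -- exponential decay as long as the solution exists
      (∀ d, 0 < d → ∀ t : ℝ, 0 ≤ t → (t : EReal) < Θ d →
        distSq (B d t) ≤
          Real.exp (-(stepSize μhat Lhat ζ (K d) * (1 - ζ) * μhat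
            * lamMin (hK d).isHermitian) * t) * distSq (B d 0)) ∧
      -- if the solution stays well inside `U` up to time `T`, then it exists beyond time `T`,
      -- and the squared distance of SGD to the optimum follows it up to time `T`
      ∀ T : ℝ, 0 < T → ∀ η : ℝ, 0 < η →
        (∀ d, 0 < d → ∀ t : ℝ, 0 ≤ t → t ≤ T → (t : EReal) < Θ d →
          avgB (hK d).isHermitian (B d t) ∈ innerSet U η) →
        (∀ d, 0 < d → (T : EReal) < Θ d) ∧
        ∃ ε : ℝ, 0 < ε ∧
          WithOverwhelmingProbability P (fun d => {ω : Ω d | ∀ t : ℝ, 0 ≤ t → t ≤ T →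
            |‖sgd f (Xs d) (X0 d) (stepSize μhat Lhat ζ (K d))
                (fun k => a d k ω) (fun k => e d k ω) ⌊t * d⌋₊ - Xs d‖ ^ 2
              - distSq (B d t)| ≤ (d : ℝ) ^ (-ε)}) := by
  have hsm : ∀ y e : Vec l, ContDiff ℝ 1 (slice f y e) := fun y e => (hsmooth y e).1
  have hKp : ∀ d, (K d).PosSemidef := fun d => (hK d).posSemidef
  have hγ0 : ∀ d, 0 ≤ stepSize μhat Lhat ζ (K d) := fun d =>
    stepSize_nonneg (hKp d) hμ.le hζ0.le
  refine ⟨fun d hd => exists_isMaximalSolution hα hf_meas hf_lip hsm hh hI hd (hKp d) _ (hU0 d hd),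
    fun Θ B hB => ?_⟩
  have hdecay := fun d (hd : 0 < d) (t : ℝ) (h0 : 0 ≤ t) (ht : (t : EReal) < Θ d) =>
    (hB d hd).sol.distSq_le hα hf_meas hf_int hf_lip hh hL hμ hζ0 hζ1 hsmooth hrsi hd (hK d)
      (hmin_outer d hd) h0 ht
  refine ⟨hdecay, fun T hT η hη hin => ?_⟩
  have htrace : ∀ d, 0 < d → ∀ t : ℝ, 0 ≤ t → (t : EReal) < Θ d →
      (momB (hK d).isHermitian 0 (B d t)).trace ≤ 11 * C ^ 2 := fun d hd t h0 ht => by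
    refine (hB d hd).sol.trace_momB_zero_le hd (hC d hd).2 (hC d hd).1 h0 ht
      ((hdecay d hd t h0 ht).trans ?_)
    refine mul_le_of_le_one_left ?_ (Real.exp_le_one_iff.2 ?_)
    · have hpsd := (hB d hd).sol.psd 0 le_rfl (by exact_mod_cast (hB d hd).pos)
      rw [distSq_eq_trace (hK d).isHermitian hpsd]
      exact trace_mul_diffForm_nonneg (momB_posSemidef (hKp d) 0 hpsd)
    · have h1 := lamMin_nonneg (hKp d)
      have h2 := hγ0 d
      have h3 : 0 ≤ 1 - ζ := by linarith
      rw [neg_mul, neg_nonpos]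
      positivity
  have hΘ : ∀ d, 0 < d → (T : EReal) < Θ d := fun d hd =>
    lt_of_isMaximalSolution hα hf_meas hf_lip hsm hh hI hd (hKp d) (hB d hd) hη (hin d hd)
      (htrace d hd)
  -- The comparison error is a constant times `d^{-1/4}`; half of this exponent is spent on
  -- absorbing the constant.
  refine ⟨hΘ, 1 / 8, by norm_num, ?_⟩
  obtain ⟨κ, hκ⟩ : ∃ κ, κ = max Kbar 1 := ⟨_, rfl⟩
  have hκ1 : 1 ≤ κ := hκ ▸ le_max_right _ _
  have hκ0 : 0 ≤ κ := by linarith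
  have heig : ∀ d, 0 < d → ∀ i, (hKp d).isHermitian.eigenvalues i ≤ κ := fun d hd i =>
    (le_abs_self _).trans (eigenvalues_le_of_opNorm _
      ((hKbar d hd).trans (hκ ▸ le_max_left _ _)) i)
  obtain ⟨g, hg⟩ : ∃ g, g = |γbar| := ⟨_, rfl⟩
  have hg0 : 0 ≤ g := hg ▸ abs_nonneg _
  have hγg : ∀ d, 0 < d → stepSize μhat Lhat ζ (K d) ≤ g := fun d hd =>
    hg ▸ (hγ d hd).trans (le_abs_self _)
  obtain ⟨r, hr⟩ : ∃ r, r = 11 * C ^ 2 := ⟨_, rfl⟩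
  rw [← hr] at htrace
  have hr0 : 0 ≤ r := hr ▸ by positivity
  obtain ⟨c, hc0, hc⟩ := exists_abs_trace_mul_le (1 : Mat2 l)
  obtain ⟨c', hc'0, hc'⟩ := exists_abs_trace_mul_le (diffForm l)
  -- This radius contains every `W` whose `P_0` differs by at most `1` in norm from a value of
  -- `M_0`.
  obtain ⟨R, hR0, hR⟩ : ∃ R : ℝ, 0 ≤ R ∧ R ^ 2 = r + c :=
    ⟨√(r + c), Real.sqrt_nonneg _, Real.sq_sqrt (by positivity)⟩
  obtain ⟨m₀, hm₀, hbd, hlip⟩ := exists_coeff_bounds hα hh hI (κ * R ^ 2)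
  have hcb : CoeffBounds f h U (κ * R ^ 2) m₀ := ⟨hm₀, hbd, hlip⟩
  have hlip0 : 0 ≤ fieldLip g κ m₀ r := by unfold fieldLip; positivity
  have hfb0 : 0 ≤ fieldBound g κ m₀ r := by unfold fieldBound; positivity
  have hmc0 : 0 ≤ meanConst l Lhat κ R g := by
    unfold meanConst
    have := mul_self_nonneg (gradConst l Lhat κ R * gaussMom 4)
    positivity
  obtain ⟨Q, hQ⟩ : ∃ Q, Q = ((2 * (l : ℝ)) ^ 2 + T * ((2 * (l : ℝ)) ^ 2 * meanConst l Lhat κ R g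
      + fieldLip g κ m₀ r * fieldBound g κ m₀ r)) * Real.exp (fieldLip g κ m₀ r * T) := ⟨_, rfl⟩
  have hδlim : Tendsto (fun d : ℕ => (d : ℝ) ^ (-(1 / 8) : ℝ)) atTop (𝓝 0) :=
    (tendsto_rpow_neg_atTop (by norm_num)).comp tendsto_natCast_atTop_atTop
  have hev : ∀ᶠ d : ℕ in atTop, ((d : ℝ) ^ (-(1 / 8) : ℝ)) ^ 2 * Q ≤ 1 ∧
      2 * κ * (((d : ℝ) ^ (-(1 / 8) : ℝ)) ^ 2 * Q) ≤ η / 2 ∧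
      c' * (Q + fieldBound g κ m₀ r) * (d : ℝ) ^ (-(1 / 8) : ℝ) ≤ 1 := by
    have h1 : Tendsto (fun d : ℕ => ((d : ℝ) ^ (-(1 / 8) : ℝ)) ^ 2 * Q) atTop (𝓝 0) := by
      simpa using (hδlim.pow 2).mul_const Q
    have h2 : Tendsto (fun d : ℕ => 2 * κ * (((d : ℝ) ^ (-(1 / 8) : ℝ)) ^ 2 * Q)) atTop (𝓝 0) := by
      simpa using h1.const_mul (2 * κ)
    have h3 : Tendsto (fun d : ℕ => c' * (Q + fieldBound g κ m₀ r) * (d : ℝ) ^ (-(1 / 8) : ℝ))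
        atTop (𝓝 0) := by
      simpa using hδlim.const_mul (c' * (Q + fieldBound g κ m₀ r))
    filter_upwards [h1.eventually_le_const one_pos, h2.eventually_le_const (half_pos hη),
      h3.eventually_le_const one_pos] with d e1 e2 e3 using ⟨e1, e2, e3⟩
  obtain ⟨d₀, hd₀⟩ := eventually_atTop.1 hev
  refine withOverwhelmingProbability_of_superpolynomial fun p => ?_
  obtain ⟨C₁, hC₁, hprob⟩ := exists_noise_deviation_bound hf_meas hL hsmooth hκ1 hR0 hg0 hT.le p
  -- The summand `d₀ ^ p` makes the claim trivial for the finitely many `d < d₀`.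
  refine ⟨C₁ + (d₀ : ℝ) ^ p, fun d hd => ?_⟩
  have hd' : (0 : ℝ) < d := by positivity
  have hd1 : (1 : ℝ) ≤ d := by exact_mod_cast hd
  rcases lt_or_ge d d₀ with hlt | hge
  · refine prob_le_one.trans ?_
    rw [← ENNReal.ofReal_one]
    refine ENNReal.ofReal_le_ofReal ?_
    rw [← div_eq_mul_inv, le_div_iff₀ (by positivity), one_mul]
    have : (d : ℝ) ≤ d₀ := by exact_mod_cast hlt.le
    have h2 := pow_le_pow_left₀ hd'.le this p
    linarith
  obtain ⟨hs1, hs2, hs3⟩ := hd₀ d hge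
  obtain ⟨b, hb⟩ : ∃ b, b = (d : ℝ) ^ (-(1 / 8) : ℝ) := ⟨_, rfl⟩
  rw [← hb] at hs1 hs2 hs3 ⊢
  have hb0 : 0 < b := hb ▸ Real.rpow_pos_of_pos hd' _
  have hb1 : b ≤ 1 := hb ▸ Real.rpow_le_one_of_one_le_of_nonpos hd1 (by norm_num)
  have hb8 : b ^ 8 = 1 / d := by
    rw [hb, ← Real.rpow_natCast, ← Real.rpow_mul hd'.le]
    norm_num [Real.rpow_neg_one]
  have h1d : 1 / (d : ℝ) ≤ b ^ 2 := hb8 ▸ pow_le_pow_of_le_one hb0.le hb1 (by norm_num)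
  have hsq : 1 / √(d : ℝ) ≤ b ^ 2 := by
    have e1 : 1 / √(d : ℝ) = b ^ 4 := by
      rw [one_div, ← Real.sqrt_inv, ← one_div, ← hb8, show b ^ 8 = (b ^ 4) ^ 2 by ring,
        Real.sqrt_sq (by positivity)]
    exact e1 ▸ pow_le_pow_of_le_one hb0.le hb1 (by norm_num)
  -- The good set has margin `η / 2`, so it contains the iterates whose covariance is within `η / 2`
  -- of `𝓑(t)`. The deviation is `δ = b² = d^{-1/4}`.
  have hbad := hprob hd (hKp d) (heig d hd) (X0 := X0 d) (hmin_outer d hd) (U := U) (half_pos hη)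
    (hγ0 d) (hγg d hd) (hlaw d hd) (hindep d hd) (δ := b ^ 2) (by positivity)
    (by rw [← hb8]; ring)
  refine (measure_mono (fun ω hω => ?_)).trans (hbad.trans (ENNReal.ofReal_le_ofReal
    (mul_le_mul_of_nonneg_right (le_add_of_nonneg_right (by positivity)) (by positivity))))
  by_contra hgood
  refine hω fun t ht0 htT => ?_
  have hdev : ∀ n ≤ ⌊T * d⌋₊, ∀ m ij, |∑ k ∈ Finset.range n,
      noise f (K d) (Xs d) (stepSize μhat Lhat ζ (K d)) (goodSet (K d) U (Xs d) (η / 2) R) m ij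
        (sgd f (Xs d) (X0 d) (stepSize μhat Lhat ζ (K d)) (fun k => a d k ω) (fun k => e d k ω) k,
          (a d k ω, e d k ω))| ≤ (2 * κ) ^ m * b ^ 2 := fun n hn m ij => by
    by_contra hcon
    exact hgood ⟨n, hn, m, ij, not_le.1 hcon⟩
  have hcmp := abs_norm_sq_sub_distSq_le hd hh hf_meas hL hsmooth (hKp d) (heig d hd) hκ1
    (hmin_outer d hd) (hgrad d hd) (hγ0 d) (hγg d hd) (hB d hd).sol (hΘ d hd) hT.le hη
    (fun t ht => hin d hd t ht.1 ht.2 (lt_of_le_of_lt (EReal.coe_le_coe_iff.2 ht.2) (hΘ d hd)))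
    hr0
    (fun t ht => htrace d hd t ht.1 (lt_of_le_of_lt (EReal.coe_le_coe_iff.2 ht.2) (hΘ d hd)))
    hc hc0 hc' hc'0 hR0 hR.ge hcb
    (x := sgd f (Xs d) (X0 d) (stepSize μhat Lhat ζ (K d)) (fun k => a d k ω) (fun k => e d k ω))
    (z := fun k => (a d k ω, e d k ω)) rfl (fun n => rfl) (δ := b ^ 2) (ε := b ^ 2 * Q)
    (by positivity) hdev hs1 hs2
    (by
      rw [mul_comm (b ^ 2) Q, hQ]
      exact comparison_error_le hd hlip0 hfb0 hmc0 hT.le (by positivity) h1d hsq) ht0 htT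
  refine hcmp.trans ?_
  have h4 : fieldBound g κ m₀ r / d ≤ fieldBound g κ m₀ r * b ^ 2 := by
    rw [← mul_one_div]
    exact mul_le_mul_of_nonneg_left h1d hfb0
  -- Of the two factors `b = d^{-1/8}`, one is used against the constants, which `hs3` allows, and
  -- the other is the final bound.
  calc c' * (b ^ 2 * Q + fieldBound g κ m₀ r / d)
      ≤ c' * (b ^ 2 * Q + fieldBound g κ m₀ r * b ^ 2) := by gcongr
    _ = c' * (Q + fieldBound g κ m₀ r) * b * b := by ring
    _ ≤ 1 * b := by gcongr
    _ = b := one_mul b
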